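/- Let $(M,\omega)$ be a compact symplectic manifold (without boundary) of dimension $2m$, $L\to M$ a prequantum line bundle (a Hermitian line bundle with a compatible connection of curvature $-i\omega$), $\mathcal P\subset TM$ a real polarization (a foliation with Lagrangian leaves), and $N^{1/2}$ a metalinear correction, that is, a line bundle with an isomorphism $N^{1/2}\otimes N^{1/2}\cong N=\bigwedge^m_{\mathbb C}(\mathcal P\otimes\mathbb C)$, with the flat connection along $\mathcal P$ induced by the dual of the Bott connection under the isomorphism $\mathcal P\cong(TM/\mathcal P)^*$ given by $\omega$. Let $\mathcal J$ be the sheaf of sections of $L\otimes N^{1/2}$ that are flat along $\mathcal P$, and let $\mathcal S$ be the sheaf of smooth sections of $L\otimes N^{1/2}$. On $\mathbb R^{2k}$ with coordinates $(x,y)$, $x,y\in\mathbb R^k$, let $\mathcal P_0$ be the foliation by the leaves $x=\mathrm{const}$, let $\theta$ be any smooth $1$-form with $d\theta=\sum_i dx_i\wedge dy_i$, and let $\mathcal J_0$ be the sheaf of sections, flat along $\mathcal P_0$, of the trivial complex line bundle with connection $d-i\theta$. On $M\times\mathbb R^{2k}$ let $\mathcal J_{10}$ be the sheaf of sections, flat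 along $\mathcal P\times\mathcal P_0$, of the external tensor product of the two line bundles with the product connection. An open set of $\mathbb R^{2k}$ is a cotangent ball if its nonempty intersections with the leaves of $\mathcal P_0$ are contractible and the space of these leaves (with the quotient topology) is contractible. A closed cotangent ball is a compact set that is the closure of a cotangent ball and whose leaves and leaf space are still contractible. For a closed subset $C$ (of $M$, $\mathbb R^{2k}$ or $M\times\mathbb R^{2k}$), $H^n(C,\cdot)$ denotes the degree $n$ cohomology of the Kostant complex of germs along $C$: the direct limit, over the open neighbourhoods $W$ of $C$, of the complexes $(\mathcal S\otimes\Omega^\bullet_{\mathcal P})(W)$ of smooth forms along the polarization with values in the line bundle, with the covariant exterior derivative along the polarization as differential. (This complex resolves the sheaf of flat sections.) Suppose that the Geometric Quantization $\bigoplus_{i\ge 0}H^i(M,\mathcal J)$ is finite-dimensional, and let $U\subset\mathbb R^{2k}$ be a closed cotangent ball. Then, for every $n\ge 0$, the natural map $$H^n(M,\mathcal J)\otimes_{\mathbb C} H^0(U,\mathcal J_0)\longrightarrow H^n(M\times U,\mathcal J_{10}),\qquad [\alpha]\otimes f\longmapsto[\pi_1^*\alpha\cdot\pi_2^*f],$$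 where $\pi_1,\pi_2$ are the projections, is well defined and is an isomorphism of complex vector spaces. -/

import Mathlib

open Set VectorField
open scoped Manifold ContDiff TensorProduct

noncomputable section

namespace GeometricQuantization

section General

set_option linter.unusedSectionVars false

variable {E : Type*} [NormedAddCommGroup E] [NormedSpace ℝ E]
  {H : Type*} [TopologicalSpace H] (I : ModelWithCorners ℝ E H)
  (X : Type*) [TopologicalSpace X] [ChartedSpace H X] [IsManifold I ∞ X]

/-! ### Distributions and foliations -/

/-- A (not necessarily smooth) distribution of tangent subspaces. -/
abbrev Distribution := ∀ x : X, Submodule ℝ (TangentSpace I x)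

/-- The distribution consisting of all tangent vectors. -/
def fullDistribution : Distribution I X := fun _ => ⊤

variable {I X}

/-- The section `V` of the distribution `D` is smooth on `W`, as a vector field. -/
def Distribution.SmoothOn (D : Distribution I X) (V : ∀ x, D x) (W : Set X) : Prop :=
  ContMDiffOn I I.tangent ∞ (fun x => (⟨x, (V x : TangentSpace I x)⟩ : TangentBundle I X)) W

open Classical in
/-- The Lie bracket of two sections of `D`; it is only used for sections of involutive
distributions, at points near which the sections are smooth, where it does lie in `D`. -/
def Distribution.bracket (D : Distribution I X) (V V' : ∀ x, D x) (x : X) : D x :=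
  if h : mlieBracket I (fun y => (V y : TangentSpace I y)) (fun y => (V' y : TangentSpace I y)) x
      ∈ D x then ⟨_, h⟩ else 0

/-- `D` is (the tangent distribution of) a smooth foliation with `r`-dimensional leaves: a smooth
subbundle of rank `r` of the tangent bundle that is closed under Lie brackets. -/
structure Distribution.IsFoliation (D : Distribution I X) (r : ℕ) : Prop where
  exists_frame : ∀ x : X, ∃ W : Set X, IsOpen W ∧ x ∈ W ∧ ∃ V : Fin r → ∀ y, D y,
    (∀ j, D.SmoothOn (V j) W) ∧
    ∀ y ∈ W, LinearIndependent ℝ (fun j => V j y) ∧ Submodule.span ℝ (range fun j => V j y) = ⊤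
  involutive : ∀ W : Set X, IsOpen W → ∀ V V' : ∀ y, D y, D.SmoothOn V W → D.SmoothOn V' W →
    ∀ x ∈ W, mlieBracket I (fun y => (V y : TangentSpace I y))
      (fun y => (V' y : TangentSpace I y)) x ∈ D x

/-! ### Complex line bundles and connections -/

variable (I X) in
/-- A smooth complex line bundle over `X`, given by transition functions. Its fibre over every
point `x` is a copy of `ℂ`, through the distinguished trivialization `indexAt x`. -/
structure LineBundle (ι : Type*) extends VectorBundleCore ℂ X ℂ ι where
  smooth_coordChange : ∀ i j, ContMDiffOn I 𝓘(ℝ, ℂ) ∞ (fun x => coordChange i j x 1)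
    (baseSet i ∩ baseSet j)

namespace LineBundle

variable {ι : Type*} (S : LineBundle I X ι)

/-- The expression of a section `s` in the trivialization `i`. -/
def coord (i : ι) (s : X → ℂ) (x : X) : ℂ := S.coordChange (S.indexAt x) i x (s x)

/-- The section `s` is smooth on `W`: its expression in every trivialization is. -/
def SmoothOn (s : X → ℂ) (W : Set X) : Prop :=
  ∀ i, ContMDiffOn I 𝓘(ℝ, ℂ) ∞ (S.coord i s) (W ∩ S.baseSet i)

end LineBundle

/-- Local connection forms of a connection along a distribution `D`, on a line bundle with
trivializations indexed by `ι`. -/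
abbrev ConnectionForms (D : Distribution I X) (ι : Type*) := ι → ∀ x, D x →ₗ[ℝ] ℂ

section Connection

variable {ι : Type*} (D : Distribution I X) (S : LineBundle I X ι) (A : ConnectionForms D ι)

/-- The forms `A i` are smooth along `D` and define a connection along `D` on `S`: with
`g = coordChange j i`, so that local expressions of a section satisfy `sᵢ = g sⱼ`, one has
`g Aⱼ = dg + g Aᵢ`. If `D` is the full distribution, this is a connection in the usual sense. -/
structure IsConnection : Prop where
  smooth : ∀ i, ∀ W ⊆ S.baseSet i, IsOpen W → ∀ V : ∀ x, D x, D.SmoothOn V W →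
    ContMDiffOn I 𝓘(ℝ, ℂ) ∞ (fun x => A i x (V x)) W
  gauge : ∀ i j, ∀ x ∈ S.baseSet i ∩ S.baseSet j, ∀ v : D x,
    S.coordChange j i x 1 * A j x v =
      mvfderiv I (fun y => S.coordChange j i y 1) x (v : TangentSpace I x) +
        S.coordChange j i x 1 * A i x v

/-- The covariant derivative `∇_v s` at `x`, for `v ∈ D x`: in the trivialization `i` at `x` it is
`dsᵢ(v) + Aᵢ(v) sᵢ`. -/
def covDeriv (s : X → ℂ) (x : X) (v : D x) : ℂ :=
  mvfderiv I (S.coord (S.indexAt x) s) x (v : TangentSpace I x) + A (S.indexAt x) x v * s x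

/-- The curvature, the local forms `dAᵢ`, is the `ℂ`-valued `2`-form `F` on `D`. -/
def HasCurvature (F : ∀ x, D x → D x → ℂ) : Prop :=
  ∀ i, ∀ W ⊆ S.baseSet i, IsOpen W → ∀ V V' : ∀ x, D x, D.SmoothOn V W → D.SmoothOn V' W →
    ∀ x ∈ W,
      mvfderiv I (fun y => A i y (V' y)) x (V x : TangentSpace I x) -
        mvfderiv I (fun y => A i y (V y)) x (V' x : TangentSpace I x) -
        A i x (D.bracket V V' x) = F x (V x) (V' x)

end Connection

/-- The restriction of a connection along `D` to a distribution `D'` contained in `D`. -/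
def ConnectionForms.restrict {D D' : Distribution I X} {ι : Type*} (A : ConnectionForms D ι)
    (h : ∀ x, D' x ≤ D x) : ConnectionForms D' ι :=
  fun i x => (A i x).comp (Submodule.inclusion (h x))

lemma contMDiffOn_mul {f g : X → ℂ} {W : Set X} (hf : ContMDiffOn I 𝓘(ℝ, ℂ) ∞ f W)
    (hg : ContMDiffOn I 𝓘(ℝ, ℂ) ∞ g W) : ContMDiffOn I 𝓘(ℝ, ℂ) ∞ (fun x => f x * g x) W :=
  (contDiff_mul (𝕜 := ℝ) (𝔸 := ℂ)).contMDiff.comp_contMDiffOn (hf.prodMk_space hg)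

namespace LineBundle

variable {ι ι' : Type*}

lemma comp_apply_one (f g : ℂ →L[ℂ] ℂ) : f (g 1) = f 1 * g 1 := by
  have h := f.map_smul (g 1) 1
  simp only [smul_eq_mul, mul_one] at h
  rw [h, mul_comm]

/-- The tensor product of line bundles: transition functions are multiplied. The tensor product
of the sections `s` and `t` is `x ↦ s x * t x`. -/
def tensor (S : LineBundle I X ι) (T : LineBundle I X ι') : LineBundle I X (ι × ι') where
  baseSet i := S.baseSet i.1 ∩ T.baseSet i.2
  isOpen_baseSet i := (S.isOpen_baseSet i.1).inter (T.isOpen_baseSet i.2)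
  indexAt x := (S.indexAt x, T.indexAt x)
  mem_baseSet_at x := ⟨S.mem_baseSet_at x, T.mem_baseSet_at x⟩
  coordChange i j x := (S.coordChange i.1 j.1 x).comp (T.coordChange i.2 j.2 x)
  coordChange_self i x hx v := by
    simp [S.coordChange_self i.1 x hx.1, T.coordChange_self i.2 x hx.2]
  continuousOn_coordChange i j :=
    ((S.continuousOn_coordChange i.1 j.1).mono fun _ hx => ⟨hx.1.1, hx.2.1⟩).clm_comp
      ((T.continuousOn_coordChange i.2 j.2).mono fun _ hx => ⟨hx.1.2, hx.2.2⟩)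
  coordChange_comp i j k x hx v := by
    obtain ⟨⟨⟨h1, h2⟩, h3, h4⟩, h5, h6⟩ := hx
    have hS := S.coordChange_comp i.1 j.1 k.1 x ⟨⟨h1, h3⟩, h5⟩
    have hT := T.coordChange_comp i.2 j.2 k.2 x ⟨⟨h2, h4⟩, h6⟩
    have comm (f g : ℂ →L[ℂ] ℂ) (z : ℂ) : f (g z) = g (f z) := by
      have hf (w : ℂ) : f w = w * f 1 := by simpa using f.map_smul w 1
      have hg (w : ℂ) : g w = w * g 1 := by simpa using g.map_smul w 1
      rw [hf (g z), hg z, hg (f z), hf z]; ring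
    simp only [ContinuousLinearMap.comp_apply]
    rw [comm (T.coordChange j.2 k.2 x), hS, hT]
  smooth_coordChange i j := by
    simp only [ContinuousLinearMap.comp_apply, comp_apply_one]
    exact contMDiffOn_mul ((S.smooth_coordChange i.1 j.1).mono fun _ hx => ⟨hx.1.1, hx.2.1⟩)
      ((T.smooth_coordChange i.2 j.2).mono fun _ hx => ⟨hx.1.2, hx.2.2⟩)

variable (I X) in
/-- The trivial line bundle. -/
def trivial : LineBundle I X Unit where
  toVectorBundleCore := trivialVectorBundleCore ℂ X ℂ Unit
  smooth_coordChange _ _ := contMDiffOn_const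

end LineBundle

/-- The connection `∇ ⊗ 1 + 1 ⊗ ∇` on a tensor product of line bundles. -/
def ConnectionForms.tensor {D : Distribution I X} {ι ι' : Type*} (A : ConnectionForms D ι)
    (B : ConnectionForms D ι') : ConnectionForms D (ι × ι') :=
  fun i x => A i.1 x + B i.2 x

/-! ### The Kostant complex -/

variable (I X) in
/-- A line bundle `S` with a connection along a distribution `D`, given by local connection
forms. -/
structure FoliatedBundle (ι : Type*) where
  D : Distribution I X
  S : LineBundle I X ι
  A : ConnectionForms D ι

namespace FoliatedBundle

variable {ι : Type*} (K : FoliatedBundle I X ι)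

/-- Alternating `n`-forms along `D` with values in `S`, without any smoothness. -/
abbrev Form (n : ℕ) := ∀ x : X, K.D x [⋀^Fin n]→ₗ[ℝ] ℂ

variable {K} in
/-- The form `α` is smooth on `W`, that is, it is an element of `(𝒮 ⊗ Ω_D^n)(W)`: it takes smooth
local sections of `D` to smooth local sections of `S`. -/
def Form.SmoothOn {n : ℕ} (α : K.Form n) (W : Set X) : Prop :=
  ∀ W' ⊆ W, IsOpen W' → ∀ V : Fin n → ∀ x, K.D x, (∀ j, K.D.SmoothOn (V j) W') →
    K.S.SmoothOn (fun x => α x fun j => V j x) W'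

variable {K} in
/-- The Kostant differential of `α`, evaluated on sections `V 0, …, V n` of `D`, by the Koszul
formula `∑ᵢ (-1)ⁱ ∇_{Vᵢ} (α (V₀, …, V̂ᵢ, …)) + ∑_{i<j} (-1)ⁱ⁺ʲ α ([Vᵢ, Vⱼ], …, V̂ᵢ, …, V̂ⱼ, …)`.
In the second sum the bracket has been moved to the place of `Vⱼ`, which is entry `j - 1` of
`V₀, …, V̂ᵢ, …`; this changes the sign `(-1)ⁱ⁺ʲ` to `-(-1)ⁱ`. -/
def Form.koszul {n : ℕ} (α : K.Form n) (V : Fin (n + 1) → ∀ x, K.D x) (x : X) : ℂ :=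
  ∑ i : Fin (n + 1), (-1 : ℂ) ^ (i : ℕ) *
    (covDeriv K.D K.S K.A (fun y => α y fun j => i.removeNth V j y) x (V i x) -
      ∑ j : Fin n with i ≤ j.castSucc,
        α x (Function.update (fun l => i.removeNth V l x) j (K.D.bracket (V i) (V j.succ) x)))

variable {K} in
/-- `β = ∇_D α` on `W`. -/
def Form.HasDiffOn {n : ℕ} (α : K.Form n) (β : K.Form (n + 1)) (W : Set X) : Prop :=
  ∀ W' ⊆ W, IsOpen W' → ∀ V : Fin (n + 1) → ∀ x, K.D x, (∀ j, K.D.SmoothOn (V j) W') →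
    ∀ x ∈ W', α.koszul V x = β x fun j => V j x

end FoliatedBundle

section Linearity

variable {ι : Type*} {S : LineBundle I X ι}

lemma LineBundle.SmoothOn.mono {s : X → ℂ} {W W' : Set X} (h : S.SmoothOn s W) (hW : W' ⊆ W) :
    S.SmoothOn s W' := fun i => (h i).mono (inter_subset_inter_left _ hW)

lemma LineBundle.coord_add (i : ι) (s t : X → ℂ) : S.coord i (s + t) = S.coord i s + S.coord i t :=
  funext fun _ => map_add _ _ _

lemma LineBundle.coord_smul (i : ι) (c : ℂ) (s : X → ℂ) : S.coord i (c • s) = c • S.coord i s :=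
  funext fun x => (S.coordChange (S.indexAt x) i x).map_smul c (s x)

lemma contMDiffOn_const_smul {f : X → ℂ} {W : Set X} (c : ℂ) (hf : ContMDiffOn I 𝓘(ℝ, ℂ) ∞ f W) :
    ContMDiffOn I 𝓘(ℝ, ℂ) ∞ (c • f) W := by
  have : ContMDiffOn I 𝓘(ℝ, ℂ) ∞ (fun x => c * f x) W := contMDiffOn_mul contMDiffOn_const hf
  exact this

lemma LineBundle.SmoothOn.add {s t : X → ℂ} {W : Set X} (hs : S.SmoothOn s W)
    (ht : S.SmoothOn t W) : S.SmoothOn (s + t) W := fun i => by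
  rw [LineBundle.coord_add]; exact (hs i).add (ht i)

lemma LineBundle.SmoothOn.smul {s : X → ℂ} {W : Set X} (c : ℂ) (hs : S.SmoothOn s W) :
    S.SmoothOn (c • s) W := fun i => by
  rw [LineBundle.coord_smul]; exact contMDiffOn_const_smul c (hs i)

lemma LineBundle.smoothOn_zero (W : Set X) : S.SmoothOn 0 W := fun i => by
  have : S.coord i 0 = fun _ => 0 := funext fun _ => map_zero _
  rw [this]; exact contMDiffOn_const

lemma LineBundle.SmoothOn.mdifferentiableAt {s : X → ℂ} {W : Set X} (hW : IsOpen W)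
    (hs : S.SmoothOn s W) {x : X} (hx : x ∈ W) :
    MDifferentiableAt I 𝓘(ℝ, ℂ) (S.coord (S.indexAt x) s) x :=
  ((hs _).contMDiffAt ((hW.inter (S.isOpen_baseSet _)).mem_nhds
    ⟨hx, S.mem_baseSet_at x⟩)).mdifferentiableAt (by simp)

variable {D : Distribution I X} {A : ConnectionForms D ι}

lemma covDeriv_add {s t : X → ℂ} {W : Set X} (hW : IsOpen W) (hs : S.SmoothOn s W)
    (ht : S.SmoothOn t W) {x : X} (hx : x ∈ W) (v : D x) :
    covDeriv D S A (s + t) x v = covDeriv D S A s x v + covDeriv D S A t x v := by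
  unfold covDeriv
  rw [LineBundle.coord_add, mvfderiv_add (hs.mdifferentiableAt hW hx) (ht.mdifferentiableAt hW hx)]
  simp only [add_apply, Pi.add_apply]
  ring

lemma covDeriv_smul {s : X → ℂ} {W : Set X} (hW : IsOpen W) (c : ℂ) (hs : S.SmoothOn s W)
    {x : X} (hx : x ∈ W) (v : D x) :
    covDeriv D S A (c • s) x v = c * covDeriv D S A s x v := by
  have h := (hs.mdifferentiableAt hW hx)
  have key : mvfderiv I (c • S.coord (S.indexAt x) s) x (v : TangentSpace I x) =
      c * mvfderiv I (S.coord (S.indexAt x) s) x (v : TangentSpace I x) := by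
    let L : ℂ →L[ℝ] ℂ := ContinuousLinearMap.mul ℝ ℂ c
    have hL : HasMFDerivAt 𝓘(ℝ, ℂ) 𝓘(ℝ, ℂ) L (S.coord (S.indexAt x) s x) L :=
      L.hasFDerivAt.hasMFDerivAt
    have := (hL.comp x h.hasMFDerivAt).mfderiv
    have e : (L ∘ S.coord (S.indexAt x) s) = c • S.coord (S.indexAt x) s := rfl
    rw [e] at this
    simp only [mvfderiv, this]
    rfl
  unfold covDeriv
  rw [LineBundle.coord_smul, key]
  simp only [Pi.smul_apply, smul_eq_mul]
  ring

namespace FoliatedBundle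

variable {K : FoliatedBundle I X ι} {n : ℕ} {W : Set X}

lemma Form.SmoothOn.mono {α : K.Form n} {W' : Set X} (h : α.SmoothOn W) (hW : W' ⊆ W) :
    α.SmoothOn W' := fun W₁ hW₁ => h W₁ (hW₁.trans hW)

lemma Form.SmoothOn.add {α β : K.Form n} (hα : α.SmoothOn W) (hβ : β.SmoothOn W) :
    Form.SmoothOn (α + β) W := fun W' hW' ho V hV => (hα W' hW' ho V hV).add (hβ W' hW' ho V hV)

lemma Form.SmoothOn.smul {α : K.Form n} (c : ℂ) (hα : α.SmoothOn W) :
    Form.SmoothOn (c • α) W := fun W' hW' ho V hV => (hα W' hW' ho V hV).smul c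

lemma Form.smoothOn_zero (W : Set X) : Form.SmoothOn (0 : K.Form n) W :=
  fun W' _ _ _ _ => LineBundle.smoothOn_zero W'

lemma Form.HasDiffOn.mono {α : K.Form n} {β : K.Form (n + 1)} {W' : Set X} (h : α.HasDiffOn β W)
    (hW : W' ⊆ W) : α.HasDiffOn β W' := fun W₁ hW₁ => h W₁ (hW₁.trans hW)

lemma smoothOn_removeNth {W : Set X} {V : Fin (n + 1) → ∀ x, K.D x}
    (hV : ∀ j, K.D.SmoothOn (V j) W) (i : Fin (n + 1)) (j : Fin n) :
    K.D.SmoothOn (i.removeNth V j) W := hV (i.succAbove j)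

lemma Form.HasDiffOn.add {α α' : K.Form n} {β β' : K.Form (n + 1)} (hα : α.SmoothOn W)
    (hα' : α'.SmoothOn W) (h : α.HasDiffOn β W) (h' : α'.HasDiffOn β' W) :
    Form.HasDiffOn (α + α') (β + β') W := by
  intro W' hW' ho V hV x hx
  have e : Form.koszul (α + α') V x = α.koszul V x + α'.koszul V x := by
    unfold Form.koszul
    rw [← Finset.sum_add_distrib]
    refine Finset.sum_congr rfl fun i _ => ?_
    have h1 := covDeriv_add (D := K.D) (A := K.A) ho (hα W' hW' ho _ (smoothOn_removeNth hV i))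
      (hα' W' hW' ho _ (smoothOn_removeNth hV i)) hx (V i x)
    have h2 : (fun y => (α + α') y fun j => i.removeNth V j y) =
      (fun y => α y fun j => i.removeNth V j y) + fun y => α' y fun j => i.removeNth V j y := rfl
    rw [h2, h1]
    simp only [Pi.add_apply, AlternatingMap.add_apply, Finset.sum_add_distrib]
    ring
  rw [e, h W' hW' ho V hV x hx, h' W' hW' ho V hV x hx]
  rfl

lemma Form.HasDiffOn.smul {α : K.Form n} {β : K.Form (n + 1)} (c : ℂ) (hα : α.SmoothOn W)
    (h : α.HasDiffOn β W) : Form.HasDiffOn (c • α) (c • β) W := by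
  intro W' hW' ho V hV x hx
  have e : Form.koszul (c • α) V x = c * α.koszul V x := by
    unfold Form.koszul
    rw [Finset.mul_sum]
    refine Finset.sum_congr rfl fun i _ => ?_
    have h1 := covDeriv_smul (D := K.D) (A := K.A) ho c
      (hα W' hW' ho _ (smoothOn_removeNth hV i)) hx (V i x)
    have h2 : (fun y => (c • α) y fun j => i.removeNth V j y) =
      c • (fun y => α y fun j => i.removeNth V j y) := rfl
    rw [h2, h1]
    simp only [Pi.smul_apply, AlternatingMap.smul_apply, smul_eq_mul, ← Finset.mul_sum]
    ring
  rw [e, h W' hW' ho V hV x hx]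
  rfl

lemma Form.hasDiffOn_zero (W : Set X) :
    Form.HasDiffOn (0 : K.Form n) (0 : K.Form (n + 1)) W := by
  intro W' hW' ho V hV x hx
  have e : Form.koszul (0 : K.Form n) V x = 0 := by
    unfold Form.koszul
    refine Finset.sum_eq_zero fun i _ => ?_
    have h1 := covDeriv_smul (D := K.D) (A := K.A) (S := K.S) ho 0
      (LineBundle.smoothOn_zero W') hx (V i x)
    rw [zero_smul, zero_mul] at h1
    have h2 : (fun y => (0 : K.Form n) y fun j => i.removeNth V j y) = 0 := rfl
    rw [h2, h1]
    simp
  rw [e]; rfl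

end FoliatedBundle

end Linearity

namespace FoliatedBundle

variable {ι : Type*} (K : FoliatedBundle I X ι)

/-- Representatives of closed germs: the forms of degree `n` that are smooth and closed on an open
neighbourhood of `C`. -/
def cocycles (C : Set X) (n : ℕ) : Submodule ℂ (K.Form n) where
  carrier := {α | ∃ W, IsOpen W ∧ C ⊆ W ∧ α.SmoothOn W ∧ α.HasDiffOn 0 W}
  add_mem' := by
    rintro α β ⟨W, hW, hC, hs, hd⟩ ⟨W', hW', hC', hs', hd'⟩
    refine ⟨W ∩ W', hW.inter hW', subset_inter hC hC',
      (hs.mono inter_subset_left).add (hs'.mono inter_subset_right), ?_⟩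
    have := (hd.mono inter_subset_left).add (hs.mono inter_subset_left)
      (hs'.mono inter_subset_right) (hd'.mono inter_subset_right)
    rwa [add_zero] at this
  zero_mem' := ⟨univ, isOpen_univ, subset_univ _, Form.smoothOn_zero _,
    Form.hasDiffOn_zero univ⟩
  smul_mem' := by
    rintro c α ⟨W, hW, hC, hs, hd⟩
    refine ⟨W, hW, hC, hs.smul c, ?_⟩
    have := hd.smul c hs
    rwa [smul_zero] at this

/-- Representatives of exact germs: the forms that coincide on an open neighbourhood of `C` with
the differential of a form that is smooth there (with `0`, in degree `0`). -/
def coboundaries (C : Set X) : ∀ n : ℕ, Submodule ℂ (K.Form n)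
  | 0 =>
    { carrier := {α | ∃ W, IsOpen W ∧ C ⊆ W ∧ ∀ x ∈ W, α x = 0}
      add_mem' := by
        rintro α β ⟨W, hW, hC, h⟩ ⟨W', hW', hC', h'⟩
        refine ⟨W ∩ W', hW.inter hW', subset_inter hC hC', fun x hx => ?_⟩
        rw [Pi.add_apply, h x hx.1, h' x hx.2, add_zero]
      zero_mem' := ⟨univ, isOpen_univ, subset_univ _, fun _ _ => rfl⟩
      smul_mem' := by
        rintro c α ⟨W, hW, hC, h⟩
        refine ⟨W, hW, hC, fun x hx => ?_⟩
        rw [Pi.smul_apply, h x hx, smul_zero] }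
  | n + 1 =>
    { carrier := {α | ∃ W, IsOpen W ∧ C ⊆ W ∧ ∃ β : K.Form n, β.SmoothOn W ∧ β.HasDiffOn α W}
      add_mem' := by
        rintro α α' ⟨W, hW, hC, β, hs, hd⟩ ⟨W', hW', hC', β', hs', hd'⟩
        exact ⟨W ∩ W', hW.inter hW', subset_inter hC hC', β + β',
          (hs.mono inter_subset_left).add (hs'.mono inter_subset_right),
          (hd.mono inter_subset_left).add (hs.mono inter_subset_left)
            (hs'.mono inter_subset_right) (hd'.mono inter_subset_right)⟩
      zero_mem' := ⟨univ, isOpen_univ, subset_univ _, 0, Form.smoothOn_zero _,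
        Form.hasDiffOn_zero univ⟩
      smul_mem' := by
        rintro c α ⟨W, hW, hC, β, hs, hd⟩
        exact ⟨W, hW, hC, c • β, hs.smul c, hd.smul c hs⟩ }

/-- The cohomology `H^n(C, 𝒥)` of the Kostant complex of germs along `C` of `S`-valued forms, that
is, of the direct limit, over the open neighbourhoods `W` of `C`, of the complexes
`(𝒮 ⊗ Ω_D^•)(W)`. For `C = univ` it is the cohomology of the Kostant complex of `X`; in degree `0`
it is the space of flat sections of `S` near `C`. -/
abbrev Cohomology (C : Set X) (n : ℕ) : Type _ :=
  K.cocycles C n ⧸ (K.coboundaries C n).submoduleOf (K.cocycles C n)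

/-- The class of a closed form. -/
def classOf (C : Set X) (n : ℕ) (α : K.Form n) (h : α ∈ K.cocycles C n) : K.Cohomology C n :=
  Submodule.Quotient.mk ⟨α, h⟩

/-- The Geometric Quantization space, the direct sum of all cohomology groups. -/
abbrev QuantizationSpace : Type _ := DirectSum ℕ fun n => K.Cohomology univ n

end FoliatedBundle

/-! ### Symplectic manifolds, prequantization, polarizations, metalinear correction -/

variable (I X) in
/-- A symplectic form: a smooth, closed, nondegenerate `2`-form. -/
structure SymplecticForm where
  form : ∀ x : X, TangentSpace I x →ₗ[ℝ] TangentSpace I x →ₗ[ℝ] ℝ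
  self_eq_zero : ∀ x v, form x v v = 0
  nondegenerate : ∀ x v, (∀ w, form x v w = 0) → v = 0
  smooth : ∀ W : Set X, IsOpen W → ∀ V V' : ∀ x, fullDistribution I X x,
    (fullDistribution I X).SmoothOn V W → (fullDistribution I X).SmoothOn V' W →
    ContMDiffOn I 𝓘(ℝ, ℝ) ∞ (fun x => form x (V x) (V' x)) W
  closed : ∀ W : Set X, IsOpen W → ∀ V₀ V₁ V₂ : ∀ x, fullDistribution I X x,
    (fullDistribution I X).SmoothOn V₀ W → (fullDistribution I X).SmoothOn V₁ W →
    (fullDistribution I X).SmoothOn V₂ W → ∀ x ∈ W,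
    mvfderiv I (fun y => form y (V₁ y) (V₂ y)) x (V₀ x : TangentSpace I x)
      - mvfderiv I (fun y => form y (V₀ y) (V₂ y)) x (V₁ x : TangentSpace I x)
      + mvfderiv I (fun y => form y (V₀ y) (V₁ y)) x (V₂ x : TangentSpace I x)
      - form x ((fullDistribution I X).bracket V₀ V₁ x) (V₂ x)
      + form x ((fullDistribution I X).bracket V₀ V₂ x) (V₁ x)
      - form x ((fullDistribution I X).bracket V₁ V₂ x) (V₀ x) = 0

/-- The positive function `h` is a smooth Hermitian metric `⟨s, t⟩ = h s t̄` on the line bundle `L`,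
with which the connection `A` is compatible: `d⟨s, t⟩ = ⟨∇s, t⟩ + ⟨s, ∇t⟩`. -/
structure IsHermitian {ι : Type*} (L : LineBundle I X ι)
    (A : ConnectionForms (fullDistribution I X) ι) (h : X → ℝ) : Prop where
  pos : ∀ x, 0 < h x
  smooth : ∀ W : Set X, IsOpen W → ∀ s t : X → ℂ, L.SmoothOn s W → L.SmoothOn t W →
    ContMDiffOn I 𝓘(ℝ, ℂ) ∞ (fun x => h x * s x * star (t x)) W
  compatible : ∀ W : Set X, IsOpen W → ∀ s t : X → ℂ, L.SmoothOn s W → L.SmoothOn t W →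
    ∀ x ∈ W, ∀ v : fullDistribution I X x,
      mvfderiv I (fun y => h y * s y * star (t y)) x (v : TangentSpace I x) =
        h x * covDeriv (fullDistribution I X) L A s x v * star (t x) +
          h x * s x * star (covDeriv (fullDistribution I X) L A t x v)

/-- `w = ∇_Z Y` at `x`, for the connection along the leaves of the Lagrangian foliation `P` on `P`
that is dual, under the isomorphism `Y ↦ σ(Y, ·)` of `P` with `(TX/P)*`, to the Bott connection
`∇_Z [V] = [[Z, V]]` on `TX/P`: one has `σ(∇_Z Y, V) = Z(σ(Y, V)) - σ(Y, [Z, V])` for every smooth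
vector field `V` near `x`. -/
def IsBottDerivative (σ : SymplecticForm I X) (P : Distribution I X) (Z Y : ∀ x, P x) (x : X)
    (w : P x) : Prop :=
  ∀ W : Set X, IsOpen W → x ∈ W → ∀ V : ∀ y, fullDistribution I X y,
    (fullDistribution I X).SmoothOn V W →
    σ.form x w (V x) =
      mvfderiv I (fun y => σ.form y (Y y) (V y)) x (Z x : TangentSpace I x) -
        σ.form x (Y x) (mlieBracket I (fun y => (Z y : TangentSpace I y))
          (fun y => (V y : TangentSpace I y)) x)

/-- The element `Y₁ ∧ ⋯ ∧ Yₘ` of the top exterior power of the complexification of a real vector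
space `P`. -/
def complexWedge {P : Type*} [AddCommGroup P] [Module ℝ P] {m : ℕ} (Y : Fin m → P) :
    ⋀[ℂ]^m (ℂ ⊗[ℝ] P) :=
  exteriorPower.ιMulti ℂ m fun j => (1 : ℂ) ⊗ₜ[ℝ] Y j

variable (I X) in
/-- The data of Geometric Quantization on a manifold of dimension `2 * m`:
* a symplectic form `σ`;
* a prequantum line bundle: a Hermitian line bundle `L` with a compatible connection `AL` of
  curvature `-iσ`;
* a real polarization `P`: a foliation with Lagrangian leaves;
* a metalinear correction: a line bundle `N½` with an isomorphism `sq` of the bundle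
  `N = ⋀^m_ℂ (P ⊗ ℂ)` with `N½ ⊗ N½`, and the connection `AN` along `P` on `N½` that induces on
  `N½ ⊗ N½ ≅ N` the connection coming from the dual Bott connection on `P`. -/
structure QuantizationData (m : ℕ) (ιL ιN : Type*) where
  σ : SymplecticForm I X
  L : LineBundle I X ιL
  AL : ConnectionForms (fullDistribution I X) ιL
  metric : X → ℝ
  isConnection_AL : IsConnection (fullDistribution I X) L AL
  isHermitian : IsHermitian L AL metric
  curvature : HasCurvature (fullDistribution I X) L AL
    fun x v w => -Complex.I * (σ.form x v w : ℝ)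
  P : Distribution I X
  isFoliation : P.IsFoliation m
  isotropic : ∀ x, ∀ v ∈ P x, ∀ w ∈ P x, σ.form x v w = 0
  Nhalf : LineBundle I X ιN
  sq : ∀ x, ⋀[ℂ]^m (ℂ ⊗[ℝ] P x) ≃ₗ[ℂ] ℂ
  smooth_sq : ∀ W : Set X, IsOpen W → ∀ Y : Fin m → ∀ x, P x, (∀ j, P.SmoothOn (Y j) W) →
    (Nhalf.tensor Nhalf).SmoothOn (fun x => sq x (complexWedge fun j => Y j x)) W
  AN : ConnectionForms P ιN
  isConnection_AN : IsConnection P Nhalf AN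
  covDeriv_sq : ∀ W : Set X, IsOpen W → ∀ (Z : ∀ x, P x) (Y : Fin m → ∀ x, P x),
    P.SmoothOn Z W → (∀ j, P.SmoothOn (Y j) W) → ∀ x ∈ W, ∀ w : Fin m → P x,
    (∀ j, IsBottDerivative σ P Z (Y j) x (w j)) →
    covDeriv P (Nhalf.tensor Nhalf) (AN.tensor AN)
        (fun y => sq y (complexWedge fun j => Y j y)) x (Z x) =
      ∑ j, sq x (complexWedge (Function.update (fun l => Y l x) j (w j)))

/-- The bundle `L ⊗ N½` with the induced connection `∇'` along the polarization; its sheaf of flat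
sections is the sheaf `𝒥` of Geometric Quantization. -/
def QuantizationData.bundle {m : ℕ} {ιL ιN : Type*} (Q : QuantizationData I X m ιL ιN) :
    FoliatedBundle I X (ιL × ιN) where
  D := Q.P
  S := Q.L.tensor Q.Nhalf
  A := (Q.AL.restrict fun _ => le_top).tensor Q.AN

end General

/-! ### Products -/

section Product

variable {E : Type*} [NormedAddCommGroup E] [NormedSpace ℝ E]
  {H : Type*} [TopologicalSpace H] {I : ModelWithCorners ℝ E H}
  {X : Type*} [TopologicalSpace X] [ChartedSpace H X] [IsManifold I ∞ X]
  {E' : Type*} [NormedAddCommGroup E'] [NormedSpace ℝ E']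
  {H' : Type*} [TopologicalSpace H'] {I' : ModelWithCorners ℝ E' H'}
  {Y : Type*} [TopologicalSpace Y] [ChartedSpace H' Y] [IsManifold I' ∞ Y]
  {ι ι' : Type*}

/-- The product distribution `D ⊕ D'` on `X × Y`. -/
def Distribution.prod (D : Distribution I X) (D' : Distribution I' Y) :
    Distribution (I.prod I') (X × Y) :=
  fun z => Submodule.prod (p := D z.1) (q₁ := D' z.2)

/-- The component along `X` of a vector of the product distribution. -/
def Distribution.prodFst (D : Distribution I X) (D' : Distribution I' Y) (z : X × Y) :
    D.prod D' z →ₗ[ℝ] D z.1 where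
  toFun v := ⟨v.1.1, v.2.1⟩
  map_add' _ _ := rfl
  map_smul' _ _ := rfl

/-- The component along `Y` of a vector of the product distribution. -/
def Distribution.prodSnd (D : Distribution I X) (D' : Distribution I' Y) (z : X × Y) :
    D.prod D' z →ₗ[ℝ] D' z.2 where
  toFun v := ⟨v.1.2, v.2.2⟩
  map_add' _ _ := rfl
  map_smul' _ _ := rfl

/-- The external tensor product of line bundles over `X` and `Y`, a line bundle over `X × Y`. -/
def LineBundle.prod (S : LineBundle I X ι) (T : LineBundle I' Y ι') :
    LineBundle (I.prod I') (X × Y) (ι × ι') where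
  baseSet i := S.baseSet i.1 ×ˢ T.baseSet i.2
  isOpen_baseSet i := (S.isOpen_baseSet i.1).prod (T.isOpen_baseSet i.2)
  indexAt z := (S.indexAt z.1, T.indexAt z.2)
  mem_baseSet_at z := ⟨S.mem_baseSet_at z.1, T.mem_baseSet_at z.2⟩
  coordChange i j z := (S.coordChange i.1 j.1 z.1).comp (T.coordChange i.2 j.2 z.2)
  coordChange_self i z hz v := by
    simp [S.coordChange_self i.1 z.1 hz.1, T.coordChange_self i.2 z.2 hz.2]
  continuousOn_coordChange i j :=
    ((S.continuousOn_coordChange i.1 j.1).comp continuousOn_fst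
      fun _ hx => ⟨hx.1.1, hx.2.1⟩).clm_comp
      ((T.continuousOn_coordChange i.2 j.2).comp continuousOn_snd
        fun _ hx => ⟨hx.1.2, hx.2.2⟩)
  coordChange_comp i j k z hz v := by
    obtain ⟨⟨⟨h1, h2⟩, h3, h4⟩, h5, h6⟩ := hz
    have hS := S.coordChange_comp i.1 j.1 k.1 z.1 ⟨⟨h1, h3⟩, h5⟩
    have hT := T.coordChange_comp i.2 j.2 k.2 z.2 ⟨⟨h2, h4⟩, h6⟩
    have comm (f g : ℂ →L[ℂ] ℂ) (z : ℂ) : f (g z) = g (f z) := by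
      have hf (w : ℂ) : f w = w * f 1 := by simpa using f.map_smul w 1
      have hg (w : ℂ) : g w = w * g 1 := by simpa using g.map_smul w 1
      rw [hf (g z), hg z, hg (f z), hf z]; ring
    simp only [ContinuousLinearMap.comp_apply]
    rw [comm (T.coordChange j.2 k.2 z.2), hS, hT]
  smooth_coordChange i j := by
    simp only [ContinuousLinearMap.comp_apply, comp_apply_one]
    exact contMDiffOn_mul ((S.smooth_coordChange i.1 j.1).comp contMDiffOn_fst
      fun _ hx => ⟨hx.1.1, hx.2.1⟩)
      ((T.smooth_coordChange i.2 j.2).comp contMDiffOn_snd fun _ hx => ⟨hx.1.2, hx.2.2⟩)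

/-- The product `S ⊠ T` over `X × Y`, along the product distribution, with the connection
`∇ ⊠ 1 + 1 ⊠ ∇`. -/
def FoliatedBundle.prod (K : FoliatedBundle I X ι) (K' : FoliatedBundle I' Y ι') :
    FoliatedBundle (I.prod I') (X × Y) (ι × ι') where
  D := K.D.prod K'.D
  S := K.S.prod K'.S
  A i z := (K.A i.1 z.1).comp (K.D.prodFst K'.D z) + (K'.A i.2 z.2).comp (K.D.prodSnd K'.D z)

/-- The product of the pull-back to `X × Y` of a form `α` on `X` and the pull-back of a section
`f`, seen as a form of degree `0`, on `Y`. -/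
def FoliatedBundle.pullbackMul (K : FoliatedBundle I X ι) (K' : FoliatedBundle I' Y ι') {n : ℕ}
    (α : K.Form n) (f : K'.Form 0) : (K.prod K').Form n :=
  fun z => f z.2 ![] • (α z.1).compLinearMap (K.D.prodFst K'.D z)

end Product

/-! ### Cotangent balls -/

/-- The space `ℝ²ᵏ`, with coordinates `(x, y)`. -/
abbrev PhaseSpace (k : ℕ) := EuclideanSpace ℝ (Fin k) × EuclideanSpace ℝ (Fin k)

/-- The standard symplectic form `∑ dxᵢ ∧ dyᵢ`. -/
def standardForm (k : ℕ) (u v : PhaseSpace k) : ℝ := ∑ i, (u.1 i * v.2 i - u.2 i * v.1 i)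

/-- `θ` is a smooth `1`-form on `ℝ²ᵏ` with `dθ = ∑ dxᵢ ∧ dyᵢ`. -/
structure IsPrimitive (k : ℕ) (θ : PhaseSpace k → PhaseSpace k →L[ℝ] ℝ) : Prop where
  smooth : ContDiff ℝ ∞ θ
  d_eq : ∀ z u v, fderiv ℝ θ z u v - fderiv ℝ θ z v u = standardForm k u v

/-- The foliation `P₀` of `ℝ²ᵏ` by the leaves `x = const`. -/
def verticalFoliation (k : ℕ) : Distribution 𝓘(ℝ, PhaseSpace k) (PhaseSpace k) :=
  fun _ => LinearMap.ker (LinearMap.fst ℝ (EuclideanSpace ℝ (Fin k)) (EuclideanSpace ℝ (Fin k)))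

/-- The trivial line bundle over `ℝ²ᵏ` with the connection `d - iθ` along `P₀`. Its sheaf of flat
sections is `𝒥₀`. -/
def standardBundle (k : ℕ) (θ : PhaseSpace k → PhaseSpace k →L[ℝ] ℝ) :
    FoliatedBundle 𝓘(ℝ, PhaseSpace k) (PhaseSpace k) Unit where
  D := verticalFoliation k
  S := LineBundle.trivial _ _
  A _ z :=
    ((-Complex.I) • Complex.ofRealCLM.toLinearMap.comp (θ z).toLinearMap).comp
      (verticalFoliation k z).subtype

/-- The leaves of `P₀` restricted to `U`, and the space of these leaves, are contractible. -/
structure HasContractibleLeaves {k : ℕ} (U : Set (PhaseSpace k)) : Prop where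
  leaf : ∀ c ∈ Prod.fst '' U, ContractibleSpace {z : PhaseSpace k // z ∈ U ∧ z.1 = c}
  leafSpace : ContractibleSpace (Quotient (Setoid.ker fun z : U => z.1.1))

/-- A cotangent ball: an open set whose leaves and whose leaf space are contractible. -/
def IsCotangentBall {k : ℕ} (U : Set (PhaseSpace k)) : Prop :=
  IsOpen U ∧ HasContractibleLeaves U

/-- A closed cotangent ball: a compact set that is the closure of a cotangent ball and whose leaves
and leaf space are still contractible. -/
def IsClosedCotangentBall {k : ℕ} (U : Set (PhaseSpace k)) : Prop :=
  IsCompact U ∧ HasContractibleLeaves U ∧ ∃ V, IsCotangentBall V ∧ U = closure V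

end GeometricQuantization

end

open GeometricQuantization

/-!
The theorem is a Künneth formula in which the second factor contributes only its flat sections,
because the leaves over `U` are contractible, and in which compactness of `M` and finiteness of its
cohomology replace a topological tensor product.

**Local computations.** The distribution of a foliated bundle is covered by patches (`Patch`):
charts with a trivialization of the line bundle and a frame of the distribution that is normalized
by a fixed projection. In a patch a form becomes a function with values in alternating maps on a
fixed space, and the Kostant differential, given intrinsically by the Koszul formula, becomes an
explicit first order operator `Patch.d` (`Patch.hasDiffOn_iff`). This operator is compatible with
pull-backs (`localD_pullback`), which yields all the operations on forms on `M × ℝ²ᵏ` that are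
needed: products with functions, restriction to slices `M × {z}`, families of forms, and integrals
over parameters.

**Injectivity** (`kuennethMap_injective`). Let `e₁, …, e_N` represent a basis of `H^n(M)`. If
`∑ fⱼ eⱼ` is exact near `M × U`, then restriction to `M × {z}` shows that `∑ fⱼ(z) [eⱼ] = 0` for
all `z` near `U`, so that all `fⱼ` vanish near `U`.

**Surjectivity** (`kuennethMap_surjective`).

* A primitive of `θ` along the leaves exists on all of `ℝ²ᵏ`, and its exponential is a gauge
  transformation that reduces the problem to `θ = 0` (`IsPrimitive.exists_gauge`).
* Near a leaf `{c} × A` of `U`, the compact contractible set `A` has a neighbourhood with a smooth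
  contraction (`exists_smooth_contraction`). The homotopy formula shows that a closed form `β` is,
  up to an exact form, the constant extension along the leaves of its restrictions to
  `M × {(x, y₀)}`, a smooth family of closed forms on `M` with parameter `x`
  (`exists_isPrimitiveOn_sub_famForm_sliceForm`).
* A smooth family `b(x)` of closed forms on `M` can locally be written as
  `b(x) = ∑ fⱼ(x) eⱼ + d a(x)` with smooth `fⱼ` and `a` (`exists_famSmooth_isPrimitiveOn`). For a
  single form this is the choice of the `eⱼ`. To choose primitives smoothly in `x`, the substitution
  `xᵢ = cᵢ + r sin(2π tᵢ)` makes the family periodic in `t`, and its Fourier coefficients are a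
  rapidly decreasing family of closed forms. The triples `(a, f, b)` with `b = ∑ fⱼ eⱼ + d a` form a
  complete space with countably many seminorms, whose projection to the closed forms is onto. By the
  open mapping theorem (`exists_lift_le_one`) rapidly decreasing families lift to rapidly decreasing
  families (`exists_rapidly_decreasing_lift`), and the Fourier series of the lifts is the
  desired choice. The integrals and series of forms are formed pointwise.
* A partition of unity in `x` glues these local decompositions (`exists_decomposition`): functions
  of `x` are constant along the leaves, so multiplication with them preserves primitives. The
  resulting coefficients depend on `x` only, that is, they are flat.
-/

noncomputable section

namespace GeometricQuantization

/-! ### Alternating maps on finite-dimensional spaces -/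

lemma multilinear_expand {R F : Type*} [NormedAddCommGroup R] [NormedSpace ℝ R]
    [FiniteDimensional ℝ R] [NormedAddCommGroup F] [NormedSpace ℝ F] {n : ℕ}
    (f : MultilinearMap ℝ (fun _ : Fin n => R) F) (v : Fin n → R) :
    f v = ∑ I : Fin n → Fin (Module.finrank ℝ R),
      (∏ j, (Module.finBasis ℝ R).repr (v j) (I j)) • f (fun j => Module.finBasis ℝ R (I j)) := by
  conv_lhs => rw [show v = fun j => ∑ i, (Module.finBasis ℝ R).repr (v j) i •
    Module.finBasis ℝ R i from funext fun j => ((Module.finBasis ℝ R).sum_repr (v j)).symm]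
  rw [f.map_sum]
  exact Finset.sum_congr rfl fun I _ => f.map_smul_univ _ _

/-- A multilinear map on a finite-dimensional normed space is continuous. -/
lemma multilinear_continuous {R F : Type*} [NormedAddCommGroup R] [NormedSpace ℝ R]
    [FiniteDimensional ℝ R] [NormedAddCommGroup F] [NormedSpace ℝ F] {n : ℕ}
    (f : MultilinearMap ℝ (fun _ : Fin n => R) F) : Continuous f := by
  rw [show (f : (Fin n → R) → F) = _ from funext (multilinear_expand f)]
  refine continuous_finsetSum _ fun I _ => Continuous.smul ?_ continuous_const
  refine continuous_finsetProd _ fun j _ => ?_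
  exact (LinearMap.continuous_of_finiteDimensional
    ((Module.finBasis ℝ R).coord (I j))).comp (continuous_apply j)

/-- The continuous alternating map underlying an alternating map on a finite-dimensional space. -/
def altCLM {R F : Type*} [NormedAddCommGroup R] [NormedSpace ℝ R]
    [FiniteDimensional ℝ R] [NormedAddCommGroup F] [NormedSpace ℝ F] {n : ℕ}
    (f : R [⋀^Fin n]→ₗ[ℝ] F) : R [⋀^Fin n]→L[ℝ] F :=
  { f with cont := multilinear_continuous f.toMultilinearMap }

/-- A map into a space of alternating maps is smooth if its values on fixed vectors are. -/
lemma contDiffOn_alt {G R : Type*} [NormedAddCommGroup G] [NormedSpace ℝ G] [NormedAddCommGroup R]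
    [NormedSpace ℝ R] [FiniteDimensional ℝ R] {n : ℕ} {a : G → R [⋀^Fin n]→L[ℝ] ℂ} {s : Set G}
    (h : ∀ v : Fin n → R, ContDiffOn ℝ ∞ (fun u => a u v) s) : ContDiffOn ℝ ∞ a s := by
  let b := Module.finBasis ℝ R
  let L : (R [⋀^Fin n]→L[ℝ] ℂ) →ₗ[ℝ] ((Fin n → Fin (Module.finrank ℝ R)) → ℂ) :=
    { toFun := fun f I => f fun j => b (I j)
      map_add' := fun _ _ => rfl
      map_smul' := fun _ _ => rfl }
  have hL : Function.Injective L := by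
    intro f g hfg
    have : f.toMultilinearMap = g.toMultilinearMap :=
      Module.Basis.ext_multilinear (fun _ => b) fun I => congrFun hfg I
    ext v
    exact congrArg (fun m : MultilinearMap ℝ (fun _ : Fin n => R) ℂ => m v) this
  obtain ⟨G', hG'⟩ := L.exists_leftInverse_of_injective (LinearMap.ker_eq_bot.2 hL)
  have e : a = fun u => G'.toContinuousLinearMap (L (a u)) := by
    funext u
    exact (LinearMap.congr_fun hG' (a u)).symm
  rw [e]
  exact G'.toContinuousLinearMap.contDiff.comp_contDiffOn (contDiffOn_pi.2 fun I => h _)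

lemma contDiffOn_alt_apply {G R : Type*} [NormedAddCommGroup G] [NormedSpace ℝ G]
    [NormedAddCommGroup R] [NormedSpace ℝ R] [FiniteDimensional ℝ R] {n : ℕ}
    {a : G → R [⋀^Fin n]→L[ℝ] ℂ} {g : Fin n → G → R} {s : Set G} (ha : ContDiffOn ℝ ∞ a s)
    (hg : ∀ j, ContDiffOn ℝ ∞ (g j) s) : ContDiffOn ℝ ∞ (fun u => a u fun j => g j u) s := by
  have e : (fun u => a u fun j => g j u) = fun u => ∑ I : Fin n → Fin (Module.finrank ℝ R),
      (∏ j, (Module.finBasis ℝ R).repr (g j u) (I j)) •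
        a u (fun j => Module.finBasis ℝ R (I j)) :=
    funext fun u => multilinear_expand (a u).toMultilinearMap _
  rw [e]
  refine ContDiffOn.sum fun I _ => ?_
  have h1 : ContDiffOn ℝ ∞
      (fun u => ∏ j, (Module.finBasis ℝ R).repr (g j u) (I j)) s :=
    contDiffOn_prod fun j _ => ((LinearMap.toContinuousLinearMap
      ((Module.finBasis ℝ R).coord (I j))).contDiff).comp_contDiffOn (hg j)
  have h2 : ContDiffOn ℝ ∞ (fun u => a u (fun j => Module.finBasis ℝ R (I j))) s :=
    (ContinuousAlternatingMap.apply ℝ R ℂ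
      (fun j => Module.finBasis ℝ R (I j))).contDiff.comp_contDiffOn ha
  exact h1.smul h2

/-! ### Vector fields in charts -/

section VF
variable {E : Type*} [NormedAddCommGroup E] [NormedSpace ℝ E]
  {H : Type*} [TopologicalSpace H] (I : ModelWithCorners ℝ E H)
  {X : Type*} [TopologicalSpace X] [ChartedSpace H X] [IsManifold I ∞ X]

/-- The derivative at `x` of the chart centred at `p`. -/
def dChart (p x : X) : TangentSpace I x →L[ℝ] E := mfderiv I 𝓘(ℝ, E) (extChartAt I p) x

/-- The vector field `V` in the chart centred at `p`. -/
def chartField (p : X) (V : ∀ x : X, TangentSpace I x) (u : E) : E :=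
  dChart I p ((extChartAt I p).symm u) (V ((extChartAt I p).symm u))

/-- In the trivialization of the tangent bundle at `p`, the second coordinate is the derivative of
the chart. -/
lemma trivializationAt_eq_dChart {p x : X} (hx : x ∈ (chartAt H p).source)
    (v : TangentSpace I x) :
    (trivializationAt E (TangentSpace I) p ⟨x, v⟩).2 = dChart I p x v := by
  have h := TangentBundle.continuousLinearMapAt_trivializationAt (I := I) (𝕜 := ℝ) hx
  have h2 := DFunLike.congr_fun h v
  rw [Bundle.Trivialization.continuousLinearMapAt_apply,
    Bundle.Trivialization.linearMapAt_apply, if_pos (by simpa using hx)] at h2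
  exact h2

/-- A vector field is smooth if and only if its components in a chart are. -/
lemma smoothField_iff {p : X} {V : ∀ x : X, TangentSpace I x} {W : Set X} (hW : IsOpen W)
    (hWp : W ⊆ (chartAt H p).source) :
    ContMDiffOn I I.tangent ∞ (fun x => (⟨x, V x⟩ : TangentBundle I X)) W ↔
      ContMDiffOn I 𝓘(ℝ, E) ∞ (fun x => dChart I p x (V x)) W := by
  have h := (trivializationAt E (TangentSpace I : X → Type _) p).contMDiffOn_section_iff
    (IB := I) (n := ∞) (s := V) hW (by simpa using hWp)
  refine Iff.trans h ?_
  refine contMDiffOn_congr fun x hx => ?_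
  exact (trivializationAt_eq_dChart I (hWp hx) (V x))

lemma contDiffOn_comp_chart_iff {F : Type*} [NormedAddCommGroup F] [NormedSpace ℝ F] {p : X}
    {f : X → F} {W : Set X} (hWp : W ⊆ (chartAt H p).source) :
    ContMDiffOn I 𝓘(ℝ, F) ∞ f W ↔
      ContDiffOn ℝ ∞ (fun u => f ((extChartAt I p).symm u))
        ((extChartAt I p).target ∩ (extChartAt I p).symm ⁻¹' W) := by
  constructor
  · intro h
    rw [← contMDiffOn_iff_contDiffOn]
    exact h.comp ((contMDiffOn_extChartAt_symm p).mono inter_subset_left) fun u hu => hu.2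
  · intro h
    rw [← contMDiffOn_iff_contDiffOn] at h
    have h2 := h.comp ((contMDiffOn_extChartAt (I := I) (x := p) (n := ∞)).mono hWp)
      (fun x hx => by
        have hx' : x ∈ (extChartAt I p).source := by rw [extChartAt_source]; exact hWp hx
        exact ⟨(extChartAt I p).map_source hx', by
          rw [mem_preimage, (extChartAt I p).left_inv hx']; exact hx⟩)
    refine h2.congr fun x hx => ?_
    have hx' : x ∈ (extChartAt I p).source := by rw [extChartAt_source]; exact hWp hx
    rw [Function.comp_apply, (extChartAt I p).left_inv hx']

omit [IsManifold I ∞ X] in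
lemma mem_source_symm {p : X} {u : E} (hu : u ∈ (extChartAt I p).target) :
    (extChartAt I p).symm u ∈ (chartAt H p).source := by
  have := (extChartAt I p).map_target hu
  rwa [extChartAt_source] at this

variable [I.Boundaryless]

lemma mfderiv_symm_dChart {p : X} {u : E} (hu : u ∈ (extChartAt I p).target) :
    (mfderiv 𝓘(ℝ, E) I (extChartAt I p).symm u).inverse = dChart I p ((extChartAt I p).symm u) := by
  have h1 := mfderiv_extChartAt_comp_mfderivWithin_extChartAt_symm (I := I) hu
  have h2 := mfderivWithin_extChartAt_symm_comp_mfderiv_extChartAt (I := I) hu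
  rw [I.range_eq_univ, mfderivWithin_univ] at h1 h2
  exact ContinuousLinearMap.inverse_eq h2 h1

omit [I.Boundaryless] in
lemma dChart_bijective {p x : X} (hx : x ∈ (chartAt H p).source) :
    Function.Bijective (dChart I p x) := by
  obtain ⟨e, he⟩ := isInvertible_mfderiv_extChartAt (I := I) (x := p) (y := x)
    (by rwa [extChartAt_source])
  have : (dChart I p x : TangentSpace I x → E) = e := by
    rw [dChart, ← he]; rfl
  rw [this]
  exact e.bijective

/-- The Lie bracket of vector fields is computed in a chart. -/
lemma dChart_mlieBracket {p : X} {V V' : ∀ x : X, TangentSpace I x} {W : Set X} (hW : IsOpen W)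
    (hV : ContMDiffOn I I.tangent ∞ (fun x => (⟨x, V x⟩ : TangentBundle I X)) W)
    (hV' : ContMDiffOn I I.tangent ∞ (fun x => (⟨x, V' x⟩ : TangentBundle I X)) W)
    [CompleteSpace E]
    {u : E} (hu : u ∈ (extChartAt I p).target) (huW : (extChartAt I p).symm u ∈ W) :
    dChart I p ((extChartAt I p).symm u) (mlieBracket I V V' ((extChartAt I p).symm u)) =
      lieBracket ℝ (chartField I p V) (chartField I p V') u := by
  have : IsManifold I 2 X := IsManifold.of_le (n := ∞) (WithTop.coe_le_coe.2 le_top)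
  have : IsManifold I (minSmoothness ℝ 2) X := by simpa using this
  have hf : ContMDiffAt 𝓘(ℝ, E) I ∞ (extChartAt I p).symm u :=
    (contMDiffOn_extChartAt_symm p).contMDiffAt ((isOpen_extChartAt_target p).mem_nhds hu)
  have h := mpullback_mlieBracket (I := 𝓘(ℝ, E)) (I' := I) (n := ∞)
    (f := (extChartAt I p).symm) (V := V) (W := V') (x₀ := u)
    ((hV.contMDiffAt (hW.mem_nhds huW)).mdifferentiableAt (by simp))
    ((hV'.contMDiffAt (hW.mem_nhds huW)).mdifferentiableAt (by simp))
    hf (by simpa using (WithTop.coe_le_coe.2 le_top : ((2 : ℕ∞) : WithTop ℕ∞) ≤ ∞))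
  have hnear : ∀ V : ∀ x : X, TangentSpace I x,
      mpullback 𝓘(ℝ, E) I (extChartAt I p).symm V =ᶠ[nhds u] chartField I p V := by
    intro V
    filter_upwards [(isOpen_extChartAt_target p).mem_nhds hu] with w hw
    rw [mpullback_apply, mfderiv_symm_dChart I hw]
    rfl
  rw [mpullback_apply, mfderiv_symm_dChart I hu,
    (hnear V).mlieBracket_vectorField_eq (hnear V')] at h
  refine h.trans ?_
  have e (A B : ∀ x : E, TangentSpace 𝓘(ℝ, E) x) :
      mlieBracket 𝓘(ℝ, E) A B = lieBracket ℝ A B := by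
    rw [← mlieBracketWithin_univ, mlieBracketWithin_eq_lieBracketWithin]
    exact lieBracketWithin_univ
  exact congrFun (e _ _) u

/-- The derivative of a function along a vector is computed in a chart. -/
lemma mvfderiv_eq_fderiv {F : Type*} [NormedAddCommGroup F] [NormedSpace ℝ F] {p : X}
    {f : X → F} {u : E} (hu : u ∈ (extChartAt I p).target)
    (hf : MDifferentiableAt I 𝓘(ℝ, F) f ((extChartAt I p).symm u))
    (v : TangentSpace I ((extChartAt I p).symm u)) :
    mvfderiv I f ((extChartAt I p).symm u) v =
      fderiv ℝ (fun w => f ((extChartAt I p).symm w)) u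
        (dChart I p ((extChartAt I p).symm u) v) := by
  set x := (extChartAt I p).symm u with hx
  have hxs := mem_source_symm I hu
  have hφ : extChartAt I p x = u := (extChartAt I p).right_inv hu
  have hs : MDifferentiableAt 𝓘(ℝ, E) I (extChartAt I p).symm (extChartAt I p x) := by
    rw [hφ]
    exact ((contMDiffOn_extChartAt_symm (n := ∞) p).contMDiffAt
      ((isOpen_extChartAt_target p).mem_nhds hu)).mdifferentiableAt (by simp)
  have hg : MDifferentiableAt 𝓘(ℝ, E) 𝓘(ℝ, F) (fun w => f ((extChartAt I p).symm w))
      (extChartAt I p x) := by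
    refine MDifferentiableAt.comp (extChartAt I p x) ?_ hs
    rw [hφ]; exact hf
  have hc := hg.hasMFDerivAt.comp x (mdifferentiableAt_extChartAt hxs).hasMFDerivAt
  have he : ((fun w => f ((extChartAt I p).symm w)) ∘ extChartAt I p) =ᶠ[nhds x] f := by
    filter_upwards [(isOpen_extChartAt_source (I := I) p).mem_nhds
      (by rwa [extChartAt_source])] with y hy
    simp only [Function.comp_apply]
    rw [(extChartAt I p).left_inv hy]
  have h2 := (hc.congr_of_eventuallyEq he.symm).mfderiv
  rw [mfderiv_eq_fderiv, hφ] at h2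
  unfold mvfderiv
  rw [h2]
  rfl

end VF

section Patch

set_option linter.unusedSectionVars false

variable {E : Type*} [NormedAddCommGroup E] [NormedSpace ℝ E]
  {H : Type*} [TopologicalSpace H] {I : ModelWithCorners ℝ E H}
  {X : Type*} [TopologicalSpace X] [ChartedSpace H X] [IsManifold I ∞ X]
  {ι : Type*}

/-! ### Patches of foliated bundles -/

/-- The distribution of `K` is involutive and its local forms satisfy the transformation rule of a
connection along it. -/
structure FoliatedBundle.IsRegular (K : FoliatedBundle I X ι) : Prop where
  gauge : ∀ i j, ∀ x ∈ K.S.baseSet i ∩ K.S.baseSet j, ∀ v : K.D x,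
    K.S.coordChange j i x 1 * K.A j x v =
      mvfderiv I (fun y => K.S.coordChange j i y 1) x (v : TangentSpace I x) +
        K.S.coordChange j i x 1 * K.A i x v
  involutive : ∀ W : Set X, IsOpen W → ∀ V V' : ∀ y, K.D y, K.D.SmoothOn V W → K.D.SmoothOn V' W →
    ∀ x ∈ W, mlieBracket I (fun y => (V y : TangentSpace I y))
      (fun y => (V' y : TangentSpace I y)) x ∈ K.D x

/-- A patch of a foliated bundle: an open set `N` inside the domain of a chart and of a
trivialization, with a projection `Λ` of the model space onto a vector space `R` that maps the
distribution isomorphically onto `R` at every point of `N`. The inverse `lift` of this isomorphism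
is a smooth frame of the distribution, normalized by `Λ ∘ lift = id`; a vector `v` belongs to the
distribution if and only if it is the lift of `Λ v`. -/
structure Patch (K : FoliatedBundle I X ι) (R : Type*) [NormedAddCommGroup R]
    [NormedSpace ℝ R] where
  pt : X
  i : ι
  N : Set X
  isOpen_N : IsOpen N
  N_chart : N ⊆ (chartAt H pt).source
  N_base : N ⊆ K.S.baseSet i
  Λ : E →L[ℝ] R
  lift : E → R →L[ℝ] E
  contDiffOn_lift : ContDiffOn ℝ ∞ lift
    ((extChartAt I pt).target ∩ (extChartAt I pt).symm ⁻¹' N)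
  Λ_lift : ∀ x ∈ N, ∀ r, Λ (lift (extChartAt I pt x) r) = r
  mem_D : ∀ x ∈ N, ∀ v : TangentSpace I x, v ∈ K.D x ↔
    lift (extChartAt I pt x) (Λ (dChart I pt x v)) = dChart I pt x v

namespace Patch

variable {K : FoliatedBundle I X ι} {R : Type*} [NormedAddCommGroup R] [NormedSpace ℝ R]
  (P : Patch K R)

/-- The inverse of the chart. It is meaningful on the target of the chart only. -/
def inv (u : E) : X := (extChartAt I P.pt).symm u

/-- The image in the chart of the part of `W` that is covered by the patch. -/
def img (W : Set X) : Set E := (extChartAt I P.pt).target ∩ P.inv ⁻¹' (P.N ∩ W)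

variable {P}

lemma img_mono {W W' : Set X} (h : W ⊆ W') : P.img W ⊆ P.img W' :=
  inter_subset_inter_right _ (preimage_mono (inter_subset_inter_right _ h))

lemma isOpen_img [I.Boundaryless] {W : Set X} (hW : IsOpen W) : IsOpen (P.img W) :=
  (continuousOn_extChartAt_symm P.pt).isOpen_inter_preimage (isOpen_extChartAt_target P.pt)
    (P.isOpen_N.inter hW)

lemma chart_inv {W : Set X} {u : E} (hu : u ∈ P.img W) : extChartAt I P.pt (P.inv u) = u :=
  (extChartAt I P.pt).right_inv hu.1

lemma inv_chart {x : X} (hx : x ∈ P.N) : P.inv (extChartAt I P.pt x) = x :=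
  (extChartAt I P.pt).left_inv (by rw [extChartAt_source]; exact P.N_chart hx)

lemma chart_mem_img {W : Set X} {x : X} (hx : x ∈ P.N) (hW : x ∈ W) :
    extChartAt I P.pt x ∈ P.img W :=
  ⟨(extChartAt I P.pt).map_source (by rw [extChartAt_source]; exact P.N_chart hx), by
    rw [mem_preimage, inv_chart hx]; exact ⟨hx, hW⟩⟩

lemma inv_mem_N {W : Set X} {u : E} (hu : u ∈ P.img W) : P.inv u ∈ P.N := hu.2.1

lemma inv_mem {W : Set X} {u : E} (hu : u ∈ P.img W) : P.inv u ∈ W := hu.2.2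

lemma inverse_dChart_right {x : X} (hx : x ∈ P.N) (w : E) :
    dChart I P.pt x ((dChart I P.pt x).inverse w) = w := by
  obtain ⟨e, he⟩ := isInvertible_mfderiv_extChartAt (I := I) (x := P.pt) (y := x)
    (by rw [extChartAt_source]; exact P.N_chart hx)
  rw [dChart, ← he]
  refine (congrArg _ (DFunLike.congr_fun (ContinuousLinearMap.inverse_equiv e) _)).trans ?_
  exact e.apply_symm_apply w

lemma lift_mem {x : X} (hx : x ∈ P.N) (r : R) :
    (dChart I P.pt x).inverse (P.lift (extChartAt I P.pt x) r) ∈ K.D x := by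
  rw [P.mem_D x hx, inverse_dChart_right hx, P.Λ_lift x hx]

variable (P)

open Classical in
/-- The frame of the distribution at `x`, as a linear map from `R`. Outside the patch it is `0`. -/
def frame (x : X) : R →ₗ[ℝ] K.D x :=
  if hx : x ∈ P.N then
    LinearMap.codRestrict (K.D x) (((dChart I P.pt x).inverse ∘L
      (P.lift (extChartAt I P.pt x) : R →L[ℝ] E)).toLinearMap) fun r => lift_mem hx r
  else 0

/-- The coordinates of a vector of the distribution in the frame. -/
def coframe (x : X) : K.D x →ₗ[ℝ] R :=
  P.Λ.toLinearMap ∘ₗ (dChart I P.pt x).toLinearMap ∘ₗ (K.D x).subtype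

variable {P}

lemma dChart_frame {x : X} (hx : x ∈ P.N) (r : R) :
    dChart I P.pt x (P.frame x r) = P.lift (extChartAt I P.pt x) r := by
  rw [frame, dif_pos hx]
  exact inverse_dChart_right hx _

lemma dChart_eq {x : X} (hx : x ∈ P.N) (v : K.D x) :
    dChart I P.pt x v = P.lift (extChartAt I P.pt x) (P.coframe x v) :=
  ((P.mem_D x hx v).1 v.2).symm

lemma coframe_frame {x : X} (hx : x ∈ P.N) (r : R) : P.coframe x (P.frame x r) = r := by
  change P.Λ (dChart I P.pt x (P.frame x r)) = r
  rw [dChart_frame hx, P.Λ_lift x hx]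

lemma frame_coframe {x : X} (hx : x ∈ P.N) (v : K.D x) : P.frame x (P.coframe x v) = v := by
  have := (dChart_bijective I (P.N_chart hx)).injective
  refine Subtype.ext (this ?_)
  rw [dChart_frame hx, dChart_eq hx]

lemma Λ_lift' {W : Set X} {u : E} (hu : u ∈ P.img W) (r : R) : P.Λ (P.lift u r) = r := by
  have := P.Λ_lift (P.inv u) (inv_mem_N hu) r
  rwa [chart_inv hu] at this

lemma contDiffOn_lift' {W : Set X} : ContDiffOn ℝ ∞ P.lift (P.img W) :=
  P.contDiffOn_lift.mono fun _ hu => ⟨hu.1, hu.2.1⟩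

lemma smoothOn_frame (r : R) : K.D.SmoothOn (fun x => P.frame x r) P.N := by
  refine (smoothField_iff I P.isOpen_N P.N_chart).2 ?_
  refine (contDiffOn_comp_chart_iff I P.N_chart).2 ?_
  refine (P.contDiffOn_lift.clm_apply (contDiffOn_const (c := r))).congr fun u hu => ?_
  rw [dChart_frame hu.2, (extChartAt I P.pt).right_inv hu.1]

lemma contDiffOn_chartField {V : ∀ x, K.D x} {W : Set X} (hW : IsOpen W)
    (hV : K.D.SmoothOn V W) :
    ContDiffOn ℝ ∞ (chartField I P.pt fun x => (V x : TangentSpace I x)) (P.img W) := by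
  have h : ContMDiffOn I I.tangent ∞
    (fun x => (⟨x, (V x : TangentSpace I x)⟩ : TangentBundle I X)) (P.N ∩ W) :=
    ContMDiffOn.mono hV inter_subset_right
  rw [smoothField_iff I (P.isOpen_N.inter hW) (inter_subset_left.trans P.N_chart),
    contDiffOn_comp_chart_iff I (inter_subset_left.trans P.N_chart)] at h
  exact h

lemma coframe_field {V : ∀ x, K.D x} (u : E) :
    P.coframe (P.inv u) (V (P.inv u)) =
      P.Λ (chartField I P.pt (fun x => (V x : TangentSpace I x)) u) := rfl

lemma chartField_eq {V : ∀ x, K.D x} {W : Set X} {u : E} (hu : u ∈ P.img W) :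
    chartField I P.pt (fun x => (V x : TangentSpace I x)) u =
      P.lift u (P.coframe (P.inv u) (V (P.inv u))) := by
  have := dChart_eq (P := P) (inv_mem_N hu) (V (P.inv u))
  rw [chart_inv hu] at this
  exact this

lemma contDiffOn_coframe {V : ∀ x, K.D x} {W : Set X} (hW : IsOpen W) (hV : K.D.SmoothOn V W) :
    ContDiffOn ℝ ∞ (fun u => P.coframe (P.inv u) (V (P.inv u))) (P.img W) :=
  P.Λ.contDiff.comp_contDiffOn (contDiffOn_chartField hW hV)

/-! ### Local expressions of sections -/

variable (P) in
/-- The factor from the trivialization at `x` to the trivialization of the patch. -/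
def factor (x : X) : ℂ := K.S.coordChange (K.S.indexAt x) P.i x 1

end Patch

lemma LineBundle.coordChange_apply (S : LineBundle I X ι) (i j : ι) (x : X) (z : ℂ) :
    S.coordChange i j x z = S.coordChange i j x 1 * z := by
  have := (S.coordChange i j x).map_smul z 1
  simp only [smul_eq_mul, mul_one] at this
  rw [this, mul_comm]

lemma LineBundle.coord_change (S : LineBundle I X ι) (i j : ι) (s : X → ℂ) {x : X}
    (hi : x ∈ S.baseSet i) (hj : x ∈ S.baseSet j) :
    S.coord j s x = S.coordChange i j x 1 * S.coord i s x := by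
  rw [← S.coordChange_apply]
  exact (S.coordChange_comp (S.indexAt x) i j x ⟨⟨S.mem_baseSet_at x, hi⟩, hj⟩ (s x)).symm

lemma LineBundle.coordChange_mul_symm (S : LineBundle I X ι) (i j : ι) {x : X}
    (hi : x ∈ S.baseSet i) (hj : x ∈ S.baseSet j) :
    S.coordChange j i x 1 * S.coordChange i j x 1 = 1 := by
  rw [← S.coordChange_apply]
  rw [S.coordChange_comp i j i x ⟨⟨hi, hj⟩, hi⟩, S.coordChange_self i x hi]

namespace Patch
variable {K : FoliatedBundle I X ι} {R : Type*} [NormedAddCommGroup R] [NormedSpace ℝ R]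
  {P : Patch K R}

lemma factor_ne_zero {x : X} (hx : x ∈ P.N) : P.factor x ≠ 0 := fun h => by
  have := K.S.coordChange_mul_symm (K.S.indexAt x) P.i (K.S.mem_baseSet_at x) (P.N_base hx)
  rw [show K.S.coordChange (K.S.indexAt x) P.i x 1 = 0 from h, mul_zero] at this
  exact zero_ne_one this

lemma coord_eq (s : X → ℂ) (x : X) : K.S.coord P.i s x = P.factor x * s x :=
  K.S.coordChange_apply _ _ _ _

/-- A section is smooth if and only if its coordinate in the trivialization of the patch is. -/
lemma smoothOn_section_iff {s : X → ℂ} {W : Set X} (hW : W ⊆ P.N) :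
    K.S.SmoothOn s W ↔ ContDiffOn ℝ ∞ (fun u => K.S.coord P.i s (P.inv u)) (P.img W) := by
  have e : P.img W = (extChartAt I P.pt).target ∩ (extChartAt I P.pt).symm ⁻¹' W := by
    rw [img, inter_eq_right.2 hW]; rfl
  have key := contDiffOn_comp_chart_iff I (f := K.S.coord P.i s) (hW.trans P.N_chart)
  rw [e]
  refine Iff.trans ?_ key
  constructor
  · intro h
    exact (h P.i).mono fun x hx => ⟨hx, P.N_base (hW hx)⟩
  · intro h j
    have hsub : W ∩ K.S.baseSet j ⊆ K.S.baseSet P.i ∩ K.S.baseSet j :=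
      fun x hx => ⟨P.N_base (hW hx.1), hx.2⟩
    refine ContMDiffOn.congr (contMDiffOn_mul ((K.S.smooth_coordChange P.i j).mono hsub)
      (h.mono inter_subset_left)) fun x hx => ?_
    exact K.S.coord_change P.i j s (P.N_base (hW hx.1)) hx.2

variable [I.Boundaryless]

/-- The covariant derivative in a patch: `∇_v s` is `ds(v) + A(v) s`. -/
lemma factor_mul_covDeriv (hK : K.IsRegular) {s : X → ℂ} {W : Set X} (hW : IsOpen W)
    (hs : K.S.SmoothOn s W) {u : E} (hu : u ∈ P.img W) (v : K.D (P.inv u)) :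
    P.factor (P.inv u) * covDeriv K.D K.S K.A s (P.inv u) v =
      fderiv ℝ (fun w => K.S.coord P.i s (P.inv w)) u (dChart I P.pt (P.inv u) v) +
        K.A P.i (P.inv u) v * K.S.coord P.i s (P.inv u) := by
  let a := K.S.indexAt (P.inv u)
  have hxa : P.inv u ∈ K.S.baseSet a := K.S.mem_baseSet_at _
  have hxi : P.inv u ∈ K.S.baseSet P.i := P.N_base (inv_mem_N hu)
  have hsa : MDifferentiableAt I 𝓘(ℝ, ℂ) (K.S.coord a s) (P.inv u) :=
    hs.mdifferentiableAt hW (inv_mem hu)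
  have hg : MDifferentiableAt I 𝓘(ℝ, ℂ) (fun y => K.S.coordChange a P.i y 1) (P.inv u) :=
    ((K.S.smooth_coordChange a P.i).contMDiffAt (((K.S.isOpen_baseSet a).inter
      (K.S.isOpen_baseSet P.i)).mem_nhds ⟨hxa, hxi⟩)).mdifferentiableAt (by simp)
  have hsym : MDifferentiableAt 𝓘(ℝ, E) I P.inv u :=
    ((contMDiffOn_extChartAt_symm (n := ∞) P.pt).contMDiffAt
      ((isOpen_extChartAt_target P.pt).mem_nhds hu.1)).mdifferentiableAt (by simp)
  have d1 : DifferentiableAt ℝ (fun w => K.S.coord a s (P.inv w)) u :=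
    (MDifferentiableAt.comp (g := K.S.coord a s) (f := P.inv) u hsa hsym).differentiableAt
  have d2 : DifferentiableAt ℝ (fun w => K.S.coordChange a P.i (P.inv w) 1) u :=
    (MDifferentiableAt.comp (g := fun y => K.S.coordChange a P.i y 1) (f := P.inv) u hg
      hsym).differentiableAt
  have e1 : mvfderiv I (K.S.coord a s) (P.inv u) (v : TangentSpace I (P.inv u)) =
      fderiv ℝ (fun w => K.S.coord a s (P.inv w)) u (dChart I P.pt (P.inv u) v) :=
    mvfderiv_eq_fderiv I hu.1 hsa (v : TangentSpace I (P.inv u))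
  have e2 : mvfderiv I (fun y => K.S.coordChange a P.i y 1) (P.inv u)
      (v : TangentSpace I (P.inv u)) =
      fderiv ℝ (fun w => K.S.coordChange a P.i (P.inv w) 1) u (dChart I P.pt (P.inv u) v) :=
    mvfderiv_eq_fderiv I hu.1 hg (v : TangentSpace I (P.inv u))
  have hgauge : P.factor (P.inv u) * K.A a (P.inv u) v =
      mvfderiv I (fun y => K.S.coordChange a P.i y 1) (P.inv u) (v : TangentSpace I (P.inv u)) +
        P.factor (P.inv u) * K.A P.i (P.inv u) v := hK.gauge P.i a _ ⟨hxi, hxa⟩ v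
  have hnear : (fun w => K.S.coord P.i s (P.inv w)) =ᶠ[nhds u]
      fun w => K.S.coordChange a P.i (P.inv w) 1 * K.S.coord a s (P.inv w) := by
    have : ∀ᶠ w in nhds u, w ∈ P.img (K.S.baseSet a) :=
      (isOpen_img (K.S.isOpen_baseSet a)).mem_nhds ⟨hu.1, inv_mem_N hu, hxa⟩
    filter_upwards [this] with w hw
    exact K.S.coord_change a P.i s (inv_mem hw) (P.N_base (inv_mem_N hw))
  have hsx : K.S.coord a s (P.inv u) = s (P.inv u) := K.S.coordChange_self a _ hxa _
  have hfac : K.S.coordChange a P.i (P.inv u) 1 = P.factor (P.inv u) := rfl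
  have hcov : covDeriv K.D K.S K.A s (P.inv u) v =
      mvfderiv I (K.S.coord a s) (P.inv u) (v : TangentSpace I (P.inv u)) +
        K.A a (P.inv u) v * s (P.inv u) := rfl
  rw [hnear.fderiv_eq, fderiv_fun_mul d2 d1, coord_eq, hcov, e1, hfac, hsx]
  rw [e2] at hgauge
  simp only [add_apply, smul_apply, smul_eq_mul]
  linear_combination s (P.inv u) * hgauge

end Patch
end Patch

section LocalForms

set_option linter.unusedSectionVars false

variable {E : Type*} [NormedAddCommGroup E] [NormedSpace ℝ E]
  {H : Type*} [TopologicalSpace H] {I : ModelWithCorners ℝ E H}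
  {X : Type*} [TopologicalSpace X] [ChartedSpace H X] [IsManifold I ∞ X]
  {ι : Type*} {K : FoliatedBundle I X ι}
  {R : Type*} [NormedAddCommGroup R] [NormedSpace ℝ R] [FiniteDimensional ℝ R]

open ContinuousAlternatingMap

/-! ### Local expressions of forms -/

/-- The Koszul formula in a vector space for the differential of the form `a ∘ Λ`. The brackets are
moved from the first place to the place of their second entry. -/
lemma koszul_vectorSpace {n : ℕ} {Λ : E →L[ℝ] R} {a : E → R [⋀^Fin n]→L[ℝ] ℂ}
    {V : Fin (n + 1) → E → E} {u : E} (ha : DifferentiableAt ℝ a u)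
    (hV : ∀ i, DifferentiableAt ℝ (V i) u) :
    ∑ i : Fin (n + 1), (-1 : ℂ) ^ (i : ℕ) *
      (fderiv ℝ (fun w => a w (i.removeNth fun j => Λ (V j w))) u (V i u) -
        ∑ j : Fin n with i ≤ j.castSucc, a u (Function.update (i.removeNth fun l => Λ (V l u)) j
          (Λ (lieBracket ℝ (V i) (V j.succ) u)))) =
    ∑ i : Fin (n + 1), (-1 : ℂ) ^ (i : ℕ) *
      fderiv ℝ a u (V i u) (i.removeNth fun j => Λ (V j u)) := by
  let full : E → E [⋀^Fin n]→L[ℝ] ℂ := fun w => (a w).compContinuousLinearMap Λ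
  have hfull : HasFDerivAt full (compContinuousLinearMapCLM Λ ∘L fderiv ℝ a u) u :=
    (compContinuousLinearMapCLM Λ : (R [⋀^Fin n]→L[ℝ] ℂ) →L[ℝ] _).hasFDerivAt.comp u ha.hasFDerivAt
  have h1 := extDeriv_apply hfull.differentiableAt fun i => V i u
  have e1 : extDeriv full u (fun i => V i u) = ∑ i : Fin (n + 1), (-1 : ℂ) ^ (i : ℕ) *
      fderiv ℝ a u (V i u) (i.removeNth fun j => Λ (V j u)) := by
    rw [h1]
    refine Finset.sum_congr rfl fun i _ => ?_
    rw [fderiv_continuousAlternatingMap_apply_const_apply hfull.differentiableAt, hfull.fderiv,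
      zsmul_eq_mul]
    push_cast
    rfl
  rw [← e1]
  have hrem (i : Fin (n + 1)) (w : E) : full w (i.removeNth fun j => V j w) =
    a w (i.removeNth fun j => Λ (V j w)) := rfl
  cases n with
  | zero =>
    rw [e1]
    refine Finset.sum_congr rfl fun i _ => ?_
    rw [Finset.sum_eq_zero (fun j => j.elim0), sub_zero]
    congr 1
    have : (fun w => a w (i.removeNth fun j => Λ (V j w))) = fun w => a w ![] :=
      funext fun w => congrArg _ (Subsingleton.elim _ _)
    rw [this, fderiv_continuousAlternatingMap_apply_const_apply ha]
    exact congrArg _ (Subsingleton.elim _ _)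
  | succ n =>
    rw [extDeriv_apply_vectorField hfull.differentiableAt hV]
    simp only [mul_sub, Finset.sum_sub_distrib]
    congr 1
    · refine Finset.sum_congr rfl fun i _ => ?_
      rw [zsmul_eq_mul]
      push_cast
      rfl
    · rw [Fin.sum_univ_castSucc]
      have hlast : ∑ j : Fin (n + 1) with Fin.last (n + 1) ≤ j.castSucc,
          a u (Function.update ((Fin.last (n + 1)).removeNth fun l => Λ (V l u)) j
          (Λ (lieBracket ℝ (V (Fin.last (n + 1))) (V j.succ) u))) = 0 := by
        refine Finset.sum_eq_zero fun j hj => ?_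
        have := (Finset.mem_filter.1 hj).2
        exact absurd this (not_le.2 (Fin.castSucc_lt_last j))
      -- The last term has no brackets; in the others, moving the bracket from the first place to the
      -- place `j` costs the sign `(-1) ^ j`.
      rw [hlast, mul_zero, add_zero]
      refine Finset.sum_congr rfl fun i _ => ?_
      rw [Finset.mul_sum]
      refine Finset.sum_congr (Finset.ext fun j => by simp) fun j _ => ?_
      have e2 (b : R) (v : Fin (n + 1) → R) : a u (Function.update v j b) =
          (-1 : ℂ) ^ (j : ℕ) * a u (Matrix.vecCons b (j.removeNth v)) := by
        rw [← Fin.insertNth_removeNth, (a u).map_insertNth, zsmul_eq_mul]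
        push_cast
        rfl
      rw [e2, zsmul_eq_mul, pow_add, ← mul_assoc]
      push_cast
      congr 1
      refine congrArg (a u) (funext fun l => ?_)
      refine Fin.cases ?_ (fun l => ?_) l <;> rfl

/-! ### The differential along a frame -/

/-- The differential of forms on a vector space along the frame `lift`, with values in the trivial
line bundle with the connection form `A`. -/
def localD {n : ℕ} (lift : E → R →L[ℝ] E) (A : E → R →L[ℝ] ℂ) (a : E → R [⋀^Fin n]→L[ℝ] ℂ)
    (u : E) : R [⋀^Fin (n + 1)]→L[ℝ] ℂ :=
  alternatizeUncurryFin (fderiv ℝ a u ∘L lift u + (A u).smulRight (a u))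

lemma localD_apply {n : ℕ} (lift : E → R →L[ℝ] E) (A : E → R →L[ℝ] ℂ)
    (a : E → R [⋀^Fin n]→L[ℝ] ℂ) (u : E) (r : Fin (n + 1) → R) :
    localD lift A a u r = ∑ i : Fin (n + 1), (-1 : ℂ) ^ (i : ℕ) *
      (fderiv ℝ a u (lift u (r i)) (i.removeNth r) + A u (r i) * a u (i.removeNth r)) := by
  rw [localD, alternatizeUncurryFin_apply]
  refine Finset.sum_congr rfl fun i _ => ?_
  simp [mul_add]

/-- Without the connection form, the differential along a frame is the restriction of the exterior
derivative. -/
lemma extDeriv_comp_apply {n : ℕ} {Λ : E →L[ℝ] R} {a : E → R [⋀^Fin n]→L[ℝ] ℂ} {u : E}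
    (ha : DifferentiableAt ℝ a u) (v : Fin (n + 1) → E) :
    extDeriv (fun w => (a w).compContinuousLinearMap Λ) u v =
      ∑ i : Fin (n + 1), (-1 : ℂ) ^ (i : ℕ) *
        fderiv ℝ a u (v i) (i.removeNth fun j => Λ (v j)) := by
  have hfull : HasFDerivAt (fun w => (a w).compContinuousLinearMap Λ)
      (compContinuousLinearMapCLM Λ ∘L fderiv ℝ a u) u :=
    (compContinuousLinearMapCLM Λ : (R [⋀^Fin n]→L[ℝ] ℂ) →L[ℝ] _).hasFDerivAt.comp u ha.hasFDerivAt
  rw [extDeriv_apply hfull.differentiableAt]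
  refine Finset.sum_congr rfl fun i _ => ?_
  rw [fderiv_continuousAlternatingMap_apply_const_apply hfull.differentiableAt, hfull.fderiv,
    zsmul_eq_mul]
  push_cast
  rfl

/-- The differential along a frame commutes with the pull-back along a map `f` compatible with the
frames, followed by a multiplication with a function `m` that relates the connections. -/
lemma localD_pullback {E₂ R₂ : Type*} [NormedAddCommGroup E₂] [NormedSpace ℝ E₂]
    [NormedAddCommGroup R₂] [NormedSpace ℝ R₂] [FiniteDimensional ℝ R₂] {n : ℕ}
    {Λ : E →L[ℝ] R} {lift : E → R →L[ℝ] E} {A : E → R →L[ℝ] ℂ}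
    {Λ₂ : E₂ →L[ℝ] R₂} {lift₂ : E₂ → R₂ →L[ℝ] E₂} {A₂ : E₂ → R₂ →L[ℝ] ℂ}
    {f : E → E₂} {T : E → R →L[ℝ] R₂} {m : E → ℂ} {a : E₂ → R₂ [⋀^Fin n]→L[ℝ] ℂ} {u : E}
    (ha : DifferentiableAt ℝ a (f u)) (hf : ContDiffAt ℝ ∞ f u) (hT : DifferentiableAt ℝ T u)
    (hm : DifferentiableAt ℝ m u) (hlift : ∀ r, Λ (lift u r) = r)
    (hlift₂ : ∀ r, Λ₂ (lift₂ (f u) r) = r)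
    (hΛ : ∀ᶠ w in nhds u, ∀ v, Λ₂ (fderiv ℝ f w v) = T w (Λ v))
    (hl : ∀ r, fderiv ℝ f u (lift u r) = lift₂ (f u) (T u r))
    (hA : ∀ r, fderiv ℝ m u (lift u r) + A u r * m u = m u * A₂ (f u) (T u r)) :
    localD lift A (fun w => m w • (a (f w)).compContinuousLinearMap (T w)) u =
      m u • (localD lift₂ A₂ a (f u)).compContinuousLinearMap (T u) := by
  have hfd : DifferentiableAt ℝ f u := hf.differentiableAt (by simp)
  have hb : DifferentiableAt ℝ (fun w => (a (f w)).compContinuousLinearMap (T w)) u :=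
    (HasFDerivAt.continuousAlternatingMapCompContinuousLinearMap
      (ha.hasFDerivAt.comp u hfd.hasFDerivAt) hT.hasFDerivAt).differentiableAt
  have hfull : DifferentiableAt ℝ (fun w => (a w).compContinuousLinearMap Λ₂) (f u) :=
    ((compContinuousLinearMapCLM Λ₂ : (R₂ [⋀^Fin n]→L[ℝ] ℂ) →L[ℝ] _).hasFDerivAt.comp (f u)
      ha.hasFDerivAt).differentiableAt
  ext r
  -- The derivative terms on both sides are exterior derivatives of the forms `a ∘ Λ`, for which
  -- compatibility with pull-backs is known.
  have h1 := extDeriv_comp_apply (Λ := Λ) hb fun i => lift u (r i)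
  have h2 := extDeriv_pullback hfull hf (by
    simpa using (WithTop.coe_le_coe.2 le_top : ((2 : ℕ∞) : WithTop ℕ∞) ≤ ∞))
  have h3 : (fun w => ((a (f w)).compContinuousLinearMap (T w)).compContinuousLinearMap Λ)
      =ᶠ[nhds u] fun w => ((a (f w)).compContinuousLinearMap Λ₂).compContinuousLinearMap
        (fderiv ℝ f w) := by
    filter_upwards [hΛ] with w hw
    ext v
    exact congrArg (a (f w)) (funext fun j => (hw (v j)).symm)
  rw [h3.extDeriv_eq, h2] at h1
  have h4 := extDeriv_comp_apply (Λ := Λ₂) ha fun i => fderiv ℝ f u (lift u (r i))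
  have h5 := h1.symm.trans h4
  simp only [hl, hlift, hlift₂] at h5
  have hmb : HasFDerivAt (fun w => m w • (a (f w)).compContinuousLinearMap (T w)) _ u :=
    hm.hasFDerivAt.smul hb.hasFDerivAt
  rw [localD_apply, hmb.fderiv]
  change _ = m u * localD lift₂ A₂ a (f u) fun j => T u (r j)
  rw [localD_apply]
  simp only [mul_add, Finset.sum_add_distrib, ← h5]
  simp only [Finset.mul_sum, ← Finset.sum_add_distrib]
  refine Finset.sum_congr rfl fun i _ => ?_
  have h6 := hA (r i)
  have h7 : (a (f u)) (i.removeNth fun j => T u (r j)) =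
      (a (f u)).compContinuousLinearMap (T u) (i.removeNth r) := rfl
  rw [h7]
  change (-1 : ℂ) ^ (i : ℕ) * (m u * fderiv ℝ
    (fun w => (a (f w)).compContinuousLinearMap (T w)) u (lift u (r i)) (i.removeNth r) +
    fderiv ℝ m u (lift u (r i)) * (a (f u)).compContinuousLinearMap (T u) (i.removeNth r)) +
    (-1 : ℂ) ^ (i : ℕ) * (A u (r i) *
      (m u * (a (f u)).compContinuousLinearMap (T u) (i.removeNth r))) =
    m u * ((-1 : ℂ) ^ (i : ℕ) * fderiv ℝ
    (fun w => (a (f w)).compContinuousLinearMap (T w)) u (lift u (r i)) (i.removeNth r)) + _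
  linear_combination (-1 : ℂ) ^ (i : ℕ) *
    ((a (f u)).compContinuousLinearMap (T u) (i.removeNth r)) * h6

namespace Patch

section Defs

variable (P : Patch K R) {n : ℕ}

/-- The form `α` in a patch, as a function on the chart with values in the alternating maps
on `R`. -/
def loc (α : K.Form n) (u : E) : R [⋀^Fin n]→L[ℝ] ℂ :=
  altCLM (P.factor (P.inv u) • (α (P.inv u)).compLinearMap (P.frame (P.inv u)))

/-- The local connection form in a patch. -/
def conn (u : E) : R →L[ℝ] ℂ :=
  LinearMap.toContinuousLinearMap ((K.A P.i (P.inv u)).comp (P.frame (P.inv u)))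

/-- The Kostant differential in a patch. -/
def d (a : E → R [⋀^Fin n]→L[ℝ] ℂ) (u : E) : R [⋀^Fin (n + 1)]→L[ℝ] ℂ :=
  localD P.lift P.conn a u

end Defs

variable {P : Patch K R} {n : ℕ}

lemma loc_apply (α : K.Form n) (u : E) (r : Fin n → R) :
    P.loc α u r = P.factor (P.inv u) * α (P.inv u) fun j => P.frame (P.inv u) (r j) := rfl

lemma conn_apply (u : E) (r : R) : P.conn u r = K.A P.i (P.inv u) (P.frame (P.inv u) r) := rfl

lemma loc_coframe (α : K.Form n) {W : Set X} {u : E} (hu : u ∈ P.img W)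
    (v : Fin n → K.D (P.inv u)) :
    P.loc α u (fun j => P.coframe (P.inv u) (v j)) = P.factor (P.inv u) * α (P.inv u) v := by
  rw [loc_apply]
  simp only [frame_coframe (inv_mem_N hu)]

lemma coord_form (α : K.Form n) {W : Set X} {u : E} (hu : u ∈ P.img W)
    (V : Fin n → ∀ x, K.D x) :
    K.S.coord P.i (fun x => α x fun j => V j x) (P.inv u) =
      P.loc α u (fun j => P.coframe (P.inv u) (V j (P.inv u))) := by
  rw [coord_eq, loc_coframe α hu]

lemma loc_eq_iff {α β : K.Form n} {W : Set X} {u : E} (hu : u ∈ P.img W) :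
    P.loc α u = P.loc β u ↔ α (P.inv u) = β (P.inv u) := by
  constructor
  · intro h
    ext v
    have := congrArg (fun a : R [⋀^Fin n]→L[ℝ] ℂ => a fun j => P.coframe (P.inv u) (v j)) h
    simp only [loc_coframe _ hu] at this
    exact mul_left_cancel₀ (factor_ne_zero (inv_mem_N hu)) this
  · intro h
    ext r
    rw [loc_apply, loc_apply, h]

lemma loc_add (α β : K.Form n) (u : E) : P.loc (α + β) u = P.loc α u + P.loc β u := by
  ext r
  exact mul_add _ _ _

lemma loc_smul (c : ℂ) (α : K.Form n) (u : E) : P.loc (c • α) u = c • P.loc α u := by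
  ext r
  exact mul_left_comm _ _ _

lemma loc_zero (u : E) : P.loc (0 : K.Form n) u = 0 := by
  ext r
  exact mul_zero _

variable [I.Boundaryless]

/-- A form is smooth if and only if its local expressions are. -/
lemma smoothOn_iff {α : K.Form n} {W : Set X} (hW : IsOpen W) (hWN : W ⊆ P.N) :
    α.SmoothOn W ↔ ContDiffOn ℝ ∞ (P.loc α) (P.img W) := by
  constructor
  · intro h
    refine contDiffOn_alt fun r => ?_
    have h1 := h W Subset.rfl hW (fun j x => P.frame x (r j))
      fun j => (smoothOn_frame (r j)).mono hWN
    rw [smoothOn_section_iff hWN] at h1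
    refine h1.congr fun u hu => ?_
    rw [coord_form α hu fun j x => P.frame x (r j)]
    simp only [coframe_frame (inv_mem_N hu)]
  · intro h W' hW' ho V hV
    rw [smoothOn_section_iff (hW'.trans hWN)]
    have h2 : ContDiffOn ℝ ∞ (fun u => P.loc α u fun j => P.coframe (P.inv u) (V j (P.inv u)))
        (P.img W') := by
      exact contDiffOn_alt_apply (h.mono (img_mono hW')) fun j => contDiffOn_coframe ho (hV j)
    exact h2.congr fun u hu => coord_form α hu V

/-- The value of the Koszul formula on sections of the distribution, in a patch. -/
lemma factor_mul_koszul (hK : K.IsRegular) [CompleteSpace E] {α : K.Form n} {W : Set X}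
    (hW : IsOpen W) (hα : α.SmoothOn W) {V : Fin (n + 1) → ∀ x, K.D x}
    (hV : ∀ j, K.D.SmoothOn (V j) W) {u : E} (hu : u ∈ P.img W) :
    P.factor (P.inv u) * α.koszul V (P.inv u) =
      P.d (P.loc α) u fun j => P.coframe (P.inv u) (V j (P.inv u)) := by
  have hsmooth : ContDiffOn ℝ ∞ (P.loc α) (P.img W) := by
    have := (smoothOn_iff (P := P) (P.isOpen_N.inter hW) inter_subset_left).1
      (hα.mono inter_subset_right)
    exact this.mono fun u hu => ⟨hu.1, hu.2.1, hu.2⟩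
  have ha : DifferentiableAt ℝ (P.loc α) u :=
    (hsmooth.contDiffAt ((isOpen_img hW).mem_nhds hu)).differentiableAt (by simp)
  let F : Fin (n + 1) → E → E := fun i =>
    chartField I P.pt fun x => (V i x : TangentSpace I x)
  have hF (i : Fin (n + 1)) : DifferentiableAt ℝ (F i) u :=
    ((contDiffOn_chartField hW (hV i)).contDiffAt
      ((isOpen_img hW).mem_nhds hu)).differentiableAt (by simp)
  have hkos := koszul_vectorSpace (Λ := P.Λ) ha hF
  rw [d, localD_apply]
  simp only [mul_add, Finset.sum_add_distrib]
  have hF' (i : Fin (n + 1)) :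
      F i u = P.lift u (P.coframe (P.inv u) (V i (P.inv u))) := chartField_eq hu
  have e : ∑ i : Fin (n + 1), (-1 : ℂ) ^ (i : ℕ) * (fderiv ℝ (P.loc α) u
      (P.lift u (P.coframe (P.inv u) (V i (P.inv u))))
        (i.removeNth fun j => P.coframe (P.inv u) (V j (P.inv u)))) =
      ∑ i : Fin (n + 1), (-1 : ℂ) ^ (i : ℕ) *
      fderiv ℝ (P.loc α) u (F i u) (i.removeNth fun j => P.Λ (F j u)) := by
    refine Finset.sum_congr rfl fun i _ => ?_
    rw [hF' i]; rfl
  rw [e, ← hkos, FoliatedBundle.Form.koszul, Finset.mul_sum, ← Finset.sum_add_distrib]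
  refine Finset.sum_congr rfl fun i _ => ?_
  have hcov := factor_mul_covDeriv hK hW
    (hα W Subset.rfl hW _ (FoliatedBundle.smoothOn_removeNth hV i)) hu (V i (P.inv u))
  have hbr (j : Fin n) : P.coframe (P.inv u) (K.D.bracket (V i) (V j.succ) (P.inv u)) =
      P.Λ (lieBracket ℝ (F i) (F j.succ) u) := by
    rw [← dChart_mlieBracket I hW (hV i) (hV j.succ) hu.1 (inv_mem hu)]
    rw [Distribution.bracket, dif_pos (hK.involutive W hW _ _ (hV i) (hV j.succ) _ (inv_mem hu))]
    rfl
  have hsum : P.factor (P.inv u) * ∑ j : Fin n with i ≤ j.castSucc,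
      α (P.inv u) (Function.update (fun l => i.removeNth V l (P.inv u)) j
        (K.D.bracket (V i) (V j.succ) (P.inv u))) =
      ∑ j : Fin n with i ≤ j.castSucc, P.loc α u (Function.update
        (i.removeNth fun l => P.Λ (F l u)) j (P.Λ (lieBracket ℝ (F i) (F j.succ) u))) := by
    rw [Finset.mul_sum]
    refine Finset.sum_congr rfl fun j _ => ?_
    rw [← loc_coframe α hu, ← hbr j]
    congr 1
    funext l
    by_cases hl : l = j
    · subst hl; simp
    · simp only [Function.update_of_ne hl]; rfl
  rw [mul_left_comm, mul_sub, hcov, hsum]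
  have e3 : (fun w => K.S.coord P.i (fun y => α y fun j => i.removeNth V j y) (P.inv w)) =ᶠ[nhds u]
      fun w => P.loc α w (i.removeNth fun j => P.Λ (F j w)) := by
    filter_upwards [(isOpen_img hW).mem_nhds hu] with w hw
    exact coord_form α hw (i.removeNth V)
  rw [e3.fderiv_eq, e3.eq_of_nhds]
  have e4 : K.A P.i (P.inv u) (V i (P.inv u)) =
      P.conn u (P.coframe (P.inv u) (V i (P.inv u))) := by
    rw [conn_apply, frame_coframe (inv_mem_N hu)]
  rw [e4]
  change (-1 : ℂ) ^ (i : ℕ) * (fderiv ℝ _ u (F i u) + _ * P.loc α u (i.removeNth fun j =>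
    P.Λ (F j u)) - _) = _ + (-1 : ℂ) ^ (i : ℕ) * (_ * P.loc α u (i.removeNth fun j => P.Λ (F j u)))
  ring

/-- In a patch the Kostant differential is computed by `Patch.d`. -/
lemma hasDiffOn_iff (hK : K.IsRegular) [CompleteSpace E] {α : K.Form n} {β : K.Form (n + 1)}
    {W : Set X} (hW : IsOpen W) (hWN : W ⊆ P.N) (hα : α.SmoothOn W) :
    α.HasDiffOn β W ↔ ∀ u ∈ P.img W, P.d (P.loc α) u = P.loc β u := by
  constructor
  · intro h u hu
    ext r
    have hV (j : Fin (n + 1)) : K.D.SmoothOn (fun x => P.frame x (r j)) W :=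
      (smoothOn_frame (r j)).mono hWN
    have h1 := h W Subset.rfl hW (fun j x => P.frame x (r j)) hV _ (inv_mem hu)
    have h2 := factor_mul_koszul (P := P) hK hW hα hV hu
    rw [h1] at h2
    simp only [coframe_frame (inv_mem_N hu)] at h2
    exact h2.symm
  · intro h W' hW' ho V hV x hx
    have hxN : x ∈ P.N := hWN (hW' hx)
    have hu : extChartAt I P.pt x ∈ P.img W' := chart_mem_img hxN hx
    have h2 := factor_mul_koszul (P := P) hK ho (hα.mono hW') hV hu
    rw [h _ (img_mono hW' hu), loc_coframe β hu] at h2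
    have h3 := mul_left_cancel₀ (factor_ne_zero (inv_mem_N hu)) h2
    rwa [inv_chart hxN] at h3

end Patch
end LocalForms

section Existence

set_option linter.unusedSectionVars false

variable {E : Type*} [NormedAddCommGroup E] [NormedSpace ℝ E]
  {H : Type*} [TopologicalSpace H] {I : ModelWithCorners ℝ E H}
  {X : Type*} [TopologicalSpace X] [ChartedSpace H X] [IsManifold I ∞ X]
  {ι : Type*} {K : FoliatedBundle I X ι}

/-! ### Existence of patches -/

/-- A foliation has a patch around every point: a local frame becomes a smooth lift after
multiplication by the inverse of its projection by a left inverse of its value at the point. -/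
lemma exists_patch [FiniteDimensional ℝ E] {r : ℕ} (hD : K.D.IsFoliation r) (p : X) :
    ∃ P : Patch K (Fin r → ℝ), p ∈ P.N := by
  obtain ⟨W, hW, hpW, V, hV, hspan⟩ := hD.exists_frame p
  let i := K.S.indexAt p
  -- `A u` is the frame at `u`, and `Λ` a left inverse of it at the given point. The patch is the set
  -- where `B u = Λ ∘ A u` is invertible, with the normalized frame `A u ∘ (B u)⁻¹`.
  let A : E → (Fin r → ℝ) →L[ℝ] E := fun u => ∑ j,
    (ContinuousLinearMap.proj j : (Fin r → ℝ) →L[ℝ] ℝ).smulRight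
      (chartField I p (fun x => (V j x : TangentSpace I x)) u)
  have hA (u : E) (c : Fin r → ℝ) :
      A u c = ∑ j, c j • chartField I p (fun x => (V j x : TangentSpace I x)) u := by
    simp [A]
  have hAx {x : X} (hx : x ∈ (chartAt H p).source) (c : Fin r → ℝ) :
      A (extChartAt I p x) c = dChart I p x ((∑ j, c j • V j x : K.D x) : TangentSpace I x) := by
    have hx' : x ∈ (extChartAt I p).source := by rwa [extChartAt_source]
    rw [hA]
    simp only [Submodule.coe_sum, Submodule.coe_smul, map_sum, map_smul]
    refine Finset.sum_congr rfl fun j _ => congrArg (c j • ·) ?_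
    exact congrArg (fun y => dChart I p y (V j y)) ((extChartAt I p).left_inv hx')
  have hsm : ContDiffOn ℝ ∞ A ((extChartAt I p).target ∩
      (extChartAt I p).symm ⁻¹' ((chartAt H p).source ∩ W)) := by
    refine ContDiffOn.sum fun j _ => ?_
    have h : ContMDiffOn I I.tangent ∞
        (fun x => (⟨x, (V j x : TangentSpace I x)⟩ : TangentBundle I X))
        ((chartAt H p).source ∩ W) := ContMDiffOn.mono (hV j) inter_subset_right
    rw [smoothField_iff I ((chartAt H p).open_source.inter hW) inter_subset_left,
      contDiffOn_comp_chart_iff I inter_subset_left] at h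
    exact ((ContinuousLinearMap.smulRightL ℝ (Fin r → ℝ) E
      (ContinuousLinearMap.proj j)).contDiff).comp_contDiffOn h
  have hinj : Function.Injective (A (extChartAt I p p)) := by
    rw [injective_iff_map_eq_zero]
    intro c hc
    rw [hAx (mem_chart_source H p)] at hc
    have h0 := (dChart_bijective I (mem_chart_source H p)).injective
      (hc.trans (map_zero (dChart I p p)).symm)
    have h1 : ∑ j, c j • V j p = 0 := Subtype.ext h0
    exact funext fun j => Fintype.linearIndependent_iff.1 (hspan p hpW).1 c h1 j
  obtain ⟨Λ₀, hΛ₀⟩ := (A (extChartAt I p p)).toLinearMap.exists_leftInverse_of_injective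
    (LinearMap.ker_eq_bot.2 hinj)
  let Λ : E →L[ℝ] (Fin r → ℝ) := LinearMap.toContinuousLinearMap Λ₀
  let B : E → (Fin r → ℝ) →L[ℝ] (Fin r → ℝ) := fun u => Λ ∘L A u
  have hB0 : B (extChartAt I p p) = 1 := by
    ext1 c
    exact LinearMap.congr_fun hΛ₀ c
  have hBsm : ContDiffOn ℝ ∞ B ((extChartAt I p).target ∩
      (extChartAt I p).symm ⁻¹' ((chartAt H p).source ∩ W)) := contDiffOn_const.clm_comp hsm
  let N₀ : Set X := (chartAt H p).source ∩ W ∩ K.S.baseSet i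
  have hN₀ : IsOpen N₀ := ((chartAt H p).open_source.inter hW).inter (K.S.isOpen_baseSet i)
  let N : Set X := N₀ ∩ (fun x => B (extChartAt I p x)) ⁻¹' {b | IsUnit b}
  have hcont : ContinuousOn (fun x => B (extChartAt I p x)) N₀ := by
    refine hBsm.continuousOn.comp ((continuousOn_extChartAt (I := I) p).mono ?_) ?_
    · intro x hx
      rw [extChartAt_source]; exact hx.1.1
    · intro x hx
      have hx' : x ∈ (extChartAt I p).source := by rw [extChartAt_source]; exact hx.1.1
      refine ⟨(extChartAt I p).map_source hx', ?_⟩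
      rw [mem_preimage, (extChartAt I p).left_inv hx']
      exact hx.1
  have hinvB {x : X} (hx : x ∈ N) :
      Ring.inverse (B (extChartAt I p x)) * B (extChartAt I p x) = 1 ∧
      B (extChartAt I p x) * Ring.inverse (B (extChartAt I p x)) = 1 :=
    ⟨Ring.inverse_mul_cancel _ hx.2, Ring.mul_inverse_cancel _ hx.2⟩
  refine ⟨{
    pt := p
    i := i
    N := N
    isOpen_N := hcont.isOpen_inter_preimage hN₀ Units.isOpen
    N_chart := fun x hx => hx.1.1.1
    N_base := fun x hx => hx.1.2
    Λ := Λ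
    lift := fun u => A u ∘L Ring.inverse (B u)
    contDiffOn_lift := ?_
    Λ_lift := ?_
    mem_D := ?_ }, ⟨⟨mem_chart_source H p, hpW⟩, K.S.mem_baseSet_at p⟩, ?_⟩
  · refine ContDiffOn.clm_comp (hsm.mono fun u hu => ⟨hu.1, hu.2.1.1⟩) fun u hu => ?_
    obtain ⟨b, hb⟩ := hu.2.2
    have e : B u = b := by
      rw [hb]
      exact congrArg B ((extChartAt I p).right_inv hu.1).symm
    have h1 : ContDiffAt ℝ ∞ Ring.inverse (B u) := by
      rw [e]; exact contDiffAt_ringInverse ℝ b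
    exact h1.comp_contDiffWithinAt u ((hBsm u ⟨hu.1, hu.2.1.1⟩).mono
      fun w hw => ⟨hw.1, hw.2.1.1⟩)
  · intro x hx c
    exact DFunLike.congr_fun (hinvB hx).2 c
  · intro x hx v
    constructor
    · intro hv
      have hv' : (⟨v, hv⟩ : K.D x) ∈ Submodule.span ℝ (range fun j => V j x) := by
        rw [(hspan x hx.1.1.2).2]; exact Submodule.mem_top
      obtain ⟨c, hc⟩ := (Submodule.mem_span_range_iff_exists_fun ℝ).1 hv'
      have e : dChart I p x v = A (extChartAt I p x) c := by
        rw [hAx hx.1.1.1, hc]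
      rw [e]
      exact congrArg (A (extChartAt I p x)) (DFunLike.congr_fun (hinvB hx).1 c)
    · intro h
      rw [ContinuousLinearMap.comp_apply, hAx hx.1.1.1] at h
      rw [← (dChart_bijective I hx.1.1.1).injective h]
      exact Submodule.coe_mem _
  · change IsUnit (B (extChartAt I p p))
    rw [hB0]; exact isUnit_one

/-! ### Involutivity in a patch -/

section Involutive
variable {R : Type*} [NormedAddCommGroup R] [NormedSpace ℝ R] {P : Patch K R}
  [I.Boundaryless] [CompleteSpace E]

lemma Patch.differentiableAt_lift {W : Set X} (hW : IsOpen W) {u : E} (hu : u ∈ P.img W) :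
    DifferentiableAt ℝ P.lift u :=
  (P.contDiffOn_lift'.contDiffAt ((Patch.isOpen_img hW).mem_nhds hu)).differentiableAt (by simp)

/-- The normalization `Λ ∘ lift = id` shows that derivatives of the frame lie in the kernel of `Λ`. -/
lemma Patch.Λ_fderiv_lift {u : E} (hu : u ∈ P.img univ) (v : E) (r : R) :
    P.Λ (fderiv ℝ (fun w => P.lift w r) u v) = 0 := by
  have h1 : HasFDerivAt (fun w => P.Λ (P.lift w r))
      (P.Λ ∘L fderiv ℝ (fun w => P.lift w r) u) u :=
    P.Λ.hasFDerivAt.comp u ((Patch.differentiableAt_lift isOpen_univ hu).clm_apply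
      (differentiableAt_const r)).hasFDerivAt
  have h2 : (fun w => P.Λ (P.lift w r)) =ᶠ[nhds u] fun _ => r := by
    filter_upwards [(Patch.isOpen_img isOpen_univ).mem_nhds hu] with w hw
    exact Patch.Λ_lift' hw r
  have h3 := h1.fderiv
  rw [h2.fderiv_eq, fderiv_const_apply] at h3
  exact (DFunLike.congr_fun h3 v).symm

/-- The normalized frame of an involutive distribution commutes. -/
lemma Patch.lift_commute
    (hK : ∀ W : Set X, IsOpen W → ∀ V V' : ∀ y, K.D y, K.D.SmoothOn V W → K.D.SmoothOn V' W →
      ∀ x ∈ W, mlieBracket I (fun y => (V y : TangentSpace I y))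
        (fun y => (V' y : TangentSpace I y)) x ∈ K.D x)
    {u : E} (hu : u ∈ P.img univ) (r r' : R) :
    fderiv ℝ (fun w => P.lift w r') u (P.lift u r) =
      fderiv ℝ (fun w => P.lift w r) u (P.lift u r') := by
  have hmem := hK P.N P.isOpen_N _ _ (P.smoothOn_frame r) (P.smoothOn_frame r') (P.inv u)
    (Patch.inv_mem_N hu)
  rw [P.mem_D _ (Patch.inv_mem_N hu)] at hmem
  have hu' : P.inv u ∈ P.N := Patch.inv_mem_N hu
  have hb := dChart_mlieBracket I P.isOpen_N (P.smoothOn_frame r) (P.smoothOn_frame r') hu.1 hu'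
  have hnear (r : R) : chartField I P.pt (fun x => (P.frame x r : TangentSpace I x)) =ᶠ[nhds u]
      fun w => P.lift w r := by
    filter_upwards [(Patch.isOpen_img isOpen_univ).mem_nhds hu] with w hw
    rw [Patch.chartField_eq hw, Patch.coframe_frame (Patch.inv_mem_N hw)]
  rw [lieBracket_eq] at hb
  beta_reduce at hb
  rw [(hnear r).fderiv_eq, (hnear r').fderiv_eq, (hnear r).eq_of_nhds,
    (hnear r').eq_of_nhds] at hb
  have hb' : dChart I P.pt (P.inv u) (mlieBracket I (fun x => (P.frame x r : TangentSpace I x))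
      (fun x => (P.frame x r' : TangentSpace I x)) (P.inv u)) =
      fderiv ℝ (fun w => P.lift w r') u (P.lift u r) -
      fderiv ℝ (fun w => P.lift w r) u (P.lift u r') := hb
  rw [hb', map_sub, Patch.Λ_fderiv_lift hu, Patch.Λ_fderiv_lift hu, sub_zero, map_zero] at hmem
  exact (sub_eq_zero.1 hmem.symm)

/-- A distribution with a commuting frame is involutive. -/
lemma Patch.mlieBracket_mem
    (hP : ∀ u ∈ P.img univ, ∀ r r' : R, fderiv ℝ (fun w => P.lift w r') u (P.lift u r) =
      fderiv ℝ (fun w => P.lift w r) u (P.lift u r'))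
    {W : Set X} (hW : IsOpen W) {V V' : ∀ y, K.D y} (hV : K.D.SmoothOn V W)
    (hV' : K.D.SmoothOn V' W) {x : X} (hx : x ∈ W) (hxN : x ∈ P.N) :
    mlieBracket I (fun y => (V y : TangentSpace I y)) (fun y => (V' y : TangentSpace I y)) x
      ∈ K.D x := by
  obtain ⟨u, hu, rfl⟩ : ∃ u, u ∈ P.img W ∧ P.inv u = x :=
    ⟨_, Patch.chart_mem_img hxN hx, Patch.inv_chart hxN⟩
  have hu1 : u ∈ P.img univ := Patch.img_mono (subset_univ W) hu
  have hb := dChart_mlieBracket I hW hV hV' hu.1 (Patch.inv_mem hu)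
  have hderiv (V : ∀ y, K.D y) (hV : K.D.SmoothOn V W) (v : E) :
      fderiv ℝ (chartField I P.pt fun x => (V x : TangentSpace I x)) u v =
      fderiv ℝ (fun w => P.lift w (P.coframe (P.inv u) (V (P.inv u)))) u v +
      P.lift u (P.Λ (fderiv ℝ (chartField I P.pt fun x => (V x : TangentSpace I x)) u v)) := by
    have hd : DifferentiableAt ℝ (chartField I P.pt fun x => (V x : TangentSpace I x)) u :=
      ((Patch.contDiffOn_chartField hW hV).contDiffAt
        ((Patch.isOpen_img hW).mem_nhds hu)).differentiableAt (by simp)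
    have hl := Patch.differentiableAt_lift hW hu
    have hnear : (chartField I P.pt fun x => (V x : TangentSpace I x)) =ᶠ[nhds u]
        fun w => P.lift w (P.Λ (chartField I P.pt (fun x => (V x : TangentSpace I x)) w)) := by
      filter_upwards [(Patch.isOpen_img hW).mem_nhds hu] with w hw
      exact Patch.chartField_eq hw
    have h1 := hl.hasFDerivAt.clm_apply (P.Λ.hasFDerivAt.comp u hd.hasFDerivAt)
    have h2 := hl.hasFDerivAt.clm_apply (hasFDerivAt_const (P.coframe (P.inv u) (V (P.inv u))) u)
    rw [h2.fderiv]
    conv_lhs => rw [hnear.fderiv_eq]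
    refine (DFunLike.congr_fun h1.fderiv v).trans ?_
    simp [Patch.coframe_field]
    exact add_comm _ _
  rw [P.mem_D _ (Patch.inv_mem_N hu)]
  rw [lieBracket_eq] at hb
  have hb' : dChart I P.pt (P.inv u) (mlieBracket I (fun y => (V y : TangentSpace I y))
      (fun y => (V' y : TangentSpace I y)) (P.inv u)) = _ := hb
  rw [hb', Patch.chart_inv hu]
  simp only [map_sub]
  rw [hderiv V hV, hderiv V' hV', Patch.chartField_eq hu, Patch.chartField_eq hu, hP u hu1]
  simp only [map_add, Patch.Λ_fderiv_lift hu1, Patch.Λ_lift' hu, zero_add]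
  abel

end Involutive
end Existence

section Regularity

set_option linter.unusedSectionVars false

variable {E : Type*} [NormedAddCommGroup E] [NormedSpace ℝ E]
  {H : Type*} [TopologicalSpace H] {I : ModelWithCorners ℝ E H}
  {X : Type*} [TopologicalSpace X] [ChartedSpace H X] [IsManifold I ∞ X]
  {E' : Type*} [NormedAddCommGroup E'] [NormedSpace ℝ E']
  {H' : Type*} [TopologicalSpace H'] {I' : ModelWithCorners ℝ E' H'}
  {Y : Type*} [TopologicalSpace Y] [ChartedSpace H' Y] [IsManifold I' ∞ Y]
  {ι ι' : Type*}

/-! ### Patches of products -/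

lemma dChart_prod {p x : X} {p' y : Y} (hx : x ∈ (chartAt H p).source)
    (hy : y ∈ (chartAt H' p').source) (v : TangentSpace (I.prod I') (x, y)) :
    dChart (I.prod I') (p, p') (x, y) v = (dChart I p x v.1, dChart I' p' y v.2) := by
  have e : ⇑(extChartAt (I.prod I') (p, p')) = Prod.map (extChartAt I p) (extChartAt I' p') := by
    rw [extChartAt_prod]; rfl
  have h := mfderiv_prodMap (p := (x, y)) (mdifferentiableAt_extChartAt (I := I) hx)
    (mdifferentiableAt_extChartAt (I := I') hy)
  unfold dChart
  rw [modelWithCornersSelf_prod, ← chartedSpaceSelf_prod, e]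
  exact DFunLike.congr_fun h v

/-- The product of two patches. -/
def Patch.prod {K : FoliatedBundle I X ι} {K' : FoliatedBundle I' Y ι'} {R R' : Type*}
    [NormedAddCommGroup R] [NormedSpace ℝ R] [NormedAddCommGroup R'] [NormedSpace ℝ R']
    (P : Patch K R) (P' : Patch K' R') : Patch (K.prod K') (R × R') where
  pt := (P.pt, P'.pt)
  i := (P.i, P'.i)
  N := P.N ×ˢ P'.N
  isOpen_N := P.isOpen_N.prod P'.isOpen_N
  N_chart := by
    rw [prodChartedSpace_chartAt]
    exact prod_mono P.N_chart P'.N_chart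
  N_base := prod_mono P.N_base P'.N_base
  Λ := P.Λ.prodMap P'.Λ
  lift z := (P.lift z.1).prodMap (P'.lift z.2)
  contDiffOn_lift := by
    rw [extChartAt_prod]
    have h1 := P.contDiffOn_lift.comp (contDiff_fst (E := E) (F := E')).contDiffOn
      (s := ((extChartAt I P.pt).prod (extChartAt I' P'.pt)).target ∩
        ((extChartAt I P.pt).prod (extChartAt I' P'.pt)).symm ⁻¹' (P.N ×ˢ P'.N))
      fun u hu => ⟨hu.1.1, hu.2.1⟩
    have h2 := P'.contDiffOn_lift.comp (contDiff_snd (E := E) (F := E')).contDiffOn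
      (s := ((extChartAt I P.pt).prod (extChartAt I' P'.pt)).target ∩
        ((extChartAt I P.pt).prod (extChartAt I' P'.pt)).symm ⁻¹' (P.N ×ˢ P'.N))
      fun u hu => ⟨hu.1.2, hu.2.2⟩
    exact (ContinuousLinearMap.prodMapL ℝ R E R' E').contDiff.comp_contDiffOn (h1.prodMk h2)
  Λ_lift z hz r := by
    rw [extChartAt_prod]
    exact Prod.ext (P.Λ_lift z.1 hz.1 r.1) (P'.Λ_lift z.2 hz.2 r.2)
  mem_D z hz v := by
    rw [extChartAt_prod]
    have e := dChart_prod (I := I) (I' := I') (P.N_chart hz.1) (P'.N_chart hz.2) v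
    rw [e]
    refine Iff.trans ?_ Prod.ext_iff.symm
    exact and_congr (P.mem_D z.1 hz.1 v.1) (P'.mem_D z.2 hz.2 v.2)

/-! ### Regularity -/

lemma mvfderiv_mul_complex {f g : X → ℂ} {x : X} (hf : MDifferentiableAt I 𝓘(ℝ, ℂ) f x)
    (hg : MDifferentiableAt I 𝓘(ℝ, ℂ) g x) (v : TangentSpace I x) :
    mvfderiv I (fun y => f y * g y) x v = f x * mvfderiv I g x v + g x * mvfderiv I f x v :=
  DFunLike.congr_fun (hf.hasMFDerivAt.mul hg.hasMFDerivAt).mfderiv v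

lemma LineBundle.mdifferentiableAt_coordChange (S : LineBundle I X ι) {i j : ι} {x : X}
    (hi : x ∈ S.baseSet i) (hj : x ∈ S.baseSet j) :
    MDifferentiableAt I 𝓘(ℝ, ℂ) (fun y => S.coordChange i j y 1) x :=
  ((S.smooth_coordChange i j).contMDiffAt (((S.isOpen_baseSet i).inter
    (S.isOpen_baseSet j)).mem_nhds ⟨hi, hj⟩)).mdifferentiableAt (by simp)

/-- The transformation rules of the two connections add up. -/
lemma QuantizationData.isRegular_bundle {m : ℕ} {ιL ιN : Type*}
    (Q : QuantizationData I X m ιL ιN) : Q.bundle.IsRegular where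
  gauge := by
    intro i j x hx v
    have h1 := Q.isConnection_AL.gauge i.1 j.1 x ⟨hx.1.1, hx.2.1⟩ ⟨v.1, Submodule.mem_top⟩
    have h2 := Q.isConnection_AN.gauge i.2 j.2 x ⟨hx.1.2, hx.2.2⟩ v
    have hmul : (fun y => Q.bundle.S.coordChange j i y 1) =
        fun y => Q.L.coordChange j.1 i.1 y 1 * Q.Nhalf.coordChange j.2 i.2 y 1 :=
      funext fun y => LineBundle.comp_apply_one _ _
    have hmulx := congrFun hmul x
    have h3 := mvfderiv_mul_complex (Q.L.mdifferentiableAt_coordChange hx.2.1 hx.1.1)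
      (Q.Nhalf.mdifferentiableAt_coordChange hx.2.2 hx.1.2) (v : TangentSpace I x)
    rw [← hmul] at h3
    rw [h3, hmulx]
    change _ * (Q.AL j.1 x ⟨v.1, _⟩ + Q.AN j.2 x v) =
      _ + _ * (Q.AL i.1 x ⟨v.1, _⟩ + Q.AN i.2 x v)
    linear_combination Q.Nhalf.coordChange j.2 i.2 x 1 * h1 + Q.L.coordChange j.1 i.1 x 1 * h2
  involutive := Q.isFoliation.involutive

/-- The product of regular foliated bundles is regular; involutivity is checked on the commuting
frames of product patches. -/
lemma FoliatedBundle.IsRegular.prod {K : FoliatedBundle I X ι} {K' : FoliatedBundle I' Y ι'}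
    {R R' : Type*} [NormedAddCommGroup R] [NormedSpace ℝ R] [NormedAddCommGroup R']
    [NormedSpace ℝ R'] [I.Boundaryless] [I'.Boundaryless] [CompleteSpace E] [CompleteSpace E']
    (hK : K.IsRegular) (hK' : K'.IsRegular)
    (hP : ∀ x, ∃ P : Patch K R, x ∈ P.N) (hP' : ∀ y, ∃ P : Patch K' R', y ∈ P.N) :
    (K.prod K').IsRegular where
  gauge := by
    rintro i j ⟨x, y⟩ hz v
    have h1 := hK.gauge i.1 j.1 x ⟨hz.1.1, hz.2.1⟩ (K.D.prodFst K'.D (x, y) v)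
    have h2 := hK'.gauge i.2 j.2 y ⟨hz.1.2, hz.2.2⟩ (K.D.prodSnd K'.D (x, y) v)
    have hmul : (fun z => (K.prod K').S.coordChange j i z 1) =
        fun z : X × Y => K.S.coordChange j.1 i.1 z.1 1 * K'.S.coordChange j.2 i.2 z.2 1 :=
      funext fun y => LineBundle.comp_apply_one _ _
    have hmulx := congrFun hmul (x, y)
    have d1 := K.S.mdifferentiableAt_coordChange hz.2.1 hz.1.1
    have d2 := K'.S.mdifferentiableAt_coordChange hz.2.2 hz.1.2
    have d1' := MDifferentiableAt.comp (x, y) d1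
      (mdifferentiableAt_fst (I := I) (I' := I') (x := (x, y)))
    have d2' := MDifferentiableAt.comp (x, y) d2
      (mdifferentiableAt_snd (I := I) (I' := I') (x := (x, y)))
    have h3 := mvfderiv_mul_complex d1' d2' (v : TangentSpace (I.prod I') (x, y))
    have e1 : mvfderiv (I.prod I') ((fun y => K.S.coordChange j.1 i.1 y 1) ∘ Prod.fst) (x, y)
        (v : TangentSpace (I.prod I') (x, y)) =
        mvfderiv I (fun y => K.S.coordChange j.1 i.1 y 1) x
          (K.D.prodFst K'.D (x, y) v : TangentSpace I x) :=
      DFunLike.congr_fun (HasMFDerivAt.comp (x, y) d1.hasMFDerivAt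
        (hasMFDerivAt_fst (I := I) (I' := I') (x, y))).mfderiv _
    have e2 : mvfderiv (I.prod I') ((fun y => K'.S.coordChange j.2 i.2 y 1) ∘ Prod.snd) (x, y)
        (v : TangentSpace (I.prod I') (x, y)) =
        mvfderiv I' (fun y => K'.S.coordChange j.2 i.2 y 1) y
          (K.D.prodSnd K'.D (x, y) v : TangentSpace I' y) :=
      DFunLike.congr_fun (HasMFDerivAt.comp (x, y) d2.hasMFDerivAt
        (hasMFDerivAt_snd (I := I) (I' := I') (x, y))).mfderiv _
    rw [e1, e2] at h3
    simp only [Function.comp_apply] at h3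
    rw [hmul, hmulx, h3]
    change _ * (K.A j.1 x (K.D.prodFst K'.D (x, y) v) + K'.A j.2 y (K.D.prodSnd K'.D (x, y) v)) =
      _ + _ * (K.A i.1 x (K.D.prodFst K'.D (x, y) v) + K'.A i.2 y (K.D.prodSnd K'.D (x, y) v))
    linear_combination K'.S.coordChange j.2 i.2 y 1 * h1 + K.S.coordChange j.1 i.1 x 1 * h2
  involutive := by
    rintro W hW V V' hV hV' ⟨x, y⟩ hz
    obtain ⟨P, hx⟩ := hP x
    obtain ⟨P', hy⟩ := hP' y
    refine Patch.mlieBracket_mem (P := P.prod P') ?_ hW hV hV' hz ⟨hx, hy⟩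
    intro u hu r r'
    have hu0 : u ∈ (extChartAt (I.prod I') (P.pt, P'.pt)).target := hu.1
    have hu2 : (extChartAt (I.prod I') (P.pt, P'.pt)).symm u ∈ P.N ×ˢ P'.N := hu.2.1
    rw [extChartAt_prod] at hu0 hu2
    have hu1 : u.1 ∈ P.img univ := ⟨hu0.1, hu2.1, mem_univ _⟩
    have hu1' : u.2 ∈ P'.img univ := ⟨hu0.2, hu2.2, mem_univ _⟩
    have key (r v) : fderiv ℝ (fun w => (P.prod P').lift w r) u v =
        (fderiv ℝ (fun w => P.lift w r.1) u.1 v.1, fderiv ℝ (fun w => P'.lift w r.2) u.2 v.2) := by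
      have d1 : DifferentiableAt ℝ (fun w => P.lift w r.1) u.1 :=
        (Patch.differentiableAt_lift isOpen_univ hu1).clm_apply (differentiableAt_const _)
      have d2 : DifferentiableAt ℝ (fun w => P'.lift w r.2) u.2 :=
        (Patch.differentiableAt_lift isOpen_univ hu1').clm_apply (differentiableAt_const _)
      exact DFunLike.congr_fun (HasFDerivAt.prodMap u d1.hasFDerivAt d2.hasFDerivAt).fderiv v
    rw [key, key]
    exact Prod.ext (Patch.lift_commute hK.involutive hu1 r.1 r'.1)
      (Patch.lift_commute hK'.involutive hu1' r.2 r'.2)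

/-! ### The standard bundle -/

/-- The patch that covers the phase space. -/
def standardPatch (k : ℕ) (θ : PhaseSpace k → PhaseSpace k →L[ℝ] ℝ) :
    Patch (standardBundle k θ) (EuclideanSpace ℝ (Fin k)) where
  pt := 0
  i := ()
  N := univ
  isOpen_N := isOpen_univ
  N_chart := by
    rw [chartAt_self_eq]
    exact subset_univ _
  N_base := fun _ _ => mem_univ _
  Λ := ContinuousLinearMap.snd ℝ _ _
  lift _ := ContinuousLinearMap.inr ℝ _ _
  contDiffOn_lift := contDiffOn_const
  Λ_lift _ _ _ := rfl
  mem_D z _ v := by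
    have e : dChart 𝓘(ℝ, PhaseSpace k) (0 : PhaseSpace k) z v = v := by
      unfold dChart
      rw [extChartAt_model_space_eq_id]
      exact DFunLike.congr_fun (mfderiv_id (I := 𝓘(ℝ, PhaseSpace k)) (x := z)) v
    rw [e]
    constructor
    · intro h
      exact Prod.ext (LinearMap.mem_ker.1 h).symm rfl
    · intro h
      exact LinearMap.mem_ker.2 (congrArg Prod.fst h).symm

lemma isRegular_standardBundle (k : ℕ) (θ : PhaseSpace k → PhaseSpace k →L[ℝ] ℝ) :
    (standardBundle k θ).IsRegular where
  gauge := by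
    intro i j x _ v
    have : (fun y => (standardBundle k θ).S.coordChange j i y 1) = fun _ => 1 := rfl
    rw [this, mvfderiv_const]
    exact (zero_add _).symm
  involutive W hW V V' hV hV' x hx :=
    Patch.mlieBracket_mem (P := standardPatch k θ) (by simp [standardPatch]) hW hV hV' hx
      (mem_univ x)

end Regularity

section Operations

set_option linter.unusedSectionVars false

variable {E : Type*} [NormedAddCommGroup E] [NormedSpace ℝ E]
  {H : Type*} [TopologicalSpace H] {I : ModelWithCorners ℝ E H}
  {X : Type*} [TopologicalSpace X] [ChartedSpace H X] [IsManifold I ∞ X]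
  {ι : Type*} {K : FoliatedBundle I X ι}

/-! ### Locality -/

section Locality

variable {n : ℕ} {W : Set X}

lemma LineBundle.SmoothOn.congr {S : LineBundle I X ι} {s t : X → ℂ} (hs : S.SmoothOn s W)
    (h : EqOn t s W) : S.SmoothOn t W := fun i =>
  (hs i).congr fun x hx => congrArg (S.coordChange (S.indexAt x) i x) (h hx.1)

lemma FoliatedBundle.Form.SmoothOn.congr {α β : K.Form n} (hα : α.SmoothOn W)
    (h : ∀ x ∈ W, β x = α x) : β.SmoothOn W := fun W' hW' ho V hV =>
  (hα W' hW' ho V hV).congr fun x hx => by rw [h x (hW' hx)]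

lemma FoliatedBundle.Form.smoothOn_of_nhds {α : K.Form n}
    (h : ∀ x ∈ W, ∃ N : Set X, IsOpen N ∧ x ∈ N ∧ α.SmoothOn (W ∩ N)) : α.SmoothOn W := by
  intro W' hW' ho V hV i x hx
  obtain ⟨N, hN, hxN, hα⟩ := h x (hW' hx.1)
  have h1 := hα (W' ∩ N) (inter_subset_inter_left _ hW') (ho.inter hN) V
    (fun j => ContMDiffOn.mono (hV j) inter_subset_left) i x ⟨⟨hx.1, hxN⟩, hx.2⟩
  have e : W' ∩ N ∩ K.S.baseSet i = (W' ∩ K.S.baseSet i) ∩ N := by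
    ext; simp only [mem_inter_iff]; tauto
  rw [e] at h1
  exact (contMDiffWithinAt_inter (hN.mem_nhds hxN)).1 h1

lemma FoliatedBundle.Form.hasDiffOn_of_nhds {α : K.Form n} {β : K.Form (n + 1)}
    (h : ∀ x ∈ W, ∃ N : Set X, IsOpen N ∧ x ∈ N ∧ α.HasDiffOn β (W ∩ N)) :
    α.HasDiffOn β W := by
  intro W' hW' ho V hV x hx
  obtain ⟨N, hN, hxN, hα⟩ := h x (hW' hx)
  exact hα (W' ∩ N) (inter_subset_inter_left _ hW') (ho.inter hN) V
    (fun j => ContMDiffOn.mono (hV j) inter_subset_left) x ⟨hx, hxN⟩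

lemma FoliatedBundle.Form.HasDiffOn.congr {α α' : K.Form n} {β β' : K.Form (n + 1)}
    (h : α.HasDiffOn β W) (hα : ∀ x ∈ W, α' x = α x) (hβ : ∀ x ∈ W, β' x = β x) :
    α'.HasDiffOn β' W := by
  intro W' hW' ho V hV x hx
  rw [hβ x (hW' hx), ← h W' hW' ho V hV x hx]
  unfold Form.koszul
  refine Finset.sum_congr rfl fun i _ => ?_
  rw [hα x (hW' hx)]
  congr 2
  unfold covDeriv
  congr 1
  · have : K.S.coord (K.S.indexAt x) (fun y => α' y fun j => i.removeNth V j y) =ᶠ[nhds x]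
        K.S.coord (K.S.indexAt x) (fun y => α y fun j => i.removeNth V j y) := by
      filter_upwards [ho.mem_nhds hx] with y hy
      exact congrArg (K.S.coordChange (K.S.indexAt y) (K.S.indexAt x) y)
        (by beta_reduce; rw [hα y (hW' hy)])
    unfold mvfderiv
    rw [this.mfderiv_eq]
    rfl
  · beta_reduce
    rw [hα x (hW' hx)]

end Locality

/-! ### Pull-backs in patches -/

/-- Smoothness of a pull-back of alternating maps. -/
lemma contDiffOn_alt_comp {G R R₂ : Type*} [NormedAddCommGroup G] [NormedSpace ℝ G]
    [NormedAddCommGroup R] [NormedSpace ℝ R] [FiniteDimensional ℝ R] [NormedAddCommGroup R₂]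
    [NormedSpace ℝ R₂] [FiniteDimensional ℝ R₂] {n : ℕ} {a : G → R₂ [⋀^Fin n]→L[ℝ] ℂ}
    {T : G → R →L[ℝ] R₂} {s : Set G} (ha : ContDiffOn ℝ ∞ a s) (hT : ContDiffOn ℝ ∞ T s) :
    ContDiffOn ℝ ∞ (fun u => (a u).compContinuousLinearMap (T u)) s :=
  contDiffOn_alt fun v => contDiffOn_alt_apply (g := fun j u => T u (v j)) ha
    fun _ => hT.clm_apply contDiffOn_const

section Pull

variable {R : Type*} [NormedAddCommGroup R] [NormedSpace ℝ R] [FiniteDimensional ℝ R]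
  {E₂ : Type*} [NormedAddCommGroup E₂] [NormedSpace ℝ E₂]
  {H₂ : Type*} [TopologicalSpace H₂] {I₂ : ModelWithCorners ℝ E₂ H₂}
  {X₂ : Type*} [TopologicalSpace X₂] [ChartedSpace H₂ X₂] [IsManifold I₂ ∞ X₂]
  {ι₂ : Type*} {K₂ : FoliatedBundle I₂ X₂ ι₂}
  {R₂ : Type*} [NormedAddCommGroup R₂] [NormedSpace ℝ R₂] [FiniteDimensional ℝ R₂]

/-- A local morphism of foliated bundles, expressed in patches: a map `f` with the map `T` that it
induces on the distributions, and a function `m` that relates the trivializations. -/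
structure PullData (P : Patch K R) (P₂ : Patch K₂ R₂) (W : Set X) (W₂ : Set X₂) where
  f : E → E₂
  T : E → R →L[ℝ] R₂
  m : E → ℂ
  contDiffOn_f : ContDiffOn ℝ ∞ f (P.img W)
  contDiffOn_T : ContDiffOn ℝ ∞ T (P.img W)
  contDiffOn_m : ContDiffOn ℝ ∞ m (P.img W)
  mapsTo : MapsTo f (P.img W) (P₂.img W₂)
  Λ_f : ∀ u ∈ P.img W, ∀ v, P₂.Λ (fderiv ℝ f u v) = T u (P.Λ v)
  f_lift : ∀ u ∈ P.img W, ∀ r, fderiv ℝ f u (P.lift u r) = P₂.lift (f u) (T u r)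
  conn_f : ∀ u ∈ P.img W, ∀ r,
    fderiv ℝ m u (P.lift u r) + P.conn u r * m u = m u * P₂.conn (f u) (T u r)

namespace PullData

variable {P : Patch K R} {P₂ : Patch K₂ R₂} {W : Set X} {W₂ : Set X₂} (φ : PullData P P₂ W W₂)
  {n : ℕ}

/-- In patches, the form `β` is the pull-back of the form `α`. -/
def IsPull (α : K₂.Form n) (β : K.Form n) : Prop :=
  ∀ u ∈ P.img W, P.loc β u = φ.m u • (P₂.loc α (φ.f u)).compContinuousLinearMap (φ.T u)

variable {φ} [I.Boundaryless] [I₂.Boundaryless]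

lemma contDiffOn_loc {P : Patch K R} {W : Set X} {α : K.Form n} (hW : IsOpen W)
    (hα : α.SmoothOn W) : ContDiffOn ℝ ∞ (P.loc α) (P.img W) := by
  have := (Patch.smoothOn_iff (P := P) (P.isOpen_N.inter hW) inter_subset_left).1
    (hα.mono inter_subset_right)
  exact this.mono fun u hu => ⟨hu.1, hu.2.1, hu.2⟩

lemma d_loc (hK : K.IsRegular) [CompleteSpace E] {α : K.Form n} {β : K.Form (n + 1)} {W : Set X}
    (hW : IsOpen W) (hα : α.SmoothOn W) (h : α.HasDiffOn β W) {u : E} (hu : u ∈ P.img W) :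
    P.d (P.loc α) u = P.loc β u :=
  (Patch.hasDiffOn_iff hK (P.isOpen_N.inter hW) inter_subset_left (hα.mono inter_subset_right)).1
    (h.mono inter_subset_right) u ⟨hu.1, hu.2.1, hu.2⟩

lemma IsPull.smoothOn {α : K₂.Form n} {β : K.Form n} (h : φ.IsPull α β) (hW : IsOpen W)
    (hW₂ : IsOpen W₂) (hα : α.SmoothOn W₂) (hWN : W ⊆ P.N) : β.SmoothOn W := by
  rw [Patch.smoothOn_iff (P := P) hW hWN]
  refine ContDiffOn.congr ?_ h
  exact φ.contDiffOn_m.smul (contDiffOn_alt_comp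
    ((contDiffOn_loc hW₂ hα).comp φ.contDiffOn_f φ.mapsTo) φ.contDiffOn_T)

/-- Pull-backs commute with the differentials. -/
lemma IsPull.hasDiffOn {α : K₂.Form n} {β : K.Form n} {α' : K₂.Form (n + 1)}
    {β' : K.Form (n + 1)} (h : φ.IsPull α β) (h' : φ.IsPull α' β') (hK : K.IsRegular)
    (hK₂ : K₂.IsRegular) [CompleteSpace E] [CompleteSpace E₂] (hW : IsOpen W)
    (hW₂ : IsOpen W₂) (hα : α.SmoothOn W₂) (hd : α.HasDiffOn α' W₂) (hWN : W ⊆ P.N) :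
    β.HasDiffOn β' W := by
  rw [Patch.hasDiffOn_iff (P := P) hK hW hWN (h.smoothOn hW hW₂ hα hWN)]
  intro u hu
  have hnh : P.img W ∈ nhds u := (Patch.isOpen_img hW).mem_nhds hu
  have hfu : φ.f u ∈ P₂.img W₂ := φ.mapsTo hu
  have hnear : P.loc β =ᶠ[nhds u]
      fun w => φ.m w • (P₂.loc α (φ.f w)).compContinuousLinearMap (φ.T w) := by
    filter_upwards [hnh] with w hw using h w hw
  have e : P.d (P.loc β) u = P.d
      (fun w => φ.m w • (P₂.loc α (φ.f w)).compContinuousLinearMap (φ.T w)) u := by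
    unfold Patch.d localD
    rw [hnear.fderiv_eq, hnear.eq_of_nhds]
  rw [e, h' u hu, ← d_loc hK₂ hW₂ hα hd hfu]
  exact localD_pullback (Λ := P.Λ) (Λ₂ := P₂.Λ)
    (((contDiffOn_loc hW₂ hα).contDiffAt ((Patch.isOpen_img hW₂).mem_nhds hfu)).differentiableAt
      (by simp))
    (φ.contDiffOn_f.contDiffAt hnh) ((φ.contDiffOn_T.contDiffAt hnh).differentiableAt (by simp))
    ((φ.contDiffOn_m.contDiffAt hnh).differentiableAt (by simp)) (Patch.Λ_lift' hu)
    (Patch.Λ_lift' hfu) (by filter_upwards [hnh] with w hw using φ.Λ_f w hw) (φ.f_lift u hu)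
    (φ.conn_f u hu)

end PullData

end Pull

/-! ### Products with the phase space -/

section PhaseSpace

variable {k : ℕ} {θ : PhaseSpace k → PhaseSpace k →L[ℝ] ℝ}
  {R : Type*} [NormedAddCommGroup R] [NormedSpace ℝ R] [FiniteDimensional ℝ R]
  {P : Patch K R} {n : ℕ}

lemma standardPatch_inv (z : PhaseSpace k) : (standardPatch k θ).inv z = z := by
  unfold Patch.inv
  rw [extChartAt_model_space_eq_id]; rfl

lemma standardPatch_img (W : Set (PhaseSpace k)) : (standardPatch k θ).img W = W := by
  unfold Patch.img
  rw [extChartAt_model_space_eq_id]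
  ext z
  rw [mem_inter_iff, mem_preimage, standardPatch_inv]
  exact ⟨fun h => h.2.2, fun h => ⟨mem_univ _, mem_univ _, h⟩⟩

lemma standardPatch_factor (z : PhaseSpace k) : (standardPatch k θ).factor z = 1 := rfl

lemma standardPatch_frame (z : PhaseSpace k) (s : EuclideanSpace ℝ (Fin k)) :
    @Eq (PhaseSpace k) ((standardPatch k θ).frame z s).1 (0, s) := by
  have h := Patch.dChart_frame (P := standardPatch k θ) (mem_univ z) s
  have e : dChart 𝓘(ℝ, PhaseSpace k) (0 : PhaseSpace k) z ((standardPatch k θ).frame z s).1 =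
      ((standardPatch k θ).frame z s).1 := by
    unfold dChart
    rw [extChartAt_model_space_eq_id]
    exact DFunLike.congr_fun (mfderiv_id (I := 𝓘(ℝ, PhaseSpace k)) (x := z)) _
  exact e.symm.trans h

variable (P) (θ) in
/-- The patch of the product with the phase space that is given by a patch. -/
abbrev Patch.cyl : Patch (K.prod (standardBundle k θ)) (R × EuclideanSpace ℝ (Fin k)) :=
  P.prod (standardPatch k θ)

lemma Patch.cyl_inv (w : E × PhaseSpace k) : (P.cyl θ).inv w = (P.inv w.1, w.2) := by
  have : (P.cyl θ).inv w = (P.inv w.1, (standardPatch k θ).inv w.2) := by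
    unfold Patch.inv
    change (extChartAt (I.prod 𝓘(ℝ, PhaseSpace k)) (P.pt, (standardPatch k θ).pt)).symm w = _
    rw [extChartAt_prod]; rfl
  rw [this, standardPatch_inv]

lemma Patch.mem_cyl_img {W : Set (X × PhaseSpace k)} {w : E × PhaseSpace k} :
    w ∈ (P.cyl θ).img W ↔ w.1 ∈ P.img univ ∧ (P.inv w.1, w.2) ∈ W := by
  unfold Patch.img
  rw [mem_inter_iff, mem_preimage, Patch.cyl_inv]
  change (w ∈ (extChartAt (I.prod 𝓘(ℝ, PhaseSpace k)) (P.pt, (standardPatch k θ).pt)).target ∧ _)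
    ↔ _
  rw [extChartAt_prod, extChartAt_model_space_eq_id]
  constructor
  · rintro ⟨h1, h2, h3⟩
    exact ⟨⟨h1.1, h2.1, mem_univ _⟩, h3⟩
  · rintro ⟨⟨h1, h2, -⟩, h3⟩
    exact ⟨⟨h1, mem_univ _⟩, ⟨h2, mem_univ _⟩, h3⟩

lemma Patch.prodFst_cyl_frame {q : X × PhaseSpace k} (hq : q.1 ∈ P.N)
    (r : R × EuclideanSpace ℝ (Fin k)) :
    K.D.prodFst (standardBundle k θ).D q ((P.cyl θ).frame q r) = P.frame q.1 r.1 := by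
  have h := Patch.coframe_frame (P := P.cyl θ) (x := q) ⟨hq, mem_univ _⟩ r
  have e : ((P.cyl θ).coframe q ((P.cyl θ).frame q r)).1 =
      P.coframe q.1 (K.D.prodFst (standardBundle k θ).D q ((P.cyl θ).frame q r)) := by
    have := dChart_prod (I := I) (I' := 𝓘(ℝ, PhaseSpace k)) (p := P.pt)
      (p' := (standardPatch k θ).pt) (x := q.1) (y := q.2) (P.N_chart hq)
      ((standardPatch k θ).N_chart (mem_univ _)) ((P.cyl θ).frame q r).1
    exact congrArg (fun v => ((P.cyl θ).Λ v).1) this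
  rw [h] at e
  rw [e, Patch.frame_coframe hq]

lemma Patch.prodSnd_cyl_frame {q : X × PhaseSpace k} (hq : q.1 ∈ P.N)
    (r : R × EuclideanSpace ℝ (Fin k)) :
    K.D.prodSnd (standardBundle k θ).D q ((P.cyl θ).frame q r) =
      (standardPatch k θ).frame q.2 r.2 := by
  have h := Patch.coframe_frame (P := P.cyl θ) (x := q) ⟨hq, mem_univ _⟩ r
  have e : ((P.cyl θ).coframe q ((P.cyl θ).frame q r)).2 =
      (standardPatch k θ).coframe q.2
        (K.D.prodSnd (standardBundle k θ).D q ((P.cyl θ).frame q r)) := by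
    have := dChart_prod (I := I) (I' := 𝓘(ℝ, PhaseSpace k)) (p := P.pt)
      (p' := (standardPatch k θ).pt) (x := q.1) (y := q.2) (P.N_chart hq)
      ((standardPatch k θ).N_chart (mem_univ _)) ((P.cyl θ).frame q r).1
    exact congrArg (fun v => ((P.cyl θ).Λ v).2) this
  rw [h] at e
  rw [e, Patch.frame_coframe (P := standardPatch k θ) (mem_univ _)]

/-- The connection form of the product patch. -/
lemma Patch.cyl_conn {w : E × PhaseSpace k} (hw : w.1 ∈ P.img univ)
    (r : R × EuclideanSpace ℝ (Fin k)) :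
    (P.cyl θ).conn w r = P.conn w.1 r.1 - Complex.I * θ w.2 (0, r.2) := by
  have hq : ((P.cyl θ).inv w).1 ∈ P.N := by rw [Patch.cyl_inv]; exact hw.2.1
  have h1 := Patch.prodFst_cyl_frame (θ := θ) hq r
  have h2 := Patch.prodSnd_cyl_frame (θ := θ) hq r
  have e : (P.cyl θ).conn w r =
      K.A P.i ((P.cyl θ).inv w).1 (K.D.prodFst (standardBundle k θ).D ((P.cyl θ).inv w)
        ((P.cyl θ).frame ((P.cyl θ).inv w) r)) +
      -Complex.I * θ ((P.cyl θ).inv w).2 (K.D.prodSnd (standardBundle k θ).D ((P.cyl θ).inv w)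
        ((P.cyl θ).frame ((P.cyl θ).inv w) r) : (standardBundle k θ).D _).1 := rfl
  rw [e, h1, h2, standardPatch_frame, Patch.conn_apply, Patch.cyl_inv]
  ring

end PhaseSpace
end Operations

section CylinderForms

set_option linter.unusedSectionVars false

variable {E : Type*} [NormedAddCommGroup E] [NormedSpace ℝ E]
  {H : Type*} [TopologicalSpace H] {I : ModelWithCorners ℝ E H}
  {X : Type*} [TopologicalSpace X] [ChartedSpace H X] [IsManifold I ∞ X]
  {ι : Type*} {K : FoliatedBundle I X ι}
  {k : ℕ} {θ θ' : PhaseSpace k → PhaseSpace k →L[ℝ] ℝ}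
  {R : Type*} [NormedAddCommGroup R] [NormedSpace ℝ R] [FiniteDimensional ℝ R]
  {P : Patch K R} {n : ℕ}

/-! ### Operations on forms on a product with the phase space -/

/-- The product of a form with a function on the phase space. The connection on the phase space may
change. -/
def mulForm (θ' : PhaseSpace k → PhaseSpace k →L[ℝ] ℝ) (s : PhaseSpace k → ℂ)
    (β : (K.prod (standardBundle k θ)).Form n) : (K.prod (standardBundle k θ')).Form n :=
  fun q => s q.2 • β q

/-- The vector along `X` as a vector along the product. -/
def prodInl (θ : PhaseSpace k → PhaseSpace k →L[ℝ] ℝ) (p : X) (z : PhaseSpace k) :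
    K.D p →ₗ[ℝ] (K.prod (standardBundle k θ)).D (p, z) where
  toFun v := ⟨(v.1, 0), v.2, Submodule.zero_mem _⟩
  map_add' _ _ := Subtype.ext (Prod.ext rfl (zero_add _).symm)
  map_smul' _ _ := Subtype.ext (Prod.ext rfl (smul_zero _).symm)

/-- The restriction of a form to `X × {z}`. -/
def sliceForm (z : PhaseSpace k) (β : (K.prod (standardBundle k θ)).Form n) : K.Form n :=
  fun p => (β (p, z)).compLinearMap (prodInl θ p z)

/-- The form on the product with the phase space, without components along the phase space, that is
given by a family of forms parametrized by the first coordinate of the phase space. -/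
def famForm (θ : PhaseSpace k → PhaseSpace k →L[ℝ] ℝ)
    (a : EuclideanSpace ℝ (Fin k) → K.Form n) : (K.prod (standardBundle k θ)).Form n :=
  fun q => (a q.2.1 q.1).compLinearMap (K.D.prodFst (standardBundle k θ).D q)

lemma pullbackMul_eq_mulForm (α : K.Form n) (f : (standardBundle k θ).Form 0) :
    K.pullbackMul (standardBundle k θ) α f =
      mulForm θ (fun z => f z ![]) (famForm 0 fun _ => α) := rfl

lemma Patch.loc_chart_apply (α : K.Form n) {x : X} (hx : x ∈ P.N) (r : Fin n → R) :
    P.loc α (extChartAt I P.pt x) r = P.factor x * α x fun j => P.frame x (r j) := by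
  rw [Patch.loc_apply]
  exact congrArg (fun y => P.factor y * α y fun j => P.frame y (r j)) (Patch.inv_chart hx)

lemma Patch.cyl_chart (q : X × PhaseSpace k) :
    extChartAt (I.prod 𝓘(ℝ, PhaseSpace k)) (P.cyl θ).pt q = (extChartAt I P.pt q.1, q.2) := by
  change extChartAt (I.prod 𝓘(ℝ, PhaseSpace k)) (P.pt, (standardPatch k θ).pt) q = _
  rw [extChartAt_prod, extChartAt_model_space_eq_id]; rfl

lemma Patch.loc_cyl_apply (α : (K.prod (standardBundle k θ)).Form n) {p : X} (hp : p ∈ P.N)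
    (z : PhaseSpace k) (r : Fin n → R × EuclideanSpace ℝ (Fin k)) :
    (P.cyl θ).loc α (extChartAt I P.pt p, z) r =
      P.factor p * α (p, z) fun j => (P.cyl θ).frame (p, z) (r j) := by
  have h := Patch.loc_chart_apply (P := P.cyl θ) α (x := (p, z)) ⟨hp, mem_univ _⟩ r
  rwa [Patch.cyl_chart] at h

lemma Patch.loc_mulForm (s : PhaseSpace k → ℂ) (β : (K.prod (standardBundle k θ)).Form n)
    (w : E × PhaseSpace k) :
    (P.cyl θ').loc (mulForm θ' s β) w = s w.2 • (P.cyl θ).loc β w := by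
  ext r
  have h : (P.cyl θ').loc (mulForm θ' s β) w r = (P.cyl θ).factor ((P.cyl θ).inv w) *
    (s ((P.cyl θ).inv w).2 * β ((P.cyl θ).inv w)
      fun j => (P.cyl θ).frame ((P.cyl θ).inv w) (r j)) := rfl
  have h2 : ((P.cyl θ).inv w).2 = w.2 := by rw [Patch.cyl_inv]
  rw [h, h2, mul_left_comm]
  rfl

lemma Patch.inl_frame {p : X} (hp : p ∈ P.N) (z : PhaseSpace k) (r : R) :
    prodInl θ p z (P.frame p r) = (P.cyl θ).frame (p, z) (r, 0) := by
  have h1 := Patch.prodFst_cyl_frame (θ := θ) (P := P) (q := (p, z)) hp (r, 0)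
  have h2 := Patch.prodSnd_cyl_frame (θ := θ) (P := P) (q := (p, z)) hp (r, 0)
  rw [map_zero] at h2
  have e1 := congrArg Subtype.val h1
  have e2 := congrArg Subtype.val h2
  exact Subtype.ext (Prod.ext e1.symm e2.symm)

lemma Patch.loc_sliceForm (z : PhaseSpace k) (β : (K.prod (standardBundle k θ)).Form n) {u : E}
    (hu : u ∈ P.img univ) :
    P.loc (sliceForm z β) u = ((P.cyl θ).loc β (u, z)).compContinuousLinearMap
      (ContinuousLinearMap.inl ℝ R (EuclideanSpace ℝ (Fin k))) := by
  obtain ⟨p, hp, rfl⟩ : ∃ p ∈ P.N, extChartAt I P.pt p = u :=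
    ⟨P.inv u, hu.2.1, Patch.chart_inv hu⟩
  ext r
  rw [Patch.loc_chart_apply _ hp]
  change _ = (P.cyl θ).loc β (extChartAt I P.pt p, z) fun j => (r j, 0)
  rw [Patch.loc_cyl_apply _ hp]
  simp only [← Patch.inl_frame hp]
  rfl

lemma Patch.loc_famForm (a : EuclideanSpace ℝ (Fin k) → K.Form n) {w : E × PhaseSpace k}
    (hw : w.1 ∈ P.img univ) :
    (P.cyl θ).loc (famForm θ a) w = (P.loc (a w.2.1) w.1).compContinuousLinearMap
      (ContinuousLinearMap.fst ℝ R (EuclideanSpace ℝ (Fin k))) := by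
  obtain ⟨u, z⟩ := w
  obtain ⟨p, hp, rfl⟩ : ∃ p ∈ P.N, extChartAt I P.pt p = u :=
    ⟨P.inv u, hw.2.1, Patch.chart_inv hw⟩
  ext r
  rw [Patch.loc_cyl_apply _ hp]
  change _ = P.loc (a z.1) (extChartAt I P.pt p) fun j => (r j).1
  rw [Patch.loc_chart_apply _ hp]
  simp only [← Patch.prodFst_cyl_frame (P := P) (θ := θ) (q := (p, z)) hp]
  rfl

section Boundaryless

variable [I.Boundaryless]

lemma FoliatedBundle.Form.smoothOn_of_atlas {W : Set X} (hW : IsOpen W) {α : K.Form n}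
    (h : ∀ x ∈ W, ∃ P : Patch K R, x ∈ P.N ∧ ContDiffOn ℝ ∞ (P.loc α) (P.img W)) :
    α.SmoothOn W := by
  refine smoothOn_of_nhds fun x hx => ?_
  obtain ⟨P, hxP, hP⟩ := h x hx
  refine ⟨P.N, P.isOpen_N, hxP, (Patch.smoothOn_iff (hW.inter P.isOpen_N) inter_subset_right).2 ?_⟩
  exact hP.mono (Patch.img_mono inter_subset_left)

lemma FoliatedBundle.Form.hasDiffOn_of_atlas [CompleteSpace E] (hK : K.IsRegular) {W : Set X}
    (hW : IsOpen W) {α : K.Form n} {β : K.Form (n + 1)} (hα : α.SmoothOn W)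
    (h : ∀ x ∈ W, ∃ P : Patch K R, x ∈ P.N ∧ ∀ u ∈ P.img W, P.d (P.loc α) u = P.loc β u) :
    α.HasDiffOn β W := by
  refine hasDiffOn_of_nhds fun x hx => ?_
  obtain ⟨P, hxP, hP⟩ := h x hx
  refine ⟨P.N, P.isOpen_N, hxP, (Patch.hasDiffOn_iff hK (hW.inter P.isOpen_N) inter_subset_right
    (hα.mono inter_subset_left)).2 fun u hu => ?_⟩
  exact hP u (Patch.img_mono inter_subset_left hu)

section Mul

variable {s : PhaseSpace k → ℂ} {Ω : Set (PhaseSpace k)} {W : Set (X × PhaseSpace k)}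

lemma smoothOn_mulForm (h𝒰 : ∀ x, ∃ P : Patch K R, x ∈ P.N) (hW : IsOpen W)
    (hWΩ : W ⊆ univ ×ˢ Ω) (hs : ContDiffOn ℝ ∞ s Ω)
    {β : (K.prod (standardBundle k θ)).Form n} (hβ : β.SmoothOn W) :
    (mulForm θ' s β).SmoothOn W := by
  refine FoliatedBundle.Form.smoothOn_of_atlas
    (R := R × EuclideanSpace ℝ (Fin k)) hW fun q _ => ?_
  obtain ⟨P, hP⟩ := h𝒰 q.1
  refine ⟨P.cyl θ', ⟨hP, mem_univ _⟩, ?_⟩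
  have h1 : ContDiffOn ℝ ∞ (fun w : E × PhaseSpace k => s w.2) ((P.cyl θ').img W) :=
    hs.comp contDiff_snd.contDiffOn fun w hw => (hWΩ (Patch.mem_cyl_img.1 hw).2).2
  have h2 : ContDiffOn ℝ ∞ ((P.cyl θ).loc β) ((P.cyl θ').img W) :=
    PullData.contDiffOn_loc (P := P.cyl θ) hW hβ
  exact (h1.smul h2).congr fun w _ => Patch.loc_mulForm s β w

/-- Multiplication with `s` commutes with the differentials if the derivative of `s` along the
leaves is the difference of the connection forms. -/
lemma hasDiffOn_mulForm [CompleteSpace E] (hK : (K.prod (standardBundle k θ)).IsRegular)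
    (hK' : (K.prod (standardBundle k θ')).IsRegular)
    (h𝒰 : ∀ x, ∃ P : Patch K R, x ∈ P.N) (hW : IsOpen W) (hΩ : IsOpen Ω)
    (hWΩ : W ⊆ univ ×ˢ Ω) (hs : ContDiffOn ℝ ∞ s Ω)
    (hd : ∀ z ∈ Ω, ∀ r, fderiv ℝ s z (0, r) =
      Complex.I * ((θ' z (0, r) : ℂ) - θ z (0, r)) * s z)
    {β : (K.prod (standardBundle k θ)).Form n} {γ : (K.prod (standardBundle k θ)).Form (n + 1)}
    (hβ : β.SmoothOn W) (h : β.HasDiffOn γ W) :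
    (mulForm θ' s β).HasDiffOn (mulForm θ' s γ) W := by
  refine FoliatedBundle.Form.hasDiffOn_of_nhds fun q hq => ?_
  obtain ⟨P, hP⟩ := h𝒰 q.1
  refine ⟨(P.cyl θ').N, (P.cyl θ').isOpen_N, ⟨hP, mem_univ _⟩, ?_⟩
  have hWN : IsOpen (W ∩ (P.cyl θ').N) := hW.inter (P.cyl θ').isOpen_N
  have hΩ' {w : E × PhaseSpace k} (hw : w ∈ (P.cyl θ').img (W ∩ (P.cyl θ').N)) : w.2 ∈ Ω :=
    (hWΩ (Patch.mem_cyl_img.1 hw).2.1).2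
  have hm : ContDiffOn ℝ ∞ (fun w : E × PhaseSpace k => s w.2)
      ((P.cyl θ').img (W ∩ (P.cyl θ').N)) :=
    hs.comp contDiff_snd.contDiffOn fun w hw => hΩ' hw
  let φ : PullData (P.cyl θ') (P.cyl θ) (W ∩ (P.cyl θ').N) W :=
    { f := id
      T := fun _ => ContinuousLinearMap.id ℝ _
      m := fun w => s w.2
      contDiffOn_f := contDiffOn_id
      contDiffOn_T := contDiffOn_const
      contDiffOn_m := hm
      mapsTo := fun w hw => Patch.img_mono (P := P.cyl θ') inter_subset_left hw
      Λ_f := fun u _ v => by rw [fderiv_id]; rfl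
      f_lift := fun u _ r => by rw [fderiv_id]; rfl
      conn_f := fun w hw r => by
        have hsd : DifferentiableAt ℝ s w.2 :=
          (hs.contDiffAt (hΩ.mem_nhds (hΩ' hw))).differentiableAt (by simp)
        have h1 : HasFDerivAt (fun w : E × PhaseSpace k => s w.2)
            (fderiv ℝ s w.2 ∘L ContinuousLinearMap.snd ℝ E (PhaseSpace k)) w :=
          hsd.hasFDerivAt.comp w hasFDerivAt_snd
        have hw1 := (Patch.mem_cyl_img.1 hw).1
        rw [h1.fderiv, Patch.cyl_conn hw1]
        change fderiv ℝ s w.2 (0, r.2) + _ = s w.2 * (P.cyl θ).conn w r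
        rw [Patch.cyl_conn hw1, hd _ (hΩ' hw)]
        ring }
  have hpull {n : ℕ} (β : (K.prod (standardBundle k θ)).Form n) :
      φ.IsPull β (mulForm θ' s β) := fun w _ => Patch.loc_mulForm s β w
  exact (hpull β).hasDiffOn (hpull γ) hK' hK hWN hW hβ h inter_subset_right

end Mul

section Slice

variable {W : Set (X × PhaseSpace k)} {z : PhaseSpace k}

/-- Restriction to a slice is a pull-back in patches. -/
lemma slice_pull (W : Set (X × PhaseSpace k)) (z : PhaseSpace k) (P : Patch K R) :
    ∃ φ : PullData P (P.cyl θ) ({p | (p, z) ∈ W} ∩ P.N) W,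
      ∀ {n : ℕ} (β : (K.prod (standardBundle k θ)).Form n), φ.IsPull β (sliceForm z β) := by
  have hf (u : E) : HasFDerivAt (fun u : E => (u, z))
      (ContinuousLinearMap.inl ℝ E (PhaseSpace k)) u := hasFDerivAt_prodMk_left u z
  refine ⟨
    { f := fun u => (u, z)
      T := fun _ => ContinuousLinearMap.inl ℝ _ _
      m := fun _ => 1
      contDiffOn_f := contDiffOn_id.prodMk contDiffOn_const
      contDiffOn_T := contDiffOn_const
      contDiffOn_m := contDiffOn_const
      mapsTo := fun u hu => Patch.mem_cyl_img.2 ⟨Patch.img_mono (subset_univ _) hu, hu.2.2.1⟩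
      Λ_f := fun u _ v => by rw [(hf u).fderiv]; rfl
      f_lift := fun u _ r => by rw [(hf u).fderiv]; rfl
      conn_f := fun u hu r => by
        have h0 : θ z (0, 0) = 0 := map_zero (θ z)
        rw [fderiv_const_apply, Patch.cyl_conn (Patch.img_mono (subset_univ _) hu)]
        simp [h0] }, fun β u hu => ?_⟩
  rw [Patch.loc_sliceForm z β (Patch.img_mono (subset_univ _) hu)]
  exact (one_smul _ _).symm

lemma isOpen_slice (hW : IsOpen W) : IsOpen {p | (p, z) ∈ W} :=
  hW.preimage (Continuous.prodMk_left z)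

lemma smoothOn_sliceForm (h𝒰 : ∀ x, ∃ P : Patch K R, x ∈ P.N) (hW : IsOpen W)
    {β : (K.prod (standardBundle k θ)).Form n} (hβ : β.SmoothOn W) :
    (sliceForm z β).SmoothOn {p | (p, z) ∈ W} := by
  refine FoliatedBundle.Form.smoothOn_of_nhds fun p _ => ?_
  obtain ⟨P, hP⟩ := h𝒰 p
  obtain ⟨φ, hφ⟩ := slice_pull (θ := θ) W z P
  exact ⟨P.N, P.isOpen_N, hP, (hφ β).smoothOn ((isOpen_slice hW).inter P.isOpen_N) hW hβ
    inter_subset_right⟩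

lemma hasDiffOn_sliceForm [CompleteSpace E] (hK : K.IsRegular)
    (hK' : (K.prod (standardBundle k θ)).IsRegular) (h𝒰 : ∀ x, ∃ P : Patch K R, x ∈ P.N)
    (hW : IsOpen W) {β : (K.prod (standardBundle k θ)).Form n}
    {γ : (K.prod (standardBundle k θ)).Form (n + 1)} (hβ : β.SmoothOn W) (h : β.HasDiffOn γ W) :
    (sliceForm z β).HasDiffOn (sliceForm z γ) {p | (p, z) ∈ W} := by
  refine FoliatedBundle.Form.hasDiffOn_of_nhds fun p _ => ?_
  obtain ⟨P, hP⟩ := h𝒰 p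
  obtain ⟨φ, hφ⟩ := slice_pull (θ := θ) W z P
  exact ⟨P.N, P.isOpen_N, hP, (hφ β).hasDiffOn (hφ γ) hK hK' ((isOpen_slice hW).inter P.isOpen_N)
    hW hβ h inter_subset_right⟩

end Slice

/-! ### Smooth families of forms -/

/-- The family `b` of forms is smooth for the parameter in `Ω`, jointly in the point and the
parameter: its local expressions in patches around every point are. -/
def FamSmooth (R : Type*) [NormedAddCommGroup R] [NormedSpace ℝ R] [FiniteDimensional ℝ R]
    {G : Type*} [NormedAddCommGroup G] [NormedSpace ℝ G] (b : G → K.Form n) (Ω : Set G) : Prop :=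
  ∀ x, ∃ P : Patch K R, x ∈ P.N ∧
    ContDiffOn ℝ ∞ (fun w : E × G => P.loc (b w.2) w.1) (P.img univ ×ˢ Ω)

section Family

variable {Ω : Set (EuclideanSpace ℝ (Fin k))}
  {a : EuclideanSpace ℝ (Fin k) → K.Form n} {b : EuclideanSpace ℝ (Fin k) → K.Form (n + 1)}

lemma FamSmooth.smoothOn_famForm (hΩ : IsOpen Ω)
    (ha : FamSmooth R a Ω) : (famForm θ a).SmoothOn (univ ×ˢ (Prod.fst ⁻¹' Ω)) := by
  have hop : IsOpen (univ ×ˢ (Prod.fst ⁻¹' Ω) : Set (X × PhaseSpace k)) :=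
    isOpen_univ.prod (hΩ.preimage continuous_fst)
  refine FoliatedBundle.Form.smoothOn_of_atlas
    (R := R × EuclideanSpace ℝ (Fin k)) hop fun q _ => ?_
  obtain ⟨P, hP, haP⟩ := ha q.1
  refine ⟨P.cyl θ, ⟨hP, mem_univ _⟩, ?_⟩
  have h1 : ContDiffOn ℝ ∞ (fun w : E × PhaseSpace k => P.loc (a w.2.1) w.1)
      ((P.cyl θ).img (univ ×ˢ (Prod.fst ⁻¹' Ω))) :=
    ContDiffOn.comp (g := fun w : E × EuclideanSpace ℝ (Fin k) => P.loc (a w.2) w.1)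
      (f := fun w : E × PhaseSpace k => (w.1, w.2.1)) haP
      (contDiff_fst.prodMk (contDiff_fst.comp contDiff_snd)).contDiffOn
      fun w hw => ⟨(Patch.mem_cyl_img.1 hw).1, (Patch.mem_cyl_img.1 hw).2.2⟩
  have h2 : ContDiffOn ℝ ∞ (fun _ : E × PhaseSpace k =>
      ContinuousLinearMap.fst ℝ R (EuclideanSpace ℝ (Fin k)))
      ((P.cyl θ).img (univ ×ˢ (Prod.fst ⁻¹' Ω))) := contDiffOn_const
  exact (contDiffOn_alt_comp h1 h2).congr
    fun w hw => Patch.loc_famForm a (Patch.mem_cyl_img.1 hw).1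

/-- The differential of a smooth family of forms, seen as a form on the product with the phase
space, is computed pointwise in the parameter. -/
lemma FamSmooth.hasDiffOn_famForm [CompleteSpace E] (hK : K.IsRegular)
    (hK' : (K.prod (standardBundle k 0)).IsRegular)
    (hΩ : IsOpen Ω) (ha : FamSmooth R a Ω)
    (has : ∀ x ∈ Ω, (a x).SmoothOn univ) (h : ∀ x ∈ Ω, (a x).HasDiffOn (b x) univ) :
    (famForm 0 a).HasDiffOn (famForm 0 b) (univ ×ˢ (Prod.fst ⁻¹' Ω)) := by
  have hop : IsOpen (univ ×ˢ (Prod.fst ⁻¹' Ω) : Set (X × PhaseSpace k)) :=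
    isOpen_univ.prod (hΩ.preimage continuous_fst)
  refine FoliatedBundle.Form.hasDiffOn_of_atlas (R := R × EuclideanSpace ℝ (Fin k)) hK' hop
    (ha.smoothOn_famForm hΩ) fun q _ => ?_
  obtain ⟨P, hP, haP⟩ := ha q.1
  refine ⟨P.cyl 0, ⟨hP, mem_univ _⟩, fun w hw => ?_⟩
  have hw1 : w.1 ∈ P.img univ := (Patch.mem_cyl_img.1 hw).1
  have hw2 : w.2.1 ∈ Ω := (Patch.mem_cyl_img.1 hw).2.2
  have hnear : (P.cyl 0).loc (famForm 0 a) =ᶠ[nhds w]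
      fun w => (P.loc (a w.2.1) w.1).compContinuousLinearMap
        (ContinuousLinearMap.fst ℝ R (EuclideanSpace ℝ (Fin k))) := by
    filter_upwards [(Patch.isOpen_img hop).mem_nhds hw] with w hw
    exact Patch.loc_famForm a (Patch.mem_cyl_img.1 hw).1
  have hda : DifferentiableAt ℝ (fun w : E × EuclideanSpace ℝ (Fin k) => P.loc (a w.2) w.1)
      (w.1, w.2.1) := (haP.contDiffAt
    (((Patch.isOpen_img isOpen_univ).prod hΩ).mem_nhds ⟨hw1, hw2⟩)).differentiableAt (by simp)
  let L : (R [⋀^Fin n]→L[ℝ] ℂ) →L[ℝ] (R × EuclideanSpace ℝ (Fin k)) [⋀^Fin n]→L[ℝ] ℂ :=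
    ContinuousAlternatingMap.compContinuousLinearMapCLM
      (ContinuousLinearMap.fst ℝ R (EuclideanSpace ℝ (Fin k)))
  have hd1 : HasFDerivAt (fun w : E × PhaseSpace k => (P.loc (a w.2.1) w.1).compContinuousLinearMap
      (ContinuousLinearMap.fst ℝ R (EuclideanSpace ℝ (Fin k))))
      (L ∘L fderiv ℝ (fun w : E × EuclideanSpace ℝ (Fin k) => P.loc (a w.2) w.1) (w.1, w.2.1) ∘L
        ((ContinuousLinearMap.fst ℝ E (PhaseSpace k)).prod
          (ContinuousLinearMap.fst ℝ _ _ ∘L ContinuousLinearMap.snd ℝ E (PhaseSpace k)))) w :=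
    L.hasFDerivAt.comp w (HasFDerivAt.comp w
      (g := fun w : E × EuclideanSpace ℝ (Fin k) => P.loc (a w.2) w.1)
      (f := fun w : E × PhaseSpace k => (w.1, w.2.1)) hda.hasFDerivAt
      (hasFDerivAt_fst.prodMk (hasFDerivAt_fst.comp w hasFDerivAt_snd)))
  have hd2 : HasFDerivAt (P.loc (a w.2.1))
      (fderiv ℝ (fun w : E × EuclideanSpace ℝ (Fin k) => P.loc (a w.2) w.1) (w.1, w.2.1) ∘L
        ContinuousLinearMap.inl ℝ E _) w.1 :=
    HasFDerivAt.comp w.1 (g := fun w : E × EuclideanSpace ℝ (Fin k) => P.loc (a w.2) w.1)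
      (f := fun u => (u, w.2.1)) hda.hasFDerivAt (hasFDerivAt_prodMk_left _ _)
  have hdb := PullData.d_loc hK isOpen_univ (has _ hw2) (h _ hw2) hw1
  rw [Patch.loc_famForm b hw1, ← hdb]
  ext r
  change _ = P.d (P.loc (a w.2.1)) w.1 fun j => (r j).1
  unfold Patch.d
  rw [localD_apply, localD_apply, hnear.fderiv_eq, hnear.eq_of_nhds, hd1.fderiv, hd2.fderiv]
  refine Finset.sum_congr rfl fun i _ => ?_
  rw [Patch.cyl_conn hw1]
  simp only [Pi.zero_apply, zero_apply, Complex.ofReal_zero, mul_zero, sub_zero]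
  rfl

end Family
end Boundaryless
end CylinderForms

section ParametricIntegral

open MeasureTheory

universe u

/-! ### Integrals depending on a parameter -/

section Calculus

variable {E F : Type u} [NormedAddCommGroup E] [NormedSpace ℝ E] [FiniteDimensional ℝ E]
  [NormedAddCommGroup F] [NormedSpace ℝ F]
  {G : Type*} [NormedAddCommGroup G] [NormedSpace ℝ G] [MeasurableSpace G]
  [OpensMeasurableSpace G]
  {μ : Measure G} [IsFiniteMeasureOnCompacts μ] {T : Set G} {Ω : Set E} {f : E × G → F}

omit [FiniteDimensional ℝ E] [OpensMeasurableSpace G]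
  [IsFiniteMeasureOnCompacts μ] [MeasurableSpace G] [NormedSpace ℝ E] [NormedSpace ℝ F]
  [NormedSpace ℝ G] in
lemma continuous_section_of_continuousOn (hf : ContinuousOn f (Ω ×ˢ univ)) {u : E} (hu : u ∈ Ω) :
    Continuous fun t => f (u, t) :=
  continuousOn_univ.1 (hf.comp (Continuous.prodMk_right u).continuousOn
    fun t _ => ⟨hu, mem_univ t⟩)

omit [FiniteDimensional ℝ E] [NormedSpace ℝ E] [NormedSpace ℝ F] [NormedSpace ℝ G] in
lemma integrableOn_section_of_continuousOn (hT : IsCompact T)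
    (hf : ContinuousOn f (Ω ×ˢ univ)) {u : E} (hu : u ∈ Ω) :
    IntegrableOn (fun t => f (u, t)) T μ :=
  (continuous_section_of_continuousOn hf hu).continuousOn.integrableOn_compact' hT
    hT.isClosed.measurableSet

lemma hasFDerivAt_integral_of_contDiffOn (hT : IsCompact T) (hΩ : IsOpen Ω)
    (hf : ContDiffOn ℝ ∞ f (Ω ×ˢ univ)) {u : E} (hu : u ∈ Ω) :
    HasFDerivAt (fun u => ∫ t in T, f (u, t) ∂μ)
      (∫ t in T, fderiv ℝ f (u, t) ∘L ContinuousLinearMap.inl ℝ E G ∂μ) u := by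
  have hop : IsOpen (Ω ×ˢ (univ : Set G)) := hΩ.prod isOpen_univ
  have hf' : ContinuousOn (fun w => fderiv ℝ f w ∘L ContinuousLinearMap.inl ℝ E G)
      (Ω ×ˢ univ) :=
    ((hf.continuousOn_fderiv_of_isOpen hop (by simp)).clm_comp continuousOn_const)
  obtain ⟨ε, hε, hball⟩ := Metric.nhds_basis_closedBall.mem_iff.1 (hΩ.mem_nhds hu)
  have : ProperSpace E := FiniteDimensional.proper_real E
  obtain ⟨C, hC⟩ := ((isCompact_closedBall u ε).prod hT).exists_bound_of_continuousOn
    (hf'.mono (prod_mono hball (subset_univ T)))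
  refine hasFDerivAt_integral_of_dominated_of_fderiv_le (s := Metric.closedBall u ε)
    (F' := fun u t => fderiv ℝ f (u, t) ∘L ContinuousLinearMap.inl ℝ E G)
    (bound := fun _ => C) (Metric.closedBall_mem_nhds u hε) ?_ ?_ ?_ ?_ ?_ ?_
  · filter_upwards [hΩ.mem_nhds hu] with w hw
    exact (integrableOn_section_of_continuousOn hT hf.continuousOn hw).aestronglyMeasurable
  · exact integrableOn_section_of_continuousOn hT hf.continuousOn hu
  · exact (integrableOn_section_of_continuousOn hT hf' hu).aestronglyMeasurable
  · refine (ae_restrict_iff' hT.isClosed.measurableSet).2 (Filter.Eventually.of_forall ?_)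
    exact fun t ht w hw => hC (w, t) ⟨hw, ht⟩
  · exact integrableOn_const hT.measure_ne_top
  · refine Filter.Eventually.of_forall fun t w hw => ?_
    exact HasFDerivAt.comp w ((hf.contDiffAt (hop.mem_nhds
      ⟨hball hw, mem_univ t⟩)).differentiableAt (by simp)).hasFDerivAt (hasFDerivAt_prodMk_left w t)

omit [FiniteDimensional ℝ E] [OpensMeasurableSpace G]
  [MeasurableSpace G] in
lemma contDiffOn_fderiv_inl (hΩ : IsOpen Ω) (hf : ContDiffOn ℝ ∞ f (Ω ×ˢ univ)) :
    ContDiffOn ℝ ∞ (fun w => fderiv ℝ f w ∘L ContinuousLinearMap.inl ℝ E G) (Ω ×ˢ univ) :=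
  ContDiffOn.clm_comp (hf.fderiv_of_isOpen (hΩ.prod isOpen_univ) (by simp)) contDiffOn_const

lemma contDiffOn_integral (hT : IsCompact T) (hΩ : IsOpen Ω)
    (hf : ContDiffOn ℝ ∞ f (Ω ×ˢ univ)) :
    ContDiffOn ℝ ∞ (fun u => ∫ t in T, f (u, t) ∂μ) Ω := by
  rw [contDiffOn_infty]
  intro n
  induction n generalizing F with
  | zero =>
    rw [Nat.cast_zero, contDiffOn_zero]
    exact fun u hu =>
      (hasFDerivAt_integral_of_contDiffOn hT hΩ hf hu).continuousAt.continuousWithinAt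
  | succ n ih =>
    rw [Nat.cast_succ, contDiffOn_succ_iff_fderiv_of_isOpen hΩ]
    refine ⟨fun u hu => (hasFDerivAt_integral_of_contDiffOn hT hΩ hf
      hu).differentiableAt.differentiableWithinAt, by simp, ?_⟩
    refine (ih (contDiffOn_fderiv_inl hΩ hf)).congr fun u hu => ?_
    exact (hasFDerivAt_integral_of_contDiffOn hT hΩ hf hu).fderiv

omit [FiniteDimensional ℝ E] [OpensMeasurableSpace G] [MeasurableSpace G] in
lemma hasFDerivAt_section (hΩ : IsOpen Ω) (hf : ContDiffOn ℝ ∞ f (Ω ×ˢ univ)) {u : E}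
    (hu : u ∈ Ω) (t : G) : HasFDerivAt (fun w => f (w, t))
      (fderiv ℝ f (u, t) ∘L ContinuousLinearMap.inl ℝ E G) u :=
  HasFDerivAt.comp u ((hf.contDiffAt ((hΩ.prod isOpen_univ).mem_nhds
    ⟨hu, mem_univ t⟩)).differentiableAt (by simp)).hasFDerivAt (hasFDerivAt_prodMk_left u t)

omit [FiniteDimensional ℝ E] in
lemma integrableOn_fderiv_section (hT : IsCompact T) (hΩ : IsOpen Ω)
    (hf : ContDiffOn ℝ ∞ f (Ω ×ˢ univ)) {u : E} (hu : u ∈ Ω) (v : E) :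
    IntegrableOn (fun t => fderiv ℝ (fun w => f (w, t)) u v) T μ := by
  simp only [(hasFDerivAt_section hΩ hf hu _).fderiv]
  exact integrableOn_section_of_continuousOn
    (f := fun w => (fderiv ℝ f w ∘L ContinuousLinearMap.inl ℝ E G) v) hT
    ((contDiffOn_fderiv_inl hΩ hf).continuousOn.clm_apply continuousOn_const) hu

lemma fderiv_integral_apply [CompleteSpace F] (hT : IsCompact T) (hΩ : IsOpen Ω)
    (hf : ContDiffOn ℝ ∞ f (Ω ×ˢ univ)) {u : E} (hu : u ∈ Ω) (v : E) :
    fderiv ℝ (fun u => ∫ t in T, f (u, t) ∂μ) u v =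
      ∫ t in T, fderiv ℝ (fun w => f (w, t)) u v ∂μ := by
  rw [(hasFDerivAt_integral_of_contDiffOn hT hΩ hf hu).fderiv]
  simp only [(hasFDerivAt_section hΩ hf hu _).fderiv]
  exact ContinuousLinearMap.integral_apply (integrableOn_section_of_continuousOn hT
    (contDiffOn_fderiv_inl hΩ hf).continuousOn hu) v

/-- The derivatives of an integral are bounded by the derivatives of the integrand. -/
lemma norm_iteratedFDeriv_integral_le (hT : IsCompact T) (hf : ContDiff ℝ ∞ f) (n : ℕ) {C : ℝ}
    (u : E) (hC : ∀ t ∈ T, ‖iteratedFDeriv ℝ n (fun w => f (w, t)) u‖ ≤ C) :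
    ‖iteratedFDeriv ℝ n (fun u => ∫ t in T, f (u, t) ∂μ) u‖ ≤ C * μ.real T := by
  induction n generalizing F with
  | zero =>
    rw [norm_iteratedFDeriv_zero]
    refine norm_setIntegral_le_of_norm_le_const hT.measure_lt_top fun t ht => ?_
    simpa using hC t ht
  | succ n ih =>
    have hf' : ContDiffOn ℝ ∞ f (univ ×ˢ univ) := hf.contDiffOn
    have hd : fderiv ℝ (fun u => ∫ t in T, f (u, t) ∂μ) =
        fun u => ∫ t in T, fderiv ℝ f (u, t) ∘L ContinuousLinearMap.inl ℝ E G ∂μ :=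
      funext fun u => (hasFDerivAt_integral_of_contDiffOn hT isOpen_univ hf' (mem_univ u)).fderiv
    rw [← norm_iteratedFDeriv_fderiv, hd]
    have h1 := contDiffOn_fderiv_inl isOpen_univ hf'
    rw [univ_prod_univ, contDiffOn_univ] at h1
    refine ih (f := fun w => fderiv ℝ f w ∘L ContinuousLinearMap.inl ℝ E G) h1 fun t ht => ?_
    have h2 : (fun w => fderiv ℝ f (w, t) ∘L ContinuousLinearMap.inl ℝ E G) =
        fderiv ℝ fun w => f (w, t) :=
      funext fun w => (HasFDerivAt.comp w ((hf.differentiable (by simp)) (w, t)).hasFDerivAt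
        (hasFDerivAt_prodMk_left w t)).fderiv.symm
    rw [h2, norm_iteratedFDeriv_fderiv]
    exact hC t ht

end Calculus

/-! ### Integrals of forms depending on a parameter -/

section Forms

set_option linter.unusedSectionVars false

variable {E : Type u} [NormedAddCommGroup E] [NormedSpace ℝ E] [FiniteDimensional ℝ E]
  {H : Type*} [TopologicalSpace H] {I : ModelWithCorners ℝ E H} [I.Boundaryless]
  {X : Type*} [TopologicalSpace X] [ChartedSpace H X] [IsManifold I ∞ X]
  {ι : Type*} {K : FoliatedBundle I X ι}
  {R : Type u} [NormedAddCommGroup R] [NormedSpace ℝ R] [FiniteDimensional ℝ R]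
  {P : Patch K R} {n : ℕ}
  {G : Type*} [NormedAddCommGroup G] [NormedSpace ℝ G] [MeasurableSpace G]
  [OpensMeasurableSpace G]
  {μ : Measure G} [IsFiniteMeasureOnCompacts μ] {T : Set G} {γ : G → K.Form n} {W : Set X}

open Classical in
/-- The integral over `T` of a family of forms. At points where not all values of the forms are
integrable it is zero. -/
def integralForm (μ : Measure G) (T : Set G) (γ : G → K.Form n) : K.Form n := fun x =>
  if h : ∀ v, IntegrableOn (fun t => γ t x v) T μ then
    { toFun := fun v => ∫ t in T, γ t x v ∂μ
      map_update_add' := fun v i a b => by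
        rw [← integral_add (h _) (h _)]
        congr 1
        funext t
        exact (γ t x).map_update_add' v i a b
      map_update_smul' := fun v i c a => by
        rw [← integral_smul]
        congr 1
        funext t
        exact (γ t x).map_update_smul' v i c a
      map_eq_zero_of_eq' := fun v i j h hij => by
        rw [← integral_zero G ℂ (μ := μ.restrict T)]
        congr 1
        funext t
        exact (γ t x).map_eq_zero_of_eq' v i j h hij }
  else 0

lemma integralForm_apply {x : X} (h : ∀ v, IntegrableOn (fun t => γ t x v) T μ)
    (v : Fin n → K.D x) : integralForm μ T γ x v = ∫ t in T, γ t x v ∂μ := by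
  unfold integralForm
  rw [dif_pos h]
  rfl

lemma integrableOn_form (hT : IsCompact T)
    (hγ : ContDiffOn ℝ ∞ (fun w : E × G => P.loc (γ w.2) w.1) (P.img W ×ˢ univ))
    {x : X} (hx : x ∈ W) (hxP : x ∈ P.N) (v : Fin n → K.D x) :
    IntegrableOn (fun t => γ t x v) T μ := by
  obtain ⟨u, hu, rfl⟩ : ∃ u, u ∈ P.img W ∧ P.inv u = x :=
    ⟨_, Patch.chart_mem_img hxP hx, Patch.inv_chart hxP⟩
  have h1 : Continuous fun t => P.loc (γ t) u fun j => P.coframe (P.inv u) (v j) :=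
    (ContinuousAlternatingMap.apply ℝ R ℂ fun j => P.coframe (P.inv u) (v j)).continuous.comp
      (continuous_section_of_continuousOn hγ.continuousOn hu)
  simp only [Patch.loc_coframe _ hu] at h1
  have h2 : Continuous fun t => γ t (P.inv u) v := by
    have := h1.const_mul (P.factor (P.inv u))⁻¹
    simpa only [inv_mul_cancel_left₀ (Patch.factor_ne_zero (Patch.inv_mem_N hu))] using this
  exact h2.continuousOn.integrableOn_compact' hT hT.isClosed.measurableSet

lemma loc_integralForm (hT : IsCompact T)
    (hγ : ContDiffOn ℝ ∞ (fun w : E × G => P.loc (γ w.2) w.1) (P.img W ×ˢ univ))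
    {u : E} (hu : u ∈ P.img W) :
    P.loc (integralForm μ T γ) u = ∫ t in T, P.loc (γ t) u ∂μ := by
  have hint := integrableOn_section_of_continuousOn (μ := μ) hT hγ.continuousOn hu
  ext r
  rw [Patch.loc_apply, integralForm_apply
    (integrableOn_form hT hγ (Patch.inv_mem hu) (Patch.inv_mem_N hu)), ← integral_const_mul]
  exact ((ContinuousAlternatingMap.apply ℝ R ℂ r).integral_comp_comm hint)

lemma contDiffOn_loc_integralForm (hT : IsCompact T) (hW : IsOpen W)
    (hγ : ContDiffOn ℝ ∞ (fun w : E × G => P.loc (γ w.2) w.1) (P.img W ×ˢ univ)) :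
    ContDiffOn ℝ ∞ (P.loc (integralForm μ T γ)) (P.img W) :=
  (contDiffOn_integral (f := fun w : E × G => P.loc (γ w.2) w.1) hT (Patch.isOpen_img hW)
    hγ).congr fun _ hu => loc_integralForm hT hγ hu

lemma smoothOn_integralForm (hT : IsCompact T) (hW : IsOpen W)
    (hγ : ∀ x ∈ W, ∃ P : Patch K R, x ∈ P.N ∧
      ContDiffOn ℝ ∞ (fun w : E × G => P.loc (γ w.2) w.1) (P.img W ×ˢ univ)) :
    (integralForm μ T γ).SmoothOn W := by
  refine FoliatedBundle.Form.smoothOn_of_atlas (R := R) hW fun x hx => ?_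
  obtain ⟨P, hP, h⟩ := hγ x hx
  exact ⟨P, hP, contDiffOn_loc_integralForm hT hW h⟩

/-- The differential of an integral of forms is the integral of the differentials. -/
lemma d_loc_integralForm_apply (hT : IsCompact T) (hW : IsOpen W)
    (h1 : ContDiffOn ℝ ∞ (fun w : E × G => P.loc (γ w.2) w.1) (P.img W ×ˢ univ)) {u : E}
    (hu : u ∈ P.img W) (r : Fin (n + 1) → R) :
    P.d (P.loc (integralForm μ T γ)) u r = ∫ t in T, P.d (P.loc (γ t)) u r ∂μ := by
  have hop := Patch.isOpen_img (P := P) hW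
  have hnear : P.loc (integralForm μ T γ) =ᶠ[nhds u] fun u => ∫ t in T, P.loc (γ t) u ∂μ := by
    filter_upwards [hop.mem_nhds hu] with w hw using loc_integralForm hT h1 hw
  have hi2 : IntegrableOn (fun t => P.loc (γ t) u) T μ :=
    integrableOn_section_of_continuousOn (f := fun w : E × G => P.loc (γ w.2) w.1) hT
      h1.continuousOn hu
  unfold Patch.d
  simp only [localD_apply]
  let L (i : Fin (n + 1)) : (R [⋀^Fin n]→L[ℝ] ℂ) →L[ℝ] ℂ :=
    ContinuousAlternatingMap.apply ℝ R ℂ (i.removeNth r)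
  have hi1 (i : Fin (n + 1)) : IntegrableOn
      (fun t => fderiv ℝ (P.loc (γ t)) u (P.lift u (r i))) T μ :=
    integrableOn_fderiv_section (f := fun w : E × G => P.loc (γ w.2) w.1) hT hop h1 hu _
  have i1 (i : Fin (n + 1)) : IntegrableOn (fun t => fderiv ℝ (P.loc (γ t)) u (P.lift u (r i))
      (i.removeNth r)) T μ := (L i).integrable_comp (hi1 i)
  have i2 (i : Fin (n + 1)) : IntegrableOn (fun t => P.conn u (r i) *
      P.loc (γ t) u (i.removeNth r)) T μ := ((L i).integrable_comp hi2).const_mul _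
  refine Eq.trans ?_ (integral_finsetSum (μ := μ.restrict T) Finset.univ
    (f := fun (i : Fin (n + 1)) t => (-1 : ℂ) ^ (i : ℕ) * (fderiv ℝ (P.loc (γ t)) u (P.lift u (r i))
      (i.removeNth r) + P.conn u (r i) * P.loc (γ t) u (i.removeNth r)))
    fun i _ => ((i1 i).add (i2 i)).const_mul _).symm
  refine Finset.sum_congr rfl fun i _ => ?_
  rw [integral_const_mul, integral_add (i1 i) (i2 i), integral_const_mul, hnear.fderiv_eq,
    fderiv_integral_apply (f := fun w : E × G => P.loc (γ w.2) w.1) hT hop h1 hu,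
    hnear.eq_of_nhds]
  have e2 := (L i).integral_comp_comm (hi1 i)
  have e3 := (L i).integral_comp_comm hi2
  congr 2
  · exact e2.symm
  · exact congrArg _ e3.symm

/-- Integration over a parameter commutes with the differential. -/
lemma hasDiffOn_integralForm (hK : K.IsRegular) (hT : IsCompact T) (hW : IsOpen W)
    {δ : G → K.Form (n + 1)} (hγ : ∀ x ∈ W, ∃ P : Patch K R, x ∈ P.N ∧
      ContDiffOn ℝ ∞ (fun w : E × G => P.loc (γ w.2) w.1) (P.img W ×ˢ univ) ∧
      ContDiffOn ℝ ∞ (fun w : E × G => P.loc (δ w.2) w.1) (P.img W ×ˢ univ) ∧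
      ∀ t ∈ T, ∀ u ∈ P.img W, P.d (P.loc (γ t)) u = P.loc (δ t) u) :
    (integralForm μ T γ).HasDiffOn (integralForm μ T δ) W := by
  refine FoliatedBundle.Form.hasDiffOn_of_atlas (R := R) hK hW
    (smoothOn_integralForm (R := R) hT hW fun x hx => ?_) fun x hx => ?_
  · obtain ⟨P, hP, h, -⟩ := hγ x hx
    exact ⟨P, hP, h⟩
  obtain ⟨P, hP, h1, h2, hd⟩ := hγ x hx
  refine ⟨P, hP, fun u hu => ?_⟩
  ext r
  rw [d_loc_integralForm_apply hT hW h1 hu, loc_integralForm hT h2 hu]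
  refine Eq.trans ?_ ((ContinuousAlternatingMap.apply ℝ R ℂ r).integral_comp_comm
    (integrableOn_section_of_continuousOn (f := fun w : E × G => P.loc (δ w.2) w.1) hT
      h2.continuousOn hu))
  refine setIntegral_congr_fun hT.isClosed.measurableSet fun t ht => ?_
  rw [hd t ht u hu]
  rfl

end Forms
end ParametricIntegral

section Contraction

/-! ### Contractions of a neighbourhood of a compact contractible set -/

/-- A compact contractible set `A` in a Euclidean space has arbitrarily small neighbourhoods with a
smooth contraction inside a slightly larger one. A continuous contraction of `A` is extended to
the whole space, approximated by a smooth map, and corrected at both ends of the time interval. -/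
lemma exists_smooth_contraction {k : ℕ} {A W : Set (EuclideanSpace ℝ (Fin k))} (hA : IsCompact A)
    [ContractibleSpace A] (hW : IsOpen W) (hAW : A ⊆ W) :
    ∃ (y₀ : EuclideanSpace ℝ (Fin k)) (h : EuclideanSpace ℝ (Fin k) × ℝ → EuclideanSpace ℝ (Fin k))
      (W' : Set (EuclideanSpace ℝ (Fin k))), ContDiff ℝ ∞ h ∧ IsOpen W' ∧ A ⊆ W' ∧
      (∀ y, h (y, 0) = y) ∧ (∀ y, h (y, 1) = y₀) ∧ ∀ y ∈ W', ∀ t, h (y, t) ∈ W := by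
  obtain ⟨y₀, ⟨H⟩⟩ := id_nullhomotopic A
  let e : unitInterval × A → EuclideanSpace ℝ (Fin k) × ℝ := fun p => (p.2.1, p.1.1)
  have he : Topology.IsClosedEmbedding e := by
    have h1 : Topology.IsClosedEmbedding (Prod.map (Subtype.val : unitInterval → ℝ)
        (Subtype.val : A → EuclideanSpace ℝ (Fin k))) :=
      isClosed_Icc.isClosedEmbedding_subtypeVal.prodMap hA.isClosed.isClosedEmbedding_subtypeVal
    exact (Homeomorph.prodComm ℝ (EuclideanSpace ℝ (Fin k))).isClosedEmbedding.comp h1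
  obtain ⟨g, hg⟩ := ContinuousMap.exists_extension' he
    ((⟨Subtype.val, continuous_subtype_val⟩ : C(A, EuclideanSpace ℝ (Fin k))).comp
      H.toContinuousMap)
  have hg' (t : unitInterval) (a : A) : g (a.1, t.1) = (H (t, a)).1 := congrFun hg (t, a)
  obtain ⟨δ, hδ, hthick⟩ := hA.exists_thickening_subset_open hW hAW
  obtain ⟨f, hf, hfg, -⟩ := g.continuous.exists_contDiff_approx (ε := fun _ => δ / 2) ⊤
    continuous_const fun _ => half_pos hδ
  -- The correction terms make `F` equal to the identity at time `0` and to `y₀` at time `1`; their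
  -- weights `1 - t` and `t` keep `F` within `δ` of the continuous contraction `g` on `A`.
  let F : EuclideanSpace ℝ (Fin k) × ℝ → EuclideanSpace ℝ (Fin k) := fun p =>
    f p + (1 - p.2) • (p.1 - f (p.1, 0)) + p.2 • (y₀.1 - f (p.1, 1))
  have hF : ContDiff ℝ ∞ F := by
    have h0 : ContDiff ℝ ∞ fun p : EuclideanSpace ℝ (Fin k) × ℝ => f (p.1, 0) :=
      hf.comp (contDiff_fst.prodMk contDiff_const)
    have h1 : ContDiff ℝ ∞ fun p : EuclideanSpace ℝ (Fin k) × ℝ => f (p.1, 1) :=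
      hf.comp (contDiff_fst.prodMk contDiff_const)
    exact (hf.add ((contDiff_const.sub contDiff_snd).smul (contDiff_fst.sub h0))).add
      (contDiff_snd.smul (contDiff_const.sub h1))
  have hFA : A ×ˢ Icc (0 : ℝ) 1 ⊆ F ⁻¹' W := by
    rintro ⟨a, t⟩ ⟨ha, ht⟩
    refine hthick (Metric.mem_thickening_iff.2 ⟨g (a, t), ?_, ?_⟩)
    · rw [hg' ⟨t, ht⟩ ⟨a, ha⟩]
      exact (H _).2
    · have h0 : g (a, 0) = a :=
        (hg' 0 ⟨a, ha⟩).trans (congrArg Subtype.val (H.map_zero_left ⟨a, ha⟩))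
      have h1 : g (a, 1) = y₀ :=
        (hg' 1 ⟨a, ha⟩).trans (congrArg Subtype.val (H.map_one_left ⟨a, ha⟩))
      have e1 : F (a, t) - g (a, t) = (f (a, t) - g (a, t)) + ((1 - t) • (g (a, 0) - f (a, 0)) +
          t • (g (a, 1) - f (a, 1))) := by
        rw [h0, h1]
        simp only [F]
        abel
      have n1 : ‖f (a, t) - g (a, t)‖ < δ / 2 := by rw [← dist_eq_norm]; exact hfg _
      have n2 (s : ℝ) : ‖g (a, s) - f (a, s)‖ ≤ δ / 2 := by
        rw [← dist_eq_norm, dist_comm]; exact (hfg _).le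
      rw [dist_eq_norm, e1]
      have n3 : ‖(1 - t) • (g (a, 0) - f (a, 0)) + t • (g (a, 1) - f (a, 1))‖ ≤ δ / 2 := by
        refine (norm_add_le _ _).trans ?_
        rw [norm_smul, norm_smul, Real.norm_of_nonneg ht.1,
          Real.norm_of_nonneg (sub_nonneg.2 ht.2)]
        calc (1 - t) * _ + t * _ ≤ (1 - t) * (δ / 2) + t * (δ / 2) :=
              add_le_add (mul_le_mul_of_nonneg_left (n2 0) (sub_nonneg.2 ht.2))
                (mul_le_mul_of_nonneg_left (n2 1) ht.1)
          _ = δ / 2 := by ring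
      calc _ ≤ _ := norm_add_le _ _
        _ < δ / 2 + δ / 2 := add_lt_add_of_lt_of_le n1 n3
        _ = δ := add_halves δ
  obtain ⟨W', V, hW', -, hAW', hV, hsub⟩ := generalized_tube_lemma hA isCompact_Icc
    (hW.preimage hF.continuous) hFA
  -- The smooth transition makes the time run in `[0, 1]` for all real `t`.
  refine ⟨y₀, fun p => F (p.1, Real.smoothTransition p.2), W',
    hF.comp (contDiff_fst.prodMk (Real.smoothTransition.contDiff.comp contDiff_snd)), hW', hAW',
    fun y => ?_, fun y => ?_, fun y hy t => ?_⟩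
  · simp [F, Real.smoothTransition.zero]
  · simp [F, Real.smoothTransition.one]
  · exact hsub ⟨hy, hV ⟨Real.smoothTransition.nonneg t, Real.smoothTransition.le_one t⟩⟩

end Contraction

section FiberHomotopy

set_option linter.unusedSectionVars false

open MeasureTheory

universe u

variable {E : Type u} [NormedAddCommGroup E] [NormedSpace ℝ E] [FiniteDimensional ℝ E]
  {H : Type*} [TopologicalSpace H] {I : ModelWithCorners ℝ E H} [I.Boundaryless]
  {X : Type*} [TopologicalSpace X] [ChartedSpace H X] [IsManifold I ∞ X]
  {ι : Type*} {K : FoliatedBundle I X ι} {k : ℕ}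
  {R : Type u} [NormedAddCommGroup R] [NormedSpace ℝ R] [FiniteDimensional ℝ R]
  {P : Patch K R} {n : ℕ}
  {h : EuclideanSpace ℝ (Fin k) × ℝ → EuclideanSpace ℝ (Fin k)}

/-! ### Homotopy invariance along the leaves of the phase space -/

/-- The homotopy `h` of the leaves, as a map on `X × ℝ²ᵏ`. -/
def homotopyMap (h : EuclideanSpace ℝ (Fin k) × ℝ → EuclideanSpace ℝ (Fin k)) {Y : Type*}
    (q : Y × PhaseSpace k) (t : ℝ) : Y × PhaseSpace k := (q.1, (q.2.1, h (q.2.2, t)))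

/-- The map induced by the homotopy at time `t` on the distributions. -/
def homotopyTangent (h : EuclideanSpace ℝ (Fin k) × ℝ → EuclideanSpace ℝ (Fin k))
    (q : X × PhaseSpace k) (t : ℝ) : (K.prod (standardBundle k 0)).D q →ₗ[ℝ]
      (K.prod (standardBundle k 0)).D (homotopyMap h q t) where
  toFun v := ⟨(v.1.1, ((0 : EuclideanSpace ℝ (Fin k)), fderiv ℝ h (q.2.2, t) (v.1.2.2, 0))),
    v.2.1, rfl⟩
  map_add' v w := Subtype.ext (Prod.ext rfl (Prod.ext (zero_add _).symm (by
    have : ((v + w : (K.prod (standardBundle k 0)).D q).1.2.2, (0 : ℝ)) =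
        (v.1.2.2, (0 : ℝ)) + (w.1.2.2, (0 : ℝ)) := Prod.ext rfl (zero_add _).symm
    exact (congrArg (fderiv ℝ h (q.2.2, t)) this).trans (map_add _ _ _))))
  map_smul' c v := Subtype.ext (Prod.ext rfl (Prod.ext (smul_zero _).symm (by
    have : ((c • v : (K.prod (standardBundle k 0)).D q).1.2.2, (0 : ℝ)) =
        c • (v.1.2.2, (0 : ℝ)) := Prod.ext rfl (smul_zero _).symm
    exact (congrArg (fderiv ℝ h (q.2.2, t)) this).trans (map_smul _ _ _))))

/-- The velocity of the homotopy, as a vector of the distribution. -/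
def homotopyVelocity (h : EuclideanSpace ℝ (Fin k) × ℝ → EuclideanSpace ℝ (Fin k))
    (q : X × PhaseSpace k) (t : ℝ) : (K.prod (standardBundle k 0)).D (homotopyMap h q t) :=
  ⟨((0 : TangentSpace I q.1), ((0 : EuclideanSpace ℝ (Fin k)), fderiv ℝ h (q.2.2, t) (0, 1))),
    Submodule.zero_mem _, rfl⟩

/-- The pull-back of a form by the homotopy at time `t`. -/
def homotopyPull (h : EuclideanSpace ℝ (Fin k) × ℝ → EuclideanSpace ℝ (Fin k))
    (β : (K.prod (standardBundle k 0)).Form n) (t : ℝ) : (K.prod (standardBundle k 0)).Form n :=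
  fun q => (β (homotopyMap h q t)).compLinearMap (homotopyTangent h q t)

/-- The contraction of the pull-back of a form by the homotopy with the time direction. -/
def homotopyContract (h : EuclideanSpace ℝ (Fin k) × ℝ → EuclideanSpace ℝ (Fin k))
    (β : (K.prod (standardBundle k 0)).Form (n + 1)) (t : ℝ) :
    (K.prod (standardBundle k 0)).Form n :=
  fun q => ((β (homotopyMap h q t)).curryLeft (homotopyVelocity h q t)).compLinearMap
    (homotopyTangent h q t)

/-- The map induced by the homotopy on the coordinates of vectors of the distribution and of the
time direction, in a patch. -/
def homotopyT (R : Type u) [NormedAddCommGroup R] [NormedSpace ℝ R]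
    (h : EuclideanSpace ℝ (Fin k) × ℝ → EuclideanSpace ℝ (Fin k))
    (w : (E × PhaseSpace k) × ℝ) :
    ((R × EuclideanSpace ℝ (Fin k)) × ℝ) →L[ℝ] R × EuclideanSpace ℝ (Fin k) :=
  (ContinuousLinearMap.fst ℝ R _ ∘L ContinuousLinearMap.fst ℝ _ ℝ).prod
    (fderiv ℝ h (w.1.2.2, w.2) ∘L
      ((ContinuousLinearMap.snd ℝ R _ ∘L ContinuousLinearMap.fst ℝ _ ℝ).prod
        (ContinuousLinearMap.snd ℝ _ ℝ)))

/-- The pull-back of a form by the homotopy, as a form on the product of a patch and the time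
line. -/
def homotopyLoc (P : Patch K R)
    (h : EuclideanSpace ℝ (Fin k) × ℝ → EuclideanSpace ℝ (Fin k))
    (β : (K.prod (standardBundle k 0)).Form n) (w : (E × PhaseSpace k) × ℝ) :
    ((R × EuclideanSpace ℝ (Fin k)) × ℝ) [⋀^Fin n]→L[ℝ] ℂ :=
  ((P.cyl 0).loc β (homotopyMap h w.1 w.2)).compContinuousLinearMap (homotopyT R h w)

lemma homotopyTangent_frame {p : X} (hp : p ∈ P.N) (z : PhaseSpace k) (t : ℝ)
    (r : R × EuclideanSpace ℝ (Fin k)) :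
    homotopyTangent h (p, z) t ((P.cyl 0).frame (p, z) r) =
      (P.cyl 0).frame (homotopyMap h (p, z) t) (r.1, fderiv ℝ h (z.2, t) (r.2, 0)) := by
  have h1 := congrArg Subtype.val
    (Patch.prodFst_cyl_frame (P := P) (θ := (0 : PhaseSpace k → PhaseSpace k →L[ℝ] ℝ))
      (q := (p, z)) hp r)
  have h2 := congrArg Subtype.val
    (Patch.prodSnd_cyl_frame (P := P) (θ := (0 : PhaseSpace k → PhaseSpace k →L[ℝ] ℝ))
      (q := (p, z)) hp r)
  have h3 := congrArg Subtype.val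
    (Patch.prodFst_cyl_frame (P := P) (θ := (0 : PhaseSpace k → PhaseSpace k →L[ℝ] ℝ))
      (q := homotopyMap h (p, z) t) hp (r.1, fderiv ℝ h (z.2, t) (r.2, 0)))
  have h4 := congrArg Subtype.val
    (Patch.prodSnd_cyl_frame (P := P) (θ := (0 : PhaseSpace k → PhaseSpace k →L[ℝ] ℝ))
      (q := homotopyMap h (p, z) t) hp (r.1, fderiv ℝ h (z.2, t) (r.2, 0)))
  have h2' := h2.trans (standardPatch_frame z r.2)
  have h4' := h4.trans (standardPatch_frame _ _)
  refine Subtype.ext (Prod.ext (h1.trans h3.symm) (Eq.trans ?_ h4'.symm))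
  have h5 : ((P.cyl 0).frame (p, z) r).1.2.2 = r.2 := congrArg Prod.snd h2'
  exact congrArg (fun s => ((0 : EuclideanSpace ℝ (Fin k)), fderiv ℝ h (z.2, t) (s, 0))) h5

lemma homotopyVelocity_eq {p : X} (hp : p ∈ P.N) (z : PhaseSpace k) (t : ℝ) :
    homotopyVelocity h (p, z) t =
      (P.cyl 0).frame (homotopyMap h (p, z) t) (0, fderiv ℝ h (z.2, t) (0, 1)) := by
  have h3 := congrArg Subtype.val
    (Patch.prodFst_cyl_frame (P := P) (θ := (0 : PhaseSpace k → PhaseSpace k →L[ℝ] ℝ))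
      (q := homotopyMap h (p, z) t) hp (0, fderiv ℝ h (z.2, t) (0, 1)))
  have h4 := congrArg Subtype.val
    (Patch.prodSnd_cyl_frame (P := P) (θ := (0 : PhaseSpace k → PhaseSpace k →L[ℝ] ℝ))
      (q := homotopyMap h (p, z) t) hp (0, fderiv ℝ h (z.2, t) (0, 1)))
  have h4' := h4.trans (standardPatch_frame _ _)
  rw [map_zero] at h3
  exact Subtype.ext (Prod.ext h3.symm h4'.symm)

lemma loc_homotopyPull (β : (K.prod (standardBundle k 0)).Form n) {w : E × PhaseSpace k}
    (hw : w.1 ∈ P.img univ) (t : ℝ) (r : Fin n → R × EuclideanSpace ℝ (Fin k)) :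
    (P.cyl 0).loc (homotopyPull h β t) w r = homotopyLoc P h β (w, t) fun j => (r j, 0) := by
  obtain ⟨u, z⟩ := w
  obtain ⟨p, hp, rfl⟩ : ∃ p ∈ P.N, extChartAt I P.pt p = u :=
    ⟨P.inv u, hw.2.1, Patch.chart_inv hw⟩
  rw [Patch.loc_cyl_apply _ hp]
  refine Eq.trans ?_ (Patch.loc_cyl_apply (P := P) β hp (z.1, h (z.2, t)) fun j =>
    ((r j).1, fderiv ℝ h (z.2, t) ((r j).2, 0))).symm
  refine congrArg (P.factor p * ·) ?_
  exact congrArg (β (homotopyMap h (p, z) t)) (funext fun j => homotopyTangent_frame hp z t (r j))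

lemma loc_homotopyContract (β : (K.prod (standardBundle k 0)).Form (n + 1)) {w : E × PhaseSpace k}
    (hw : w.1 ∈ P.img univ) (t : ℝ) (r : Fin n → R × EuclideanSpace ℝ (Fin k)) :
    (P.cyl 0).loc (homotopyContract h β t) w r =
      homotopyLoc P h β (w, t) (Fin.cons (0, 1) fun j => (r j, 0)) := by
  obtain ⟨u, z⟩ := w
  obtain ⟨p, hp, rfl⟩ : ∃ p ∈ P.N, extChartAt I P.pt p = u :=
    ⟨P.inv u, hw.2.1, Patch.chart_inv hw⟩
  rw [Patch.loc_cyl_apply _ hp]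
  have e : (fun j => homotopyT R h ((extChartAt I P.pt p, z), t)
      ((Fin.cons (0, 1) fun j => (r j, 0) : Fin (n + 1) → (R × EuclideanSpace ℝ (Fin k)) × ℝ) j)) =
      (Fin.cons (0, fderiv ℝ h (z.2, t) (0, 1))
        fun j => ((r j).1, fderiv ℝ h (z.2, t) ((r j).2, 0))) := by
    funext j
    refine Fin.cases rfl (fun j => rfl) j
  refine Eq.trans ?_ (congrArg ((P.cyl 0).loc β (extChartAt I P.pt p, (z.1, h (z.2, t)))) e.symm)
  rw [Patch.loc_cyl_apply _ hp]
  refine congrArg (P.factor p * ·) ?_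
  refine congrArg (β (homotopyMap h (p, z) t)) (funext fun j => ?_)
  refine Fin.cases ?_ (fun j => ?_) j
  · exact homotopyVelocity_eq hp z t
  · exact homotopyTangent_frame hp z t (r j)

section Smooth

variable {O : Set (EuclideanSpace ℝ (Fin k))} {W W' : Set (EuclideanSpace ℝ (Fin k))}
  {β : (K.prod (standardBundle k 0)).Form n}

lemma contDiff_homotopyT (hh : ContDiff ℝ ∞ h) :
    ContDiff ℝ ∞ (homotopyT R h : (E × PhaseSpace k) × ℝ → _) := by
  have h1 : ContDiff ℝ ∞ fun w : (E × PhaseSpace k) × ℝ => fderiv ℝ h (w.1.2.2, w.2) :=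
    (hh.fderiv_right (m := ∞) (by simp)).comp
      ((contDiff_snd.comp (contDiff_snd.comp contDiff_fst)).prodMk contDiff_snd)
  have e : (homotopyT R h : (E × PhaseSpace k) × ℝ → _) = fun w =>
      ContinuousLinearMap.inl ℝ R _ ∘L
        (ContinuousLinearMap.fst ℝ R (EuclideanSpace ℝ (Fin k)) ∘L
          ContinuousLinearMap.fst ℝ _ ℝ) +
      ContinuousLinearMap.inr ℝ R _ ∘L (fderiv ℝ h (w.1.2.2, w.2) ∘L
        ((ContinuousLinearMap.snd ℝ R _ ∘L ContinuousLinearMap.fst ℝ _ ℝ).prod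
          (ContinuousLinearMap.snd ℝ _ ℝ))) := by
    funext w
    refine ContinuousLinearMap.ext fun v => Prod.ext ?_ ?_
    · exact (add_zero _).symm
    · exact (zero_add _).symm
  rw [e]
  exact contDiff_const.add (contDiff_const.clm_comp (h1.clm_comp contDiff_const))

lemma mapsTo_homotopyMap (hW' : ∀ y ∈ W', ∀ t, h (y, t) ∈ W) {w : (E × PhaseSpace k) × ℝ}
    (hw : w ∈ (P.cyl (0 : PhaseSpace k → PhaseSpace k →L[ℝ] ℝ)).img (univ ×ˢ (O ×ˢ W')) ×ˢ
      (univ : Set ℝ)) :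
    homotopyMap h w.1 w.2 ∈ (P.cyl (0 : PhaseSpace k → PhaseSpace k →L[ℝ] ℝ)).img
      (univ ×ˢ (O ×ˢ W)) := by
  have h1 := Patch.mem_cyl_img.1 hw.1
  exact Patch.mem_cyl_img.2 ⟨h1.1, mem_univ _, h1.2.2.1, hW' _ h1.2.2.2 _⟩

lemma contDiff_homotopyMap (hh : ContDiff ℝ ∞ h) :
    ContDiff ℝ ∞ fun w : (E × PhaseSpace k) × ℝ => homotopyMap h w.1 w.2 :=
  (contDiff_fst.comp contDiff_fst).prodMk
    ((contDiff_fst.comp (contDiff_snd.comp contDiff_fst)).prodMk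
      (hh.comp ((contDiff_snd.comp (contDiff_snd.comp contDiff_fst)).prodMk contDiff_snd)))

lemma contDiffOn_homotopyLoc (hh : ContDiff ℝ ∞ h) (hO : IsOpen O) (hW : IsOpen W)
    (hW' : ∀ y ∈ W', ∀ t, h (y, t) ∈ W) (hβ : β.SmoothOn (univ ×ˢ (O ×ˢ W))) :
    ContDiffOn ℝ ∞ (homotopyLoc P h β)
      ((P.cyl (0 : PhaseSpace k → PhaseSpace k →L[ℝ] ℝ)).img (univ ×ˢ (O ×ˢ W')) ×ˢ univ) :=
  contDiffOn_alt_comp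
    ((PullData.contDiffOn_loc (P := P.cyl 0) (isOpen_univ.prod (hO.prod hW)) hβ).comp
      (contDiff_homotopyMap hh).contDiffOn fun _ hw => mapsTo_homotopyMap hW' hw)
    (contDiff_homotopyT hh).contDiffOn

lemma hasFDerivAt_homotopyMap (hh : ContDiff ℝ ∞ h) (w v : (E × PhaseSpace k) × ℝ) :
    fderiv ℝ (fun w : (E × PhaseSpace k) × ℝ => homotopyMap h w.1 w.2) w v =
      (v.1.1, (v.1.2.1, fderiv ℝ h (w.1.2.2, w.2) (v.1.2.2, v.2))) := by
  have h1 : HasFDerivAt h (fderiv ℝ h (w.1.2.2, w.2)) (w.1.2.2, w.2) :=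
    (hh.differentiable (by simp) _).hasFDerivAt
  have h2 : HasFDerivAt (fun w : (E × PhaseSpace k) × ℝ => (w.1.2.2, w.2)) _ w :=
    (((ContinuousLinearMap.snd ℝ _ _ ∘L ContinuousLinearMap.snd ℝ E (PhaseSpace k)) ∘L
      ContinuousLinearMap.fst ℝ _ ℝ).prod (ContinuousLinearMap.snd ℝ _ ℝ)).hasFDerivAt
  have h3 := h1.comp w h2
  have h4 : HasFDerivAt (fun w : (E × PhaseSpace k) × ℝ => w.1.1) _ w :=
    (ContinuousLinearMap.fst ℝ E (PhaseSpace k) ∘L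
      ContinuousLinearMap.fst ℝ _ ℝ).hasFDerivAt
  have h5 : HasFDerivAt (fun w : (E × PhaseSpace k) × ℝ => w.1.2.1) _ w :=
    ((ContinuousLinearMap.fst ℝ _ _ ∘L ContinuousLinearMap.snd ℝ E (PhaseSpace k)) ∘L
      ContinuousLinearMap.fst ℝ _ ℝ).hasFDerivAt
  exact DFunLike.congr_fun (h4.prodMk (h5.prodMk h3)).fderiv v

variable {β' : (K.prod (standardBundle k 0)).Form (n + 1)}

/-- The pull-back of a closed form by the homotopy is closed on the product with the time line. -/
lemma localD_homotopyLoc (hKP : (K.prod (standardBundle k 0)).IsRegular) (hh : ContDiff ℝ ∞ h)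
    (hO : IsOpen O) (hW : IsOpen W) (hW' : ∀ y ∈ W', ∀ t, h (y, t) ∈ W)
    (hβ : β.SmoothOn (univ ×ˢ (O ×ˢ W))) (hd : β.HasDiffOn 0 (univ ×ˢ (O ×ˢ W)))
    {w : (E × PhaseSpace k) × ℝ}
    (hw : w ∈ (P.cyl (0 : PhaseSpace k → PhaseSpace k →L[ℝ] ℝ)).img (univ ×ˢ (O ×ˢ W')) ×ˢ
      (univ : Set ℝ)) :
    localD (fun w => ((P.cyl 0).lift w.1).prodMap (ContinuousLinearMap.id ℝ ℝ))
      (fun w => (P.cyl 0).conn w.1 ∘L ContinuousLinearMap.fst ℝ _ ℝ) (homotopyLoc P h β) w = 0 := by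
  have hm := mapsTo_homotopyMap (P := P) hW' hw
  have hop : IsOpen (univ ×ˢ (O ×ˢ W) : Set (X × PhaseSpace k)) :=
    isOpen_univ.prod (hO.prod hW)
  have hdl := PullData.d_loc (P := P.cyl 0) hKP hop hβ hd hm
  rw [Patch.loc_zero] at hdl
  have hw1 := (Patch.mem_cyl_img.1 hw.1).1
  -- The homotopy is a map of foliated bundles from the product with the time line, whose leaves
  -- contain the time direction.
  have key := localD_pullback (Λ := (P.cyl 0).Λ.prodMap (ContinuousLinearMap.id ℝ ℝ))
    (lift := fun w : (E × PhaseSpace k) × ℝ =>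
      ((P.cyl 0).lift w.1).prodMap (ContinuousLinearMap.id ℝ ℝ))
    (A := fun w => (P.cyl 0).conn w.1 ∘L ContinuousLinearMap.fst ℝ _ ℝ)
    (Λ₂ := (P.cyl 0).Λ) (lift₂ := (P.cyl 0).lift) (A₂ := (P.cyl 0).conn)
    (f := fun w => homotopyMap h w.1 w.2) (T := homotopyT R h) (m := fun _ => 1)
    (a := (P.cyl 0).loc β) (u := w)
    (((PullData.contDiffOn_loc (P := P.cyl 0) hop hβ).contDiffAt
      ((Patch.isOpen_img hop).mem_nhds hm)).differentiableAt (by simp))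
    (contDiff_homotopyMap hh).contDiffAt
    ((contDiff_homotopyT hh).differentiable (by simp) _) (differentiableAt_const _)
    (fun r => Prod.ext (Patch.Λ_lift' hw.1 r.1) rfl) (Patch.Λ_lift' hm)
    (Filter.Eventually.of_forall fun w v => by rw [hasFDerivAt_homotopyMap hh]; rfl)
    (fun r => by rw [hasFDerivAt_homotopyMap hh]; rfl)
    (fun r => by
      have e1 := Patch.cyl_conn (P := P) (θ := (0 : PhaseSpace k → PhaseSpace k →L[ℝ] ℝ))
        hw1 r.1
      have e2 := Patch.cyl_conn (P := P) (θ := (0 : PhaseSpace k → PhaseSpace k →L[ℝ] ℝ))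
        (w := homotopyMap h w.1 w.2) hw1 (homotopyT R h w r)
      rw [fderiv_const_apply, e2]
      change 0 + (P.cyl 0).conn w.1 r.1 * 1 = _
      rw [e1]
      simp only [Pi.zero_apply, zero_apply, Complex.ofReal_zero, mul_zero, sub_zero, zero_add,
        mul_one, one_mul]
      rfl)
  have e3 : localD (P.cyl 0).lift (P.cyl 0).conn ((P.cyl 0).loc β) (homotopyMap h w.1 w.2) = 0 :=
    hdl
  rw [e3] at key
  simp only [one_smul] at key
  refine Eq.trans key ?_
  ext r
  rfl

end Smooth
end FiberHomotopy

/-! ### The homotopy formula -/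

section FiberHomotopyFormula

set_option linter.unusedSectionVars false

open MeasureTheory

universe u

variable {E : Type u} [NormedAddCommGroup E] [NormedSpace ℝ E] [FiniteDimensional ℝ E]
  {H : Type*} [TopologicalSpace H] {I : ModelWithCorners ℝ E H} [I.Boundaryless]
  {X : Type*} [TopologicalSpace X] [ChartedSpace H X] [IsManifold I ∞ X]
  {ι : Type*} {K : FoliatedBundle I X ι} {k : ℕ}
  {R : Type u} [NormedAddCommGroup R] [NormedSpace ℝ R] [FiniteDimensional ℝ R]
  {P : Patch K R} {n : ℕ}
  {h : EuclideanSpace ℝ (Fin k) × ℝ → EuclideanSpace ℝ (Fin k)}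
  {O W W' : Set (EuclideanSpace ℝ (Fin k))} {y₀ : EuclideanSpace ℝ (Fin k)}
  {β : (K.prod (standardBundle k 0)).Form (n + 1)}

lemma contDiffOn_loc_homotopyContract (hh : ContDiff ℝ ∞ h) (hO : IsOpen O) (hW : IsOpen W)
    (hW' : ∀ y ∈ W', ∀ t, h (y, t) ∈ W) (hβ : β.SmoothOn (univ ×ˢ (O ×ˢ W))) :
    ContDiffOn ℝ ∞
      (fun w : (E × PhaseSpace k) × ℝ => (P.cyl 0).loc (homotopyContract h β w.2) w.1)
      ((P.cyl (0 : PhaseSpace k → PhaseSpace k →L[ℝ] ℝ)).img (univ ×ˢ (O ×ˢ W')) ×ˢ univ) := by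
  refine contDiffOn_alt fun r => ?_
  refine ContDiffOn.congr (contDiffOn_alt_apply
    (g := fun j _ => (Fin.cons (0, 1) fun j => (r j, 0) :
      Fin (n + 1) → (R × EuclideanSpace ℝ (Fin k)) × ℝ) j)
    (contDiffOn_homotopyLoc (P := P) hh hO hW hW' hβ)
    fun j => contDiffOn_const) fun w hw => ?_
  exact loc_homotopyContract β (Patch.mem_cyl_img.1 hw.1).1 w.2 r

lemma hasFDerivAt_comp_prodMk_left {A B C : Type*} [NormedAddCommGroup A] [NormedSpace ℝ A]
    [NormedAddCommGroup B] [NormedSpace ℝ B] [NormedAddCommGroup C] [NormedSpace ℝ C]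
    {f : A × B → C} {f' : A × B →L[ℝ] C} {a : A} {b : B} (hf : HasFDerivAt f f' (a, b)) :
    HasFDerivAt (fun a => f (a, b)) (f' ∘L ContinuousLinearMap.inl ℝ A B) a :=
  HasFDerivAt.comp (f := fun a => (a, b)) a hf (hasFDerivAt_prodMk_left a b)

lemma hasDerivAt_comp_prodMk_right {A C : Type*} [NormedAddCommGroup A] [NormedSpace ℝ A]
    [NormedAddCommGroup C] [NormedSpace ℝ C]
    {f : A × ℝ → C} {f' : A × ℝ →L[ℝ] C} {a : A} {t : ℝ} (hf : HasFDerivAt f f' (a, t)) :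
    HasDerivAt (fun t => f (a, t)) (f' (0, 1)) t :=
  hf.comp_hasDerivAt t ((hasDerivAt_const t a).prodMk (hasDerivAt_id t))

/-- The coefficient along `dt` of the equation saying that a form on a product with the time line
is closed. -/
lemma fderiv_time_eq_localD {A B : Type*} [NormedAddCommGroup A] [NormedSpace ℝ A]
    [NormedAddCommGroup B] [NormedSpace ℝ B] [FiniteDimensional ℝ B]
    {lift : A → B →L[ℝ] A} {conn : A → B →L[ℝ] ℂ}
    {c : A × ℝ → (B × ℝ) [⋀^Fin (n + 1)]→L[ℝ] ℂ} {b : A → B [⋀^Fin n]→L[ℝ] ℂ} {w : A} {t : ℝ}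
    (hc : DifferentiableAt ℝ c (w, t)) (hb : DifferentiableAt ℝ b w)
    (hbc : ∀ᶠ w in nhds w, ∀ s, b w s = c (w, t) (Fin.cons (0, 1) fun j => (s j, 0)))
    (hd : localD (fun w => (lift w.1).prodMap (ContinuousLinearMap.id ℝ ℝ))
      (fun w => conn w.1 ∘L ContinuousLinearMap.fst ℝ B ℝ) c (w, t) = 0)
    (r : Fin (n + 1) → B) :
    fderiv ℝ c (w, t) (0, 1) (fun j => (r j, 0)) = localD lift conn b w r := by
  let s : Fin (n + 1) → B × ℝ := fun j => (r j, 0)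
  let e : B × ℝ := (0, 1)
  have key : localD (fun w => (lift w.1).prodMap (ContinuousLinearMap.id ℝ ℝ))
      (fun w => conn w.1 ∘L ContinuousLinearMap.fst ℝ B ℝ) c (w, t) (Fin.cons e s) = 0 := by
    rw [hd]
    rfl
  rw [localD_apply, Fin.sum_univ_succ] at key
  have hrem (j : Fin (n + 1)) : j.succ.removeNth (Fin.cons e s : Fin (n + 2) → _) =
      Fin.cons e (j.removeNth s) := by
    funext l
    refine Fin.cases ?_ (fun l => ?_) l
    · simp [Fin.removeNth]
    · simp [Fin.removeNth]
  have hrem0 : (0 : Fin (n + 2)).removeNth (Fin.cons e s : Fin (n + 2) → _) = s := by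
    funext l
    simp [Fin.removeNth]
  have hr (j : Fin (n + 1)) : fderiv ℝ b w (lift w (r j)) (j.removeNth r) =
      fderiv ℝ c (w, t) (lift w (r j), 0) (Fin.cons e (j.removeNth s)) := by
    have h1 := (ContinuousAlternatingMap.apply ℝ B ℂ (j.removeNth r)).hasFDerivAt.comp w
      hb.hasFDerivAt
    have h2 := (ContinuousAlternatingMap.apply ℝ (B × ℝ) ℂ
      (Fin.cons e (j.removeNth s))).hasFDerivAt.comp w
        (hasFDerivAt_comp_prodMk_left hc.hasFDerivAt)
    have h3 : (fun w => b w (j.removeNth r)) =ᶠ[nhds w]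
        fun w => c (w, t) (Fin.cons e (j.removeNth s)) := by
      filter_upwards [hbc] with w' hw'
      exact hw' (j.removeNth r)
    exact DFunLike.congr_fun (h1.unique (h2.congr_of_eventuallyEq h3)) (lift w (r j))
  have hv (j : Fin (n + 1)) : b w (j.removeNth r) =
      c (w, t) (Fin.cons e (j.removeNth s)) := hbc.self_of_nhds _
  rw [localD_apply]
  simp only [hrem, hrem0, Fin.cons_zero, Fin.cons_succ, Fin.val_zero, pow_zero, one_mul,
    Fin.val_succ, pow_succ, mul_neg, mul_one, neg_mul, Finset.sum_neg_distrib] at key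
  simp only [hr, hv]
  have k0 : ((lift w).prodMap (ContinuousLinearMap.id ℝ ℝ)) e = (0, 1) :=
    Prod.ext (map_zero (lift w)) rfl
  have k1 : (conn w ∘L ContinuousLinearMap.fst ℝ B ℝ) e = 0 := map_zero (conn w)
  have k2 (j : Fin (n + 1)) :
      ((lift w).prodMap (ContinuousLinearMap.id ℝ ℝ)) (s j) = (lift w (r j), 0) := rfl
  have k3 (j : Fin (n + 1)) : (conn w ∘L ContinuousLinearMap.fst ℝ B ℝ) (s j) = conn w (r j) := rfl
  simp only [k0, k1, k2, k3, zero_mul, add_zero, ← sub_eq_add_neg] at key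
  exact sub_eq_zero.1 key

/-- Cartan's formula: the derivative in time of the pull-back of a closed form by the homotopy is
the differential of its contraction with the time direction. -/
lemma hasDerivAt_loc_homotopyPull (hKP : (K.prod (standardBundle k 0)).IsRegular)
    (hh : ContDiff ℝ ∞ h) (hO : IsOpen O) (hW : IsOpen W) (hWo : IsOpen W')
    (hW' : ∀ y ∈ W', ∀ t, h (y, t) ∈ W)
    (hβ : β.SmoothOn (univ ×ˢ (O ×ˢ W))) (hd : β.HasDiffOn 0 (univ ×ˢ (O ×ˢ W)))
    {w : E × PhaseSpace k}
    (hw : w ∈ (P.cyl (0 : PhaseSpace k → PhaseSpace k →L[ℝ] ℝ)).img (univ ×ˢ (O ×ˢ W')))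
    (t : ℝ) (r : Fin (n + 1) → R × EuclideanSpace ℝ (Fin k)) :
    HasDerivAt (fun t => (P.cyl 0).loc (homotopyPull h β t) w r)
      ((P.cyl 0).d ((P.cyl 0).loc (homotopyContract h β t)) w r) t := by
  have himg := Patch.isOpen_img (P := P.cyl (0 : PhaseSpace k → PhaseSpace k →L[ℝ] ℝ))
    (isOpen_univ.prod (hO.prod hWo) : IsOpen (univ ×ˢ (O ×ˢ W') : Set (X × PhaseSpace k)))
  have hw1 := (Patch.mem_cyl_img.1 hw).1
  have hdiff : DifferentiableAt ℝ (homotopyLoc P h β) (w, t) :=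
    ((contDiffOn_homotopyLoc (P := P) hh hO hW hW' hβ).contDiffAt
      ((himg.prod isOpen_univ).mem_nhds ⟨hw, mem_univ t⟩)).differentiableAt (by simp)
  have hcd : DifferentiableAt ℝ ((P.cyl 0).loc (homotopyContract h β t)) w :=
    (hasFDerivAt_comp_prodMk_left (((contDiffOn_loc_homotopyContract (P := P) hh hO hW hW'
      hβ).contDiffAt ((himg.prod isOpen_univ).mem_nhds ⟨hw, mem_univ t⟩)).differentiableAt
        (by simp)).hasFDerivAt).differentiableAt
  have key := fderiv_time_eq_localD hdiff hcd (by
    filter_upwards [himg.mem_nhds hw] with w' hw' s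
    exact loc_homotopyContract β (Patch.mem_cyl_img.1 hw').1 t s)
    (localD_homotopyLoc (P := P) hKP hh hO hW hW' hβ hd (w := (w, t)) ⟨hw, mem_univ t⟩) r
  unfold Patch.d
  rw [← key]
  have h3 := (ContinuousAlternatingMap.apply ℝ ((R × EuclideanSpace ℝ (Fin k)) × ℝ) ℂ
    fun j => (r j, 0)).hasFDerivAt.comp_hasDerivAt t
      (hasDerivAt_comp_prodMk_right hdiff.hasFDerivAt)
  refine h3.congr_of_eventuallyEq (Filter.Eventually.of_forall fun t => ?_)
  exact loc_homotopyPull β hw1 t r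

/-- At time `0` the homotopy is the identity. -/
lemma loc_homotopyPull_zero (hh : ContDiff ℝ ∞ h) (h0 : ∀ y, h (y, 0) = y)
    (β : (K.prod (standardBundle k 0)).Form n) {w : E × PhaseSpace k} (hw : w.1 ∈ P.img univ) :
    (P.cyl 0).loc (homotopyPull h β 0) w = (P.cyl 0).loc β w := by
  ext r
  rw [loc_homotopyPull β hw]
  have hD (s : EuclideanSpace ℝ (Fin k)) : fderiv ℝ h (w.2.2, 0) (s, 0) = s := by
    have h1 := hasFDerivAt_comp_prodMk_left
      (hh.differentiable (by simp) (w.2.2, 0)).hasFDerivAt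
    have h2 : (fun y => h (y, (0 : ℝ))) = id := funext h0
    rw [h2] at h1
    exact DFunLike.congr_fun (h1.unique (hasFDerivAt_id _)) s
  have e1 : homotopyMap h w 0 = w := Prod.ext rfl (Prod.ext rfl (h0 _))
  change (P.cyl 0).loc β (homotopyMap h w 0) _ = _
  rw [e1]
  refine congrArg _ (funext fun j => Prod.ext rfl (hD _))

/-- At time `1` the homotopy is the retraction to the slice `y = y₀`. -/
lemma loc_homotopyPull_one (hh : ContDiff ℝ ∞ h) (h1 : ∀ y, h (y, 1) = y₀)
    (β : (K.prod (standardBundle k 0)).Form n) {w : E × PhaseSpace k} (hw : w.1 ∈ P.img univ) :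
    (P.cyl 0).loc (homotopyPull h β 1) w =
      (P.cyl 0).loc (famForm 0 fun x => sliceForm (x, y₀) β) w := by
  ext r
  rw [loc_homotopyPull β hw, Patch.loc_famForm _ hw, Patch.loc_sliceForm (θ := 0) (w.2.1, y₀) β hw]
  have hD (s : EuclideanSpace ℝ (Fin k)) : fderiv ℝ h (w.2.2, 1) (s, 0) = 0 := by
    have h2 := hasFDerivAt_comp_prodMk_left
      (hh.differentiable (by simp) (w.2.2, 1)).hasFDerivAt
    have h3 : (fun y => h (y, (1 : ℝ))) = fun _ => y₀ := funext h1
    rw [h3] at h2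
    exact DFunLike.congr_fun (h2.unique (hasFDerivAt_const _ _)) s
  change (P.cyl 0).loc β (homotopyMap h w 1) _ = _
  have e1 : homotopyMap h w 1 = (w.1, (w.2.1, y₀)) := Prod.ext rfl (Prod.ext rfl (h1 _))
  rw [e1]
  refine congrArg _ (funext fun j => Prod.ext rfl (hD _))

/-- The form `γ` is a primitive of the form `β` of degree `n` on `W`; in degree `0` this means that
`β` vanishes on `W`, and `γ` is irrelevant. -/
def FoliatedBundle.Form.IsPrimitiveOn : ∀ {n : ℕ}, K.Form (n - 1) → K.Form n → Set X → Prop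
  | 0, _, β, W => ∀ x ∈ W, β x = 0
  | _ + 1, γ, β, W => γ.SmoothOn W ∧ γ.HasDiffOn β W

/-- In degree `0`, a closed form is constant along the homotopy. -/
lemma loc_homotopyPull_eq_of_zero {β : (K.prod (standardBundle k 0)).Form 0}
    (hKP : (K.prod (standardBundle k 0)).IsRegular)
    (hh : ContDiff ℝ ∞ h) (hO : IsOpen O) (hW : IsOpen W) (hWo : IsOpen W')
    (hW' : ∀ y ∈ W', ∀ t, h (y, t) ∈ W)
    (hβ : β.SmoothOn (univ ×ˢ (O ×ˢ W))) (hd : β.HasDiffOn 0 (univ ×ˢ (O ×ˢ W)))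
    {w : E × PhaseSpace k}
    (hw : w ∈ (P.cyl (0 : PhaseSpace k → PhaseSpace k →L[ℝ] ℝ)).img (univ ×ˢ (O ×ˢ W'))) :
    (P.cyl 0).loc (homotopyPull h β 0) w = (P.cyl 0).loc (homotopyPull h β 1) w := by
  have hop : IsOpen (univ ×ˢ (O ×ˢ W') : Set (X × PhaseSpace k)) :=
    isOpen_univ.prod (hO.prod hWo)
  have himg := Patch.isOpen_img
    (P := P.cyl (0 : PhaseSpace k → PhaseSpace k →L[ℝ] ℝ)) hop
  have hw1 := (Patch.mem_cyl_img.1 hw).1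
  set c := homotopyLoc P h β with hc
  have hsm := contDiffOn_homotopyLoc (P := P) hh hO hW hW' hβ
  have hl (t : ℝ) : HasDerivAt (fun t => c (w, t) ![]) 0 t := by
    have hdiff : DifferentiableAt ℝ c (w, t) :=
      (hsm.contDiffAt ((himg.prod isOpen_univ).mem_nhds ⟨hw, mem_univ t⟩)).differentiableAt
        (by simp)
    have key := congrArg (fun a => a fun _ => ((0 : R × EuclideanSpace ℝ (Fin k)), (1 : ℝ)))
      (localD_homotopyLoc (P := P) hKP hh hO hW hW' hβ hd (w := (w, t)) ⟨hw, mem_univ t⟩)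
    simp only [localD_apply, Fin.sum_univ_succ, Finset.univ_eq_empty, Finset.sum_empty] at key
    have k0 : (((P.cyl 0).lift w).prodMap (ContinuousLinearMap.id ℝ ℝ)) (0, 1) = (0, 1) :=
      Prod.ext (map_zero ((P.cyl 0).lift w)) rfl
    have k1 : ((P.cyl 0).conn w ∘L ContinuousLinearMap.fst ℝ _ ℝ) (0, 1) = 0 :=
      map_zero ((P.cyl 0).conn w)
    rw [k0, k1] at key
    simp only [Fin.val_zero, pow_zero, one_mul, zero_mul, add_zero] at key
    have h3 := (ContinuousAlternatingMap.apply ℝ ((R × EuclideanSpace ℝ (Fin k)) × ℝ) ℂ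
      ![]).hasFDerivAt.comp_hasDerivAt t (hasDerivAt_comp_prodMk_right hdiff.hasFDerivAt)
    have h4 : (ContinuousAlternatingMap.apply ℝ ((R × EuclideanSpace ℝ (Fin k)) × ℝ) ℂ ![])
        (fderiv ℝ c (w, t) (0, 1)) = 0 :=
      (congrArg (fderiv ℝ c (w, t) (0, 1)) (Subsingleton.elim _ _)).trans key
    rw [h4] at h3
    exact h3
  have hconst := is_const_of_deriv_eq_zero (fun t => (hl t).differentiableAt)
    (fun t => (hl t).deriv) 0 1
  ext r
  rw [loc_homotopyPull β hw1, loc_homotopyPull β hw1]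
  exact (congrArg (c (w, 0)) (Subsingleton.elim _ _)).trans
    (Eq.trans hconst (congrArg (c (w, 1)) (Subsingleton.elim _ _)))

/-- A closed form on a product with a set that is contractible along the leaves of the phase space
differs by an exact form from the form that is constant along these leaves and agrees with it on
the slice `y = y₀`. -/
theorem exists_isPrimitiveOn_sub_famForm_sliceForm {β : (K.prod (standardBundle k 0)).Form n}
    (hKP : (K.prod (standardBundle k 0)).IsRegular) (h𝒰 : ∀ x, ∃ P : Patch K R, x ∈ P.N)
    (hh : ContDiff ℝ ∞ h) (h0 : ∀ y, h (y, 0) = y) (h1 : ∀ y, h (y, 1) = y₀)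
    (hO : IsOpen O) (hW : IsOpen W) (hWo : IsOpen W') (hW' : ∀ y ∈ W', ∀ t, h (y, t) ∈ W)
    (hβ : β.SmoothOn (univ ×ˢ (O ×ˢ W))) (hd : β.HasDiffOn 0 (univ ×ˢ (O ×ˢ W))) :
    ∃ γ : (K.prod (standardBundle k 0)).Form (n - 1),
      γ.IsPrimitiveOn (β - famForm 0 fun x => sliceForm (x, y₀) β) (univ ×ˢ (O ×ˢ W')) := by
  have hop : IsOpen (univ ×ˢ (O ×ˢ W') : Set (X × PhaseSpace k)) :=
    isOpen_univ.prod (hO.prod hWo)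
  cases n with
  | zero =>
    refine ⟨0, fun q hq => ?_⟩
    obtain ⟨P, hP⟩ := h𝒰 q.1
    have hmem : (extChartAt I P.pt q.1, q.2) ∈
        (P.cyl (0 : PhaseSpace k → PhaseSpace k →L[ℝ] ℝ)).img (univ ×ˢ (O ×ˢ W')) :=
      Patch.mem_cyl_img.2 ⟨Patch.chart_mem_img hP (mem_univ _), by
        rw [Patch.inv_chart hP]; exact hq⟩
    have hm1 := (Patch.mem_cyl_img.1 hmem).1
    have e := loc_homotopyPull_eq_of_zero (P := P) hKP hh hO hW hWo hW' hβ hd hmem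
    rw [loc_homotopyPull_zero hh h0 β hm1, loc_homotopyPull_one hh h1 β hm1,
      Patch.loc_eq_iff hmem, Patch.cyl_inv, Patch.inv_chart hP] at e
    exact sub_eq_zero.2 e
  | succ n =>
    -- The homotopy operator: the integral over time of the contraction.
    let γ := integralForm volume (Icc (0 : ℝ) 1) (homotopyContract h β)
    have hs : γ.SmoothOn (univ ×ˢ (O ×ˢ W')) := by
      refine smoothOn_integralForm (R := R × EuclideanSpace ℝ (Fin k)) isCompact_Icc hop
        fun q _ => ?_
      obtain ⟨P, hP⟩ := h𝒰 q.1
      exact ⟨P.cyl 0, ⟨hP, mem_univ _⟩, contDiffOn_loc_homotopyContract hh hO hW hW' hβ⟩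
    have hdiff : γ.HasDiffOn ((famForm 0 fun x => sliceForm (x, y₀) β) - β)
        (univ ×ˢ (O ×ˢ W')) := by
      refine FoliatedBundle.Form.hasDiffOn_of_atlas (R := R × EuclideanSpace ℝ (Fin k)) hKP hop hs
        fun q _ => ?_
      obtain ⟨P, hP⟩ := h𝒰 q.1
      refine ⟨P.cyl 0, ⟨hP, mem_univ _⟩, fun w hw => ?_⟩
      have hm1 := (Patch.mem_cyl_img.1 hw).1
      have hc := contDiffOn_loc_homotopyContract (P := P) hh hO hW hW' hβ
      ext r
      rw [d_loc_integralForm_apply isCompact_Icc hop hc hw]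
      have hder := fun t => hasDerivAt_loc_homotopyPull (P := P) hKP hh hO hW hWo hW' hβ hd hw t r
      have hcont : Continuous fun t => (P.cyl 0).d ((P.cyl 0).loc (homotopyContract h β t)) w r := by
        have himg := Patch.isOpen_img
          (P := P.cyl (0 : PhaseSpace k → PhaseSpace k →L[ℝ] ℝ)) hop
        have h2 : ContDiff ℝ ∞ fun t => (P.cyl 0).loc (homotopyPull h β t) w r := by
          have h3 : ContDiff ℝ ∞ fun t => homotopyLoc P h β (w, t) :=
            contDiffOn_univ.1 ((contDiffOn_homotopyLoc (P := P) hh hO hW hW' hβ).comp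
              (f := fun t => (w, t)) (contDiff_prodMk_right w).contDiffOn
              fun t _ => ⟨hw, mem_univ t⟩)
          have h4 := (ContinuousAlternatingMap.apply ℝ ((R × EuclideanSpace ℝ (Fin k)) × ℝ) ℂ
            fun j => (r j, 0)).contDiff.comp h3
          have h5 : (fun t => (P.cyl 0).loc (homotopyPull h β t) w r) =
              fun t => homotopyLoc P h β (w, t) fun j => (r j, 0) :=
            funext fun t => loc_homotopyPull β hm1 t r
          rw [h5]
          exact h4
        have h5 : deriv (fun t => (P.cyl 0).loc (homotopyPull h β t) w r) = _ :=
          funext fun t => (hder t).deriv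
        rw [← h5]
        exact h2.continuous_deriv (by simp)
      rw [integral_Icc_eq_integral_Ioc, ← intervalIntegral.integral_of_le zero_le_one,
        intervalIntegral.integral_eq_sub_of_hasDerivAt (fun t _ => hder t)
          (hcont.intervalIntegrable _ _), loc_homotopyPull_zero hh h0 β hm1,
        loc_homotopyPull_one hh h1 β hm1]
      have e1 : (famForm 0 fun x => sliceForm (x, y₀) β) - β =
          (famForm 0 fun x => sliceForm (x, y₀) β) + (-1 : ℂ) • β := by
        rw [neg_one_smul, sub_eq_add_neg]
      rw [e1, Patch.loc_add, Patch.loc_smul, sub_eq_add_neg, ← neg_one_mul]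
      rfl
    refine ⟨(-1 : ℂ) • γ, hs.smul _, ?_⟩
    have := hdiff.smul (-1) hs
    rwa [neg_one_smul ℂ (_ - _), neg_sub] at this

end FiberHomotopyFormula

section OpenMapping

/-! ### Linear maps between spaces with countably many seminorms -/

open Filter Topology Finset

/-- Completeness of a vector space with an increasing sequence of seminorms, in terms of series. -/
def SeriesComplete {G : Type*} [AddCommGroup G] [Module ℝ G] (p : ℕ → Seminorm ℝ G) : Prop :=
  ∀ g : ℕ → G, (∀ n, p n (g n) ≤ (1 / 2) ^ n) →
    ∃ s, ∀ j, Tendsto (fun N => p j (s - ∑ i ∈ range N, g i)) atTop (𝓝 0)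

variable {G Z : Type*} [AddCommGroup G] [Module ℝ G] [AddCommGroup Z] [Module ℝ Z]
  {p : ℕ → Seminorm ℝ G} {q : ℕ → Seminorm ℝ Z}

lemma sum_half_pow_le (m N : ℕ) : ∑ i ∈ range N, ((1 : ℝ) / 2) ^ (m + i) ≤ 2 * (1 / 2) ^ m := by
  have h : ∑ i ∈ range N, ((1 : ℝ) / 2) ^ (m + i) =
      (1 / 2) ^ m * (2 * (1 - (1 / 2) ^ N)) := by
    simp only [pow_add, ← Finset.mul_sum]
    rw [geom_sum_eq (by norm_num)]
    ring
  rw [h]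
  have h1 : (0 : ℝ) < (1 / 2) ^ m := by positivity
  have h2 : (0 : ℝ) < (1 / 2) ^ N := by positivity
  nlinarith

/-- The limit of a series is bounded by the sum of the bounds of the terms. -/
lemma seminorm_le_of_tendsto {q : Seminorm ℝ Z} {s : Z} {g : ℕ → Z} {C : ℝ}
    (hs : Tendsto (fun N => q (s - ∑ i ∈ range N, g i)) atTop (𝓝 0))
    (hC : ∀ N, ∑ i ∈ range N, q (g i) ≤ C) : q s ≤ C := by
  have h : Tendsto (fun N => q (s - ∑ i ∈ range N, g i) + C) atTop (𝓝 (0 + C)) :=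
    hs.add_const C
  rw [zero_add] at h
  refine ge_of_tendsto' h fun N => ?_
  calc q s = q ((s - ∑ i ∈ range N, g i) + ∑ i ∈ range N, g i) := by rw [sub_add_cancel]
    _ ≤ q (s - ∑ i ∈ range N, g i) + q (∑ i ∈ range N, g i) := map_add_le_add _ _ _
    _ ≤ _ := by
      gcongr
      exact (Finset.le_sum_of_subadditive q (map_zero q).le (map_add_le_add q) _ _).trans (hC N)

/-- Baire's theorem: a countable family of sets that covers the space contains a set that is dense
in some ball. -/
lemma exists_dense_in_ball (hq : Monotone q) (cq : SeriesComplete q) (A : ℕ → Set Z)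
    (hA : ∀ z, ∃ m, z ∈ A m) :
    ∃ m z₀ i, ∃ r > 0, ∀ z, q i (z - z₀) ≤ r → ∀ k, ∀ δ > 0, ∃ a ∈ A m, q k (z - a) < δ := by
  by_contra! H
  -- A ball is a centre, the index of a seminorm and a radius. Inside every ball there is a smaller one
  -- whose double is disjoint from `A m`; the centres of a nested sequence converge.
  have step (m : ℕ) (b : Z × ℕ × {r : ℝ // 0 < r}) : ∃ b' : Z × ℕ × {r : ℝ // 0 < r},
      q b.2.1 (b'.1 - b.1) ≤ b.2.2.1 ∧ b.2.1 ≤ b'.2.1 ∧ m < b'.2.1 ∧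
      b'.2.2.1 ≤ b.2.2.1 / 2 ∧
      b'.2.2.1 ≤ (1 / 2) ^ (m + 1) ∧ ∀ w, q b'.2.1 (w - b'.1) ≤ 2 * b'.2.2.1 → w ∉ A m := by
    obtain ⟨z, i, r, hr⟩ := b
    obtain ⟨z', hz', k, δ, hδ, h⟩ := H m z i r hr
    refine ⟨⟨z', max (max i k) (m + 1), min (min (r / 2) ((1 / 2) ^ (m + 1))) (δ / 3),
      by positivity⟩, hz', (le_max_left _ _).trans (le_max_left _ _),
      Nat.lt_of_succ_le (le_max_right _ _),
      (min_le_left _ _).trans (min_le_left _ _), (min_le_left _ _).trans (min_le_right _ _),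
      fun w hw hwA => ?_⟩
    have h1 := h w hwA
    have h2 : q k (w - z') ≤ q (max (max i k) (m + 1)) (w - z') :=
      hq ((le_max_right i k).trans (le_max_left _ _)) _
    have h3 : min (min (r / 2) ((1 / 2) ^ (m + 1))) (δ / 3) ≤ δ / 3 := min_le_right _ _
    rw [map_sub_rev] at h1
    dsimp only at hw
    linarith
  choose f hf using step
  let b : ℕ → Z × ℕ × {r : ℝ // 0 < r} := fun m =>
    Nat.rec (motive := fun _ => Z × ℕ × {r : ℝ // 0 < r}) (0, 0, ⟨1, one_pos⟩) f m
  have hb (m : ℕ) : b (m + 1) = f m (b m) := rfl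
  have hi (m : ℕ) : m ≤ (b m).2.1 := by
    cases m with
    | zero => exact Nat.zero_le _
    | succ m => rw [hb]; exact (hf m (b m)).2.2.1
  have hr (m : ℕ) : (b m).2.2.1 ≤ (1 / 2) ^ m := by
    cases m with
    | zero => exact le_of_eq (pow_zero _).symm
    | succ m => rw [hb]; exact (hf m (b m)).2.2.2.2.1
  have hmono : Monotone fun m => (b m).2.1 := monotone_nat_of_le_succ fun m => by
    rw [hb]; exact (hf m (b m)).2.1
  have hdec (m l : ℕ) : (b (m + l)).2.2.1 ≤ (b m).2.2.1 * (1 / 2) ^ l := by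
    induction l with
    | zero => simp
    | succ l ih =>
      have : (b (m + l + 1)).2.2.1 ≤ (b (m + l)).2.2.1 / 2 := by
        rw [hb]; exact (hf _ (b (m + l))).2.2.2.1
      rw [← add_assoc, pow_succ]
      linarith
  have hst (m : ℕ) : q (b m).2.1 ((b (m + 1)).1 - (b m).1) ≤ (b m).2.2.1 := by
    rw [hb]; exact (hf m (b m)).1
  obtain ⟨s, hs⟩ := cq (fun m => (b (m + 1)).1 - (b m).1) fun m =>
    (hq (hi m) _).trans ((hst m).trans (hr m))
  simp only [sum_range_sub (fun m => (b m).1)] at hs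
  have hlim (m : ℕ) : q (b m).2.1 (s + (b 0).1 - (b m).1) ≤ 2 * (b m).2.2.1 := by
    refine seminorm_le_of_tendsto (g := fun l => (b (m + l + 1)).1 - (b (m + l)).1) ?_ fun N => ?_
    · have h1 := (tendsto_add_atTop_iff_nat m).2 (hs (b m).2.1)
      refine h1.congr fun N => congrArg _ ?_
      have := sum_range_sub (fun l => (b (m + l)).1) N
      simp only [add_zero, ← add_assoc] at this
      rw [this, add_comm N m]
      abel
    · have h1 (l : ℕ) : q (b m).2.1 ((b (m + l + 1)).1 - (b (m + l)).1) ≤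
          (b m).2.2.1 * (1 / 2) ^ (0 + l) := by
        rw [zero_add]
        exact (hq (hmono (Nat.le_add_right m l)) _).trans ((hst _).trans (hdec m l))
      refine (sum_le_sum fun l _ => h1 l).trans ?_
      rw [← Finset.mul_sum]
      have := sum_half_pow_le 0 N
      have h0 := (b m).2.2.2
      nlinarith
  obtain ⟨m, hm⟩ := hA (s + (b 0).1)
  refine (hf m (b m)).2.2.2.2.2 _ ?_ hm
  have := hlim (m + 1)
  rwa [hb] at this

/-- The open mapping theorem for complete spaces with countably many seminorms. -/
theorem exists_lift_le_one (hp : Monotone p) (hq : Monotone q) (cp : SeriesComplete p)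
    (cq : SeriesComplete q) (T : G →ₗ[ℝ] Z) (hT : Function.Surjective T)
    (hTc : ∀ j g, q j (T g) ≤ p j g) (hsep : ∀ z, (∀ j, q j z = 0) → z = 0) (j : ℕ) :
    ∃ i, ∃ ε > 0, ∀ z, q i z ≤ ε → ∃ g, T g = z ∧ p j g ≤ 1 := by
  -- The closure of the image of a ball contains a ball, by Baire's theorem and homogeneity.
  have almost (j : ℕ) (η : ℝ) (hη : 0 < η) : ∃ i, ∃ ε > 0, ∀ z, q i z ≤ ε → ∀ k, ∀ δ > 0,
      ∃ g, p j g ≤ η ∧ q k (z - T g) < δ := by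
    obtain ⟨m, z₀, i, r, hr, h⟩ := exists_dense_in_ball hq cq
      (fun m => {z | ∃ g, T g = z ∧ p j g ≤ m}) (fun z => by
        obtain ⟨g, hg⟩ := hT z
        obtain ⟨m, hm⟩ := exists_nat_ge (p j g)
        exact ⟨m, g, hg, hm⟩)
    have hc : (0 : ℝ) < η / (2 * m + 1) := by positivity
    set c := η / (2 * m + 1) with hcd
    refine ⟨i, c * r, by positivity, fun z hz k δ hδ => ?_⟩
    have hz' : q i (z₀ + c⁻¹ • z - z₀) ≤ r := by
      rw [add_sub_cancel_left, map_smul_eq_mul, Real.norm_of_nonneg (by positivity)]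
      rw [inv_mul_le_iff₀ hc]
      exact hz
    have hδ' : 0 < c⁻¹ * δ / 2 := by positivity
    obtain ⟨_, ⟨g₁, rfl, hg₁⟩, h₁⟩ := h _ hz' k _ hδ'
    obtain ⟨_, ⟨g₂, rfl, hg₂⟩, h₂⟩ := h z₀ (by simp [hr.le]) k _ hδ'
    refine ⟨c • (g₁ - g₂), ?_, ?_⟩
    · rw [map_smul_eq_mul, Real.norm_of_nonneg hc.le]
      have h3 : p j (g₁ - g₂) ≤ 2 * m + 1 := by
        have := map_sub_le_add (p j) g₁ g₂
        linarith
      calc c * p j (g₁ - g₂) ≤ c * (2 * m + 1) := by gcongr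
        _ = η := by rw [hcd]; field_simp
    · have e : z - T (c • (g₁ - g₂)) = c • ((z₀ + c⁻¹ • z - T g₁) - (z₀ - T g₂)) := by
        rw [map_smul, map_sub]
        have : c • ((z₀ + c⁻¹ • z - T g₁) - (z₀ - T g₂)) =
            c • c⁻¹ • z - c • (T g₁ - T g₂) := by
          rw [← smul_sub]; congr 1; abel
        rw [this, smul_inv_smul₀ hc.ne']
      rw [e, map_smul_eq_mul, Real.norm_of_nonneg hc.le]
      have h3 := map_sub_le_add (q k) (z₀ + c⁻¹ • z - T g₁) (z₀ - T g₂)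
      calc _ < c * (c⁻¹ * δ) := by
            gcongr
            linarith
        _ = δ := mul_inv_cancel_left₀ hc.ne' δ
  choose i ε hε h using fun n : ℕ => almost (j + n) ((1 / 2) ^ (n + 1)) (by positivity)
  refine ⟨i 0, ε 0, hε 0, fun z hz => ?_⟩
  -- Successive approximation: the `n`-th remainder is small in the seminorm `q (i n)`, so that it can
  -- be approximated by the image of an element that is small in the seminorm `p (j + n)`.
  have step (n : ℕ) (x : {x : Z // q (i n) x ≤ ε n}) : ∃ g : G, p (j + n) g ≤ (1 / 2) ^ (n + 1) ∧
      q (i (n + 1)) (x.1 - T g) ≤ ε (n + 1) ∧ q n (x.1 - T g) ≤ (1 / 2) ^ n := by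
    obtain ⟨g, hg, hg'⟩ := h n x.1 x.2 (max (i (n + 1)) n) (min (ε (n + 1)) ((1 / 2) ^ n))
      (lt_min (hε _) (by positivity))
    exact ⟨g, hg, ((hq (le_max_left _ _) _).trans hg'.le).trans (min_le_left _ _),
      ((hq (le_max_right _ _) _).trans hg'.le).trans (min_le_right _ _)⟩
  choose f hf using step
  let x : ∀ n, {x : Z // q (i n) x ≤ ε n} := fun n =>
    Nat.rec (motive := fun n => {x : Z // q (i n) x ≤ ε n}) ⟨z, hz⟩
      (fun n x => ⟨x.1 - T (f n x), (hf n x).2.1⟩) n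
  have hx (n : ℕ) : (x (n + 1)).1 = (x n).1 - T (f n (x n)) := rfl
  have hsum (N : ℕ) : (x N).1 = z - T (∑ n ∈ range N, f n (x n)) := by
    induction N with
    | zero => simp [x]
    | succ N ih => rw [hx, ih, sum_range_succ, map_add, sub_sub]
  have hpf (n : ℕ) : p (j + n) (f n (x n)) ≤ (1 / 2) ^ (n + 1) := (hf n (x n)).1
  obtain ⟨g, hg⟩ := cp (fun n => f n (x n)) fun n =>
    (hp (Nat.le_add_left n j) _).trans ((hpf n).trans
      (pow_le_pow_of_le_one (by norm_num) (by norm_num) (Nat.le_succ n)))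
  refine ⟨g, ?_, ?_⟩
  · refine (sub_eq_zero.1 (hsep _ fun l => ?_)).symm
    have h1 : Tendsto (fun N => q l (x N).1 + p l (g - ∑ n ∈ range N, f n (x n))) atTop
        (𝓝 (0 + 0)) := by
      refine Tendsto.add ?_ (hg l)
      refine squeeze_zero' (Eventually.of_forall fun N => apply_nonneg _ _) ?_
        ((tendsto_pow_atTop_nhds_zero_of_lt_one (r := (1 : ℝ) / 2) (by norm_num)
          (by norm_num)).comp (tendsto_sub_atTop_nat 1))
      filter_upwards [eventually_ge_atTop (l + 1)] with N hN
      obtain ⟨M, rfl⟩ : ∃ M, N = M + 1 := ⟨N - 1, by omega⟩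
      exact (hq (by omega : l ≤ M) _).trans (hf M (x M)).2.2
    rw [add_zero] at h1
    refine le_antisymm (ge_of_tendsto' h1 fun N => ?_) (apply_nonneg _ _)
    have e : z - T g = (x N).1 - T (g - ∑ n ∈ range N, f n (x n)) := by
      rw [hsum, map_sub]; abel
    rw [e]
    exact (map_sub_le_add _ _ _).trans (add_le_add_right (hTc _ _) _)
  · refine seminorm_le_of_tendsto (hg j) fun N => ?_
    refine (sum_le_sum (g := fun n => (1 / 2) ^ (n + 1)) fun n _ =>
      (hp (Nat.le_add_right j n) (f n (x n))).trans (hpf n)).trans ?_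
    have := sum_half_pow_le 1 N
    simp only [add_comm 1] at this
    linarith

/-- Rapidly decreasing families can be lifted to rapidly decreasing families. -/
theorem exists_rapidly_decreasing_lift (hp : Monotone p) (hq : Monotone q) (cp : SeriesComplete p)
    (cq : SeriesComplete q) (T : G →ₗ[ℝ] Z) (hT : Function.Surjective T)
    (hTc : ∀ j g, q j (T g) ≤ p j g) (hsep : ∀ z, (∀ j, q j z = 0) → z = 0)
    {Λ : Type*} {w : Λ → ℝ} (hw1 : ∀ l, 1 ≤ w l) (hw : Tendsto w cofinite atTop) {z : Λ → Z}
    (hz : ∀ j s : ℕ, ∃ C, ∀ l, w l ^ s * q j (z l) ≤ C) :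
    ∃ g : Λ → G, (∀ l, T (g l) = z l) ∧ ∀ j : ℕ, ∀ᶠ l in cofinite, w l ^ j * p j (g l) ≤ 1 := by
  classical
  choose i ε hε h using exists_lift_le_one hp hq cp cq T hT hTc hsep
  let good (l : Λ) (j : ℕ) : Prop := w l ^ j * q (i j) (z l) ≤ ε j
  have hgood (j : ℕ) : ∀ᶠ l in cofinite, good l j := by
    obtain ⟨C, hC⟩ := hz (i j) (j + 1)
    filter_upwards [hw.eventually_ge_atTop (C / ε j)] with l hl
    have h1 := hC l
    have h2 : 0 < w l := lt_of_lt_of_le one_pos (hw1 l)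
    rw [div_le_iff₀ (hε j)] at hl
    change w l ^ j * q (i j) (z l) ≤ ε j
    rw [pow_succ, mul_right_comm, mul_comm _ (w l)] at h1
    exact le_of_mul_le_mul_left (h1.trans hl) h2
  -- The level up to which the lift of `z l` is controlled.
  let J (l : Λ) : ℕ := Nat.findGreatest (good l) ⌊w l⌋₊
  have lift (l : Λ) : ∃ g, T g = z l ∧ (good l (J l) → w l ^ J l * p (J l) g ≤ 1) := by
    by_cases hg : good l (J l)
    · have hpos : 0 < w l ^ J l := pow_pos (lt_of_lt_of_le one_pos (hw1 l)) _
      obtain ⟨g, hg1, hg2⟩ := h (J l) (w l ^ J l • z l) (by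
        rw [map_smul_eq_mul, Real.norm_of_nonneg hpos.le]; exact hg)
      refine ⟨(w l ^ J l)⁻¹ • g, by rw [map_smul, hg1, inv_smul_smul₀ hpos.ne'], fun _ => ?_⟩
      rw [map_smul_eq_mul, Real.norm_of_nonneg (by positivity), mul_inv_cancel_left₀ hpos.ne']
      exact hg2
    · obtain ⟨g, hg'⟩ := hT (z l)
      exact ⟨g, hg', fun h => (hg h).elim⟩
  choose g hg hg' using lift
  refine ⟨g, hg, fun j => ?_⟩
  filter_upwards [hgood j, hw.eventually_ge_atTop (j : ℝ)] with l hl hl'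
  have hj : j ≤ ⌊w l⌋₊ := Nat.le_floor hl'
  have hJ : j ≤ J l := Nat.le_findGreatest hj hl
  refine le_trans ?_ (hg' l (Nat.findGreatest_spec hj hl))
  exact mul_le_mul (pow_le_pow_right₀ (hw1 l) hJ) (hp hJ _) (apply_nonneg _ _)
    (by have := hw1 l; positivity)

end OpenMapping

section SmoothForms

set_option linter.unusedSectionVars false

universe u

variable {E : Type u} [NormedAddCommGroup E] [NormedSpace ℝ E] [FiniteDimensional ℝ E]
  {H : Type*} [TopologicalSpace H] {I : ModelWithCorners ℝ E H} [I.Boundaryless]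
  {X : Type*} [TopologicalSpace X] [ChartedSpace H X] [IsManifold I ∞ X]
  {ι : Type*} {K : FoliatedBundle I X ι}
  {R : Type u} [NormedAddCommGroup R] [NormedSpace ℝ R] [FiniteDimensional ℝ R]
  {n : ℕ}

/-! ### Seminorms on spaces of smooth forms -/

/-- The restriction of a patch to an open set. -/
def Patch.restrict (P : Patch K R) (N : Set X) (hN : IsOpen N) : Patch K R :=
  { P with
    N := P.N ∩ N
    isOpen_N := P.isOpen_N.inter hN
    N_chart := inter_subset_left.trans P.N_chart
    N_base := inter_subset_left.trans P.N_base
    contDiffOn_lift := P.contDiffOn_lift.mono fun _ hu => ⟨hu.1, hu.2.1⟩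
    Λ_lift := fun x hx => P.Λ_lift x hx.1
    mem_D := fun x hx => P.mem_D x hx.1 }

lemma Patch.frame_restrict {P : Patch K R} {N : Set X} {hN : IsOpen N} {x : X} (hx : x ∈ P.N ∩ N)
    (r : R) : (P.restrict N hN).frame x r = P.frame x r := by
  refine Subtype.ext ((dChart_bijective I (P.N_chart hx.1)).injective ?_)
  exact (Patch.dChart_frame (P := P.restrict N hN) hx r).trans (Patch.dChart_frame hx.1 r).symm

lemma Patch.restrict_img {P : Patch K R} {N : Set X} {hN : IsOpen N} :
    (P.restrict N hN).img univ = P.img N := by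
  ext u
  simp only [Patch.img, Patch.restrict, inter_univ]
  rfl

lemma Patch.loc_restrict {P : Patch K R} {N : Set X} {hN : IsOpen N} (α : K.Form n) {u : E}
    (hu : u ∈ P.img N) : (P.restrict N hN).loc α u = P.loc α u := by
  ext r
  rw [Patch.loc_apply, Patch.loc_apply]
  exact congrArg (P.factor (P.inv u) * ·) (congrArg (α (P.inv u))
    (funext fun j => Patch.frame_restrict (hN := hN) hu.2 (r j)))

variable (K R) in
/-- A patch with a smooth function `ρ` with compact support in the patch that is `1` on the open
set `V`. -/
structure BumpPatch where
  P : Patch K R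
  ρ : E → ℝ
  V : Set E
  contDiff_ρ : ContDiff ℝ ∞ ρ
  hasCompactSupport_ρ : HasCompactSupport ρ
  tsupport_ρ : tsupport ρ ⊆ P.img univ
  isOpen_V : IsOpen V
  ρ_eq_one : ∀ u ∈ V, ρ u = 1

namespace BumpPatch

lemma V_subset (B : BumpPatch K R) : B.V ⊆ B.P.img univ := fun u hu =>
  B.tsupport_ρ (subset_tsupport _ (by
    rw [Function.mem_support, B.ρ_eq_one u hu]; exact one_ne_zero))

lemma isOpen_core (B : BumpPatch K R) :
    IsOpen (B.P.N ∩ extChartAt I B.P.pt ⁻¹' B.V) :=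
  ((continuousOn_extChartAt (I := I) B.P.pt).mono (by
    rw [extChartAt_source]; exact B.P.N_chart)).isOpen_inter_preimage B.P.isOpen_N B.isOpen_V

/-- The restriction of the patch to the set where the bump function is `1`. -/
def core (B : BumpPatch K R) : Patch K R := B.P.restrict _ B.isOpen_core

lemma core_img_subset (B : BumpPatch K R) : B.core.img univ ⊆ B.V := by
  intro u hu
  rw [core, Patch.restrict_img] at hu
  have := hu.2.2.2
  rwa [mem_preimage, Patch.chart_inv hu] at this

lemma loc_core (B : BumpPatch K R) (α : K.Form n) {u : E} (hu : u ∈ B.core.img univ) :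
    B.core.loc α u = B.P.loc α u := by
  rw [core, Patch.restrict_img] at hu
  exact Patch.loc_restrict α hu

/-- Bump patches indexed by `σ` cover the manifold if the sets where their bump functions are `1`
do. -/
def Covers {σ : Type*} (B : σ → BumpPatch K R) : Prop :=
  ∀ x, ∃ i, x ∈ (B i).P.N ∧ extChartAt I (B i).P.pt x ∈ (B i).V

lemma exists_bumpPatch (P : Patch K R) {x : X} (hx : x ∈ P.N) :
    ∃ B : BumpPatch K R, x ∈ B.P.N ∧ extChartAt I B.P.pt x ∈ B.V := by
  have hmem := Patch.chart_mem_img (P := P) hx (mem_univ x)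
  obtain ⟨ε, hε, hball⟩ := Metric.nhds_basis_closedBall.mem_iff.1
    ((Patch.isOpen_img (P := P) isOpen_univ).mem_nhds hmem)
  let f : ContDiffBump (extChartAt I P.pt x) :=
    { rIn := ε / 2, rOut := ε, rIn_pos := half_pos hε, rIn_lt_rOut := half_lt_self hε }
  exact ⟨{ P := P, ρ := f, V := Metric.ball _ (ε / 2), contDiff_ρ := f.contDiff
           hasCompactSupport_ρ := f.hasCompactSupport
           tsupport_ρ := by rw [f.tsupport_eq]; exact hball
           isOpen_V := Metric.isOpen_ball
           ρ_eq_one := fun u hu => f.one_of_mem_closedBall (Metric.ball_subset_closedBall hu) },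
    hx, Metric.mem_ball_self (half_pos hε)⟩

/-- A compact manifold is covered by finitely many bump patches. -/
lemma exists_covers [CompactSpace X] (h𝒰 : ∀ x, ∃ P : Patch K R, x ∈ P.N) :
    ∃ (N : ℕ) (B : Fin N → BumpPatch K R), Covers B := by
  choose P hP using h𝒰
  choose B hB hBV using fun x => exists_bumpPatch (P x) (hP x)
  obtain ⟨t, ht⟩ := isCompact_univ.elim_finite_subcover _ (fun x => (B x).isOpen_core)
    fun x _ => mem_iUnion.2 ⟨x, hB x, hBV x⟩
  refine ⟨t.card, fun i => B (t.equivFin.symm i), fun x => ?_⟩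
  obtain ⟨y, hy⟩ := mem_iUnion.1 (ht (mem_univ x))
  obtain ⟨hyt, hy⟩ := mem_iUnion.1 hy
  refine ⟨t.equivFin ⟨y, hyt⟩, ?_⟩
  dsimp only
  rw [Equiv.symm_apply_apply]
  exact hy

end BumpPatch

variable (K n) in
/-- The space of smooth forms. -/
def smoothForms : Submodule ℝ (K.Form n) where
  carrier := {α | α.SmoothOn univ}
  add_mem' := FoliatedBundle.Form.SmoothOn.add
  zero_mem' := FoliatedBundle.Form.smoothOn_zero _
  smul_mem' c _ h := h.smul (c : ℂ)

namespace BumpPatch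

/-- The local expression of a form in a patch, cut off by the bump function. -/
def cutLoc (B : BumpPatch K R) (α : K.Form n) (u : E) : R [⋀^Fin n]→L[ℝ] ℂ := B.ρ u • B.P.loc α u

lemma cutLoc_eq (B : BumpPatch K R) (α : K.Form n) {u : E} (hu : u ∈ B.V) :
    B.cutLoc α u = B.P.loc α u := by
  rw [cutLoc, B.ρ_eq_one u hu, one_smul]

lemma cutLoc_eq_zero (B : BumpPatch K R) (α : K.Form n) {u : E} (hu : u ∉ B.P.img univ) :
    B.cutLoc α u = 0 := by
  rw [cutLoc, image_eq_zero_of_notMem_tsupport fun h => hu (B.tsupport_ρ h)]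
  exact zero_smul ℝ (B.P.loc α u)

/-- The product of the bump function and a function that is smooth in the patch is smooth. -/
lemma contDiff_smul_of_contDiffOn {G F : Type*} [NormedAddCommGroup G] [NormedSpace ℝ G]
    [NormedAddCommGroup F] [NormedSpace ℝ F] (B : BumpPatch K R) {a : E × G → F} {Ω : Set G}
    (hΩ : IsOpen Ω) (ha : ContDiffOn ℝ ∞ a (B.P.img univ ×ˢ Ω)) :
    ContDiffOn ℝ ∞ (fun w => B.ρ w.1 • a w) (univ ×ˢ Ω) := by
  intro w hw
  by_cases h : w.1 ∈ B.P.img univ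
  · exact ((B.contDiff_ρ.comp contDiff_fst).contDiffAt.smul (ha.contDiffAt
      (((Patch.isOpen_img isOpen_univ).prod hΩ).mem_nhds ⟨h, hw.2⟩))).contDiffWithinAt
  · have h1 : ∀ᶠ w' in nhds w, B.ρ w'.1 • a w' = 0 := by
      have h2 : IsOpen ((tsupport B.ρ)ᶜ) := (isClosed_tsupport _).isOpen_compl
      filter_upwards [(h2.preimage continuous_fst).mem_nhds
        (show w ∈ Prod.fst ⁻¹' (tsupport B.ρ)ᶜ from fun h' => h (B.tsupport_ρ h'))] with w' hw'
      rw [image_eq_zero_of_notMem_tsupport hw', zero_smul]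
    exact (contDiffAt_const.congr_of_eventuallyEq h1).contDiffWithinAt

lemma contDiffOn_loc_of_smoothOn (P : Patch K R) {α : K.Form n} (hα : α.SmoothOn univ) :
    ContDiffOn ℝ ∞ (P.loc α) (P.img univ) := PullData.contDiffOn_loc isOpen_univ hα

lemma contDiff_cutLoc (B : BumpPatch K R) {α : K.Form n} (hα : α.SmoothOn univ) :
    ContDiff ℝ ∞ (B.cutLoc α) := by
  have h : ContDiffOn ℝ ∞ (fun w : E × ℝ => B.P.loc α w.1) (B.P.img univ ×ˢ univ) :=
    (contDiffOn_loc_of_smoothOn B.P hα).comp contDiff_fst.contDiffOn fun w hw => hw.1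
  have h1 := B.contDiff_smul_of_contDiffOn isOpen_univ h
  rw [univ_prod_univ, contDiffOn_univ] at h1
  exact h1.comp (f := fun u => (u, (0 : ℝ))) (contDiff_prodMk_left 0)

lemma hasCompactSupport_cutLoc (B : BumpPatch K R) (α : K.Form n) :
    HasCompactSupport (B.cutLoc α) :=
  B.hasCompactSupport_ρ.mono fun u hu h => hu (by
    rw [cutLoc, h]
    exact zero_smul ℝ (B.P.loc α u))

/-- The cut off local expression of smooth forms, as a linear map to the Schwartz space. -/
def cutSchwartz (B : BumpPatch K R) :
    smoothForms K n →ₗ[ℝ] SchwartzMap E (R [⋀^Fin n]→L[ℝ] ℂ) where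
  toFun α := (B.hasCompactSupport_cutLoc α.1).toSchwartzMap (B.contDiff_cutLoc α.2)
  map_add' α β := SchwartzMap.ext fun u =>
    (congrArg (B.ρ u • ·) (Patch.loc_add α.1 β.1 u)).trans (smul_add _ _ _)
  map_smul' c α := SchwartzMap.ext fun u => by
    refine (congrArg (B.ρ u • ·) (Patch.loc_smul (c : ℂ) α.1 u)).trans ?_
    exact smul_comm (B.ρ u) c (B.P.loc α.1 u)

variable {σ : Type*} [Fintype σ] {B : σ → BumpPatch K R}

/-- The norms of the derivatives up to order `s` of the cut off local expressions of a smooth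
form. -/
def formSeminorm (B : σ → BumpPatch K R) (s : ℕ) : Seminorm ℝ (smoothForms K n) :=
  (Finset.univ ×ˢ Finset.range (s + 1)).sup fun i : σ × ℕ =>
    (SchwartzMap.seminorm ℝ 0 i.2).comp (B i.1).cutSchwartz

lemma monotone_formSeminorm : Monotone (formSeminorm (n := n) B) := fun s t hst =>
  Finset.sup_mono (Finset.product_subset_product_right (Finset.range_subset_range.2 (by omega)))

lemma norm_iteratedFDeriv_cutLoc_le (α : smoothForms K n) (i : σ) {s t : ℕ} (h : t ≤ s) (u : E) :
    ‖iteratedFDeriv ℝ t ((B i).cutLoc α.1) u‖ ≤ formSeminorm B s α := by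
  refine (SchwartzMap.norm_iteratedFDeriv_le_seminorm ℝ ((B i).cutSchwartz α) t u).trans ?_
  exact Seminorm.le_finset_sup_apply (p := fun i : σ × ℕ =>
    (SchwartzMap.seminorm ℝ 0 i.2).comp (B i.1).cutSchwartz) (x := α) (i := (i, t))
    (Finset.mem_product.2 ⟨Finset.mem_univ _, Finset.mem_range.2 (Nat.lt_succ_of_le h)⟩)

lemma norm_cutLoc_le (α : smoothForms K n) (i : σ) (u : E) (s : ℕ) :
    ‖(B i).cutLoc α.1 u‖ ≤ formSeminorm B s α := by
  rw [← norm_iteratedFDeriv_zero (𝕜 := ℝ)]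
  exact norm_iteratedFDeriv_cutLoc_le α i (Nat.zero_le s) u

lemma formSeminorm_le {α : smoothForms K n} {s : ℕ} {C : ℝ} (hC : 0 ≤ C)
    (h : ∀ i, ∀ t ≤ s, ∀ u, ‖iteratedFDeriv ℝ t ((B i).cutLoc α.1) u‖ ≤ C) :
    formSeminorm B s α ≤ C := by
  refine Seminorm.finset_sup_apply_le hC fun i hi => ?_
  refine SchwartzMap.seminorm_le_bound ℝ 0 i.2 _ hC fun u => ?_
  rw [pow_zero, one_mul]
  exact h i.1 i.2 (by have := Finset.mem_range.1 (Finset.mem_product.1 hi).2; omega) u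

/-- The seminorms separate smooth forms. -/
lemma eq_zero_of_formSeminorm (hB : Covers B) {α : smoothForms K n}
    (h : ∀ s, formSeminorm B s α = 0) : α = 0 := by
  refine Subtype.ext (funext fun x => ?_)
  obtain ⟨i, hi, hV⟩ := hB x
  have h1 := norm_cutLoc_le (B := B) α i (extChartAt I (B i).P.pt x) 0
  rw [h 0, norm_le_zero_iff, cutLoc_eq _ _ hV, ← Patch.loc_zero (n := n) (P := (B i).P),
    Patch.loc_eq_iff ((B i).V_subset hV), Patch.inv_chart hi] at h1
  exact h1

end BumpPatch

end SmoothForms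

section FormSeries

set_option linter.unusedSectionVars false

open Filter Topology

universe u

variable {E : Type u} [NormedAddCommGroup E] [NormedSpace ℝ E] [FiniteDimensional ℝ E]
  {H : Type*} [TopologicalSpace H] {I : ModelWithCorners ℝ E H} [I.Boundaryless]
  {X : Type*} [TopologicalSpace X] [ChartedSpace H X] [IsManifold I ∞ X]
  {ι : Type*} {K : FoliatedBundle I X ι}
  {R : Type u} [NormedAddCommGroup R] [NormedSpace ℝ R] [FiniteDimensional ℝ R]
  {n : ℕ} {Λ : Type*}

/-! ### Series of forms -/

open Classical in
/-- The sum of a series of forms. At points where not all values are summable it is zero. -/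
def tsumForm (γ : Λ → K.Form n) : K.Form n := fun x =>
  if h : ∀ v, Summable fun l => γ l x v then
    { toFun := fun v => ∑' l, γ l x v
      map_update_add' := fun v i a b => by
        rw [← (h _).tsum_add (h _)]
        congr 1
        funext l
        exact (γ l x).map_update_add' v i a b
      map_update_smul' := fun v i c a => by
        rw [← (h _).tsum_const_smul]
        congr 1
        funext l
        exact (γ l x).map_update_smul' v i c a
      map_eq_zero_of_eq' := fun v i j h hij => by
        rw [← tsum_zero (α := ℂ) (β := Λ)]
        congr 1
        funext l
        exact (γ l x).map_eq_zero_of_eq' v i j h hij }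
  else 0

lemma hasSum_tsumForm {γ : Λ → K.Form n} {x : X} (h : ∀ v, Summable fun l => γ l x v)
    (v : Fin n → K.D x) : HasSum (fun l => γ l x v) (tsumForm γ x v) := by
  unfold tsumForm
  rw [dif_pos h]
  exact (h v).hasSum

lemma hasSum_loc_tsumForm {γ : Λ → K.Form n} (h : ∀ x v, Summable fun l => γ l x v)
    (P : Patch K R) (u : E) (r : Fin n → R) :
    HasSum (fun l => P.loc (γ l) u r) (P.loc (tsumForm γ) u r) :=
  (hasSum_tsumForm (h _) _).mul_left _

variable {σ : Type*} [Fintype σ] {B : σ → BumpPatch K R}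
  {G : Type*} [NormedAddCommGroup G] [NormedSpace ℝ G]

/-- The series `∑ φ l t • γ l` of smooth forms with smooth functions as coefficients converges,
together with all its derivatives. -/
def FamSummable (B : σ → BumpPatch K R) (φ : Λ → G → ℂ) (γ : Λ → smoothForms K n) : Prop :=
  (∀ l, ContDiff ℝ ∞ (φ l)) ∧ ∃ b : ℕ → Λ → ℝ,
    (∀ s l t, ‖iteratedFDeriv ℝ s (φ l) t‖ ≤ b s l) ∧
    ∀ s s', Summable fun l => b s l * BumpPatch.formSeminorm B s' (γ l)

namespace FamSummable

variable {φ : Λ → G → ℂ} {γ : Λ → smoothForms K n}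

lemma norm_iteratedFDeriv_comp_fst_le {F : Type*} [NormedAddCommGroup F] [NormedSpace ℝ F]
    {f : E → F} (hf : ContDiff ℝ ∞ f) (s : ℕ) (w : E × G) :
    ‖iteratedFDeriv ℝ s (fun w : E × G => f w.1) w‖ ≤ ‖iteratedFDeriv ℝ s f w.1‖ := by
  have h := (ContinuousLinearMap.fst ℝ E G).iteratedFDeriv_comp_right hf w (i := s)
    (by exact_mod_cast le_top)
  rw [show (fun w : E × G => f w.1) = f ∘ ContinuousLinearMap.fst ℝ E G from rfl, h]
  refine (ContinuousMultilinearMap.norm_compContinuousLinearMap_le _ _).trans ?_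
  refine mul_le_of_le_one_right (norm_nonneg _) (Finset.prod_le_one (fun _ _ => norm_nonneg _)
    fun _ _ => ContinuousLinearMap.norm_fst_le ℝ E G)

lemma norm_iteratedFDeriv_comp_snd_le {F : Type*} [NormedAddCommGroup F] [NormedSpace ℝ F]
    {f : G → F} (hf : ContDiff ℝ ∞ f) (s : ℕ) (w : E × G) :
    ‖iteratedFDeriv ℝ s (fun w : E × G => f w.2) w‖ ≤ ‖iteratedFDeriv ℝ s f w.2‖ := by
  have h := (ContinuousLinearMap.snd ℝ E G).iteratedFDeriv_comp_right hf w (i := s)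
    (by exact_mod_cast le_top)
  rw [show (fun w : E × G => f w.2) = f ∘ ContinuousLinearMap.snd ℝ E G from rfl, h]
  refine (ContinuousMultilinearMap.norm_compContinuousLinearMap_le _ _).trans ?_
  refine mul_le_of_le_one_right (norm_nonneg _) (Finset.prod_le_one (fun _ _ => norm_nonneg _)
    fun _ _ => ContinuousLinearMap.norm_snd_le ℝ E G)

lemma contDiff_term (h : FamSummable B φ γ) (i : σ) (l : Λ) :
    ContDiff ℝ ∞ fun w : E × G => φ l w.2 • (B i).cutLoc (γ l).1 w.1 :=
  ((h.1 l).comp contDiff_snd).smul (((B i).contDiff_cutLoc (γ l).2).comp contDiff_fst)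

lemma exists_bound (h : FamSummable B φ γ) : ∃ v : ℕ → Λ → ℝ, (∀ s, Summable (v s)) ∧
    ∀ s l (i : σ) (w : E × G),
      ‖iteratedFDeriv ℝ s (fun w : E × G => φ l w.2 • (B i).cutLoc (γ l).1 w.1) w‖ ≤ v s l := by
  obtain ⟨hφ, b, hb, hs⟩ := h
  refine ⟨fun s l => ∑ j ∈ Finset.range (s + 1), (s.choose j : ℝ) *
    (b j l * BumpPatch.formSeminorm B s (γ l)), fun s => ?_, fun s l i w => ?_⟩
  · exact summable_sum fun j _ => (hs j s).mul_left _
  · refine (norm_iteratedFDeriv_smul_le ((hφ l).comp contDiff_snd)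
      (((B i).contDiff_cutLoc (γ l).2).comp contDiff_fst) w
      (by exact_mod_cast le_top)).trans (Finset.sum_le_sum fun j _ => ?_)
    rw [mul_assoc]
    gcongr
    · exact (norm_nonneg _).trans (hb j l 0)
    · exact (norm_iteratedFDeriv_comp_snd_le (hφ l) j w).trans (hb j l _)
    · exact (norm_iteratedFDeriv_comp_fst_le ((B i).contDiff_cutLoc (γ l).2) _ w).trans
        (BumpPatch.norm_iteratedFDeriv_cutLoc_le _ _ (Nat.sub_le _ _) _)

lemma summable_cutLoc (h : FamSummable B φ γ) (i : σ) (w : E × G) :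
    Summable fun l => φ l w.2 • (B i).cutLoc (γ l).1 w.1 := by
  obtain ⟨v, hv, hb⟩ := h.exists_bound
  refine Summable.of_norm_bounded (hv 0) fun l => ?_
  have := hb 0 l i w
  rwa [norm_iteratedFDeriv_zero] at this

lemma summable_apply (hB : BumpPatch.Covers B) (h : FamSummable B φ γ) (t : G) (x : X)
    (v : Fin n → K.D x) : Summable fun l => (φ l t • (γ l).1) x v := by
  obtain ⟨i, hi, hV⟩ := hB x
  have hu := (B i).V_subset hV
  set u := extChartAt I (B i).P.pt x with hud
  have h1 := (ContinuousAlternatingMap.apply ℝ R ℂ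
    fun j => (B i).P.coframe x (v j)).summable (h.summable_cutLoc i (u, t))
  have h2 := h1.mul_left ((B i).P.factor x)⁻¹
  refine h2.congr fun l => ?_
  have h3 : (ContinuousAlternatingMap.apply ℝ R ℂ fun j => (B i).P.coframe x (v j))
      (φ l t • (B i).cutLoc (γ l).1 u) = φ l t * ((B i).P.factor x * (γ l).1 x v) := by
    change φ l t * (B i).cutLoc (γ l).1 u _ = _
    rw [BumpPatch.cutLoc_eq _ _ hV, hud, Patch.loc_chart_apply _ hi]
    simp only [Patch.frame_coframe hi]
  change _ = φ l t * (γ l).1 x v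
  rw [h3, mul_left_comm, inv_mul_cancel_left₀]
  have := Patch.factor_ne_zero (Patch.inv_mem_N hu)
  rwa [hud, Patch.inv_chart hi] at this

lemma cutLoc_tsumForm (hB : BumpPatch.Covers B) (h : FamSummable B φ γ) (i : σ) (t : G) (u : E) :
    (B i).cutLoc (tsumForm fun l => φ l t • (γ l).1) u =
      ∑' l, φ l t • (B i).cutLoc (γ l).1 u := by
  have hs := h.summable_cutLoc i (u, t)
  ext r
  have h1 := (ContinuousAlternatingMap.apply ℝ R ℂ r).hasSum hs.hasSum
  have h2 := (hasSum_loc_tsumForm (fun x v => h.summable_apply hB t x v) (B i).P u r).mul_left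
    ((B i).ρ u : ℂ)
  refine Eq.trans Complex.real_smul (h2.unique ?_)
  refine h1.congr_fun fun l => ?_
  rw [Patch.loc_smul]
  change (B i).ρ u * (φ l t * (B i).P.loc (γ l).1 u r) =
    φ l t * ((B i).ρ u • (B i).P.loc (γ l).1 u r)
  rw [Complex.real_smul]
  ring

lemma contDiff_tsum_cutLoc (h : FamSummable B φ γ) (i : σ) :
    ContDiff ℝ ∞ fun w : E × G => ∑' l, φ l w.2 • (B i).cutLoc (γ l).1 w.1 := by
  obtain ⟨v, hv, hb⟩ := h.exists_bound
  exact contDiff_tsum (h.contDiff_term i) (fun s _ => hv s) fun s l w _ => hb s l i w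

lemma loc_tsumForm (hB : BumpPatch.Covers B) (h : FamSummable B φ γ) (i : σ) (t : G) {u : E}
    (hu : u ∈ (B i).core.img univ) :
    (B i).core.loc (tsumForm fun l => φ l t • (γ l).1) u =
      ∑' l, φ l t • (B i).cutLoc (γ l).1 u := by
  rw [(B i).loc_core _ hu, ← BumpPatch.cutLoc_eq _ _ ((B i).core_img_subset hu),
    h.cutLoc_tsumForm hB]

/-- The sum of the series is a smooth family of forms. -/
lemma famSmooth (hB : BumpPatch.Covers B) (h : FamSummable B φ γ) :
    FamSmooth R (fun t => tsumForm fun l => φ l t • (γ l).1) (univ : Set G) := by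
  intro x
  obtain ⟨i, hi, hV⟩ := hB x
  refine ⟨(B i).core, ⟨hi, hi, hV⟩, ?_⟩
  exact (h.contDiff_tsum_cutLoc i).contDiffOn.congr fun w hw => h.loc_tsumForm hB i w.2 hw.1

end FamSummable

lemma FamSmooth.smoothOn {b : G → K.Form n} {Ω : Set G} (hb : FamSmooth R b Ω) {t : G}
    (ht : t ∈ Ω) : (b t).SmoothOn univ := by
  refine FoliatedBundle.Form.smoothOn_of_atlas (R := R) isOpen_univ fun x _ => ?_
  obtain ⟨P, hP, h⟩ := hb x
  exact ⟨P, hP, ContDiffOn.comp (g := fun w : E × G => P.loc (b w.2) w.1) (f := fun u => (u, t)) h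
    (contDiff_prodMk_left t).contDiffOn fun u hu => ⟨hu, ht⟩⟩

namespace FamSummable

variable {φ : Λ → G → ℂ} {γ : Λ → smoothForms K n}

lemma contDiff_slice (h : FamSummable B φ γ) (i : σ) (t : G) (l : Λ) :
    ContDiff ℝ ∞ fun u => φ l t • (B i).cutLoc (γ l).1 u :=
  ContDiff.comp (g := fun w : E × G => φ l w.2 • (B i).cutLoc (γ l).1 w.1)
    (h.contDiff_term i l) (contDiff_prodMk_left t)

lemma exists_fderiv_bound (h : FamSummable B φ γ) (i : σ) (t : G) : ∃ v : Λ → ℝ, Summable v ∧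
    ∀ l u, ‖fderiv ℝ (fun u => φ l t • (B i).cutLoc (γ l).1 u) u‖ ≤ v l := by
  obtain ⟨v, hv, hb⟩ := h.exists_bound
  refine ⟨v 1, hv 1, fun l u => ?_⟩
  have h1 := hasFDerivAt_comp_prodMk_left (((h.contDiff_term i l).differentiable
    (by simp)) (u, t)).hasFDerivAt
  have h2 := hb 1 l i (u, t)
  rw [norm_iteratedFDeriv_one] at h2
  rw [h1.fderiv]
  refine (ContinuousLinearMap.opNorm_comp_le _ _).trans ?_
  exact (mul_le_of_le_one_right (norm_nonneg _) (ContinuousLinearMap.norm_inl_le_one ℝ E G)).trans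
    h2

lemma hasSum_alt_apply {f : Λ → R [⋀^Fin n]→L[ℝ] ℂ} {a : R [⋀^Fin n]→L[ℝ] ℂ} (h : HasSum f a)
    (r : Fin n → R) : HasSum (fun l => f l r) (a r) :=
  (ContinuousAlternatingMap.apply ℝ R ℂ r).hasSum h

lemma hasSum_fderiv_tsum_apply {F : Type*} [NormedAddCommGroup F] [NormedSpace ℝ F]
    [CompleteSpace F] {f : Λ → E → F} {b : Λ → ℝ} (hb : Summable b)
    (hf : ∀ l, Differentiable ℝ (f l)) (hfb : ∀ l u, ‖fderiv ℝ (f l) u‖ ≤ b l) {u : E}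
    (hs : Summable fun l => f l u) (v : E) :
    HasSum (fun l => fderiv ℝ (f l) u v) (fderiv ℝ (fun u => ∑' l, f l u) u v) := by
  rw [fderiv_tsum_apply hb hf hfb hs u]
  exact (ContinuousLinearMap.apply ℝ F v).hasSum
    (Summable.of_norm_bounded hb fun l => hfb l u).hasSum

lemma hasSum_fderiv (h : FamSummable B φ γ) (i : σ) (t : G) (u v : E) (r : Fin n → R) :
    HasSum (fun l => fderiv ℝ (fun u => φ l t • (B i).cutLoc (γ l).1 u) u v r)
      (fderiv ℝ (fun u => ∑' l, φ l t • (B i).cutLoc (γ l).1 u) u v r) := by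
  obtain ⟨b, hb, hfb⟩ := h.exists_fderiv_bound i t
  exact hasSum_alt_apply (hasSum_fderiv_tsum_apply hb
    (fun l => (h.contDiff_slice i t l).differentiable (by simp)) hfb
    (h.summable_cutLoc i (u, t)) v) r

lemma loc_smul_eq (i : σ) (t : G) (l : Λ) {u : E} (hu : u ∈ (B i).core.img univ) :
    (B i).core.loc (φ l t • (γ l).1) u = φ l t • (B i).cutLoc (γ l).1 u := by
  rw [Patch.loc_smul, (B i).loc_core _ hu, ← BumpPatch.cutLoc_eq _ _ ((B i).core_img_subset hu)]

lemma hasSum_d (hB : BumpPatch.Covers B) (h : FamSummable B φ γ) (i : σ) (t : G) {u : E}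
    (hu : u ∈ (B i).core.img univ) (r : Fin (n + 1) → R) :
    HasSum (fun l => (B i).core.d ((B i).core.loc (φ l t • (γ l).1)) u r)
      ((B i).core.d ((B i).core.loc (tsumForm fun l => φ l t • (γ l).1)) u r) := by
  have hop := (Patch.isOpen_img (P := (B i).core) isOpen_univ).mem_nhds hu
  have hnear : (B i).core.loc (tsumForm fun l => φ l t • (γ l).1) =ᶠ[𝓝 u]
      fun u => ∑' l, φ l t • (B i).cutLoc (γ l).1 u := by
    filter_upwards [hop] with w hw using h.loc_tsumForm hB i t hw
  have hnear' (l : Λ) : (B i).core.loc (φ l t • (γ l).1) =ᶠ[𝓝 u]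
      fun u => φ l t • (B i).cutLoc (γ l).1 u := by
    filter_upwards [hop] with w hw using loc_smul_eq i t l hw
  unfold Patch.d
  simp only [localD_apply, hnear.fderiv_eq, hnear.eq_of_nhds, (hnear' _).fderiv_eq,
    (hnear' _).eq_of_nhds]
  refine hasSum_sum fun j _ => HasSum.mul_left _ (HasSum.add ?_ (HasSum.mul_left _ ?_))
  · exact h.hasSum_fderiv i t u _ _
  · exact hasSum_alt_apply (h.summable_cutLoc i (u, t)).hasSum _

/-- The differential of the series is computed term by term. -/
lemma hasDiffOn (hK : K.IsRegular) (hB : BumpPatch.Covers B) (h : FamSummable B φ γ)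
    {δ : Λ → smoothForms K (n + 1)} (h' : FamSummable B φ δ)
    (hd : ∀ l, FoliatedBundle.Form.HasDiffOn (γ l).1 (δ l).1 univ) (t : G) :
    FoliatedBundle.Form.HasDiffOn (tsumForm fun l => φ l t • (γ l).1)
      (tsumForm fun l => φ l t • (δ l).1) univ := by
  refine FoliatedBundle.Form.hasDiffOn_of_atlas (R := R) hK isOpen_univ
    ((h.famSmooth hB).smoothOn (mem_univ t)) fun x _ => ?_
  obtain ⟨i, hi, hV⟩ := hB x
  refine ⟨(B i).core, ⟨hi, hi, hV⟩, fun u hu => ?_⟩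
  ext r
  refine (h.hasSum_d hB i t hu r).unique ((hasSum_loc_tsumForm
    (fun x v => h'.summable_apply hB t x v) (B i).core u r).congr_fun fun l => ?_)
  have h1 : FoliatedBundle.Form.HasDiffOn (φ l t • (γ l).1) (φ l t • (δ l).1) univ :=
    (hd l).smul (φ l t) (γ l).2
  rw [PullData.d_loc hK isOpen_univ
    (FoliatedBundle.Form.SmoothOn.smul (φ l t) (γ l).2) h1 hu]

end FamSummable

namespace BumpPatch

lemma famSummable_one {g : ℕ → smoothForms K n}
    (hsum : ∀ s, Summable fun l => formSeminorm B s (g l)) :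
    FamSummable B (fun _ _ => 1 : ℕ → ℝ → ℂ) g := by
  refine ⟨fun l => contDiff_const, fun s _ => if s = 0 then 1 else 0, fun s l t => ?_,
    fun s s' => (hsum s').mul_left _⟩
  dsimp only
  split_ifs with hs
  · rw [hs, norm_iteratedFDeriv_zero, norm_one]
  · rw [iteratedFDeriv_const_of_ne hs]
    simp

/-- Spaces of smooth forms are complete: absolutely convergent series converge. -/
lemma tendsto_formSeminorm_sub_sum (hB : Covers B) {g : ℕ → smoothForms K n}
    (hsum : ∀ s, Summable fun l => formSeminorm B s (g l)) {S : smoothForms K n}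
    (hS : S.1 = tsumForm fun l => (1 : ℂ) • (g l).1) (j : ℕ) :
    Tendsto (fun N => formSeminorm B j (S - ∑ l ∈ Finset.range N, g l)) atTop (𝓝 0) := by
  have h := famSummable_one hsum
  have hcut (N : ℕ) (i : σ) (u : E) : (B i).cutLoc (S - ∑ l ∈ Finset.range N, g l).1 u =
      ∑' l, (B i).cutLoc (g (l + N)).1 u := by
    have h1 := h.cutLoc_tsumForm hB i 0 u
    have h2 := h.summable_cutLoc i (u, 0)
    simp only [one_smul ℂ] at h2
    have h3 := h2.sum_add_tsum_nat_add N
    have h4 : (B i).cutLoc (S - ∑ l ∈ Finset.range N, g l).1 u =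
        (B i).cutLoc S.1 u - ∑ l ∈ Finset.range N, (B i).cutLoc (g l).1 u := by
      have h5 := congrArg (fun f => f u) (map_sub (B i).cutSchwartz S
        (∑ l ∈ Finset.range N, g l))
      rw [map_sum] at h5
      refine h5.trans ?_
      rw [sub_apply, sum_apply]
      rfl
    rw [h4, sub_eq_iff_eq_add', h3, hS]
    refine h1.trans ?_
    simp only [one_smul ℂ]
  have hle (N : ℕ) : formSeminorm B j (S - ∑ l ∈ Finset.range N, g l) ≤
      ∑' l, formSeminorm B j (g (l + N)) := by
    refine formSeminorm_le (tsum_nonneg fun _ => apply_nonneg _ _) fun i t ht u => ?_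
    rw [funext (hcut N i)]
    rw [iteratedFDeriv_tsum_apply (𝕜 := ℝ) (N := ⊤)
      (v := fun s l => formSeminorm B s (g (l + N)))
      (fun l => (B i).contDiff_cutLoc (g (l + N)).2)
      (fun s _ => (summable_nat_add_iff (f := fun l => formSeminorm B s (g l)) N).2 (hsum s))
      (fun s l u _ => norm_iteratedFDeriv_cutLoc_le _ i le_rfl u) (by exact_mod_cast le_top)]
    exact tsum_of_norm_bounded
      ((summable_nat_add_iff (f := fun l => formSeminorm B j (g l)) N).2 (hsum j)).hasSum
      fun l => norm_iteratedFDeriv_cutLoc_le _ i ht u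
  exact squeeze_zero (fun _ => apply_nonneg _ _) hle
    (tendsto_sum_nat_add fun l => formSeminorm B j (g l))

end BumpPatch

end FormSeries

section FourierSeries

open MeasureTheory Filter Topology

/-! ### Fourier coefficients of smooth periodic functions -/

variable {k : ℕ}

/-- The weight that measures the decay of families indexed by the frequencies in `ℤᵏ`. -/
def fourierWeight (l : Fin k → ℤ) : ℝ := 1 + ∑ m, |(l m : ℝ)|

lemma one_le_fourierWeight (l : Fin k → ℤ) : 1 ≤ fourierWeight l :=
  le_add_of_nonneg_right (Finset.sum_nonneg fun _ _ => abs_nonneg _)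

lemma fourierWeight_pos (l : Fin k → ℤ) : 0 < fourierWeight l :=
  lt_of_lt_of_le one_pos (one_le_fourierWeight l)

lemma summable_prod_inv_sq (k : ℕ) :
    Summable fun l : Fin k → ℤ => ∏ m, ((1 + |(l m : ℝ)|) ^ 2)⁻¹ := by
  induction k with
  | zero => exact Summable.of_finite
  | succ k ih =>
    have h1 : Summable fun j : ℤ => ((1 + |(j : ℝ)|) ^ 2)⁻¹ := by
      refine Summable.of_norm_bounded_eventually (g := fun j : ℤ => ((j : ℝ) ^ 2)⁻¹)
        (by simpa using Real.summable_one_div_int_pow.2 one_lt_two) ?_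
      filter_upwards [(finite_singleton (0 : ℤ)).compl_mem_cofinite] with j hj
      rw [Real.norm_of_nonneg (by positivity), ← sq_abs (j : ℝ)]
      have : 0 < |(j : ℝ)| := abs_pos.2 (Int.cast_ne_zero.2 hj)
      gcongr
      linarith
    have h2 := h1.mul_of_nonneg ih (fun _ => by positivity) fun _ => by positivity
    refine ((Fin.consEquiv fun _ : Fin (k + 1) => ℤ).summable_iff).1 (h2.congr fun p => ?_)
    simp [Fin.prod_univ_succ, Fin.consEquiv, mul_comm]

/-- A power of `fourierWeight l` is at least a product of `k` factors `(1 + |l m|) ^ 2`, whose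
inverses are summable. -/
lemma summable_inv_fourierWeight_pow (k : ℕ) :
    Summable fun l : Fin k → ℤ => (fourierWeight l ^ (2 * k + 2))⁻¹ := by
  refine Summable.of_nonneg_of_le (fun l => inv_nonneg.2 (pow_nonneg (fourierWeight_pos l).le _))
    (fun l => ?_) (summable_prod_inv_sq k)
  rw [Finset.prod_inv_distrib]
  refine inv_anti₀ (Finset.prod_pos fun _ _ => by positivity) ?_
  calc ∏ m, (1 + |(l m : ℝ)|) ^ 2 ≤ ∏ _m : Fin k, fourierWeight l ^ 2 := by
        refine Finset.prod_le_prod (fun _ _ => by positivity) fun m _ => ?_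
        gcongr
        exact add_le_add_right (Finset.single_le_sum (f := fun m => |(l m : ℝ)|)
          (fun _ _ => abs_nonneg _) (Finset.mem_univ m)) 1
    _ = fourierWeight l ^ (2 * k) := by simp [pow_mul]
    _ ≤ _ := pow_le_pow_right₀ (one_le_fourierWeight l) (by omega)

lemma tendsto_fourierWeight (k : ℕ) :
    Tendsto (fourierWeight : (Fin k → ℤ) → ℝ) cofinite atTop := by
  have h := (summable_inv_fourierWeight_pow k).tendsto_cofinite_zero
  refine tendsto_atTop.2 fun C => ?_
  have hC : 0 < ((|C| + 1) ^ (2 * k + 2))⁻¹ := by positivity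
  filter_upwards [h.eventually_lt_const hC] with l hl
  have h1 := (inv_lt_inv₀ (pow_pos (fourierWeight_pos l) _) (by positivity)).1 hl
  have h2 := lt_of_pow_lt_pow_left₀ _ (fourierWeight_pos l).le h1
  linarith [le_abs_self C]

/-- The phase of a Fourier mode, as a linear form. -/
def fourierPhase (l : Fin k → ℤ) : (Fin k → ℝ) →L[ℝ] ℝ :=
  ∑ m, (l m : ℝ) • ContinuousLinearMap.proj m

lemma fourierPhase_apply (l : Fin k → ℤ) (t : Fin k → ℝ) : fourierPhase l t = ∑ m, l m * t m := by
  simp [fourierPhase]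

lemma norm_fourierPhase_le (l : Fin k → ℤ) : ‖fourierPhase l‖ ≤ fourierWeight l := by
  refine ContinuousLinearMap.opNorm_le_bound _ (fourierWeight_pos l).le fun t => ?_
  rw [fourierPhase_apply, fourierWeight, add_mul, Finset.sum_mul]
  refine (norm_sum_le _ _).trans ((Finset.sum_le_sum fun m _ => ?_).trans
    (le_add_of_nonneg_left (by positivity)))
  rw [norm_mul, Real.norm_eq_abs]
  gcongr
  exact norm_le_pi_norm t m

/-- The Fourier mode of frequency `l`. -/
def fourierMode (l : Fin k → ℤ) (t : Fin k → ℝ) : ℂ :=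
  Complex.exp (2 * Real.pi * Complex.I * (fourierPhase l t : ℝ))

lemma contDiff_fourierMode (l : Fin k → ℤ) : ContDiff ℝ ∞ (fourierMode l) :=
  (contDiff_const.mul (Complex.ofRealCLM.contDiff.comp (fourierPhase l).contDiff)).cexp

lemma norm_fourierMode (l : Fin k → ℤ) (t : Fin k → ℝ) : ‖fourierMode l t‖ = 1 := by
  rw [fourierMode, Complex.norm_exp]
  simp

lemma norm_iteratedFDeriv_fourierMode_le (s : ℕ) (l : Fin k → ℤ) (t : Fin k → ℝ) :
    ‖iteratedFDeriv ℝ s (fourierMode l) t‖ ≤ (2 * Real.pi) ^ s * fourierWeight l ^ s := by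
  let c : ℂ := 2 * Real.pi * Complex.I
  let ψ : ℝ → ℂ := fun x => Complex.exp (c * x)
  have hψ : ContDiff ℝ ∞ ψ := (contDiff_const.mul Complex.ofRealCLM.contDiff).cexp
  have hD (s : ℕ) : iteratedDeriv s ψ = fun x => c ^ s * ψ x := by
    induction s with
    | zero => simp
    | succ s ih =>
      rw [iteratedDeriv_succ, ih]
      funext x
      have h1 : HasDerivAt ψ (Complex.exp (c * x) * (c * 1)) x :=
        ((Complex.ofRealCLM.hasDerivAt (x := x)).const_mul c).cexp
      rw [(h1.const_mul (c ^ s)).deriv]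
      simp only [ψ]
      ring
  have h := (fourierPhase l).iteratedFDeriv_comp_right hψ t (i := s) (by exact_mod_cast le_top)
  rw [show fourierMode l = ψ ∘ fourierPhase l from rfl, h]
  refine (ContinuousMultilinearMap.norm_compContinuousLinearMap_le _ _).trans ?_
  rw [norm_iteratedFDeriv_eq_norm_iteratedDeriv, hD, Finset.prod_const, Finset.card_univ,
    Fintype.card_fin]
  have h2 : ‖c ^ s * ψ (fourierPhase l t)‖ = (2 * Real.pi) ^ s := by
    have h3 : ‖ψ (fourierPhase l t)‖ = 1 := norm_fourierMode l t
    rw [norm_mul, h3, norm_pow, mul_one]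
    simp [c, abs_of_pos Real.pi_pos]
  rw [h2]
  gcongr
  exact norm_fourierPhase_le l

lemma fderiv_fourierMode (l : Fin k → ℤ) (t : Fin k → ℝ) (m : Fin k) :
    fderiv ℝ (fourierMode l) t (Pi.single m 1) =
      2 * Real.pi * Complex.I * l m * fourierMode l t := by
  have h1 : HasFDerivAt (fun t => (2 * Real.pi * Complex.I * (fourierPhase l t : ℝ) : ℂ)) _ t :=
    (Complex.ofRealCLM.hasFDerivAt.comp t (fourierPhase l).hasFDerivAt).const_mul
      (2 * Real.pi * Complex.I)
  have h2 : HasFDerivAt (fourierMode l) _ t := h1.cexp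
  rw [h2.fderiv]
  have h3 : fourierPhase l (Pi.single m 1) = l m := by
    simp [fourierPhase_apply, Pi.single_apply]
  change Complex.exp (2 * Real.pi * Complex.I * (fourierPhase l t : ℝ)) *
    (2 * Real.pi * Complex.I * (fourierPhase l (Pi.single m 1) : ℝ)) = _
  rw [h3, fourierMode, Complex.ofReal_intCast]
  ring

lemma fourierMode_eq_mFourier (l : Fin k → ℤ) (t : Fin k → ℝ) :
    fourierMode l t = UnitAddTorus.mFourier l fun i => (t i : UnitAddCircle) := by
  change _ = ∏ i, fourier (l i) (t i : UnitAddCircle)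
  simp only [fourier_coe_apply, fourierMode, fourierPhase_apply, ← Complex.exp_sum]
  congr 1
  push_cast
  rw [Finset.mul_sum]
  refine Finset.sum_congr rfl fun i _ => ?_
  ring

lemma fourierMode_add_single (l : Fin k → ℤ) (t : Fin k → ℝ) (m : Fin k) :
    fourierMode l (t + Pi.single m 1) = fourierMode l t := by
  rw [fourierMode_eq_mFourier, fourierMode_eq_mFourier]
  congr 1
  funext i
  by_cases h : i = m
  · subst h
    simp
  · simp [h]

/-- The integral of a derivative of a periodic function over a period vanishes. -/
lemma integral_fderiv_single_eq_zero {V : Type*} [NormedAddCommGroup V] [NormedSpace ℝ V]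
    [CompleteSpace V] {g : (Fin k → ℝ) → V} (hg : ContDiff ℝ ∞ g) {m : Fin k}
    (hper : ∀ t, g (t + Pi.single m 1) = g t) :
    ∫ t in Icc (0 : Fin k → ℝ) 1, fderiv ℝ g t (Pi.single m 1) = 0 := by
  obtain ⟨j, rfl⟩ : ∃ j, k = j + 1 := ⟨k - 1, by have := m.pos; omega⟩
  have hcont : Continuous fun t => fderiv ℝ g t (Pi.single m 1) :=
    (hg.continuous_fderiv (by simp)).clm_apply continuous_const
  have hsum (t : Fin (j + 1) → ℝ) : ∑ i : Fin (j + 1), (if i = m then fderiv ℝ g t else 0)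
      (Pi.single i 1) = fderiv ℝ g t (Pi.single m 1) := by
    rw [Finset.sum_eq_single m (fun i _ hi => by rw [if_neg hi]; rfl) (by simp), if_pos rfl]
  have h := integral_divergence_of_hasFDerivAt_off_countable' (0 : Fin (j + 1) → ℝ) 1
    (zero_le_one) (fun i t => if i = m then g t else 0)
    (fun i t => if i = m then fderiv ℝ g t else 0) ∅ countable_empty
    (fun i => by
      split_ifs
      · exact hg.continuous.continuousOn
      · exact continuousOn_const)
    (fun t _ i => by
      split_ifs
      · exact (hg.differentiable (by simp) t).hasFDerivAt
      · exact hasFDerivAt_const _ _)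
    (by
      simp only [hsum]
      exact hcont.continuousOn.integrableOn_compact isCompact_Icc)
  simp only [hsum] at h
  rw [h]
  refine Finset.sum_eq_zero fun i _ => ?_
  by_cases hi : i = m
  · subst hi
    simp only [if_true, Pi.one_apply, Pi.zero_apply]
    rw [sub_eq_zero]
    refine setIntegral_congr_fun measurableSet_Icc fun t _ => ?_
    rw [← hper (i.insertNth 0 t)]
    congr 1
    funext l
    refine Fin.succAboveCases i ?_ (fun l => ?_) l
    · simp
    · simp [Fin.succAbove_ne]
  · simp [hi]

end FourierSeries

/-! ### Decay of Fourier coefficients -/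

section FourierDecay

set_option linter.unusedSectionVars false

open MeasureTheory Filter Topology

universe u

variable {k : ℕ} {E V : Type u} [NormedAddCommGroup E] [NormedSpace ℝ E] [FiniteDimensional ℝ E]
  [NormedAddCommGroup V] [NormedSpace ℝ V] [NormedSpace ℂ V] [IsScalarTower ℝ ℂ V]
  [CompleteSpace V] {F : E × (Fin k → ℝ) → V} {S : Set E}

/-- The Fourier coefficients of `F` with respect to the second variable. -/
def fourierCoef (F : E × (Fin k → ℝ) → V) (l : Fin k → ℤ) (u : E) : V :=
  ∫ t in Icc (0 : Fin k → ℝ) 1, fourierMode (-l) t • F (u, t)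

/-- `F` is smooth, periodic in the second variable, and supported over the compact set `S`. -/
structure IsPeriodicOver (F : E × (Fin k → ℝ) → V) (S : Set E) : Prop where
  contDiff : ContDiff ℝ ∞ F
  periodic : ∀ u t m, F (u, t + Pi.single m 1) = F (u, t)
  isCompact : IsCompact S
  eq_zero : ∀ u ∉ S, ∀ t, F (u, t) = 0

namespace IsPeriodicOver

lemma fderiv_single (h : IsPeriodicOver F S) (m : Fin k) :
    IsPeriodicOver (fun w => fderiv ℝ F w (0, Pi.single m 1)) S where
  contDiff := (h.contDiff.fderiv_right (m := ∞) (by simp)).clm_apply contDiff_const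
  periodic u t i := by
    have h1 : (fun w => F (w + (0, Pi.single i 1))) = F := by
      funext ⟨u, t⟩
      simpa using h.periodic u t i
    have h2 := fderiv_comp_add_right (𝕜 := ℝ) (f := F) (x := (u, t)) (0, Pi.single i 1)
    rw [h1] at h2
    rw [h2]
    simp
  isCompact := h.isCompact
  eq_zero u hu t := by
    have h1 : F =ᶠ[𝓝 (u, t)] fun _ => 0 := by
      filter_upwards [(h.isCompact.isClosed.isOpen_compl.preimage continuous_fst).mem_nhds
        (show (u, t) ∈ Prod.fst ⁻¹' Sᶜ from hu)] with w hw using h.eq_zero w.1 hw w.2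
    rw [h1.fderiv_eq]
    simp

lemma contDiff_integrand (h : IsPeriodicOver F S) (l : Fin k → ℤ) :
    ContDiff ℝ ∞ fun w : E × (Fin k → ℝ) => fourierMode l w.2 • F w :=
  ((contDiff_fourierMode l).comp contDiff_snd).smul h.contDiff

lemma norm_iteratedFDeriv_section_le (hF : ContDiff ℝ ∞ F) (j : ℕ) (u : E) (t : Fin k → ℝ) :
    ‖iteratedFDeriv ℝ j (fun w => F (w, t)) u‖ ≤ ‖iteratedFDeriv ℝ j F (u, t)‖ := by
  let f : E × (Fin k → ℝ) → V := fun w => F (w + (0, t))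
  have hf : ContDiff ℝ ∞ f := hF.comp (contDiff_id.add contDiff_const)
  have h := (ContinuousLinearMap.inl ℝ E (Fin k → ℝ)).iteratedFDeriv_comp_right hf u (i := j)
    (by exact_mod_cast le_top)
  have e : (fun w => F (w, t)) = f ∘ ContinuousLinearMap.inl ℝ E (Fin k → ℝ) := by
    funext w
    simp [f]
  rw [e, h]
  refine (ContinuousMultilinearMap.norm_compContinuousLinearMap_le _ _).trans ?_
  refine (mul_le_of_le_one_right (norm_nonneg _) (Finset.prod_le_one (fun _ _ => norm_nonneg _)
    fun _ _ => ContinuousLinearMap.norm_inl_le_one ℝ E _)).trans ?_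
  rw [iteratedFDeriv_comp_add_right]
  simp

lemma exists_bound (h : IsPeriodicOver F S) (j : ℕ) :
    ∃ C, ∀ l u, ‖iteratedFDeriv ℝ j (fourierCoef F l) u‖ ≤ C := by
  obtain ⟨C, hC⟩ := (h.isCompact.prod (isCompact_Icc (a := (0 : Fin k → ℝ))
    (b := 1))).exists_bound_of_continuousOn
      (h.contDiff.continuous_iteratedFDeriv (m := j) (by exact_mod_cast le_top)).continuousOn
  have hC' (u : E) (t : Fin k → ℝ) (ht : t ∈ Icc (0 : Fin k → ℝ) 1) :
      ‖iteratedFDeriv ℝ j F (u, t)‖ ≤ max C 0 := by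
    by_cases hu : u ∈ S
    · exact (hC (u, t) ⟨hu, ht⟩).trans (le_max_left _ _)
    · have hts : tsupport F ⊆ S ×ˢ univ :=
        closure_minimal (fun w hw => ⟨by_contra fun hS => hw (h.eq_zero w.1 hS w.2), mem_univ _⟩)
          (h.isCompact.isClosed.prod isClosed_univ)
      have : iteratedFDeriv ℝ j F (u, t) = 0 := by
        by_contra hne
        exact hu (hts (support_iteratedFDeriv_subset j hne)).1
      rw [this, norm_zero]
      exact le_max_right _ _
  refine ⟨max C 0 * volume.real (Icc (0 : Fin k → ℝ) 1), fun l u => ?_⟩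
  refine norm_iteratedFDeriv_integral_le (f := fun w => fourierMode (-l) w.2 • F w) isCompact_Icc
    (h.contDiff_integrand (-l)) j u fun t ht => ?_
  have hs : ContDiff ℝ ∞ fun w => F (w, t) := h.contDiff.comp (contDiff_prodMk_left t)
  change ‖iteratedFDeriv ℝ j (fun w => fourierMode (-l) t • F (w, t)) u‖ ≤ _
  rw [iteratedFDeriv_const_smul_apply' ((hs.of_le (by exact_mod_cast le_top)).contDiffAt),
    norm_smul, norm_fourierMode, one_mul]
  exact (norm_iteratedFDeriv_section_le h.contDiff j u t).trans (hC' u t ht)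

/-- Differentiation multiplies the Fourier coefficients by the frequency. -/
lemma fourierCoef_fderiv_single (h : IsPeriodicOver F S) (l : Fin k → ℤ) (m : Fin k) :
    fourierCoef (fun w => fderiv ℝ F w (0, Pi.single m 1)) l =
      fun u => (2 * Real.pi * Complex.I * l m : ℂ) • fourierCoef F l u := by
  funext u
  have hg : ContDiff ℝ ∞ fun t => fourierMode (-l) t • F (u, t) :=
    (contDiff_fourierMode _).smul (h.contDiff.comp (contDiff_prodMk_right u))
  have h0 := integral_fderiv_single_eq_zero hg (m := m) fun t => by
    rw [fourierMode_add_single, h.periodic]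
  have hd (t : Fin k → ℝ) : fderiv ℝ (fun t => fourierMode (-l) t • F (u, t)) t (Pi.single m 1) =
      fourierMode (-l) t • fderiv ℝ F (u, t) (0, Pi.single m 1) -
        (2 * Real.pi * Complex.I * l m : ℂ) • fourierMode (-l) t • F (u, t) := by
    have h1 := ((contDiff_fourierMode (-l)).differentiable (by simp) t).hasFDerivAt
    have h2 : HasFDerivAt (fun t => F (u, t)) _ t :=
      HasFDerivAt.comp (g := F) (f := fun t => (u, t)) t
        (h.contDiff.differentiable (by simp) (u, t)).hasFDerivAt (hasFDerivAt_prodMk_right u t)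
    have h3 : HasFDerivAt (fun t => fourierMode (-l) t • F (u, t)) _ t := h1.smul h2
    rw [h3.fderiv]
    change fourierMode (-l) t • fderiv ℝ F (u, t) (0, Pi.single m 1) +
      fderiv ℝ (fourierMode (-l)) t (Pi.single m 1) • F (u, t) = _
    rw [fderiv_fourierMode, sub_eq_add_neg, ← smul_assoc, ← neg_smul]
    congr 2
    simp
  have hi (f : (Fin k → ℝ) → V) (hf : Continuous f) : IntegrableOn f (Icc (0 : Fin k → ℝ) 1) :=
    hf.continuousOn.integrableOn_compact isCompact_Icc
  simp only [hd] at h0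
  have i1 : IntegrableOn (fun t => fourierMode (-l) t • fderiv ℝ F (u, t) (0, Pi.single m 1))
      (Icc (0 : Fin k → ℝ) 1) := hi _ ((contDiff_fourierMode _).continuous.smul
    ((h.fderiv_single m).contDiff.continuous.comp (Continuous.prodMk_right u)))
  have i2 : IntegrableOn (fun t => (2 * Real.pi * Complex.I * l m : ℂ) •
      fourierMode (-l) t • F (u, t)) (Icc (0 : Fin k → ℝ) 1) :=
    hi _ (hg.continuous.const_smul (2 * Real.pi * Complex.I * l m : ℂ))
  rw [integral_sub i1 i2, integral_smul, sub_eq_zero] at h0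
  exact h0

lemma contDiff_fourierCoef (h : IsPeriodicOver F S) (l : Fin k → ℤ) :
    ContDiff ℝ ∞ (fourierCoef F l) := by
  have := contDiffOn_integral (f := fun w : E × (Fin k → ℝ) => fourierMode (-l) w.2 • F w)
    (μ := volume) (T := Icc (0 : Fin k → ℝ) 1) isCompact_Icc isOpen_univ
    (h.contDiff_integrand (-l)).contDiffOn
  exact contDiffOn_univ.1 this

/-- The Fourier coefficients of a smooth periodic function are rapidly decreasing, with all their
derivatives. -/
lemma exists_decay (h : IsPeriodicOver F S) (j s : ℕ) :
    ∃ C, ∀ l u, fourierWeight l ^ s * ‖iteratedFDeriv ℝ j (fourierCoef F l) u‖ ≤ C := by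
  induction s generalizing F with
  | zero => simpa using h.exists_bound j
  | succ s ih =>
    obtain ⟨C, hC⟩ := ih h
    choose D hD using fun m => ih (h.fderiv_single m)
    refine ⟨C + ∑ m, D m, fun l u => ?_⟩
    have hm (m : Fin k) : |(l m : ℝ)| * ‖iteratedFDeriv ℝ j (fourierCoef F l) u‖ ≤
        ‖iteratedFDeriv ℝ j
          (fourierCoef (fun w => fderiv ℝ F w (0, Pi.single m 1)) l) u‖ := by
      rw [h.fourierCoef_fderiv_single, iteratedFDeriv_const_smul_apply'
        (((h.contDiff_fourierCoef l).of_le (by exact_mod_cast le_top)).contDiffAt), norm_smul]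
      gcongr
      have : ‖(2 * Real.pi * Complex.I * l m : ℂ)‖ = 2 * Real.pi * |(l m : ℝ)| := by
        simp [abs_of_pos Real.pi_pos]
      rw [this]
      nlinarith [Real.pi_gt_three, abs_nonneg (l m : ℝ)]
    have hpos := pow_nonneg (fourierWeight_pos l).le s
    calc fourierWeight l ^ (s + 1) * ‖iteratedFDeriv ℝ j (fourierCoef F l) u‖
        = fourierWeight l ^ s * ‖iteratedFDeriv ℝ j (fourierCoef F l) u‖ +
          ∑ m, fourierWeight l ^ s *
            (|(l m : ℝ)| * ‖iteratedFDeriv ℝ j (fourierCoef F l) u‖) := by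
          rw [← Finset.mul_sum, ← Finset.sum_mul, pow_succ]
          nth_rewrite 2 [fourierWeight]
          ring
      _ ≤ C + ∑ m, D m := by
          refine add_le_add (hC l u) (Finset.sum_le_sum fun m _ => ?_)
          exact (mul_le_mul_of_nonneg_left (hm m) hpos).trans (hD m l u)

end IsPeriodicOver

/-- The Fourier series of a function of the sines of the variables. -/
lemma hasSum_fourierMode {h : (Fin k → ℝ) → ℂ} (hh : ContinuousOn h (Icc (-1) 1))
    (hs : Summable fun l : Fin k → ℤ => ∫ t in Icc (0 : Fin k → ℝ) 1,
      fourierMode (-l) t * h fun i => Real.sin (2 * Real.pi * t i)) (t : Fin k → ℝ) :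
    HasSum (fun l : Fin k → ℤ => fourierMode l t * ∫ t in Icc (0 : Fin k → ℝ) 1,
      fourierMode (-l) t * h fun i => Real.sin (2 * Real.pi * t i))
      (h fun i => Real.sin (2 * Real.pi * t i)) := by
  -- The function of the sines is a function on the torus, where `sin` is the imaginary part of the
  -- character of frequency `1`.
  have him (τ : UnitAddCircle) : (fourier 1 τ).im ∈ Icc (-1 : ℝ) 1 := by
    have h1 := Complex.abs_im_le_norm (fourier 1 τ)
    rw [fourier_apply, Circle.norm_coe] at h1
    exact abs_le.1 h1
  let f : C(UnitAddTorus (Fin k), ℂ) :=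
    { toFun := fun τ => h fun i => (fourier 1 (τ i)).im
      continuous_toFun := by
        refine hh.comp_continuous (continuous_pi fun i => Complex.continuous_im.comp
          ((fourier 1).continuous.comp (continuous_apply i))) fun τ => ?_
        exact ⟨fun i => (him (τ i)).1, fun i => (him (τ i)).2⟩ }
  have hf (t : Fin k → ℝ) : f (fun i => (t i : UnitAddCircle)) =
      h fun i => Real.sin (2 * Real.pi * t i) := by
    refine congrArg h (funext fun i => ?_)
    rw [fourier_coe_apply]
    have : (2 * Real.pi * Complex.I * (1 : ℤ) * (t i : ℝ) / (1 : ℝ) : ℂ) =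
        ((2 * Real.pi * t i : ℝ) : ℂ) * Complex.I := by
      push_cast
      ring
    rw [this, Complex.exp_ofReal_mul_I_im]
  have hset : {x : Fin k → ℝ | ∀ i, x i ∈ Ioc ((0 : Fin k → ℝ) i) ((0 : Fin k → ℝ) i + 1)} =
      pi univ fun i => Ioc ((0 : Fin k → ℝ) i) ((1 : Fin k → ℝ) i) := by
    ext x
    simp
  have hcoef (l : Fin k → ℤ) : UnitAddTorus.mFourierCoeff f l = ∫ t in Icc (0 : Fin k → ℝ) 1,
      fourierMode (-l) t * h fun i => Real.sin (2 * Real.pi * t i) := by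
    have hae : (pi univ fun i => Ioc ((0 : Fin k → ℝ) i) ((1 : Fin k → ℝ) i)) =ᵐ[volume]
        Icc (0 : Fin k → ℝ) 1 := Measure.univ_pi_Ioc_ae_eq_Icc
    rw [UnitAddTorus.mFourierCoeff_eq_integral f l 0, hset, setIntegral_congr_set hae]
    simp only [hf, ← fourierMode_eq_mFourier, smul_eq_mul]
  have key := UnitAddTorus.hasSum_mFourier_series_apply_of_summable (f := f)
    (hs.congr fun l => (hcoef l).symm) fun i => (t i : UnitAddCircle)
  simp only [hf, hcoef, ← fourierMode_eq_mFourier, smul_eq_mul] at key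
  exact key.congr_fun fun l => mul_comm _ _

end FourierDecay

section PrimitiveSpace

set_option linter.unusedSectionVars false

open Filter Topology

universe u

/-! ### The Fréchet space of primitives -/

namespace FoliatedBundle.Form.IsPrimitiveOn

variable {E : Type*} [NormedAddCommGroup E] [NormedSpace ℝ E]
  {H : Type*} [TopologicalSpace H] {I : ModelWithCorners ℝ E H}
  {X : Type*} [TopologicalSpace X] [ChartedSpace H X] [IsManifold I ∞ X]
  {ι : Type*} {K : FoliatedBundle I X ι} {W W' : Set X}

lemma zero : ∀ {n : ℕ}, IsPrimitiveOn (K := K) (0 : K.Form (n - 1)) (0 : K.Form n) W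
  | 0 => fun _ _ => rfl
  | _ + 1 => ⟨FoliatedBundle.Form.smoothOn_zero _, FoliatedBundle.Form.hasDiffOn_zero W⟩

lemma add : ∀ {n : ℕ} {γ γ' : K.Form (n - 1)} {β β' : K.Form n}, IsPrimitiveOn γ β W →
    IsPrimitiveOn γ' β' W → IsPrimitiveOn (K := K) (γ + γ') (β + β') W
  | 0, _, _, _, _ => fun h h' x hx => by rw [Pi.add_apply, h x hx, h' x hx, add_zero]
  | _ + 1, _, _, _, _ => fun h h' => ⟨h.1.add h'.1, h.2.add h.1 h'.1 h'.2⟩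

lemma smul (c : ℂ) : ∀ {n : ℕ} {γ : K.Form (n - 1)} {β : K.Form n}, IsPrimitiveOn γ β W →
    IsPrimitiveOn (K := K) (c • γ) (c • β) W
  | 0, _, _ => fun h x hx => by rw [Pi.smul_apply, h x hx, smul_zero]
  | _ + 1, _, _ => fun h => ⟨h.1.smul c, h.2.smul c h.1⟩

lemma mono (hW : W' ⊆ W) : ∀ {n : ℕ} {γ : K.Form (n - 1)} {β : K.Form n},
    IsPrimitiveOn γ β W → IsPrimitiveOn γ β W'
  | 0, _, _ => fun h x hx => h x (hW hx)
  | _ + 1, _, _ => fun h => ⟨h.1.mono hW, h.2.mono hW⟩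

lemma sum {κ : Type*} (s : Finset κ) {n : ℕ} {γ : κ → K.Form (n - 1)} {β : κ → K.Form n}
    (h : ∀ j ∈ s, IsPrimitiveOn (γ j) (β j) W) :
    IsPrimitiveOn (K := K) (∑ j ∈ s, γ j) (∑ j ∈ s, β j) W := by
  classical
  induction s using Finset.induction_on with
  | empty => exact zero
  | insert a s ha ih =>
    rw [Finset.sum_insert ha, Finset.sum_insert ha]
    exact (h a (Finset.mem_insert_self a s)).add
      (ih fun j hj => h j (Finset.mem_insert_of_mem hj))

end FoliatedBundle.Form.IsPrimitiveOn

open GeometricQuantization.FoliatedBundle.Form (IsPrimitiveOn)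

variable {E : Type u} [NormedAddCommGroup E] [NormedSpace ℝ E] [FiniteDimensional ℝ E]
  {H : Type*} [TopologicalSpace H] {I : ModelWithCorners ℝ E H} [I.Boundaryless]
  {X : Type*} [TopologicalSpace X] [ChartedSpace H X] [IsManifold I ∞ X]
  {ι : Type*} {K : FoliatedBundle I X ι}
  {R : Type u} [NormedAddCommGroup R] [NormedSpace ℝ R] [FiniteDimensional ℝ R]
  {n : ℕ} {Λ : Type*} {σ : Type*} [Fintype σ] {B : σ → BumpPatch K R}
  {G : Type*} [NormedAddCommGroup G] [NormedSpace ℝ G]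

lemma tsumForm_zero : tsumForm (fun _ : Λ => (0 : K.Form n)) = 0 := by
  funext x
  ext v
  exact (hasSum_tsumForm (γ := fun _ : Λ => (0 : K.Form n)) (x := x)
    (fun _ => summable_zero) v).unique hasSum_zero

lemma FamSummable.isPrimitiveOn (hK : K.IsRegular) (hB : BumpPatch.Covers B) {φ : Λ → G → ℂ} :
    ∀ {n : ℕ} {γ : Λ → smoothForms K (n - 1)} {β : Λ → smoothForms K n},
    FamSummable B φ γ → FamSummable B φ β → (∀ l, IsPrimitiveOn (γ l).1 (β l).1 univ) → ∀ t,
    IsPrimitiveOn (tsumForm fun l => φ l t • (γ l).1) (tsumForm fun l => φ l t • (β l).1) univ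
  | 0, _, β, _, _, hp, t => fun x _ => by
    have : (fun l => φ l t • (β l).1) = fun _ => (0 : K.Form 0) := by
      funext l x
      rw [Pi.smul_apply, hp l x (mem_univ x), smul_zero]
      rfl
    rw [this, tsumForm_zero]
    rfl
  | _ + 1, _, _, h, h', hp, t =>
    ⟨(h.famSmooth hB).smoothOn (mem_univ t), h.hasDiffOn hK hB h' (fun l => (hp l).2) t⟩

variable (K n) in
/-- The space of smooth closed forms. -/
def closedForms : Submodule ℝ (K.Form n) where
  carrier := {α | α.SmoothOn univ ∧ α.HasDiffOn 0 univ}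
  add_mem' ha hb := ⟨ha.1.add hb.1, by
    have := ha.2.add ha.1 hb.1 hb.2
    rwa [add_zero] at this⟩
  zero_mem' := ⟨FoliatedBundle.Form.smoothOn_zero _, FoliatedBundle.Form.hasDiffOn_zero univ⟩
  smul_mem' c α h := ⟨h.1.smul (c : ℂ), by
    have := h.2.smul (c : ℂ) h.1
    rwa [smul_zero] at this⟩

/-- Closed forms as smooth forms. -/
def closedFormsIncl : closedForms K n →ₗ[ℝ] smoothForms K n :=
  Submodule.inclusion fun _ h => h.1

/-- The seminorms on the space of closed forms. -/
def closedSeminorm (B : σ → BumpPatch K R) (s : ℕ) : Seminorm ℝ (closedForms K n) :=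
  (BumpPatch.formSeminorm B s).comp closedFormsIncl

lemma FamSummable.tsum_closed (hK : K.IsRegular) (hB : BumpPatch.Covers B) {φ : Λ → G → ℂ}
    {ζ : Λ → closedForms K n} (h : FamSummable B φ fun l => closedFormsIncl (ζ l)) (t : G) :
    tsumForm (fun l => φ l t • (ζ l).1) ∈ closedForms K n := by
  refine ⟨(h.famSmooth hB).smoothOn (mem_univ t), ?_⟩
  have h0 : FamSummable B φ fun _ : Λ => (0 : smoothForms K (n + 1)) := by
    obtain ⟨hφ, b, hb, -⟩ := h
    refine ⟨hφ, b, hb, fun s s' => ?_⟩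
    simp only [map_zero, mul_zero]
    exact summable_zero
  have h1 := h.hasDiffOn hK hB h0 (fun l => (ζ l).2.2) t
  have h2 : (fun l => φ l t • ((0 : smoothForms K (n + 1)) : K.Form (n + 1))) =
      fun _ : Λ => (0 : K.Form (n + 1)) := funext fun l => smul_zero _
  rw [h2, tsumForm_zero] at h1
  exact h1

lemma summable_of_le_half_pow {V : Type*} [AddCommGroup V] [Module ℝ V]
    {p : ℕ → Seminorm ℝ V} (hp : Monotone p) {g : ℕ → V} (hg : ∀ l, p l (g l) ≤ (1 / 2) ^ l)
    (s : ℕ) : Summable fun l => p s (g l) := by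
  refine Summable.of_norm_bounded_eventually_nat (g := fun l => (1 / 2 : ℝ) ^ l)
    (summable_geometric_of_lt_one (by norm_num) (by norm_num)) ?_
  filter_upwards [eventually_ge_atTop s] with l hl
  rw [Real.norm_of_nonneg (apply_nonneg _ _)]
  exact (hp hl _).trans (hg l)

lemma monotone_closedSeminorm : Monotone (closedSeminorm (n := n) B) := fun _ _ h ζ =>
  BumpPatch.monotone_formSeminorm h (closedFormsIncl ζ)

lemma linearMap_sub_sum {V V' : Type*} [AddCommGroup V] [Module ℝ V] [AddCommGroup V']
    [Module ℝ V'] (f : V →ₗ[ℝ] V') (v : V) (w : Λ → V) (s : Finset Λ) :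
    f (v - ∑ l ∈ s, w l) = f v - ∑ l ∈ s, f (w l) := by
  rw [map_sub, map_sum]

lemma seriesComplete_closedSeminorm (hK : K.IsRegular) (hB : BumpPatch.Covers B) :
    SeriesComplete (closedSeminorm (n := n) B) := by
  intro g hg
  have hsum := summable_of_le_half_pow monotone_closedSeminorm hg
  have h := BumpPatch.famSummable_one (B := B) (g := fun l => closedFormsIncl (g l)) hsum
  refine ⟨⟨_, FamSummable.tsum_closed hK hB h 0⟩, fun j => ?_⟩
  have := BumpPatch.tendsto_formSeminorm_sub_sum hB hsum
    (S := closedFormsIncl ⟨_, FamSummable.tsum_closed hK hB h 0⟩) rfl j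
  refine this.congr fun N => ?_
  change _ = BumpPatch.formSeminorm B j (closedFormsIncl _)
  rw [linearMap_sub_sum closedFormsIncl]

/-- Multiplication of smooth forms by complex numbers. -/
def complexSMul (c : ℂ) (α : smoothForms K n) : smoothForms K n :=
  ⟨c • α.1, FoliatedBundle.Form.SmoothOn.smul c α.2⟩

lemma formSeminorm_complexSMul_le (s : ℕ) (c : ℂ) (α : smoothForms K n) :
    BumpPatch.formSeminorm B s (complexSMul c α) ≤ ‖c‖ * BumpPatch.formSeminorm B s α := by
  refine BumpPatch.formSeminorm_le (by positivity) fun i t ht u => ?_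
  have h1 : (B i).cutLoc (complexSMul c α).1 = fun u => c • (B i).cutLoc α.1 u := by
    funext u
    refine (congrArg ((B i).ρ u • ·) (Patch.loc_smul c α.1 u)).trans ?_
    exact smul_comm ((B i).ρ u) c ((B i).P.loc α.1 u)
  rw [h1, iteratedFDeriv_const_smul_apply' ((((B i).contDiff_cutLoc α.2).of_le
    (by exact_mod_cast le_top)).contDiffAt), norm_smul]
  exact mul_le_mul_of_nonneg_left (BumpPatch.norm_iteratedFDeriv_cutLoc_le α i ht u)
    (norm_nonneg c)

variable {κ : Type*} [Fintype κ]

/-- The triples of a form `γ`, coefficients `c` and a closed form `ζ` such that `γ` is a primitive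
of `ζ - ∑ cⱼ eⱼ`. -/
def primitiveSpace (e : κ → K.Form n) :
    Submodule ℝ (smoothForms K (n - 1) × (κ → ℂ) × closedForms K n) where
  carrier := {g | IsPrimitiveOn g.1.1 (g.2.2.1 - ∑ j, g.2.1 j • e j) univ}
  add_mem' {g g'} h h' := by
    have h1 : (g + g').2.2.1 - ∑ j, (g + g').2.1 j • e j =
        (g.2.2.1 - ∑ j, g.2.1 j • e j) + (g'.2.2.1 - ∑ j, g'.2.1 j • e j) := by
      simp only [Prod.snd_add, Prod.fst_add, Pi.add_apply, add_smul, Finset.sum_add_distrib,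
        Submodule.coe_add]
      abel
    change IsPrimitiveOn (g.1.1 + g'.1.1) ((g + g').2.2.1 - ∑ j, (g + g').2.1 j • e j) univ
    rw [h1]
    exact IsPrimitiveOn.add h h'
  zero_mem' := by
    have h1 : (0 : K.Form n) - ∑ j, (0 : ℂ) • e j = 0 := by simp
    change IsPrimitiveOn (0 : K.Form (n - 1)) ((0 : K.Form n) - ∑ j, (0 : ℂ) • e j) univ
    rw [h1]
    exact IsPrimitiveOn.zero
  smul_mem' c g h := by
    have h1 : (c : ℂ) • g.2.2.1 - ∑ j, ((c : ℂ) * g.2.1 j) • e j =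
        (c : ℂ) • (g.2.2.1 - ∑ j, g.2.1 j • e j) := by
      rw [smul_sub, Finset.smul_sum]
      simp only [mul_smul]
    change IsPrimitiveOn ((c : ℂ) • g.1.1)
      ((c : ℂ) • g.2.2.1 - ∑ j, ((c : ℂ) * g.2.1 j) • e j) univ
    rw [h1]
    exact IsPrimitiveOn.smul (c : ℂ) h

lemma form_sum_apply (s : Finset κ) (f : κ → K.Form n) (x : X) (v : Fin n → K.D x) :
    (∑ j ∈ s, f j) x v = ∑ j ∈ s, f j x v := by
  classical
  induction s using Finset.induction_on with
  | empty => rfl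
  | insert a s ha ih =>
    rw [Finset.sum_insert ha, Finset.sum_insert ha, ← ih]
    rfl

namespace primitiveSpace

variable {e : κ → K.Form n}

instance : AddCommGroup (primitiveSpace e) := (primitiveSpace e).addCommGroup

instance : Module ℝ (primitiveSpace e) := (primitiveSpace e).module

/-- The primitive. -/
def fst (e : κ → K.Form n) : primitiveSpace e →ₗ[ℝ] smoothForms K (n - 1) :=
  LinearMap.fst ℝ _ _ ∘ₗ (primitiveSpace e).subtype

/-- The coefficients. -/
def coef (e : κ → K.Form n) : primitiveSpace e →ₗ[ℝ] κ → ℂ :=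
  LinearMap.fst ℝ _ _ ∘ₗ LinearMap.snd ℝ _ _ ∘ₗ (primitiveSpace e).subtype

/-- The closed form. -/
def form (e : κ → K.Form n) : primitiveSpace e →ₗ[ℝ] closedForms K n :=
  LinearMap.snd ℝ _ _ ∘ₗ LinearMap.snd ℝ _ _ ∘ₗ (primitiveSpace e).subtype

set_option synthInstance.maxHeartbeats 400000 in
/-- The seminorms on the space of primitives. -/
def seminorm (B : σ → BumpPatch K R) (e : κ → K.Form n) (s : ℕ) : Seminorm ℝ (primitiveSpace e) :=
  (BumpPatch.formSeminorm B s).comp (fst e) + (normSeminorm ℝ (κ → ℂ)).comp (coef e) +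
    (closedSeminorm B s).comp (form e)

lemma seminorm_apply (s : ℕ) (g : primitiveSpace e) : seminorm B e s g =
    BumpPatch.formSeminorm B s (fst e g) + ‖coef e g‖ + closedSeminorm B s (form e g) := rfl

lemma fst_le (s : ℕ) (g : primitiveSpace e) :
    BumpPatch.formSeminorm B s (fst e g) ≤ seminorm B e s g := by
  rw [seminorm_apply, add_assoc]
  exact le_add_of_nonneg_right (add_nonneg (norm_nonneg _) (apply_nonneg _ _))

lemma coef_le (s : ℕ) (g : primitiveSpace e) : ‖coef e g‖ ≤ seminorm B e s g := by
  rw [seminorm_apply, add_right_comm]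
  exact le_add_of_nonneg_left (add_nonneg (apply_nonneg _ _) (apply_nonneg _ _))

lemma form_le (s : ℕ) (g : primitiveSpace e) :
    closedSeminorm B s (form e g) ≤ seminorm B e s g := by
  rw [seminorm_apply]
  exact le_add_of_nonneg_left (add_nonneg (apply_nonneg _ _) (norm_nonneg _))

lemma monotone_seminorm : Monotone (seminorm B e) := fun _ _ h _ =>
  add_le_add (add_le_add (BumpPatch.monotone_formSeminorm h _) le_rfl)
    (monotone_closedSeminorm h _)

variable {φ : Λ → G → ℂ} {g : Λ → primitiveSpace e}

/-- The series `∑ φ l t • g l` of elements of the space of primitives converges, together with all its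
derivatives in `t`. -/
def Converges (B : σ → BumpPatch K R) (φ : Λ → G → ℂ) (g : Λ → primitiveSpace e) : Prop :=
  (∀ l, ContDiff ℝ ∞ (φ l)) ∧ ∃ b : ℕ → Λ → ℝ,
    (∀ s l t, ‖iteratedFDeriv ℝ s (φ l) t‖ ≤ b s l) ∧
    ∀ s s', Summable fun l => b s l * seminorm B e s' (g l)

namespace Converges

lemma famSummable_of_le {n' : ℕ} {ζ : Λ → smoothForms K n'} {C : ℕ → ℝ} (h : Converges B φ g)
    (hζ : ∀ s l, BumpPatch.formSeminorm B s (ζ l) ≤ seminorm B e s (g l) * C s) :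
    FamSummable B φ ζ := by
  obtain ⟨hφ, b, hb, hs⟩ := h
  refine ⟨hφ, b, hb, fun s s' => ?_⟩
  have hb0 (l : Λ) : 0 ≤ b s l := (norm_nonneg _).trans (hb s l 0)
  refine Summable.of_nonneg_of_le (fun l => mul_nonneg (hb0 l) (apply_nonneg _ _)) (fun l => ?_)
    ((hs s s').mul_right (C s'))
  rw [mul_assoc]
  exact mul_le_mul_of_nonneg_left (hζ s' l) (hb0 l)

lemma famSummable_fst (h : Converges B φ g) : FamSummable B φ fun l => fst e (g l) :=
  h.famSummable_of_le (C := fun _ => 1) fun s l => by rw [mul_one]; exact fst_le s _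

lemma famSummable_form (h : Converges B φ g) :
    FamSummable B φ fun l => closedFormsIncl (form e (g l)) :=
  h.famSummable_of_le (C := fun _ => 1) fun s l => by rw [mul_one]; exact form_le s _

lemma summable_coef (h : Converges B φ g) : ∃ b : ℕ → Λ → ℝ, (∀ s, Summable (b s)) ∧
    ∀ s l t j, ‖iteratedFDeriv ℝ s (fun t => φ l t * coef e (g l) j) t‖ ≤ b s l := by
  obtain ⟨hφ, b, hb, hs⟩ := h
  refine ⟨fun s l => b s l * seminorm B e 0 (g l), fun s => hs s 0, fun s l t j => ?_⟩
  have h1 : (fun t => φ l t * coef e (g l) j) = fun t => coef e (g l) j • φ l t :=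
    funext fun t => mul_comm _ _
  rw [h1, iteratedFDeriv_const_smul_apply' ((hφ l).of_le (by exact_mod_cast le_top)).contDiffAt,
    norm_smul, mul_comm]
  exact mul_le_mul (hb s l t) ((norm_le_pi_norm _ j).trans (coef_le 0 _)) (norm_nonneg _)
    ((norm_nonneg _).trans (hb s l t))

lemma contDiff_tsum_coef (h : Converges B φ g) (j : κ) :
    ContDiff ℝ ∞ fun t => ∑' l, φ l t * coef e (g l) j := by
  obtain ⟨b, hb, hbb⟩ := h.summable_coef
  exact contDiff_tsum (fun l => (h.1 l).mul contDiff_const) (fun s _ => hb s)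
    fun s l t _ => hbb s l t j

lemma hasSum_coef (h : Converges B φ g) (j : κ) (t : G) :
    HasSum (fun l => φ l t * coef e (g l) j) (∑' l, φ l t * coef e (g l) j) := by
  obtain ⟨b, hb, hbb⟩ := h.summable_coef
  refine (Summable.of_norm_bounded (hb 0) fun l => ?_).hasSum
  have := hbb 0 l t j
  rwa [norm_iteratedFDeriv_zero] at this

/-- The sum of the series is a primitive again. -/
lemma isPrimitiveOn (hK : K.IsRegular) (hB : BumpPatch.Covers B)
    (he : ∀ j, FoliatedBundle.Form.SmoothOn (e j) univ) (h : Converges B φ g) (t : G) :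
    IsPrimitiveOn (tsumForm fun l => φ l t • (fst e (g l)).1)
      ((tsumForm fun l => φ l t • (form e (g l)).1) -
        ∑ j, (∑' l, φ l t * coef e (g l) j) • e j) univ := by
  let es : κ → smoothForms K n := fun j => ⟨e j, he j⟩
  let δ : Λ → smoothForms K n := fun l =>
    ⟨(form e (g l)).1 - ∑ j, coef e (g l) j • e j, by
      have h1 : ∑ j, coef e (g l) j • e j ∈ smoothForms K n :=
        Submodule.sum_mem _ fun j _ => FoliatedBundle.Form.SmoothOn.smul _ (he j)
      exact (smoothForms K n).sub_mem (form e (g l)).2.1 h1⟩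
  have hδ (s : ℕ) (l : Λ) : BumpPatch.formSeminorm B s (δ l) ≤
      seminorm B e s (g l) * (1 + ∑ j, BumpPatch.formSeminorm B s (es j)) := by
    have hδl : δ l = closedFormsIncl (form e (g l)) - ∑ j, complexSMul (coef e (g l) j) (es j) :=
      Subtype.ext (by
        change (form e (g l)).1 - _ = (form e (g l)).1 -
          ((∑ j, complexSMul (coef e (g l) j) (es j) : smoothForms K n) : K.Form n)
        rw [Submodule.coe_sum]
        rfl)
    rw [hδl, mul_add, mul_one, Finset.mul_sum]
    refine (map_sub_le_add _ _ _).trans (add_le_add (form_le s _) ?_)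
    refine (Finset.le_sum_of_subadditive (BumpPatch.formSeminorm B s) (map_zero _).le
      (map_add_le_add _) _ _).trans (Finset.sum_le_sum fun j _ => ?_)
    refine (formSeminorm_complexSMul_le _ _ _).trans ?_
    gcongr
    exact (norm_le_pi_norm _ j).trans (coef_le s _)
  have hfam : FamSummable B φ δ := h.famSummable_of_le hδ
  have key := FamSummable.isPrimitiveOn hK hB h.famSummable_fst hfam (fun l => (g l).2) t
  convert key using 1
  funext x
  ext v
  have h1 := hasSum_tsumForm (fun v => h.famSummable_form.summable_apply hB t x v) v
  have h2 := hasSum_tsumForm (fun v => hfam.summable_apply hB t x v) v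
  have h3 : HasSum (fun l => ∑ j, φ l t * coef e (g l) j * e j x v)
      (∑ j, (∑' l, φ l t * coef e (g l) j) * e j x v) :=
    hasSum_sum fun j _ => (h.hasSum_coef j t).mul_right _
  have hδv (l : Λ) : (δ l).1 x v = (form e (g l)).1 x v - ∑ j, coef e (g l) j * e j x v :=
    congrArg ((form e (g l)).1 x v - ·) (form_sum_apply _ (fun j => coef e (g l) j • e j) x v)
  have h4 := (h1.sub h3).unique (h2.congr_fun fun l => ?_)
  · exact (congrArg (_ - ·) (form_sum_apply _ (fun j => (∑' l, φ l t * coef e (g l) j) • e j)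
      x v)).trans h4
  · refine Eq.trans ?_ (congrArg (φ l t * ·) (hδv l)).symm
    rw [mul_sub, Finset.mul_sum]
    exact congrArg _ (Finset.sum_congr rfl fun j _ => mul_assoc _ _ _)

end Converges

set_option maxHeartbeats 1000000 in
/-- The sum of an absolutely convergent series of triples is formed componentwise, and is a triple
again by `Converges.isPrimitiveOn` with constant coefficient functions. -/
lemma seriesComplete (hK : K.IsRegular) (hB : BumpPatch.Covers B)
    (he : ∀ j, FoliatedBundle.Form.SmoothOn (e j) univ) : SeriesComplete (seminorm B e) := by
  intro g hg
  have hsum := summable_of_le_half_pow monotone_seminorm hg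
  have h : Converges B (fun _ _ => 1 : ℕ → ℝ → ℂ) g := by
    refine ⟨fun l => contDiff_const, fun s _ => if s = 0 then 1 else 0, fun s l t => ?_,
      fun s s' => (hsum s').mul_left _⟩
    dsimp only
    split_ifs with hs
    · rw [hs, norm_iteratedFDeriv_zero, norm_one]
    · rw [iteratedFDeriv_const_of_ne hs]
      simp
  have hc (s : ℕ) : Summable fun l => closedSeminorm B s (form e (g l)) :=
    Summable.of_nonneg_of_le (fun _ => apply_nonneg _ _) (fun l => form_le s _) (hsum s)
  have hf (s : ℕ) : Summable fun l => BumpPatch.formSeminorm B s (fst e (g l)) :=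
    Summable.of_nonneg_of_le (fun _ => apply_nonneg _ _) (fun l => fst_le s _) (hsum s)
  have hk : Summable fun l => coef e (g l) :=
    Summable.of_norm_bounded (hsum 0) fun l => coef_le 0 _
  let S : primitiveSpace e := ⟨(⟨_, (h.famSummable_fst.famSmooth hB).smoothOn (mem_univ 0)⟩,
    fun j => ∑' l, 1 * coef e (g l) j, ⟨_, h.famSummable_form.tsum_closed hK hB 0⟩),
      h.isPrimitiveOn hK hB he 0⟩
  have hcoef : HasSum (fun l => coef e (g l)) (coef e S) := by
    convert hk.hasSum
    funext j
    rw [tsum_apply hk]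
    exact tsum_congr fun l => one_mul _
  refine ⟨S, fun j => ?_⟩
  have t1 := BumpPatch.tendsto_formSeminorm_sub_sum hB hf (S := fst e S) rfl j
  have t2 : Tendsto (fun N => ‖coef e S - ∑ l ∈ Finset.range N, coef e (g l)‖) atTop (𝓝 0) := by
    have := (hcoef.tendsto_sum_nat.const_sub (coef e S)).norm
    rwa [sub_self, norm_zero] at this
  have t3 := BumpPatch.tendsto_formSeminorm_sub_sum hB hc (S := closedFormsIncl (form e S)) rfl j
  have t := (t1.add t2).add t3
  rw [add_zero, add_zero] at t
  refine t.congr fun N => ?_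
  exact (congrArg₂ (· + ·) (congrArg₂ (· + ·)
    (congrArg (BumpPatch.formSeminorm B j) (linearMap_sub_sum (fst e) S g (Finset.range N)))
    (congrArg norm (linearMap_sub_sum (coef e) S g (Finset.range N))))
    (congrArg (BumpPatch.formSeminorm B j)
      (linearMap_sub_sum (closedFormsIncl ∘ₗ form e) S g (Finset.range N)))).symm

end primitiveSpace

end PrimitiveSpace

section FamilyLift

set_option linter.unusedSectionVars false

open Filter Topology MeasureTheory
open GeometricQuantization.FoliatedBundle.Form (IsPrimitiveOn)

universe u

/-! ### Primitives of families of closed forms -/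

variable {E : Type u} [NormedAddCommGroup E] [NormedSpace ℝ E] [FiniteDimensional ℝ E]
  {H : Type*} [TopologicalSpace H] {I : ModelWithCorners ℝ E H} [I.Boundaryless]
  {X : Type*} [TopologicalSpace X] [ChartedSpace H X] [IsManifold I ∞ X]
  {ι : Type*} {K : FoliatedBundle I X ι}
  {R : Type u} [NormedAddCommGroup R] [NormedSpace ℝ R] [FiniteDimensional ℝ R]
  {n k : ℕ} {σ : Type*} [Fintype σ] {B : σ → BumpPatch K R}

lemma FamSmooth.comp {G G' : Type*} [NormedAddCommGroup G] [NormedSpace ℝ G]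
    [NormedAddCommGroup G'] [NormedSpace ℝ G'] {b : G → K.Form n} {f : G' → G} {Ω : Set G}
    {Ω' : Set G'} (hb : FamSmooth R b Ω) (hf : ContDiffOn ℝ ∞ f Ω') (hΩ : MapsTo f Ω' Ω) :
    FamSmooth R (fun t => b (f t)) Ω' := fun x => by
  obtain ⟨P, hP, h⟩ := hb x
  exact ⟨P, hP, ContDiffOn.comp (g := fun w : E × G => P.loc (b w.2) w.1)
    (f := fun w : E × G' => (w.1, f w.2)) h
    (contDiffOn_fst.prodMk (hf.comp contDiffOn_snd fun w hw => hw.2))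
    fun w hw => ⟨hw.1, hΩ hw.2⟩⟩

lemma FamSmooth.continuousOn_apply {G : Type*} [NormedAddCommGroup G] [NormedSpace ℝ G]
    {b : G → K.Form n} {Ω : Set G} (hb : FamSmooth R b Ω) (x : X) (v : Fin n → K.D x) :
    ContinuousOn (fun t => b t x v) Ω := by
  obtain ⟨P, hP, h⟩ := hb x
  have hu : extChartAt I P.pt x ∈ P.img univ := Patch.chart_mem_img hP (mem_univ x)
  have h1 : ContinuousOn (fun t => P.loc (b t) (extChartAt I P.pt x)) Ω :=
    ContinuousOn.comp (g := fun w : E × G => P.loc (b w.2) w.1)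
      (f := fun t => (extChartAt I P.pt x, t)) h.continuousOn
      (Continuous.prodMk_right _).continuousOn fun t ht => ⟨hu, ht⟩
  have h2 : ContinuousOn (fun t => (P.factor x)⁻¹ *
      P.loc (b t) (extChartAt I P.pt x) fun j => P.coframe x (v j)) Ω :=
    ((ContinuousAlternatingMap.apply ℝ R ℂ
      fun j => P.coframe x (v j)).continuous.comp_continuousOn h1).const_mul _
  refine h2.congr fun t _ => ?_
  dsimp only
  rw [Patch.loc_chart_apply _ hP]
  simp only [Patch.frame_coframe hP]
  rw [inv_mul_cancel_left₀ (Patch.factor_ne_zero hP)]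

/-- The Fourier coefficients of a family of forms that depends periodically on a parameter. -/
def fourierForm (b : (Fin k → ℝ) → K.Form n) (l : Fin k → ℤ) : K.Form n :=
  integralForm volume (Icc 0 1) fun t => fourierMode (-l) t • b t

lemma real_smul_integral_smul {V : Type*} [NormedAddCommGroup V] [NormedSpace ℝ V]
    [NormedSpace ℂ V] [IsScalarTower ℝ ℂ V] (c : ℝ) {T : Set (Fin k → ℝ)} (φ : (Fin k → ℝ) → ℂ)
    (f : (Fin k → ℝ) → V) : c • ∫ t in T, φ t • f t = ∫ t in T, φ t • c • f t := by
  rw [← integral_smul]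
  simp only [smul_comm c]

section Periodic

variable {b : (Fin k → ℝ) → K.Form n}

lemma contDiffOn_loc_fourierMode_smul {P : Patch K R}
    (hb : ContDiffOn ℝ ∞ (fun w : E × (Fin k → ℝ) => P.loc (b w.2) w.1) (P.img univ ×ˢ univ))
    (l : Fin k → ℤ) :
    ContDiffOn ℝ ∞ (fun w : E × (Fin k → ℝ) => P.loc (fourierMode l w.2 • b w.2) w.1)
      (P.img univ ×ˢ univ) :=
  ((((contDiff_fourierMode l).comp contDiff_snd).contDiffOn).smul hb).congr
    fun _ _ => Patch.loc_smul _ _ _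

lemma fourierForm_mem_closedForms (hK : K.IsRegular) (hb : FamSmooth R b univ)
    (hd : ∀ t, (b t).HasDiffOn 0 univ) (l : Fin k → ℤ) : fourierForm b l ∈ closedForms K n := by
  have hs (t : Fin k → ℝ) : (b t).SmoothOn univ := hb.smoothOn (mem_univ t)
  refine ⟨smoothOn_integralForm (R := R) isCompact_Icc isOpen_univ fun x _ => ?_, ?_⟩
  · obtain ⟨P, hP, h⟩ := hb x
    exact ⟨P, hP, contDiffOn_loc_fourierMode_smul h (-l)⟩
  · have h0 : integralForm volume (Icc (0 : Fin k → ℝ) 1) (fun _ => (0 : K.Form (n + 1))) = 0 := by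
      funext x
      ext v
      refine (integralForm_apply (γ := fun _ => (0 : K.Form (n + 1)))
        (fun v => integrableOn_zero) v).trans ?_
      exact integral_zero _ _
    have := hasDiffOn_integralForm (R := R) (μ := volume) (T := Icc (0 : Fin k → ℝ) 1)
      (γ := fun t => fourierMode (-l) t • b t) (δ := fun _ => 0) hK isCompact_Icc isOpen_univ
      fun x _ => ?_
    · rwa [h0] at this
    · obtain ⟨P, hP, h⟩ := hb x
      refine ⟨P, hP, contDiffOn_loc_fourierMode_smul h (-l), ?_, fun t _ u hu => ?_⟩
      · simp only [Patch.loc_zero]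
        exact contDiffOn_const
      · have h1 := (hd t).smul (fourierMode (-l) t) (hs t)
        rw [smul_zero] at h1
        exact PullData.d_loc hK isOpen_univ (FoliatedBundle.Form.SmoothOn.smul _ (hs t)) h1 hu

variable (hb : ∀ P : Patch K R, ContDiffOn ℝ ∞ (fun w : E × (Fin k → ℝ) => P.loc (b w.2) w.1)
  (P.img univ ×ˢ univ)) (hper : ∀ t m, b (t + Pi.single m 1) = b t)
include hb

lemma cutLoc_fourierForm (i : σ) (l : Fin k → ℤ) :
    (B i).cutLoc (fourierForm b l) =
      fourierCoef (fun w : E × (Fin k → ℝ) => (B i).ρ w.1 • (B i).P.loc (b w.2) w.1) l := by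
  funext u
  by_cases hu : u ∈ (B i).P.img univ
  · have h1 := loc_integralForm (μ := volume) (T := Icc (0 : Fin k → ℝ) 1)
      (γ := fun t => fourierMode (-l) t • b t) isCompact_Icc
      (contDiffOn_loc_fourierMode_smul (hb (B i).P) (-l)) hu
    simp only [Patch.loc_smul] at h1
    exact (congrArg ((B i).ρ u • ·) h1).trans (real_smul_integral_smul ((B i).ρ u)
      (fourierMode (-l)) fun t => (B i).P.loc (b t) u)
  · have hρ : (B i).ρ u = 0 := image_eq_zero_of_notMem_tsupport fun h => hu ((B i).tsupport_ρ h)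
    rw [BumpPatch.cutLoc_eq_zero _ _ hu, fourierCoef]
    dsimp only
    rw [hρ]
    exact ((real_smul_integral_smul 0 (fourierMode (-l)) fun t => (B i).P.loc (b t) u).symm.trans
      (zero_smul ℝ (∫ t in Icc (0 : Fin k → ℝ) 1, fourierMode (-l) t • (B i).P.loc (b t) u))).symm

include hper in
lemma isPeriodicOver_cutLoc (i : σ) :
    IsPeriodicOver (fun w : E × (Fin k → ℝ) => (B i).ρ w.1 • (B i).P.loc (b w.2) w.1)
      (tsupport (B i).ρ) where
  contDiff := by
    have := (B i).contDiff_smul_of_contDiffOn isOpen_univ (hb (B i).P)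
    rwa [univ_prod_univ, contDiffOn_univ] at this
  periodic u t m := by
    dsimp only
    rw [hper]
  isCompact := (B i).hasCompactSupport_ρ
  eq_zero u hu t := by
    dsimp only
    rw [image_eq_zero_of_notMem_tsupport hu]
    exact zero_smul ℝ ((B i).P.loc (b t) u)

include hper in
/-- The Fourier coefficients of a smooth periodic family of forms are rapidly decreasing. -/
lemma exists_decay_fourierForm (hz : ∀ l, (fourierForm b l).SmoothOn univ) (j s : ℕ) :
    ∃ C, ∀ l, fourierWeight l ^ s *
      BumpPatch.formSeminorm B j (⟨fourierForm b l, hz l⟩ : smoothForms K n) ≤ C := by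
  choose C hC using fun (i : σ) (t : ℕ) =>
    (isPeriodicOver_cutLoc (B := B) hb hper i).exists_decay t s
  refine ⟨∑ i, ∑ t ∈ Finset.range (j + 1), |C i t|, fun l => ?_⟩
  have hw := pow_pos (fourierWeight_pos l) s
  rw [← le_div_iff₀' hw]
  have h0 : 0 ≤ ∑ i, ∑ t ∈ Finset.range (j + 1), |C i t| :=
    Finset.sum_nonneg fun i _ => Finset.sum_nonneg fun t _ => abs_nonneg _
  refine BumpPatch.formSeminorm_le (div_nonneg h0 hw.le) fun i t ht u => ?_
  rw [le_div_iff₀' hw, cutLoc_fourierForm hb]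
  refine (hC i t l u).trans ((le_abs_self _).trans ?_)
  refine (Finset.single_le_sum (f := fun t => |C i t|) (fun _ _ => abs_nonneg _)
    (Finset.mem_range.2 (Nat.lt_succ_of_le ht))).trans ?_
  exact Finset.single_le_sum (f := fun i => ∑ t ∈ Finset.range (j + 1), |C i t|)
    (fun _ _ => Finset.sum_nonneg fun _ _ => abs_nonneg _) (Finset.mem_univ i)

end Periodic

variable {κ : Type*} [Fintype κ] {e : κ → K.Form n}

/-- Rapidly decreasing families of closed forms have rapidly decreasing primitives, by the open
mapping theorem. -/
lemma exists_converges (hK : K.IsRegular) (hB : BumpPatch.Covers B)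
    (he : ∀ j, FoliatedBundle.Form.SmoothOn (e j) univ)
    (hspan : ∀ β ∈ closedForms K n, ∃ (γ : K.Form (n - 1)) (c : κ → ℂ), γ.SmoothOn univ ∧
      IsPrimitiveOn γ (β - ∑ j, c j • e j) univ)
    {z : (Fin k → ℤ) → closedForms K n}
    (hz : ∀ j s : ℕ, ∃ C, ∀ l, fourierWeight l ^ s * closedSeminorm B j (z l) ≤ C) :
    ∃ g : (Fin k → ℤ) → primitiveSpace e, (∀ l, primitiveSpace.form e (g l) = z l) ∧
      primitiveSpace.Converges B fourierMode g := by
  have hsurj : Function.Surjective (primitiveSpace.form e) := fun ζ => by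
    obtain ⟨γ, c, hγ, h⟩ := hspan ζ.1 ζ.2
    exact ⟨⟨(⟨γ, hγ⟩, c, ζ), h⟩, rfl⟩
  have hsep (ζ : closedForms K n) (h : ∀ j, closedSeminorm B j ζ = 0) : ζ = 0 :=
    Subtype.ext (congrArg Subtype.val (BumpPatch.eq_zero_of_formSeminorm hB h) :)
  obtain ⟨g, hg, hdec⟩ := exists_rapidly_decreasing_lift primitiveSpace.monotone_seminorm
    monotone_closedSeminorm (primitiveSpace.seriesComplete hK hB he)
    (seriesComplete_closedSeminorm hK hB) (primitiveSpace.form e) hsurj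
    (fun j g => primitiveSpace.form_le j g) hsep one_le_fourierWeight (tendsto_fourierWeight k) hz
  refine ⟨g, hg, contDiff_fourierMode, fun s l => (2 * Real.pi) ^ s * fourierWeight l ^ s,
    norm_iteratedFDeriv_fourierMode_le, fun s s' => ?_⟩
  refine Summable.of_norm_bounded_eventually
    ((summable_inv_fourierWeight_pow k).mul_left ((2 * Real.pi) ^ s)) ?_
  -- The exponent `s` pays for the derivatives of the Fourier modes, and `2 * k + 2` for summability.
  filter_upwards [hdec (max s' (s + (2 * k + 2)))] with l hl
  have hw := fourierWeight_pos l
  have hp : primitiveSpace.seminorm B e s' (g l) ≤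
      primitiveSpace.seminorm B e (max s' (s + (2 * k + 2))) (g l) :=
    primitiveSpace.monotone_seminorm (le_max_left _ _) _
  have h1 : fourierWeight l ^ (s + (2 * k + 2)) * primitiveSpace.seminorm B e s' (g l) ≤ 1 :=
    (mul_le_mul (pow_le_pow_right₀ (one_le_fourierWeight l) (le_max_right _ _)) hp
      (apply_nonneg _ _) (pow_nonneg hw.le _)).trans hl
  rw [Real.norm_of_nonneg (mul_nonneg (by positivity) (apply_nonneg _ _)), mul_assoc]
  refine mul_le_mul_of_nonneg_left ?_ (by positivity)
  rw [pow_add, mul_right_comm] at h1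
  exact (le_div_iff₀ (pow_pos hw _)).2 h1 |>.trans_eq (one_div _)

/-- A smooth family of closed forms that depends on a parameter through the sines of `k` angles has
a smooth family of primitives modulo the forms `e j`. -/
lemma exists_primitive_sin (hK : K.IsRegular) (hB : BumpPatch.Covers B)
    (he : ∀ j, FoliatedBundle.Form.SmoothOn (e j) univ)
    (hspan : ∀ β ∈ closedForms K n, ∃ (γ : K.Form (n - 1)) (c : κ → ℂ), γ.SmoothOn univ ∧
      IsPrimitiveOn γ (β - ∑ j, c j • e j) univ)
    {h : (Fin k → ℝ) → K.Form n} {b : (Fin k → ℝ) → K.Form n}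
    (hbh : ∀ t, b t = h fun i => Real.sin (2 * Real.pi * t i))
    (hh : ∀ x v, ContinuousOn (fun y => h y x v) (Icc (-1) 1)) (h𝒰 : ∀ x, ∃ P : Patch K R, x ∈ P.N)
    (hb : ∀ P : Patch K R, ContDiffOn ℝ ∞ (fun w : E × (Fin k → ℝ) => P.loc (b w.2) w.1)
      (P.img univ ×ˢ univ))
    (hd : ∀ t, (b t).HasDiffOn 0 univ) :
    ∃ (a : (Fin k → ℝ) → K.Form (n - 1)) (f : κ → (Fin k → ℝ) → ℂ), FamSmooth R a univ ∧
      (∀ j, ContDiff ℝ ∞ (f j)) ∧ ∀ t, IsPrimitiveOn (a t) (b t - ∑ j, f j t • e j) univ := by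
  have hb' : FamSmooth R b univ := fun x => (h𝒰 x).imp fun P hP => ⟨hP, hb P⟩
  have hper (t : Fin k → ℝ) (m : Fin k) : b (t + Pi.single m 1) = b t := by
    rw [hbh, hbh]
    congr 1
    funext i
    by_cases hi : i = m
    · subst hi
      rw [Pi.add_apply, Pi.single_eq_same, mul_add, mul_one, Real.sin_add_two_pi]
    · rw [Pi.add_apply, Pi.single_eq_of_ne hi, add_zero]
  have hz := fourierForm_mem_closedForms hK hb' hd
  obtain ⟨g, hg, hconv⟩ := exists_converges (z := fun l => ⟨fourierForm b l, hz l⟩) hK hB he hspan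
    fun j s => exists_decay_fourierForm hb hper (fun l => (hz l).1) j s
  refine ⟨_, fun j t => ∑' l, fourierMode l t * primitiveSpace.coef e (g l) j,
    hconv.famSummable_fst.famSmooth hB, hconv.contDiff_tsum_coef, fun t => ?_⟩
  convert hconv.isPrimitiveOn hK hB he t using 2
  funext x
  ext v
  have hint (l : Fin k → ℤ) : fourierForm b l x v = ∫ t in Icc (0 : Fin k → ℝ) 1,
      fourierMode (-l) t * h (fun i => Real.sin (2 * Real.pi * t i)) x v := by
    obtain ⟨P, hP⟩ := h𝒰 x
    have h1 (v : Fin n → K.D x) := integrableOn_form (μ := volume) (T := Icc (0 : Fin k → ℝ) 1)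
      (γ := fun t => fourierMode (-l) t • b t) (P := P) (W := univ) isCompact_Icc
      (contDiffOn_loc_fourierMode_smul (hb P) (-l)) (mem_univ x) hP v
    refine (integralForm_apply (γ := fun t => fourierMode (-l) t • b t) h1 v).trans ?_
    refine setIntegral_congr_fun measurableSet_Icc fun t _ => ?_
    exact congrArg (fun β : K.Form n => fourierMode (-l) t * β x v) (hbh t)
  have hs0 (t : Fin k → ℝ) := hconv.famSummable_form.summable_apply hB t x v
  have hterm (t : Fin k → ℝ) (l : Fin k → ℤ) : (fourierMode l t • (closedFormsIncl
      (primitiveSpace.form e (g l))).1) x v = fourierMode l t * ∫ t in Icc (0 : Fin k → ℝ) 1,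
      fourierMode (-l) t * h (fun i => Real.sin (2 * Real.pi * t i)) x v := by
    rw [hg, ← hint]
    rfl
  have hsum : Summable fun l : Fin k → ℤ => ∫ t in Icc (0 : Fin k → ℝ) 1,
      fourierMode (-l) t * h (fun i => Real.sin (2 * Real.pi * t i)) x v := by
    refine (hs0 0).congr fun l => ?_
    rw [hterm, show fourierMode l 0 = 1 by simp [fourierMode], one_mul]
  have h1 := hasSum_fourierMode (h := fun y => h y x v) (hh x v) hsum t
  have h2 := hasSum_tsumForm (fun v => hconv.famSummable_form.summable_apply hB t x v) v
  simp only [hterm] at h2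
  rw [hbh]
  exact h1.unique h2

end FamilyLift

section LocalLift

set_option linter.unusedSectionVars false

open Filter Topology
open GeometricQuantization.FoliatedBundle.Form (IsPrimitiveOn)

universe u

/-! ### Local families of closed forms -/

/-- The point with coordinates `c i + r * y i`. -/
def cubePoint {k : ℕ} (c : EuclideanSpace ℝ (Fin k)) (r : ℝ) (y : Fin k → ℝ) :
    EuclideanSpace ℝ (Fin k) := c + r • WithLp.toLp 2 y

lemma contDiff_cubePoint {k : ℕ} (c : EuclideanSpace ℝ (Fin k)) (r : ℝ) :
    ContDiff ℝ ∞ (cubePoint c r) :=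
  contDiff_const.add (ContDiff.smul (f := fun _ => r) (g := fun y : Fin k → ℝ => WithLp.toLp 2 y)
    contDiff_const PiLp.contDiff_toLp)

/-- An open set contains a cube around each of its points. -/
lemma exists_cubePoint_mem {k : ℕ} {Ω : Set (EuclideanSpace ℝ (Fin k))} (hΩ : IsOpen Ω)
    {c : EuclideanSpace ℝ (Fin k)} (hc : c ∈ Ω) :
    ∃ r > 0, ∀ y ∈ Icc (-1 : Fin k → ℝ) 1, cubePoint c r y ∈ Ω := by
  obtain ⟨ε, hε, hball⟩ := Metric.isOpen_iff.1 hΩ c hc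
  obtain ⟨C, hC⟩ := (isCompact_Icc (a := (-1 : Fin k → ℝ)) (b := 1)).exists_bound_of_continuousOn
    (PiLp.continuous_toLp 2 fun _ : Fin k => ℝ).continuousOn
  have hC0 : 0 < |C| + 1 := by positivity
  refine ⟨ε / (|C| + 1), div_pos hε hC0, fun y hy => hball ?_⟩
  rw [cubePoint, Metric.mem_ball, dist_self_add_left, norm_smul,
    Real.norm_of_nonneg (by positivity), div_mul_eq_mul_div, div_lt_iff₀ hC0]
  exact mul_lt_mul_of_pos_left (((hC y hy).trans (le_abs_self C)).trans_lt (lt_add_one _)) hε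

/-- The angles with given sines, for points of a cube. -/
def cubeAngle {k : ℕ} (c : EuclideanSpace ℝ (Fin k)) (r : ℝ) (x : EuclideanSpace ℝ (Fin k))
    (i : Fin k) : ℝ := Real.arcsin ((x i - c i) / r) / (2 * Real.pi)

/-- The open cube with centre `c`. -/
def cube {k : ℕ} (c : EuclideanSpace ℝ (Fin k)) (r : ℝ) : Set (EuclideanSpace ℝ (Fin k)) :=
  {x | ∀ i, (x i - c i) / r ∈ Ioo (-1 : ℝ) 1}

lemma isOpen_cube {k : ℕ} (c : EuclideanSpace ℝ (Fin k)) (r : ℝ) : IsOpen (cube c r) := by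
  have : cube c r = ⋂ i, (fun x => (x i - c i) / r) ⁻¹' Ioo (-1 : ℝ) 1 := by
    ext x
    simp [cube]
  rw [this]
  exact isOpen_iInter_of_finite fun i => isOpen_Ioo.preimage (by fun_prop)

lemma contDiffOn_cubeAngle {k : ℕ} (c : EuclideanSpace ℝ (Fin k)) (r : ℝ) :
    ContDiffOn ℝ ∞ (cubeAngle c r) (cube c r) := by
  refine contDiffOn_pi.2 fun i x hx => ContDiffAt.contDiffWithinAt ?_
  have h1 : ContDiffAt ℝ ∞ (fun x : EuclideanSpace ℝ (Fin k) => (x i - c i) / r) x := by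
    fun_prop
  exact ((Real.contDiffAt_arcsin (hx i).1.ne' (hx i).2.ne).comp x h1).div_const _

lemma cubePoint_sin_cubeAngle {k : ℕ} {c : EuclideanSpace ℝ (Fin k)} {r : ℝ} (hr : 0 < r)
    {x : EuclideanSpace ℝ (Fin k)} (hx : x ∈ cube c r) :
    cubePoint c r (fun i => Real.sin (2 * Real.pi * cubeAngle c r x i)) = x := by
  ext i
  have h1 : 2 * Real.pi * cubeAngle c r x i = Real.arcsin ((x i - c i) / r) := by
    rw [cubeAngle]
    field_simp
  change c i + r * Real.sin (2 * Real.pi * cubeAngle c r x i) = x i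
  rw [h1, Real.sin_arcsin (hx i).1.le (hx i).2.le]
  field_simp
  ring

variable {E : Type u} [NormedAddCommGroup E] [NormedSpace ℝ E] [FiniteDimensional ℝ E]
  {H : Type*} [TopologicalSpace H] {I : ModelWithCorners ℝ E H} [I.Boundaryless]
  {X : Type*} [TopologicalSpace X] [ChartedSpace H X] [IsManifold I ∞ X] [CompactSpace X]
  {ι : Type*} {K : FoliatedBundle I X ι}
  {R : Type u} [NormedAddCommGroup R] [NormedSpace ℝ R] [FiniteDimensional ℝ R]
  {n k : ℕ} {κ : Type*} [Fintype κ] {e : κ → K.Form n}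

/-- If the classes of finitely many closed forms span the cohomology of a compact manifold, then a
smooth family of closed forms locally has smooth coefficients and smooth primitives. -/
theorem exists_famSmooth_isPrimitiveOn (hK : K.IsRegular) (h𝒰 : ∀ x, ∃ P : Patch K R, x ∈ P.N)
    (he : ∀ j, FoliatedBundle.Form.SmoothOn (e j) univ)
    (hspan : ∀ β ∈ closedForms K n, ∃ (γ : K.Form (n - 1)) (c : κ → ℂ), γ.SmoothOn univ ∧
      IsPrimitiveOn γ (β - ∑ j, c j • e j) univ)
    {b : EuclideanSpace ℝ (Fin k) → K.Form n} {Ω : Set (EuclideanSpace ℝ (Fin k))}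
    (hΩ : IsOpen Ω)
    (hb : ∀ P : Patch K R, ContDiffOn ℝ ∞
      (fun w : E × EuclideanSpace ℝ (Fin k) => P.loc (b w.2) w.1) (P.img univ ×ˢ Ω))
    (hd : ∀ x ∈ Ω, (b x).HasDiffOn 0 univ) {c : EuclideanSpace ℝ (Fin k)} (hc : c ∈ Ω) :
    ∃ O, IsOpen O ∧ c ∈ O ∧ ∃ (a : EuclideanSpace ℝ (Fin k) → K.Form (n - 1))
      (f : κ → EuclideanSpace ℝ (Fin k) → ℂ), FamSmooth R a O ∧ (∀ j, ContDiffOn ℝ ∞ (f j) O) ∧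
      ∀ x ∈ O, IsPrimitiveOn (a x) (b x - ∑ j, f j x • e j) univ := by
  obtain ⟨N, B, hB⟩ := BumpPatch.exists_covers h𝒰
  obtain ⟨r, hr, hcube⟩ := exists_cubePoint_mem hΩ hc
  have hmem (t : Fin k → ℝ) : cubePoint c r (fun i => Real.sin (2 * Real.pi * t i)) ∈ Ω :=
    hcube _ ⟨fun i => Real.neg_one_le_sin _, fun i => Real.sin_le_one _⟩
  have hsmooth : ContDiff ℝ ∞ fun t : Fin k → ℝ =>
      cubePoint c r fun i => Real.sin (2 * Real.pi * t i) :=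
    (contDiff_cubePoint c r).comp (contDiff_pi.2 fun i =>
      Real.contDiff_sin.comp (contDiff_const.mul (contDiff_apply ℝ ℝ i)))
  have hb' : FamSmooth R b Ω := fun x => (h𝒰 x).imp fun P hP => ⟨hP, hb P⟩
  obtain ⟨a, f, ha, hf, h⟩ := exists_primitive_sin (k := k) hK hB he hspan
    (h := fun y => b (cubePoint c r y))
    (b := fun t => b (cubePoint c r fun i => Real.sin (2 * Real.pi * t i))) (fun _ => rfl)
    (fun x v => (hb'.continuousOn_apply x v).comp (contDiff_cubePoint c r).continuous.continuousOn
      hcube) h𝒰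
    (fun P => ContDiffOn.comp (g := fun w : E × EuclideanSpace ℝ (Fin k) => P.loc (b w.2) w.1)
      (f := fun w : E × (Fin k → ℝ) =>
        (w.1, cubePoint c r fun i => Real.sin (2 * Real.pi * w.2 i))) (hb P)
      (contDiff_fst.prodMk (hsmooth.comp contDiff_snd)).contDiffOn fun w hw => ⟨hw.1, hmem _⟩)
    fun t => hd _ (hmem t)
  refine ⟨cube c r, isOpen_cube c r, fun i => by simp, fun x => a (cubeAngle c r x),
    fun j x => f j (cubeAngle c r x), ha.comp (contDiffOn_cubeAngle c r) fun _ _ => mem_univ _,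
    fun j => (hf j).comp_contDiffOn (contDiffOn_cubeAngle c r), fun x hx => ?_⟩
  have := h (cubeAngle c r x)
  rwa [cubePoint_sin_cubeAngle hr hx] at this

end LocalLift

section Flat

set_option linter.unusedSectionVars false

open GeometricQuantization.FoliatedBundle.Form (IsPrimitiveOn)

/-! ### Flat sections over the phase space -/

section PrimitiveLocality

variable {E : Type*} [NormedAddCommGroup E] [NormedSpace ℝ E]
  {H : Type*} [TopologicalSpace H] {I : ModelWithCorners ℝ E H}
  {X : Type*} [TopologicalSpace X] [ChartedSpace H X] [IsManifold I ∞ X]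
  {ι : Type*} {K : FoliatedBundle I X ι} {W : Set X}

lemma FoliatedBundle.Form.IsPrimitiveOn.congr : ∀ {n : ℕ} {γ γ' : K.Form (n - 1)}
    {β β' : K.Form n}, IsPrimitiveOn γ β W → (∀ x ∈ W, γ' x = γ x) → (∀ x ∈ W, β' x = β x) →
    IsPrimitiveOn γ' β' W
  | 0, _, _, _, _ => fun h _ hβ x hx => (hβ x hx).trans (h x hx)
  | _ + 1, _, _, _, _ => fun h hγ hβ => ⟨h.1.congr hγ, h.2.congr hγ hβ⟩

lemma FoliatedBundle.Form.isPrimitiveOn_of_nhds : ∀ {n : ℕ} {γ : K.Form (n - 1)} {β : K.Form n},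
    (∀ x ∈ W, ∃ N : Set X, IsOpen N ∧ x ∈ N ∧ IsPrimitiveOn γ β (W ∩ N)) → IsPrimitiveOn γ β W
  | 0, _, _ => fun h x hx => by
    obtain ⟨N, -, hxN, hN⟩ := h x hx
    exact hN x ⟨hx, hxN⟩
  | _ + 1, _, _ => fun h =>
    ⟨FoliatedBundle.Form.smoothOn_of_nhds fun x hx => by
      obtain ⟨N, hN, hxN, h1⟩ := h x hx
      exact ⟨N, hN, hxN, h1.1⟩,
    FoliatedBundle.Form.hasDiffOn_of_nhds fun x hx => by
      obtain ⟨N, hN, hxN, h1⟩ := h x hx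
      exact ⟨N, hN, hxN, h1.2⟩⟩

lemma mem_coboundaries_iff {C : Set X} : ∀ {n : ℕ} {β : K.Form n}, β ∈ K.coboundaries C n ↔
    ∃ W, IsOpen W ∧ C ⊆ W ∧ ∃ γ : K.Form (n - 1), IsPrimitiveOn γ β W
  | 0, _ => ⟨fun ⟨W, hW, hC, h⟩ => ⟨W, hW, hC, 0, h⟩, fun ⟨W, hW, hC, _, h⟩ => ⟨W, hW, hC, h⟩⟩
  | _ + 1, _ => Iff.rfl

end PrimitiveLocality

variable {k : ℕ} {θ : PhaseSpace k → PhaseSpace k →L[ℝ] ℝ}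

/-- A function that is the exponential of a primitive of `θ` along the leaves: multiplication with
it removes `θ` from the connection. -/
lemma IsPrimitive.exists_gauge (hθ : IsPrimitive k θ) : ∃ s : PhaseSpace k → ℂ,
    ContDiff ℝ ∞ s ∧ (∀ z, s z ≠ 0) ∧ ∀ z r, fderiv ℝ s z (0, r) =
      Complex.I * (θ z (0, r) : ℂ) * s z := by
  -- `θ + ∑ yᵢ dxᵢ` is closed, and agrees with `θ` along the leaves.
  let L : EuclideanSpace ℝ (Fin k) →L[ℝ] PhaseSpace k →L[ℝ] ℝ :=
    (ContinuousLinearMap.compL ℝ (PhaseSpace k) (EuclideanSpace ℝ (Fin k)) ℝ).flip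
      (ContinuousLinearMap.fst ℝ _ _) ∘L (innerSL ℝ)
  let η : PhaseSpace k → PhaseSpace k →L[ℝ] ℝ := fun z => θ z + L z.2
  have hL (y : EuclideanSpace ℝ (Fin k)) (v : PhaseSpace k) : L y v = inner ℝ y v.1 := rfl
  have hη : ContDiff ℝ ∞ η := hθ.smooth.add (L.contDiff.comp contDiff_snd)
  have hdη (z : PhaseSpace k) : fderiv ℝ η z = fderiv ℝ θ z + L ∘L ContinuousLinearMap.snd ℝ _ _ :=
    ((hθ.smooth.differentiable (by simp) z).hasFDerivAt.add
      (L.hasFDerivAt.comp z hasFDerivAt_snd)).fderiv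
  obtain ⟨g, hg⟩ := convex_univ.exists_forall_hasFDerivAt_of_fderiv_symmetric isOpen_univ
    (hη.differentiable (by simp)).differentiableOn fun z _ u v => by
      have h1 := hθ.d_eq z u v
      have h2 : fderiv ℝ η z u v = fderiv ℝ θ z u v + inner ℝ u.2 v.1 := by rw [hdη]; rfl
      have h3 : fderiv ℝ η z v u = fderiv ℝ θ z v u + inner ℝ v.2 u.1 := by rw [hdη]; rfl
      have h4 : standardForm k u v = inner ℝ v.2 u.1 - inner ℝ u.2 v.1 := by
        simp only [standardForm, PiLp.inner_apply, Finset.sum_sub_distrib]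
        simp [mul_comm]
      rw [h2, h3]
      linarith
  have hg' (z : PhaseSpace k) : HasFDerivAt g (η z) z := hg z (mem_univ z)
  have hgs : ContDiff ℝ ∞ g := by
    refine contDiff_infty_iff_fderiv.2 ⟨fun z => (hg' z).differentiableAt, ?_⟩
    rwa [show fderiv ℝ g = η from funext fun z => (hg' z).fderiv]
  refine ⟨fun z => Complex.exp (Complex.I * (g z : ℂ)),
    (contDiff_const.mul (Complex.ofRealCLM.contDiff.comp hgs)).cexp,
    fun z => Complex.exp_ne_zero _, fun z r => ?_⟩
  have h1 : HasFDerivAt (fun z => Complex.I * (g z : ℂ)) _ z :=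
    (Complex.ofRealCLM.hasFDerivAt.comp z (hg' z)).const_mul Complex.I
  rw [h1.cexp.fderiv]
  change Complex.exp _ * (Complex.I * ((η z (0, r) : ℝ) : ℂ)) = _
  have h2 : η z (0, r) = θ z (0, r) := by
    change θ z (0, r) + inner ℝ z.2 (0 : EuclideanSpace ℝ (Fin k)) = _
    rw [inner_zero_right, add_zero]
  rw [h2]
  ring

/-- The section of the standard bundle given by a function. -/
def sectionForm (θ : PhaseSpace k → PhaseSpace k →L[ℝ] ℝ) (F : PhaseSpace k → ℂ) :
    (standardBundle k θ).Form 0 := fun z => AlternatingMap.constOfIsEmpty ℝ _ _ (F z)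

lemma loc_standardPatch (f : (standardBundle k θ).Form 0) (z : PhaseSpace k)
    (r : Fin 0 → EuclideanSpace ℝ (Fin k)) : (standardPatch k θ).loc f z r = f z ![] := by
  rw [Patch.loc_apply, standardPatch_factor, standardPatch_inv, one_mul]
  exact congrArg (f z) (Subsingleton.elim _ _)

lemma smoothOn_standardBundle_iff {f : (standardBundle k θ).Form 0} {W : Set (PhaseSpace k)}
    (hW : IsOpen W) : f.SmoothOn W ↔ ContDiffOn ℝ ∞ (fun z => f z ![]) W := by
  rw [Patch.smoothOn_iff (P := standardPatch k θ) hW (subset_univ W), standardPatch_img]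
  constructor
  · intro h
    have := contDiffOn_alt_apply (g := fun j : Fin 0 => j.elim0) h fun j => j.elim0
    exact this.congr fun z _ => (loc_standardPatch f z _).symm
  · intro h
    exact contDiffOn_alt fun r => h.congr fun z _ => loc_standardPatch f z r

/-- A section of the standard bundle is flat if its derivative along the leaves is its product with
`iθ`. -/
lemma hasDiffOn_standardBundle_iff {f : (standardBundle k θ).Form 0} {W : Set (PhaseSpace k)}
    (hW : IsOpen W) (hf : f.SmoothOn W) : f.HasDiffOn 0 W ↔
      ∀ z ∈ W, ∀ r, fderiv ℝ (fun z => f z ![]) z (0, r) =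
        Complex.I * (θ z (0, r) : ℂ) * f z ![] := by
  rw [Patch.hasDiffOn_iff (P := standardPatch k θ) (isRegular_standardBundle k θ) hW
    (subset_univ W) hf, standardPatch_img]
  refine forall₂_congr fun z hz => ?_
  have hc : ContDiffOn ℝ ∞ ((standardPatch k θ).loc f) W := by
    have := (Patch.smoothOn_iff (P := standardPatch k θ) hW (subset_univ W)).1 hf
    rwa [standardPatch_img] at this
  have hd : HasFDerivAt ((standardPatch k θ).loc f) _ z :=
    ((hc.contDiffAt (hW.mem_nhds hz)).differentiableAt (by simp)).hasFDerivAt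
  have key (r : Fin 1 → EuclideanSpace ℝ (Fin k)) :
      (standardPatch k θ).d ((standardPatch k θ).loc f) z r =
        fderiv ℝ (fun z => f z ![]) z (0, r 0) - Complex.I * (θ z (0, r 0) : ℂ) * f z ![] := by
    have h1 := (ContinuousAlternatingMap.apply ℝ (EuclideanSpace ℝ (Fin k)) ℂ
      ![]).hasFDerivAt.comp z hd
    have h2 : (ContinuousAlternatingMap.apply ℝ (EuclideanSpace ℝ (Fin k)) ℂ ![]) ∘
        (standardPatch k θ).loc f = fun z => f z ![] := funext fun z => loc_standardPatch f z _
    rw [h2] at h1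
    rw [h1.fderiv]
    have h3 : (standardPatch k θ).conn z (r 0) = -Complex.I * (θ z (0, r 0) : ℂ) := by
      rw [Patch.conn_apply, standardPatch_inv]
      exact congrArg (fun v => -Complex.I * (θ z v : ℂ)) (standardPatch_frame z (r 0))
    unfold Patch.d
    rw [localD_apply, Fin.sum_univ_one, h3, loc_standardPatch]
    simp only [Fin.val_zero, pow_zero, one_mul]
    rw [sub_eq_add_neg, ← neg_mul, ← neg_mul]
    congr 1
    exact congrArg (fderiv ℝ ((standardPatch k θ).loc f) z (0, r 0)) (Subsingleton.elim _ _)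
  rw [Patch.loc_zero]
  constructor
  · intro h r
    have := congrArg (fun a => a fun _ : Fin 1 => r) h
    exact sub_eq_zero.1 ((key fun _ => r).symm.trans this)
  · intro h
    ext r
    rw [key, h (r 0), sub_self]
    rfl

end Flat

/-! ### Products with flat sections -/

section Cylinder

set_option linter.unusedSectionVars false

open GeometricQuantization.FoliatedBundle.Form (IsPrimitiveOn)

universe u

variable {E : Type u} [NormedAddCommGroup E] [NormedSpace ℝ E] [FiniteDimensional ℝ E]
  {H : Type*} [TopologicalSpace H] {I : ModelWithCorners ℝ E H} [I.Boundaryless]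
  {X : Type*} [TopologicalSpace X] [ChartedSpace H X] [IsManifold I ∞ X]
  {ι : Type*} {K : FoliatedBundle I X ι} {k n : ℕ}
  {R : Type u} [NormedAddCommGroup R] [NormedSpace ℝ R] [FiniteDimensional ℝ R]
  {θ : PhaseSpace k → PhaseSpace k →L[ℝ] ℝ} {W : Set (PhaseSpace k)}

lemma isRegular_cylinder (hK : K.IsRegular) (h𝒰 : ∀ x, ∃ P : Patch K R, x ∈ P.N)
    (θ : PhaseSpace k → PhaseSpace k →L[ℝ] ℝ) : (K.prod (standardBundle k θ)).IsRegular :=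
  hK.prod (isRegular_standardBundle k θ) h𝒰 fun _ => ⟨standardPatch k θ, mem_univ _⟩

lemma famSmooth_const (h𝒰 : ∀ x, ∃ P : Patch K R, x ∈ P.N) {α : K.Form n} (hα : α.SmoothOn univ)
    {G : Type*} [NormedAddCommGroup G] [NormedSpace ℝ G] (Ω : Set G) :
    FamSmooth R (fun _ : G => α) Ω := fun x => (h𝒰 x).imp fun P hP => ⟨hP,
  (BumpPatch.contDiffOn_loc_of_smoothOn P hα).comp contDiffOn_fst fun _ hw => hw.1⟩

lemma smoothOn_pullbackMul (h𝒰 : ∀ x, ∃ P : Patch K R, x ∈ P.N) {α : K.Form n}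
    (hα : α.SmoothOn univ) (hW : IsOpen W) {f : (standardBundle k θ).Form 0} (hf : f.SmoothOn W) :
    (K.pullbackMul (standardBundle k θ) α f).SmoothOn (univ ×ˢ W) := by
  rw [pullbackMul_eq_mulForm]
  refine smoothOn_mulForm (R := R) h𝒰 (isOpen_univ.prod hW) Subset.rfl
    ((smoothOn_standardBundle_iff hW).1 hf) ?_
  exact ((famSmooth_const h𝒰 hα univ).smoothOn_famForm isOpen_univ).mono fun _ _ =>
    ⟨mem_univ _, mem_univ _⟩

/-- The differential of the product of a form with a flat section. -/
lemma hasDiffOn_pullbackMul (hK : K.IsRegular) (h𝒰 : ∀ x, ∃ P : Patch K R, x ∈ P.N)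
    {α : K.Form n} {β : K.Form (n + 1)} (hα : α.SmoothOn univ) (h : α.HasDiffOn β univ)
    (hW : IsOpen W) {f : (standardBundle k θ).Form 0} (hf : f.SmoothOn W) (hf' : f.HasDiffOn 0 W) :
    (K.pullbackMul (standardBundle k θ) α f).HasDiffOn
      (K.pullbackMul (standardBundle k θ) β f) (univ ×ˢ W) := by
  rw [pullbackMul_eq_mulForm, pullbackMul_eq_mulForm]
  have hsub : (univ : Set X) ×ˢ W ⊆ univ ×ˢ (Prod.fst ⁻¹' (univ : Set (EuclideanSpace ℝ (Fin k)))) :=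
    fun _ _ => ⟨mem_univ _, mem_univ _⟩
  refine hasDiffOn_mulForm (R := R) (isRegular_cylinder hK h𝒰 0) (isRegular_cylinder hK h𝒰 θ) h𝒰
    (isOpen_univ.prod hW) hW Subset.rfl ((smoothOn_standardBundle_iff hW).1 hf)
    (fun z hz r => ?_)
    (((famSmooth_const h𝒰 hα univ).smoothOn_famForm isOpen_univ).mono hsub)
    (((famSmooth_const h𝒰 hα univ).hasDiffOn_famForm hK (isRegular_cylinder hK h𝒰 0) isOpen_univ
      (fun _ _ => hα) fun _ _ => h).mono hsub)
  rw [(hasDiffOn_standardBundle_iff hW hf).1 hf' z hz r]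
  simp

lemma isPrimitiveOn_pullbackMul (hK : K.IsRegular) (h𝒰 : ∀ x, ∃ P : Patch K R, x ∈ P.N)
    (hW : IsOpen W) {f : (standardBundle k θ).Form 0} (hf : f.SmoothOn W) (hf' : f.HasDiffOn 0 W) :
    ∀ {n : ℕ} {γ : K.Form (n - 1)} {β : K.Form n}, IsPrimitiveOn γ β univ →
    IsPrimitiveOn (K.pullbackMul (standardBundle k θ) γ f)
      (K.pullbackMul (standardBundle k θ) β f) (univ ×ˢ W)
  | 0, _, β, h => fun q _ => by
    unfold FoliatedBundle.pullbackMul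
    rw [h q.1 (mem_univ _)]
    exact smul_zero _
  | _ + 1, _, _, h => ⟨smoothOn_pullbackMul h𝒰 h.1 hW hf,
      hasDiffOn_pullbackMul hK h𝒰 h.1 h.2 hW hf hf'⟩

end Cylinder

section Decomposition

set_option linter.unusedSectionVars false

open GeometricQuantization.FoliatedBundle.Form (IsPrimitiveOn)

universe u

/-! ### Decomposition of closed forms on the product -/

variable {E : Type u} [NormedAddCommGroup E] [NormedSpace ℝ E] [FiniteDimensional ℝ E]
  {H : Type*} [TopologicalSpace H] {I : ModelWithCorners ℝ E H} [I.Boundaryless]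
  {X : Type*} [TopologicalSpace X] [ChartedSpace H X] [IsManifold I ∞ X]
  {ι : Type*} {K : FoliatedBundle I X ι} {k n : ℕ}
  {R : Type u} [NormedAddCommGroup R] [NormedSpace ℝ R] [FiniteDimensional ℝ R]

lemma isPrimitiveOn_mulForm (hK : K.IsRegular) (h𝒰 : ∀ x, ∃ P : Patch K R, x ∈ P.N)
    {θ θ' : PhaseSpace k → PhaseSpace k →L[ℝ] ℝ} {s : PhaseSpace k → ℂ} (hs : ContDiff ℝ ∞ s)
    (hd : ∀ z r, fderiv ℝ s z (0, r) = Complex.I * ((θ' z (0, r) : ℂ) - θ z (0, r)) * s z)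
    {W : Set (X × PhaseSpace k)} (hW : IsOpen W) : ∀ {n : ℕ}
      {γ : (K.prod (standardBundle k θ)).Form (n - 1)} {β : (K.prod (standardBundle k θ)).Form n},
      IsPrimitiveOn γ β W → IsPrimitiveOn (mulForm θ' s γ) (mulForm θ' s β) W
  | 0, _, _, h => fun q hq => AlternatingMap.ext fun v =>
      (congrArg (fun a => s q.2 * a v) (h q hq)).trans (mul_zero _)
  | _ + 1, _, _, h =>
    have hsub : W ⊆ univ ×ˢ univ := fun _ _ => ⟨mem_univ _, mem_univ _⟩
    ⟨smoothOn_mulForm (R := R) h𝒰 hW hsub hs.contDiffOn h.1,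
      hasDiffOn_mulForm (R := R) (isRegular_cylinder hK h𝒰 θ) (isRegular_cylinder hK h𝒰 θ') h𝒰 hW
        isOpen_univ hsub hs.contDiffOn (fun z _ => hd z) h.1 h.2⟩

/-- Cutting off a primitive by a function of the first coordinate of the phase space, which is
constant along the leaves. -/
lemma isPrimitiveOn_mulForm_comp_fst (hK : K.IsRegular) (h𝒰 : ∀ x, ∃ P : Patch K R, x ∈ P.N)
    {χ : EuclideanSpace ℝ (Fin k) → ℂ} (hχ : ContDiff ℝ ∞ χ) {W : Set (PhaseSpace k)}
    (hW : IsOpen W) : ∀ {n : ℕ} {γ : (K.prod (standardBundle k 0)).Form (n - 1)}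
      {β : (K.prod (standardBundle k 0)).Form n}, IsPrimitiveOn γ β (univ ×ˢ W) →
      IsPrimitiveOn (mulForm 0 (fun z => χ z.1) γ) (mulForm 0 (fun z => χ z.1) β)
        (univ ×ˢ {z | z.1 ∈ tsupport χ → z ∈ W}) := by
  have hc : ContDiff ℝ ∞ fun z : PhaseSpace k => χ z.1 := hχ.comp contDiff_fst
  have hd (z : PhaseSpace k) (r : EuclideanSpace ℝ (Fin k)) :
      fderiv ℝ (fun z : PhaseSpace k => χ z.1) z (0, r) = 0 := by
    have h1 : HasFDerivAt (fun z : PhaseSpace k => χ z.1) _ z :=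
      (hχ.differentiable (by simp) z.1).hasFDerivAt.comp z hasFDerivAt_fst
    rw [h1.fderiv]
    exact map_zero (fderiv ℝ χ z.1)
  intro n γ β h
  refine FoliatedBundle.Form.isPrimitiveOn_of_nhds fun q hq => ?_
  by_cases hqs : q.2.1 ∈ tsupport χ
  · exact ⟨univ ×ˢ W, isOpen_univ.prod hW, ⟨mem_univ _, hq.2 hqs⟩, (isPrimitiveOn_mulForm hK h𝒰 hc
      (fun z r => by rw [hd]; simp) (isOpen_univ.prod hW) h).mono inter_subset_right⟩
  · refine ⟨{q | q.2.1 ∉ tsupport χ}, (isClosed_tsupport χ).isOpen_compl.preimage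
      (continuous_fst.comp continuous_snd), hqs, ?_⟩
    refine IsPrimitiveOn.zero.congr (fun q hq => ?_) fun q hq => ?_
    · exact (congrArg (· • γ q) (image_eq_zero_of_notMem_tsupport hq.2)).trans (zero_smul ℂ (γ q))
    · exact (congrArg (· • β q) (image_eq_zero_of_notMem_tsupport hq.2)).trans (zero_smul ℂ (β q))

lemma isPrimitiveOn_famForm (hK : K.IsRegular) (h𝒰 : ∀ x, ∃ P : Patch K R, x ∈ P.N)
    {Ω : Set (EuclideanSpace ℝ (Fin k))} (hΩ : IsOpen Ω) : ∀ {n : ℕ}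
    {a : EuclideanSpace ℝ (Fin k) → K.Form (n - 1)} {b : EuclideanSpace ℝ (Fin k) → K.Form n},
    FamSmooth R a Ω → (∀ x ∈ Ω, IsPrimitiveOn (a x) (b x) univ) →
    IsPrimitiveOn (famForm 0 a) (famForm 0 b) (univ ×ˢ (Prod.fst ⁻¹' Ω))
  | 0, _, b, _, h => fun q hq => by
    unfold famForm
    rw [h q.2.1 hq.2 q.1 (mem_univ _)]
    rfl
  | _ + 1, _, _, ha, h => ⟨ha.smoothOn_famForm hΩ,
      ha.hasDiffOn_famForm hK (isRegular_cylinder hK h𝒰 0) hΩ (fun _ hx => ha.smoothOn hx)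
        fun x hx => (h x hx).2⟩

variable {κ : Type*} [Fintype κ] {e : κ → K.Form n}

/-- The closed form `∑ fⱼ(x) eⱼ` on the product with the phase space. -/
def combForm (f : κ → EuclideanSpace ℝ (Fin k) → ℂ) (e : κ → K.Form n) :
    (K.prod (standardBundle k 0)).Form n := famForm 0 fun x => ∑ j, f j x • e j

lemma combForm_apply (f : κ → EuclideanSpace ℝ (Fin k) → ℂ) (e : κ → K.Form n)
    (q : X × PhaseSpace k) (v : Fin n → (K.prod (standardBundle k 0)).D q) :
    combForm f e q v = ∑ j, f j q.2.1 *
      e j q.1 fun i => K.D.prodFst (standardBundle k 0).D q (v i) :=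
  form_sum_apply _ (fun j => f j q.2.1 • e j) _ _

variable [CompactSpace X]

/-- Near a leaf, a closed form is a combination of the forms `e j` up to an exact form. -/
lemma exists_local_decomposition (hK : K.IsRegular) (h𝒰 : ∀ x, ∃ P : Patch K R, x ∈ P.N)
    (he : ∀ j, FoliatedBundle.Form.SmoothOn (e j) univ)
    (hspan : ∀ β ∈ closedForms K n, ∃ (γ : K.Form (n - 1)) (c : κ → ℂ), γ.SmoothOn univ ∧
      IsPrimitiveOn γ (β - ∑ j, c j • e j) univ)
    {β : (K.prod (standardBundle k 0)).Form n} {W : Set (PhaseSpace k)} (hW : IsOpen W)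
    (hβ : β.SmoothOn (univ ×ˢ W)) (hd : β.HasDiffOn 0 (univ ×ˢ W))
    {A : Set (EuclideanSpace ℝ (Fin k))} (hA : IsCompact A) [ContractibleSpace A]
    {c : EuclideanSpace ℝ (Fin k)} (hAW : ∀ y ∈ A, (c, y) ∈ W) :
    ∃ O W' : Set (EuclideanSpace ℝ (Fin k)), IsOpen O ∧ c ∈ O ∧ IsOpen W' ∧ A ⊆ W' ∧
      ∃ f : κ → EuclideanSpace ℝ (Fin k) → ℂ, (∀ j, ContDiffOn ℝ ∞ (f j) O) ∧
      ∃ γ : (K.prod (standardBundle k 0)).Form (n - 1),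
        IsPrimitiveOn γ (β - combForm f e) (univ ×ˢ (O ×ˢ W')) := by
  -- `β` is compared with the constant extension of its restrictions to the slices `(x, y₀)`, and the
  -- latter with the combination `∑ fⱼ(x) eⱼ`.
  obtain ⟨O, Y, hO, hY, hcO, hAY, hOY⟩ := generalized_tube_lemma (isCompact_singleton (x := c)) hA
    hW (by rintro ⟨x, y⟩ ⟨rfl, hy⟩; exact hAW y hy)
  obtain ⟨y₀, h, W', hh, hWo, hAW', h0, h1, hW'⟩ := exists_smooth_contraction hA hY hAY
  obtain ⟨a⟩ := (inferInstance : Nonempty A)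
  have hy₀ : y₀ ∈ Y := h1 a ▸ hW' a (hAW' a.2) 1
  have hcO' : c ∈ O := hcO rfl
  have hsub : (univ : Set X) ×ˢ (O ×ˢ Y) ⊆ univ ×ˢ W := prod_mono Subset.rfl hOY
  obtain ⟨γ₁, hγ₁⟩ := exists_isPrimitiveOn_sub_famForm_sliceForm
    (isRegular_cylinder hK h𝒰 0) h𝒰 hh h0 h1 hO hY hWo hW' (hβ.mono hsub) (hd.mono hsub)
  have hWop : IsOpen ((univ : Set X) ×ˢ W) := isOpen_univ.prod hW
  have hmem {x : EuclideanSpace ℝ (Fin k)} (hx : x ∈ O) :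
      {p : X | (p, (x, y₀)) ∈ (univ : Set X) ×ˢ W} = univ :=
    eq_univ_of_forall fun p => ⟨mem_univ _, hOY ⟨hx, hy₀⟩⟩
  have hsm (P : Patch K R) : ContDiffOn ℝ ∞ (fun w : E × EuclideanSpace ℝ (Fin k) =>
      P.loc (sliceForm (w.2, y₀) β) w.1) (P.img univ ×ˢ O) := by
    have h2 : ContDiffOn ℝ ∞ ((P.cyl 0).loc β)
        ((P.cyl (0 : PhaseSpace k → PhaseSpace k →L[ℝ] ℝ)).img (univ ×ˢ W)) :=
      PullData.contDiffOn_loc hWop hβ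
    have h3 : ContDiffOn ℝ ∞ (fun w : E × EuclideanSpace ℝ (Fin k) =>
        (P.cyl 0).loc β (w.1, (w.2, y₀))) (P.img univ ×ˢ O) :=
      h2.comp (f := fun w : E × EuclideanSpace ℝ (Fin k) => (w.1, (w.2, y₀)))
        (contDiff_fst.prodMk (contDiff_snd.prodMk contDiff_const)).contDiffOn
        fun w hw => Patch.mem_cyl_img.2 ⟨hw.1, mem_univ _, hOY ⟨hw.2, hy₀⟩⟩
    refine (contDiffOn_alt_comp h3 (contDiffOn_const (c := ContinuousLinearMap.inl ℝ R
      (EuclideanSpace ℝ (Fin k))))).congr fun w hw => ?_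
    exact Patch.loc_sliceForm (θ := 0) (w.2, y₀) β hw.1
  have hcl (x : EuclideanSpace ℝ (Fin k)) (hx : x ∈ O) :
      FoliatedBundle.Form.HasDiffOn (sliceForm (x, y₀) β) 0 univ := by
    have h2 := hasDiffOn_sliceForm (z := (x, y₀)) hK (isRegular_cylinder hK h𝒰 0) h𝒰 hWop hβ hd
    rw [hmem hx] at h2
    exact h2
  obtain ⟨O', hO', hcO'', a, f, ha, hf, hprim⟩ := exists_famSmooth_isPrimitiveOn (k := k) hK h𝒰 he
    hspan (b := fun x => sliceForm (x, y₀) β) hO hsm hcl hcO'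
  refine ⟨O ∩ O', W', hO.inter hO', ⟨hcO', hcO''⟩, hWo, hAW', f,
    fun j => (hf j).mono inter_subset_right, γ₁ + famForm 0 a, ?_⟩
  have hsub' : (univ : Set X) ×ˢ ((O ∩ O') ×ˢ W') ⊆ univ ×ˢ (Prod.fst ⁻¹' O') :=
    fun q hq => ⟨mem_univ _, hq.2.1.2⟩
  have h2 := (hγ₁.mono (prod_mono Subset.rfl (prod_mono inter_subset_left Subset.rfl))).add
    ((isPrimitiveOn_famForm hK h𝒰 hO' ha hprim).mono hsub')
  refine h2.congr (fun _ _ => rfl) fun q _ => ?_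
  ext v
  have key (a b c : ℂ) : a - c = (a - b) + (b - c) := by ring
  exact key (β q v) (famForm 0 (fun x => sliceForm (x, y₀) β) q v) (combForm f e q v)

/-- A closed form on a neighbourhood of `X × U`, where the leaves of the compact set `U` are
contractible, is a combination of the forms `e j`, with coefficients that are constant along the
leaves of the phase space, up to an exact form. -/
theorem exists_decomposition (hK : K.IsRegular) (h𝒰 : ∀ x, ∃ P : Patch K R, x ∈ P.N)
    (he : ∀ j, FoliatedBundle.Form.SmoothOn (e j) univ)
    (hspan : ∀ β ∈ closedForms K n, ∃ (γ : K.Form (n - 1)) (c : κ → ℂ), γ.SmoothOn univ ∧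
      IsPrimitiveOn γ (β - ∑ j, c j • e j) univ)
    {β : (K.prod (standardBundle k 0)).Form n} {W : Set (X × PhaseSpace k)} (hW : IsOpen W)
    (hβ : β.SmoothOn W) (hd : β.HasDiffOn 0 W) {U : Set (PhaseSpace k)} (hU : IsCompact U)
    (hleaf : ∀ c ∈ Prod.fst '' U, ContractibleSpace {z : PhaseSpace k // z ∈ U ∧ z.1 = c})
    (hUW : univ ×ˢ U ⊆ W) :
    ∃ W' : Set (PhaseSpace k), IsOpen W' ∧ U ⊆ W' ∧
      ∃ f : κ → EuclideanSpace ℝ (Fin k) → ℂ, (∀ j, ContDiff ℝ ∞ (f j)) ∧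
      ∃ γ : (K.prod (standardBundle k 0)).Form (n - 1),
        IsPrimitiveOn γ (β - combForm f e) (univ ×ˢ W') := by
  obtain ⟨Y, W₁, -, hW₁, hY, hUW₁, hsub⟩ := generalized_tube_lemma isCompact_univ hU hW hUW
  have hY' : Y = univ := univ_subset_iff.1 hY
  subst hY'
  have hlocal (c : EuclideanSpace ℝ (Fin k)) (hc : c ∈ Prod.fst '' U) :
      ∃ O W' : Set (EuclideanSpace ℝ (Fin k)), IsOpen O ∧ c ∈ O ∧ IsOpen W' ∧
      (∀ z ∈ U, z.1 ∈ O → z.2 ∈ W') ∧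
      ∃ f : κ → EuclideanSpace ℝ (Fin k) → ℂ, (∀ j, ContDiffOn ℝ ∞ (f j) O) ∧
      ∃ γ : (K.prod (standardBundle k 0)).Form (n - 1),
        IsPrimitiveOn γ (β - combForm f e) (univ ×ˢ (O ×ˢ W')) := by
    let A : Set (EuclideanSpace ℝ (Fin k)) := {y | (c, y) ∈ U}
    have hA : IsCompact A := by
      have h1 : A = Prod.snd '' (U ∩ Prod.fst ⁻¹' {c}) := by
        ext y
        constructor
        · intro hy
          exact ⟨(c, y), ⟨hy, rfl⟩, rfl⟩
        · rintro ⟨⟨x, y'⟩, ⟨hz, hx⟩, rfl⟩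
          obtain rfl : x = c := hx
          exact hz
      rw [h1]
      exact (hU.inter_right (isClosed_singleton.preimage continuous_fst)).image continuous_snd
    have hcontr : ContractibleSpace A := by
      have := hleaf c hc
      let φ : A ≃ₜ {z : PhaseSpace k // z ∈ U ∧ z.1 = c} :=
        { toFun := fun y => ⟨(c, y.1), y.2, rfl⟩
          invFun := fun z => ⟨z.1.2, by
            have h1 := z.2.1
            rwa [show z.1 = (c, z.1.2) from Prod.ext z.2.2 rfl] at h1⟩
          left_inv := fun _ => rfl
          right_inv := fun z => Subtype.ext (Prod.ext z.2.2.symm rfl)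
          continuous_toFun := by fun_prop
          continuous_invFun := by fun_prop }
      exact φ.contractibleSpace
    obtain ⟨O, W', hO, hcO, hWo, hAW', f, hf, γ, hγ⟩ := exists_local_decomposition hK h𝒰 he hspan
      hW₁ (hβ.mono hsub) (hd.mono hsub) hA (c := c) fun y hy => hUW₁ hy
    -- The leaves near `c` stay in `W'`, because `U` is compact.
    let Z : Set (EuclideanSpace ℝ (Fin k)) := Prod.fst '' (U ∩ Prod.snd ⁻¹' W'ᶜ)
    have hZ : IsClosed Z := ((hU.inter_right
      (hWo.isClosed_compl.preimage continuous_snd)).image continuous_fst).isClosed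
    refine ⟨O ∩ Zᶜ, W', hO.inter hZ.isOpen_compl, ⟨hcO, ?_⟩, hWo, fun z hz hzO => ?_, f,
      fun j => (hf j).mono inter_subset_left, γ,
      hγ.mono (prod_mono Subset.rfl (prod_mono inter_subset_left Subset.rfl))⟩
    · rintro ⟨⟨x, y⟩, ⟨hz, hy⟩, hx⟩
      obtain rfl : x = c := hx
      exact hy (hAW' hz)
    · by_contra hy
      exact hzO.2 ⟨z, ⟨hz, hy⟩, rfl⟩
  choose! O W' hO hcO hWo hOW f hf γ hγ using hlocal
  have hcomp : IsCompact (Prod.fst '' U) := hU.image continuous_fst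
  obtain ⟨t, htU, ht⟩ := hcomp.elim_nhds_subcover O fun c hc => (hO c hc).mem_nhds (hcO c hc)
  obtain ⟨C, hC, hUC, hCO⟩ := exists_compact_between hcomp
    (isOpen_biUnion fun c hc => hO c (htU c hc)) ht
  obtain ⟨χ, hχ⟩ := SmoothPartitionOfUnity.exists_isSubordinate
    𝓘(ℝ, EuclideanSpace ℝ (Fin k)) hC.isClosed (fun c : t => O c.1)
    (fun c => hO c.1 (htU c.1 c.2)) (by simpa [iUnion_subtype] using hCO)
  let χc : t → EuclideanSpace ℝ (Fin k) → ℂ := fun c x => (χ c x : ℂ)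
  have hχs (c : t) : ContDiff ℝ ∞ (χc c) :=
    Complex.ofRealCLM.contDiff.comp (χ c).contMDiff.contDiff
  have hχt (c : t) : tsupport (χc c) ⊆ O c.1 := by
    refine Subset.trans (closure_mono fun x hx => ?_) (hχ c)
    intro h0
    exact hx (by simp only [χc]; rw [h0, Complex.ofReal_zero])
  -- On `W''` the functions `χ c` add up to `1`, and the products of `χ c` with the local primitives
  -- extend by zero.
  let W'' : Set (PhaseSpace k) := {z | z.1 ∈ interior C} ∩
    ⋂ c : t, {z | z.1 ∈ tsupport (χc c) → z ∈ O c.1 ×ˢ W' c.1}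
  have hW'' : IsOpen W'' := by
    refine (isOpen_interior.preimage continuous_fst).inter (isOpen_iInter_of_finite fun c => ?_)
    have : {z : PhaseSpace k | z.1 ∈ tsupport (χc c) → z ∈ O c.1 ×ˢ W' c.1} =
        Prod.fst ⁻¹' (tsupport (χc c))ᶜ ∪ O c.1 ×ˢ W' c.1 := by
      ext z
      exact imp_iff_not_or
    rw [this]
    exact ((isClosed_tsupport _).isOpen_compl.preimage continuous_fst).union
      ((hO c.1 (htU c.1 c.2)).prod (hWo c.1 (htU c.1 c.2)))
  refine ⟨W'', hW'', fun z hz => ⟨hUC ⟨z, hz, rfl⟩, mem_iInter.2 fun c hzc =>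
    ⟨hχt c hzc, hOW c.1 (htU c.1 c.2) z hz (hχt c hzc)⟩⟩,
    fun j x => ∑ c : t, χc c x * f c.1 j x, fun j => ?_,
    ∑ c : t, mulForm 0 (fun z => χc c z.1) (γ c.1), ?_⟩
  · refine ContDiff.sum fun c _ => contDiff_iff_contDiffAt.2 fun x => ?_
    by_cases hx : x ∈ tsupport (χc c)
    · exact (hχs c).contDiffAt.mul ((hf c.1 (htU c.1 c.2) j).contDiffAt
        ((hO c.1 (htU c.1 c.2)).mem_nhds (hχt c hx)))
    · refine (contDiffAt_const (c := (0 : ℂ))).congr_of_eventuallyEq ?_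
      filter_upwards [(isClosed_tsupport (χc c)).isOpen_compl.mem_nhds hx] with y hy
      rw [image_eq_zero_of_notMem_tsupport hy, zero_mul]
  · have hsub' (c : t) : (univ : Set X) ×ˢ W'' ⊆
        univ ×ˢ {z | z.1 ∈ tsupport (χc c) → z ∈ O c.1 ×ˢ W' c.1} :=
      fun q hq => ⟨mem_univ _, mem_iInter.1 hq.2.2 c⟩
    have h1 := IsPrimitiveOn.sum Finset.univ fun c (_ : c ∈ (Finset.univ : Finset t)) =>
      (isPrimitiveOn_mulForm_comp_fst hK h𝒰 (hχs c) ((hO c.1 (htU c.1 c.2)).prod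
        (hWo c.1 (htU c.1 c.2))) (hγ c.1 (htU c.1 c.2))).mono (hsub' c)
    refine h1.congr (fun _ _ => rfl) fun q hq => ?_
    have hsum : ∑ c : t, χc c q.2.1 = 1 := by
      have := χ.sum_eq_one (interior_subset hq.2.1)
      rw [finsum_eq_sum_of_fintype] at this
      simp only [χc]
      rw [← Complex.ofReal_sum, this, Complex.ofReal_one]
    ext v
    rw [form_sum_apply]
    change β q v - combForm _ e q v = ∑ c : t, χc c q.2.1 * (β q v - combForm (f c.1) e q v)
    simp only [combForm_apply, mul_sub, Finset.sum_sub_distrib, ← Finset.sum_mul, hsum, one_mul,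
      Finset.mul_sum]
    rw [Finset.sum_comm]
    simp only [Finset.sum_mul, mul_assoc]

end Decomposition

section Kuenneth

set_option linter.unusedSectionVars false

open GeometricQuantization.FoliatedBundle.Form (IsPrimitiveOn)

universe u

/-! ### The Künneth map -/

variable {E : Type u} [NormedAddCommGroup E] [NormedSpace ℝ E] [FiniteDimensional ℝ E]
  {H : Type*} [TopologicalSpace H] {I : ModelWithCorners ℝ E H} [I.Boundaryless]
  {X : Type*} [TopologicalSpace X] [ChartedSpace H X] [IsManifold I ∞ X]
  {ι : Type*} {K : FoliatedBundle I X ι} {k n : ℕ}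
  {R : Type u} [NormedAddCommGroup R] [NormedSpace ℝ R] [FiniteDimensional ℝ R]
  {θ : PhaseSpace k → PhaseSpace k →L[ℝ] ℝ} {U : Set (PhaseSpace k)}

lemma mem_cocycles_univ_iff {α : K.Form n} :
    α ∈ K.cocycles univ n ↔ α.SmoothOn univ ∧ α.HasDiffOn 0 univ := by
  constructor
  · rintro ⟨W, -, hW, hs, hd⟩
    rw [univ_subset_iff.1 hW] at hs hd
    exact ⟨hs, hd⟩
  · rintro ⟨hs, hd⟩
    exact ⟨univ, isOpen_univ, Subset.rfl, hs, hd⟩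

lemma mem_coboundaries_univ_iff {β : K.Form n} : β ∈ K.coboundaries univ n ↔
    ∃ γ : K.Form (n - 1), γ.SmoothOn univ ∧ IsPrimitiveOn γ β univ := by
  rw [mem_coboundaries_iff]
  constructor
  · rintro ⟨W, -, hW, γ, h⟩
    rw [univ_subset_iff.1 hW] at h
    cases n with
    | zero => exact ⟨0, FoliatedBundle.Form.smoothOn_zero _, h⟩
    | succ n => exact ⟨γ, h.1, h⟩
  · rintro ⟨γ, -, h⟩
    exact ⟨univ, isOpen_univ, Subset.rfl, γ, h⟩

-- Shortcuts that spare instance search the unfolding of `Cohomology`.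
local instance (C : Set X) (n : ℕ) : AddCommGroup (K.Cohomology C n) := inferInstance

local instance (C : Set X) (n : ℕ) : Module ℂ (K.Cohomology C n) := inferInstance

lemma mem_submoduleOf_iff {V : Type*} [AddCommGroup V] [Module ℂ V] {p q : Submodule ℂ V} {x : q} :
    x ∈ p.submoduleOf q ↔ x.1 ∈ p := Iff.rfl

lemma mk_eq_zero_iff {C : Set X} {α : K.cocycles C n} :
    (Submodule.Quotient.mk α : K.Cohomology C n) = 0 ↔ α.1 ∈ K.coboundaries C n :=
  (Submodule.Quotient.mk_eq_zero _).trans mem_submoduleOf_iff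

lemma exists_mk_eq {C : Set X} (a : K.Cohomology C n) :
    ∃ α : K.cocycles C n, Submodule.Quotient.mk α = a :=
  Submodule.Quotient.mk_surjective _ a

lemma classOf_eq_zero_iff {C : Set X} {α : K.Form n} (h : α ∈ K.cocycles C n) :
    K.classOf C n α h = 0 ↔ α ∈ K.coboundaries C n :=
  mk_eq_zero_iff

lemma pullbackMul_zero_left (f : (standardBundle k θ).Form 0) :
    K.pullbackMul (standardBundle k θ) (0 : K.Form n) f = 0 :=
  funext fun q => smul_zero (f q.2 ![])

lemma pullbackMul_mem_cocycles (hK : K.IsRegular) (h𝒰 : ∀ x, ∃ P : Patch K R, x ∈ P.N)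
    {α : K.Form n} (hα : α ∈ K.cocycles univ n) {f : (standardBundle k θ).Form 0}
    (hf : f ∈ (standardBundle k θ).cocycles U 0) :
    K.pullbackMul (standardBundle k θ) α f ∈
      (K.prod (standardBundle k θ)).cocycles (univ ×ˢ U) n := by
  obtain ⟨hs, hd⟩ := mem_cocycles_univ_iff.1 hα
  obtain ⟨W, hW, hUW, hfs, hfd⟩ := hf
  refine ⟨univ ×ˢ W, isOpen_univ.prod hW, prod_mono Subset.rfl hUW,
    smoothOn_pullbackMul h𝒰 hs hW hfs, ?_⟩
  have := hasDiffOn_pullbackMul hK h𝒰 hs hd hW hfs hfd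
  rwa [pullbackMul_zero_left] at this

/-- A bilinear map that vanishes on `N` and `N'` descends to the tensor product of the quotients. -/
def tensorLiftQ {V V' P : Type*} [AddCommGroup V] [Module ℂ V] [AddCommGroup V'] [Module ℂ V']
    [AddCommGroup P] [Module ℂ P] {N : Submodule ℂ V} {N' : Submodule ℂ V'}
    (B : V →ₗ[ℂ] V' →ₗ[ℂ] P) (h : ∀ a ∈ N, ∀ b, B a b = 0) (h' : ∀ a, ∀ b ∈ N', B a b = 0) :
    (V ⧸ N) ⊗[ℂ] (V' ⧸ N') →ₗ[ℂ] P :=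
  TensorProduct.lift <| LinearMap.flip <| Submodule.liftQ N' (LinearMap.flip <| Submodule.liftQ N B
    fun a ha => LinearMap.ext fun b => h a ha b) fun b hb => Submodule.linearMap_qext _ <|
      LinearMap.ext fun a => h' a b hb

/-- The product of cocycles, as a bilinear map to the cohomology. -/
def cocycleMul (hK : K.IsRegular) (h𝒰 : ∀ x, ∃ P : Patch K R, x ∈ P.N)
    (θ : PhaseSpace k → PhaseSpace k →L[ℝ] ℝ) (U : Set (PhaseSpace k)) (n : ℕ) :
    K.cocycles univ n →ₗ[ℂ] (standardBundle k θ).cocycles U 0 →ₗ[ℂ]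
      (K.prod (standardBundle k θ)).Cohomology (univ ×ˢ U) n :=
  LinearMap.mk₂ ℂ (fun α f => (K.prod (standardBundle k θ)).classOf (univ ×ˢ U) n
      (K.pullbackMul (standardBundle k θ) α.1 f.1) (pullbackMul_mem_cocycles hK h𝒰 α.2 f.2))
    (fun _ _ f => congrArg Submodule.Quotient.mk (Subtype.ext (funext fun q =>
      AlternatingMap.ext fun _ => mul_add (f.1 q.2 ![]) _ _)))
    (fun c _ f => congrArg Submodule.Quotient.mk (Subtype.ext (funext fun q =>
      AlternatingMap.ext fun _ => mul_left_comm (f.1 q.2 ![]) c _)))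
    (fun _ f f' => congrArg Submodule.Quotient.mk (Subtype.ext (funext fun q =>
      AlternatingMap.ext fun _ => add_mul (f.1 q.2 ![]) (f'.1 q.2 ![]) _)))
    (fun c _ f => congrArg Submodule.Quotient.mk (Subtype.ext (funext fun q =>
      AlternatingMap.ext fun _ => mul_assoc c (f.1 q.2 ![]) _)))

lemma cocycleMul_eq_zero_of_left (hK : K.IsRegular) (h𝒰 : ∀ x, ∃ P : Patch K R, x ∈ P.N)
    {α : K.cocycles univ n} (hα : α.1 ∈ K.coboundaries univ n)
    (f : (standardBundle k θ).cocycles U 0) : cocycleMul hK h𝒰 θ U n α f = 0 := by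
  refine (classOf_eq_zero_iff _).2 ?_
  obtain ⟨γ, -, hγ⟩ := mem_coboundaries_univ_iff.1 hα
  obtain ⟨W, hW, hUW, hfs, hfd⟩ := f.2
  exact mem_coboundaries_iff.2 ⟨univ ×ˢ W, isOpen_univ.prod hW, prod_mono Subset.rfl hUW, _,
    isPrimitiveOn_pullbackMul hK h𝒰 hW hfs hfd hγ⟩

lemma cocycleMul_eq_zero_of_right (hK : K.IsRegular) (h𝒰 : ∀ x, ∃ P : Patch K R, x ∈ P.N)
    (α : K.cocycles univ n) {f : (standardBundle k θ).cocycles U 0}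
    (hf : f.1 ∈ (standardBundle k θ).coboundaries U 0) : cocycleMul hK h𝒰 θ U n α f = 0 := by
  refine (classOf_eq_zero_iff _).2 ?_
  obtain ⟨W, hW, hUW, h⟩ := hf
  refine mem_coboundaries_iff.2 ⟨univ ×ˢ W, isOpen_univ.prod hW, prod_mono Subset.rfl hUW, 0,
    IsPrimitiveOn.zero.congr (fun _ _ => rfl) fun q hq => ?_⟩
  change f.1 q.2 ![] • _ = _
  rw [h q.2 hq.2]
  exact zero_smul ℂ ((α.1 q.1).compLinearMap (K.D.prodFst (standardBundle k θ).D q))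

/-- The natural map from the tensor product of the cohomology groups. -/
def kuennethMap (hK : K.IsRegular) (h𝒰 : ∀ x, ∃ P : Patch K R, x ∈ P.N)
    (θ : PhaseSpace k → PhaseSpace k →L[ℝ] ℝ) (U : Set (PhaseSpace k)) (n : ℕ) :
    K.Cohomology univ n ⊗[ℂ] (standardBundle k θ).Cohomology U 0 →ₗ[ℂ]
      (K.prod (standardBundle k θ)).Cohomology (univ ×ˢ U) n :=
  tensorLiftQ (cocycleMul hK h𝒰 θ U n) (fun _ hα f => cocycleMul_eq_zero_of_left hK h𝒰 hα f)
    fun α _ hf => cocycleMul_eq_zero_of_right hK h𝒰 α hf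

lemma kuennethMap_tmul (hK : K.IsRegular) (h𝒰 : ∀ x, ∃ P : Patch K R, x ∈ P.N) {α : K.Form n}
    (hα : α ∈ K.cocycles univ n) {f : (standardBundle k θ).Form 0}
    (hf : f ∈ (standardBundle k θ).cocycles U 0) :
    kuennethMap hK h𝒰 θ U n (K.classOf univ n α hα ⊗ₜ (standardBundle k θ).classOf U 0 f hf) =
      (K.prod (standardBundle k θ)).classOf (univ ×ˢ U) n
        (K.pullbackMul (standardBundle k θ) α f) (pullbackMul_mem_cocycles hK h𝒰 hα hf) := rfl

variable {κ : Type*} [Fintype κ]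

lemma kuennethMap_sum (hK : K.IsRegular) (h𝒰 : ∀ x, ∃ P : Patch K R, x ∈ P.N)
    (e : κ → K.cocycles univ n) (F : κ → (standardBundle k θ).cocycles U 0) :
    kuennethMap hK h𝒰 θ U n (∑ j, (Submodule.Quotient.mk (e j) : K.Cohomology univ n) ⊗ₜ
      (Submodule.Quotient.mk (F j) : (standardBundle k θ).Cohomology U 0)) =
      Submodule.Quotient.mk (∑ j, (⟨K.pullbackMul (standardBundle k θ) (e j).1 (F j).1,
        pullbackMul_mem_cocycles hK h𝒰 (e j).2 (F j).2⟩ :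
          (K.prod (standardBundle k θ)).cocycles (univ ×ˢ U) n)) := by
  rw [map_sum]
  exact (map_sum (Submodule.mkQ _) _ _).symm

lemma exists_eq_sum_tmul {V V' : Type*} [AddCommGroup V] [Module ℂ V] [AddCommGroup V']
    [Module ℂ V'] (b : Module.Basis κ ℂ V) (t : V ⊗[ℂ] V') : ∃ v : κ → V', t = ∑ j, b j ⊗ₜ v j := by
  induction t using TensorProduct.induction_on with
  | zero => exact ⟨0, by simp⟩
  | tmul x y =>
    refine ⟨fun j => b.repr x j • y, ?_⟩
    conv_lhs => rw [← b.sum_repr x]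
    rw [TensorProduct.sum_tmul]
    exact Finset.sum_congr rfl fun j _ => TensorProduct.smul_tmul _ _ _
  | add t t' h h' =>
    obtain ⟨v, rfl⟩ := h
    obtain ⟨v', rfl⟩ := h'
    exact ⟨v + v', by simp [TensorProduct.tmul_add, Finset.sum_add_distrib]⟩

lemma isPrimitiveOn_sliceForm (hK : K.IsRegular) (h𝒰 : ∀ x, ∃ P : Patch K R, x ∈ P.N)
    {W : Set (X × PhaseSpace k)} (hW : IsOpen W) {z : PhaseSpace k} (hz : ∀ p, (p, z) ∈ W) :
    ∀ {n : ℕ} {γ : (K.prod (standardBundle k θ)).Form (n - 1)}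
      {β : (K.prod (standardBundle k θ)).Form n}, IsPrimitiveOn γ β W →
      IsPrimitiveOn (sliceForm z γ) (sliceForm z β) univ
  | 0, _, β, h => fun p _ => by
    unfold sliceForm
    rw [h (p, z) (hz p)]
    rfl
  | _ + 1, _, _, h => by
    have h1 := smoothOn_sliceForm (z := z) h𝒰 hW h.1
    have h2 := hasDiffOn_sliceForm (z := z) hK (isRegular_cylinder hK h𝒰 θ) h𝒰 hW h.1 h.2
    rw [eq_univ_of_forall (s := {p | (p, z) ∈ W}) hz] at h1 h2
    exact ⟨h1, h2⟩

variable [CompactSpace X]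

set_option maxHeartbeats 4000000 in
/-- Restriction to `X × {z}` shows that the coefficients of an exact combination vanish. -/
theorem kuennethMap_injective (hK : K.IsRegular) (h𝒰 : ∀ x, ∃ P : Patch K R, x ∈ P.N)
    [Module.Finite ℂ (K.Cohomology univ n)] (hU : IsCompact U) :
    Function.Injective (kuennethMap hK h𝒰 θ U n) := by
  refine (injective_iff_map_eq_zero _).2 fun t ht => ?_
  let b := Module.finBasis ℂ (K.Cohomology univ n)
  choose e he using fun j => exists_mk_eq (b j)
  obtain ⟨v, rfl⟩ := exists_eq_sum_tmul b t
  choose F hF using fun j => exists_mk_eq (v j)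
  simp only [← he, ← hF] at ht ⊢
  rw [kuennethMap_sum] at ht
  obtain ⟨W, hW, hUW, γ, hγ⟩ := mem_coboundaries_iff.1 (mk_eq_zero_iff.1 ht)
  obtain ⟨Y, W₁, -, hW₁, hY, hUW₁, hsub⟩ := generalized_tube_lemma isCompact_univ hU hW hUW
  have hzero (z : PhaseSpace k) (hz : z ∈ W₁) (j) : (F j).1 z ![] = 0 := by
    have h1 := isPrimitiveOn_sliceForm hK h𝒰 hW (z := z)
      (fun p => hsub ⟨hY (mem_univ p), hz⟩) hγ
    have h2 : sliceForm z ((∑ j, ⟨K.pullbackMul (standardBundle k θ) (e j).1 (F j).1,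
        pullbackMul_mem_cocycles hK h𝒰 (e j).2 (F j).2⟩ :
          (K.prod (standardBundle k θ)).cocycles (univ ×ˢ U) n) :
          (K.prod (standardBundle k θ)).Form n) = ((∑ j, (F j).1 z ![] • e j :
            K.cocycles univ n) : K.Form n) := by
      rw [Submodule.coe_sum, Submodule.coe_sum]
      funext p
      ext v
      rw [form_sum_apply]
      exact form_sum_apply _ _ _ _
    rw [h2] at h1
    have h3 : (Submodule.Quotient.mk (∑ j, (F j).1 z ![] • e j) : K.Cohomology univ n) = 0 :=
      mk_eq_zero_iff.2 (mem_coboundaries_iff.2 ⟨univ, isOpen_univ, Subset.rfl, _, h1⟩)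
    have h4 : ∑ j, (F j).1 z ![] • b j = 0 := by
      simp only [← he]
      rw [← h3]
      exact ((map_sum (Submodule.mkQ _) _ _).trans
        (Finset.sum_congr rfl fun j _ => map_smul _ _ _)).symm
    exact Fintype.linearIndependent_iff.1 b.linearIndependent _ h4 j
  refine Finset.sum_eq_zero fun j _ => ?_
  have : (Submodule.Quotient.mk (F j) : (standardBundle k θ).Cohomology U 0) = 0 := by
    refine mk_eq_zero_iff.2 ⟨W₁, hW₁, hUW₁, fun z hz => ?_⟩
    ext v
    rw [Subsingleton.elim v ![]]
    exact hzero z hz j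
  rw [this, TensorProduct.tmul_zero]

lemma fderiv_inv_apply_of_ne_zero {s : PhaseSpace k → ℂ} (hs : ContDiff ℝ ∞ s)
    (hs0 : ∀ z, s z ≠ 0) (z v : PhaseSpace k) :
    fderiv ℝ (fun z => (s z)⁻¹) z v = -(s z ^ 2)⁻¹ * fderiv ℝ s z v := by
  have h := (hasDerivAt_inv (hs0 z)).hasFDerivAt.restrictScalars ℝ |>.comp z
    (hs.differentiable (by simp) z).hasFDerivAt
  refine (congrArg (· v) h.fderiv).trans ?_
  simp [mul_comm]

set_option maxHeartbeats 4000000 in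
/-- After a gauge transformation, a closed form near `X × U` is a combination of the forms that
represent a basis of the cohomology, with coefficients that are constant along the leaves. -/
theorem kuennethMap_surjective (hK : K.IsRegular) (h𝒰 : ∀ x, ∃ P : Patch K R, x ∈ P.N)
    [Module.Finite ℂ (K.Cohomology univ n)] (hθ : IsPrimitive k θ) (hU : IsCompact U)
    (hleaf : ∀ c ∈ Prod.fst '' U, ContractibleSpace {z : PhaseSpace k // z ∈ U ∧ z.1 = c}) :
    Function.Surjective (kuennethMap hK h𝒰 θ U n) := by
  intro β
  obtain ⟨⟨β, W, hW, hUW, hβ, hd⟩, rfl⟩ := exists_mk_eq β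
  let b := Module.finBasis ℂ (K.Cohomology univ n)
  choose e he using fun j => exists_mk_eq (b j)
  have hspan (ζ : K.Form n) (hζ : ζ ∈ closedForms K n) : ∃ (γ : K.Form (n - 1))
      (c : Fin (Module.finrank ℂ (K.Cohomology univ n)) → ℂ), γ.SmoothOn univ ∧
      IsPrimitiveOn γ (ζ - ∑ j, c j • (e j).1) univ := by
    let ζ' : K.cocycles univ n := ⟨ζ, mem_cocycles_univ_iff.2 hζ⟩
    let c := b.repr (Submodule.Quotient.mk ζ')
    have h1 : (Submodule.Quotient.mk (ζ' - ∑ j, c j • e j) : K.Cohomology univ n) = 0 := by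
      have h2 : (Submodule.Quotient.mk (∑ j, c j • e j) : K.Cohomology univ n) =
          ∑ j, c j • b j := by
        simp only [← he]
        exact (map_sum (Submodule.mkQ _) _ _).trans
          (Finset.sum_congr rfl fun j _ => map_smul _ _ _)
      rw [Submodule.Quotient.mk_sub, h2, b.sum_repr, sub_self]
    obtain ⟨γ, hγ, h⟩ := mem_coboundaries_univ_iff.1 (mk_eq_zero_iff.1 h1)
    refine ⟨γ, c, hγ, ?_⟩
    convert h using 1
    change _ = ζ - ((∑ j, c j • e j : K.cocycles univ n) : K.Form n)
    rw [Submodule.coe_sum]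
    rfl
  -- Multiplication by `s⁻¹` turns `β` into a closed form for `θ = 0`.
  obtain ⟨s, hs, hs0, hsd⟩ := hθ.exists_gauge
  have hsi : ContDiff ℝ ∞ fun z => (s z)⁻¹ := hs.inv hs0
  have hWs : W ⊆ univ ×ˢ univ := fun _ _ => ⟨mem_univ _, mem_univ _⟩
  have hβ' : (mulForm 0 (fun z => (s z)⁻¹) β).SmoothOn W :=
    smoothOn_mulForm (R := R) h𝒰 hW hWs hsi.contDiffOn hβ
  have hd' : (mulForm 0 (fun z => (s z)⁻¹) β).HasDiffOn 0 W := by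
    have h1 := hasDiffOn_mulForm (R := R) (θ' := 0) (s := fun z => (s z)⁻¹)
      (isRegular_cylinder hK h𝒰 θ) (isRegular_cylinder hK h𝒰 0) h𝒰 hW isOpen_univ hWs
      hsi.contDiffOn (fun z _ r => by
        rw [fderiv_inv_apply_of_ne_zero hs hs0, hsd]
        have := hs0 z
        simp only [Pi.zero_apply, zero_apply, Complex.ofReal_zero]
        field_simp
        ring) hβ hd
    have h2 : mulForm 0 (fun z => (s z)⁻¹)
        (0 : (K.prod (standardBundle k θ)).Form (n + 1)) = 0 := funext fun q => smul_zero _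
    rwa [h2] at h1
  obtain ⟨W', hW', hUW', f, hf, γ, hγ⟩ := exists_decomposition (e := fun j => (e j).1) hK h𝒰
    (fun j => (mem_cocycles_univ_iff.1 (e j).2).1) hspan hW hβ' hd' hU hleaf hUW
  have hF (j) : sectionForm θ (fun z => s z * f j z.1) ∈ (standardBundle k θ).cocycles U 0 := by
    have h1 : ContDiff ℝ ∞ fun z : PhaseSpace k => s z * f j z.1 :=
      hs.mul ((hf j).comp contDiff_fst)
    have h2 : (sectionForm θ fun z => s z * f j z.1).SmoothOn univ :=
      (smoothOn_standardBundle_iff isOpen_univ).2 h1.contDiffOn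
    refine ⟨univ, isOpen_univ, subset_univ _, h2,
      (hasDiffOn_standardBundle_iff isOpen_univ h2).2 fun z _ r => ?_⟩
    have h3 : HasFDerivAt (fun z : PhaseSpace k => s z * f j z.1) _ z :=
      (hs.differentiable (by simp) z).hasFDerivAt.mul
        (((hf j).differentiable (by simp) z.1).hasFDerivAt.comp z hasFDerivAt_fst)
    change fderiv ℝ (fun z : PhaseSpace k => s z * f j z.1) z (0, r) =
      Complex.I * (θ z (0, r) : ℂ) * (s z * f j z.1)
    rw [h3.fderiv]
    change s z * fderiv ℝ (f j) z.1 0 + f j z.1 * fderiv ℝ s z (0, r) = _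
    rw [map_zero, hsd]
    ring
  refine ⟨_, (kuennethMap_sum hK h𝒰 e fun j => ⟨_, hF j⟩).trans ?_⟩
  rw [eq_comm, Submodule.Quotient.eq, mem_submoduleOf_iff]
  have h1 := isPrimitiveOn_mulForm (θ' := θ) hK h𝒰 hs (fun z r => by
    rw [hsd]
    simp) (isOpen_univ.prod hW') hγ
  refine mem_coboundaries_iff.2 ⟨univ ×ˢ W', isOpen_univ.prod hW', prod_mono Subset.rfl hUW', _,
    h1.congr (fun _ _ => rfl) fun q _ => ?_⟩
  ext v
  change β q v - ((∑ j, _ : (K.prod (standardBundle k θ)).cocycles (univ ×ˢ U) n) :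
    (K.prod (standardBundle k θ)).Form n) q v =
      s q.2 * ((s q.2)⁻¹ * β q v - combForm f (fun j => (e j).1) q v)
  rw [Submodule.coe_sum, form_sum_apply, mul_sub, mul_inv_cancel_left₀ (hs0 q.2)]
  congr 1
  refine Eq.trans ?_ (congrArg (s q.2 * ·) (combForm_apply f (fun j => (e j).1) q v)).symm
  rw [Finset.mul_sum]
  exact Finset.sum_congr rfl fun j _ => mul_assoc _ _ _

end Kuenneth

end GeometricQuantization

end

theorem mainTheorem6 (m k n : ℕ)
    {M : Type*} [TopologicalSpace M] [ChartedSpace (EuclideanSpace ℝ (Fin (2 * m))) M]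
    [IsManifold 𝓘(ℝ, EuclideanSpace ℝ (Fin (2 * m))) ∞ M] [T2Space M] [CompactSpace M]
    {ιL ιN : Type*} (Q : QuantizationData 𝓘(ℝ, EuclideanSpace ℝ (Fin (2 * m))) M m ιL ιN)
    (hQ : Module.Finite ℂ Q.bundle.QuantizationSpace)
    (θ : PhaseSpace k → PhaseSpace k →L[ℝ] ℝ)
    (hθ : IsPrimitive k θ)
    (U : Set (PhaseSpace k))
    (hU : IsClosedCotangentBall U) :
    ∃ Δ : Q.bundle.Cohomology univ n ⊗[ℂ]
          (standardBundle k θ).Cohomology U 0 ≃ₗ[ℂ]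
        (Q.bundle.prod (standardBundle k θ)).Cohomology (univ ×ˢ U) n,
      ∀ (α : Q.bundle.Form n) (hα : α ∈ Q.bundle.cocycles univ n)
        (f : (standardBundle k θ).Form 0)
        (hf : f ∈ (standardBundle k θ).cocycles U 0),
        ∃ h : Q.bundle.pullbackMul (standardBundle k θ) α f ∈
            (Q.bundle.prod (standardBundle k θ)).cocycles (univ ×ˢ U) n,
          Δ (Q.bundle.classOf univ n α hα ⊗ₜ[ℂ]
              (standardBundle k θ).classOf U 0 f hf) =
            (Q.bundle.prod (standardBundle k θ)).classOf (univ ×ˢ U) n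
              (Q.bundle.pullbackMul (standardBundle k θ) α f) h := by
  have hK := Q.isRegular_bundle
  have h𝒰 := exists_patch (K := Q.bundle) Q.isFoliation
  have : Module.Finite ℂ (Q.bundle.Cohomology univ n) :=
    Module.Finite.of_surjective
      (DirectSum.component ℂ ℕ (fun n => Q.bundle.Cohomology univ n) n)
      fun x => ⟨DirectSum.lof ℂ ℕ (fun n => Q.bundle.Cohomology univ n) n x,
        DirectSum.component.lof_self ..⟩
  exact ⟨LinearEquiv.ofBijective (kuennethMap hK h𝒰 θ U n) ⟨kuennethMap_injective hK h𝒰 hU.1,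
    kuennethMap_surjective hK h𝒰 hθ hU.1 hU.2.1.leaf⟩,
    fun α hα f hf => ⟨pullbackMul_mem_cocycles hK h𝒰 hα hf, kuennethMap_tmul hK h𝒰 hα hf⟩⟩
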